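/- **Meshes.** Let $M$ be a finite mesh of quadrilateral elements covering a planar set $\Omega$. The vertices $A,B,C,D$ of each element are listed counter-clockwise, two elements meet in nothing, in one vertex, or in one common (straight) edge, and any two elements at a vertex are joined by a chain of elements at that vertex, consecutive ones sharing an edge at it. An edge that belongs to two elements is *inner*; the others form the global boundary. Elements without a boundary edge (*inner elements*) are strictly convex. The boundary edge of an element that has one (*boundary element*) is unique, is labelled as the side from $D$ to $C$, and is a cubic Bézier curve with control points $D,E,F,C$. Consecutive boundary curves join with non-degenerate $G^1$-smoothness; every boundary vertex has exactly one adjacent inner edge; no inner edge has two boundary vertices. **In-plane parametrisation.** An inner element is parametrised bilinearly over $[0,1]^2$. A boundary element is parametrised by the bicubic patch $\sum_{i,j=0}^{3}P_{ij}B^3_i(u)B^3_j(v)$ with $$\begin{aligned} (P_{0j})_j&=\left(A,\ \tfrac{2A+D}{3},\ \tfrac{A+2D}{3},\ D\right),\\ (P_{1j})_j&=\left(\tfrac{2A+B}{3},\ \tfrac{4A+2B+C+2D}{9},\ \tfrac{2A+B+C+2D+3E}{9},\ E\right),\\ (P_{2j})_j&=\left(\tfrac{A+2B}{3},\ \tfrac{2A+4B+2C+D}{9},\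 \tfrac{A+2B+2C+D+3F}{9},\ F\right),\\ (P_{3j})_j&=\left(B,\ \tfrac{2B+C}{3},\ \tfrac{B+2C}{3},\ C\right), \end{aligned}$$ which is assumed to be regular: injective on the unit square, with nowhere vanishing (positive) Jacobian there. **Spline space and determining sets.** Let $\mathcal{CP}^{(n)}$ be the set of degree $n$ Bézier control points of all elements, those on a common edge of two elements being identified. $\mathcal{FUN}^{(n)}$ is the linear space of functions $z:\mathcal{CP}^{(n)}\to\mathbb R$ such that the Bézier patches of bidegree $(n,n)$ with coefficients $z$, composed with the inverse of the in-plane parametrisation, form a $C^1$ function on $\Omega$. A set $D\subseteq\mathcal{CP}^{(n)}$ is *determining* if $z\in\mathcal{FUN}^{(n)}$ and $z|_D=0$ imply $z=0$; it is a *minimal determining set* (MDS) if no determining set has fewer elements. An MDS $D$ *fits* a constraint that fixes a set $P\subseteq\mathcal{CP}^{(n)}$ of control points if every point of $P$ lies in $D$ or is, for functions in $\mathcal{FUN}^{(n)}$, determined by the values on $D\cap P$. **Additional constraints.** A constraint type prescribes any combination of: interpolation at any set of vertices (fixes the control point at the vertex); interpolation of tangent planes at any set of vertices (fixes the control point at the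 vertex and its neighbours along the edges there); boundary curve interpolation or a simply-supported condition along any set of boundary edges (fixes the control points on these edges); a clamped condition along any set of boundary edges (fixes the control points on these edges and the ones adjacent to them). **Algorithm.** For an inner edge let $C_0,\dots,C_n$ be the control points on it and $L_t,R_t$ those adjacent to $C_t$ in the left and in the right element. The algorithm classifies control points as *basic* or *dependent*, leaving some choices open; its output is the set of basic ones. All control points that neither lie on an inner edge nor are adjacent to one are basic. The others are classified as follows. *Stage 1, at every inner vertex $v$, with $C_0$ at $v$ on each edge at $v$.* $C_0$ is basic, and so are the $C_1$ of exactly two chosen non-colinear edges. If the valence is odd, the $C_2$ of all edges are basic and the control points $L_1,R_1$ of all edges are dependent. Otherwise exactly one control point among the $L_1,R_1$ of the edges at $v$ is basic; if in addition $v$ is a regular 4-vertex (four edges in two colinear pairs), all $C_2$ are basic; if it is not, all $C_2$ are basic except one, chosen on an edge whose two neighbouring edges are not colinear. *Stage 2, for every edge with two inner vertices.* $C_3,\dots,C_{n-3}$ are basic. Let $e$ be the vector of the edge, and let $l_0,l_1$ and $r_0,r_1$ be the cross products with $e$ of the vectors of the neighbouring edges that leave the first and the second vertex of the edge, $l$ for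 those of the right element and $r$ for those of the left element. If $l_0r_1-r_0l_1=0$, exactly one of $L_t,R_t$ is basic for each $t=2,\dots,n-2$. Otherwise exactly $n-4$ of the $L_t,R_t$ ($2\le t\le n-2$) are basic, and they are chosen such that the columns of the dependent ones in the linear system below with $d=1$ are linearly independent. *Stage 3, for every edge from an inner vertex (at $C_0$) to a boundary vertex (at $C_n$).* $C_n$ and $C_{n-1}$ are basic, exactly one of $L_n,R_n$ is basic, and exactly one of $L_{n-1},R_{n-1}$ is basic. $C_3,\dots,C_{n-3}$ are basic. Let $\lambda,\rho$ be the quadratic vector polynomials that give the cross derivatives along the edge of the left and of the right in-plane parametrisation, and let $e$ be the vector of the edge; let $l=\rho\times e$, $r=-\lambda\times e$, with quadratic Bézier coefficients $l_i,r_i$, and $c=\lambda\times\rho$. $C_{n-2}$ is dependent if and only if $\deg c-\max(\deg l,\deg r)=2$ (actual degrees). Put $g^{(ij)}=l_ir_j-l_jr_i$. If all three $g^{(ij)}$ vanish (CASE 2), exactly one of $L_t,R_t$ is basic for each $t=2,\dots,n-2$. If $g^{(01)}g^{(12)}g^{(02)}\neq0$ and $(g^{(02)})^2=4g^{(01)}g^{(12)}$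 (CASE 1), exactly $n-4$ of the $L_t,R_t$ ($2\le t\le n-2$) are basic. Otherwise (CASE 0) exactly $n-5$ are. In CASES 0 and 1 they are chosen such that the columns of the dependent ones in the linear system below with $d=2$ are linearly independent. *Linear system.* For weight functions of degree $d$ it consists of the equations $2\le s\le n+d-2$ with the coefficient of $L_t$ in equation $s$ equal to $\binom nt\binom d{s-t}l_{s-t}$, and that of $R_t$ equal to $\binom nt\binom d{s-t}r_{s-t}$. **Lemma.** For every such mesh $M$ and every $n\ge5$: 1. for every type of additional constraint there is an output $D$ of the algorithm for degree $n$ that is an MDS and fits the constraint; 2. every output of the algorithm for degree $n$ is an MDS; 3. for every set $P\subseteq\mathcal{CP}^{(n)}$ there is an MDS that fits a constraint fixing exactly the control points of $P$. -/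

import Mathlib

open Set Polynomial

noncomputable section

namespace SmoothQuadMesh

/-- Signed length of the cross product of two planar vectors. -/
def cross (a b : ℝ × ℝ) : ℝ := a.1 * b.2 - a.2 * b.1

/-- The Bézier net, of bidegree `(3, 3)`, of the in-plane parametrisation of a boundary element with vertices
`A, B, C, D` (counter-clockwise), whose side from `D` to `C` is the cubic Bézier curve with control
points `D, E, F, C`.  The entry `i j` is the coefficient of `B³ᵢ(u) B³ⱼ(v)`. -/
def bicubicNet (A B C D E F : ℝ × ℝ) : Fin 4 → Fin 4 → ℝ × ℝ :=
  ![![A,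
      (1 / 3 : ℝ) • ((2 : ℝ) • A + D),
      (1 / 3 : ℝ) • (A + (2 : ℝ) • D),
      D],
    ![(1 / 3 : ℝ) • ((2 : ℝ) • A + B),
      (1 / 9 : ℝ) • ((4 : ℝ) • A + (2 : ℝ) • B + C + (2 : ℝ) • D),
      (1 / 9 : ℝ) • ((2 : ℝ) • A + B + C + (2 : ℝ) • D + (3 : ℝ) • E),
      E],
    ![(1 / 3 : ℝ) • (A + (2 : ℝ) • B),
      (1 / 9 : ℝ) • ((2 : ℝ) • A + (4 : ℝ) • B + (2 : ℝ) • C + D),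
      (1 / 9 : ℝ) • (A + (2 : ℝ) • B + (2 : ℝ) • C + D + (3 : ℝ) • F),
      F],
    ![B,
      (1 / 3 : ℝ) • ((2 : ℝ) • B + C),
      (1 / 3 : ℝ) • (B + (2 : ℝ) • C),
      C]]

/-- The data of a planar mesh of quadrilaterals with vertex set `V` and set of elements `F`.
`corner f 0, …, corner f 3` are the vertices `A, B, C, D` of the element `f`, in counter-clockwise
order.  `bdCtrl f 0` and `bdCtrl f 1` are the two inner control points `E, F` of the cubic boundary
curve of `f` (from `D` to `C`); they are used only if `f` is a boundary element. -/
structure Mesh (V F : Type*) where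
  pos : V → ℝ × ℝ
  corner : F → Fin 4 → V
  bdCtrl : F → Fin 2 → ℝ × ℝ

namespace Mesh

variable {V F : Type*} (M : Mesh V F)

/-! ### Directed edges

The pair `h = (f, s)` is the side of `f` from corner `s` to corner `s + 1`, with `f` on its left. -/

/-- Origin of a directed edge. -/
def org (h : F × Fin 4) : V := M.corner h.1 h.2

/-- End point of a directed edge. -/
def tgt (h : F × Fin 4) : V := M.corner h.1 (h.2 + 1)

/-- The side of the same element that starts where `h` ends. -/
def next (h : F × Fin 4) : F × Fin 4 := (h.1, h.2 + 1)

/-- The side of the same element that ends where `h` starts. -/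
def prev (h : F × Fin 4) : F × Fin 4 := (h.1, h.2 + 3)

/-- `h` and `h'` are the two orientations of one edge. -/
def Opp (h h' : F × Fin 4) : Prop := M.org h = M.tgt h' ∧ M.tgt h = M.org h'

/-- The edge belongs to two elements. -/
def IsInnerEdge (h : F × Fin 4) : Prop := ∃ h', M.Opp h h'

/-- The edge lies on the global boundary. -/
def IsBdEdge (h : F × Fin 4) : Prop := ¬ M.IsInnerEdge h

/-- `v` is an end point of an edge on the global boundary. -/
def IsBdVertex (v : V) : Prop := ∃ h, M.IsBdEdge h ∧ (M.org h = v ∨ M.tgt h = v)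

/-- `f` has an edge on the global boundary. -/
def IsBdFace (f : F) : Prop := ∃ s, M.IsBdEdge (f, s)

/-- The valence of an inner vertex: the number of edges that emanate from it. -/
def valence (v : V) : ℕ := {h | M.org h = v}.ncard

/-! ### The global in-plane parametrisation: bilinear on inner elements, bicubic on boundary
elements -/

open Classical in
/-- The in-plane parametrisation of the element `f` over the unit square. -/
def param (f : F) (u v : ℝ) : ℝ × ℝ :=
  if M.IsBdFace f then
    ∑ i : Fin 4, ∑ j : Fin 4,
      ((bernsteinPolynomial ℝ 3 i).eval u * (bernsteinPolynomial ℝ 3 j).eval v) •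
        bicubicNet (M.pos (M.corner f 0)) (M.pos (M.corner f 1)) (M.pos (M.corner f 2))
          (M.pos (M.corner f 3)) (M.bdCtrl f 0) (M.bdCtrl f 1) i j
  else
    ((1 - u) * (1 - v)) • M.pos (M.corner f 0) + (u * (1 - v)) • M.pos (M.corner f 1)
      + (u * v) • M.pos (M.corner f 2) + ((1 - u) * v) • M.pos (M.corner f 3)

/-- The planar mesh element. -/
def element (f : F) : Set (ℝ × ℝ) :=
  {x | ∃ u ∈ Icc (0 : ℝ) 1, ∃ v ∈ Icc (0 : ℝ) 1, x = M.param f u v}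

/-- The planar domain covered by the mesh. -/
def domain : Set (ℝ × ℝ) := ⋃ f, M.element f

/-- Regularity of the parametrisation of `f`: it is injective on the unit square (so bijective
onto the element), and its Jacobian determinant vanishes nowhere there; the sign is the one given
by the counter-clockwise order of the corners. -/
def IsRegular (f : F) : Prop :=
  InjOn (fun p : ℝ × ℝ => M.param f p.1 p.2) (Icc 0 1 ×ˢ Icc 0 1) ∧
  ∀ u ∈ Icc (0 : ℝ) 1, ∀ v ∈ Icc (0 : ℝ) 1,
    0 < cross (deriv (fun s => M.param f s v) u) (deriv (fun s => M.param f u s) v)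

/-- `h` is an edge from an inner vertex to a boundary vertex, and `h'` is the same edge with the
opposite orientation. -/
def EdgeToBd (h h' : F × Fin 4) : Prop :=
  M.Opp h h' ∧ ¬ M.IsBdVertex (M.org h) ∧ M.IsBdVertex (M.tgt h)

/-- The meshes under consideration: regular quadrangulations of a planar domain with a `G¹`-smooth
piecewise-cubic global boundary, without corner elements, such that the bicubic in-plane
parametrisation is regular. -/
structure IsSmoothMesh : Prop where
  pos_injective : Function.Injective M.pos
  vertex_used : ∀ v, ∃ h, M.org h = v
  /-- A directed edge has at most one element on its left. -/
  edge_unique : ∀ h h', M.org h = M.org h' → M.tgt h = M.tgt h' → h = h'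
  /-- Any two elements at a vertex are joined by a chain of elements at this vertex, in which
  consecutive elements share an edge that emanates from the vertex. -/
  vertex_connected : ∀ h h', M.org h = M.org h' →
    Relation.EqvGen (fun k k' => M.Opp (prev k) k') h h'
  /-- Two elements have in common nothing, one vertex, or one (straight) edge. -/
  inter : ∀ f g, f ≠ g →
    M.element f ∩ M.element g = ∅ ∨
    (∃ s t, M.corner f s = M.corner g t ∧
      M.element f ∩ M.element g = {M.pos (M.corner f s)}) ∨
    (∃ s t, M.Opp (f, s) (g, t) ∧
      M.element f ∩ M.element g = segment ℝ (M.pos (M.org (f, s))) (M.pos (M.tgt (f, s))))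
  /-- Inner elements are strictly convex. -/
  convex : ∀ f, ¬ M.IsBdFace f → ∀ s, 0 < cross
    (M.pos (M.corner f (s + 1)) - M.pos (M.corner f s))
    (M.pos (M.corner f (s + 2)) - M.pos (M.corner f (s + 1)))
  /-- Labelling convention: the boundary edge of a boundary element is the one between its corners
  `C` and `D`. -/
  bd_label : ∀ h, M.IsBdEdge h → h.2 = 2
  /-- Every boundary vertex has exactly one adjacent inner edge. -/
  bd_vertex : ∀ v, M.IsBdVertex v → ∃! h, M.org h = v ∧ M.IsInnerEdge h
  /-- An inner edge has at most one boundary vertex. -/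
  inner_edge : ∀ h, M.IsInnerEdge h → ¬ (M.IsBdVertex (M.org h) ∧ M.IsBdVertex (M.tgt h))
  /-- Consecutive boundary curves join with (non-degenerate) `G¹`-smoothness. -/
  bd_smooth : ∀ h h', M.EdgeToBd h h' →
    M.pos (M.tgt h) - M.bdCtrl h.1 1 ≠ 0 ∧
    ∃ k : ℝ, 0 < k ∧
      M.bdCtrl h'.1 0 - M.pos (M.tgt h) = k • (M.pos (M.tgt h) - M.bdCtrl h.1 1)
  regular : ∀ f, M.IsBdFace f → M.IsRegular f

/-! ### Control points and the spline space -/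

/-- The double index of the degree `n` control point of the element `h.1` that lies `a` steps along
`h` from its origin and `b` steps away from `h` into the element. -/
def loc (n : ℕ) (h : F × Fin 4) (a b : Fin (n + 1)) : F × Fin (n + 1) × Fin (n + 1) :=
  match h.2 with
  | 0 => (h.1, a, b)
  | 1 => (h.1, b.rev, a)
  | 2 => (h.1, a.rev, b.rev)
  | 3 => (h.1, b, a.rev)

/-- Two double indices that denote the same control point on a common edge of two elements. -/
def Glued (n : ℕ) (p q : F × Fin (n + 1) × Fin (n + 1)) : Prop :=
  ∃ h h' t, M.Opp h h' ∧ p = loc n h t 0 ∧ q = loc n h' t.rev 0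

/-- The set of the degree `n` control points of all patches; control points of adjacent patches
are identified along the common edge. -/
def CP (n : ℕ) : Type _ := Quot (M.Glued n)

/-- The control point `a` steps along `h` and `b` steps into the element. -/
def cp (n : ℕ) (h : F × Fin 4) (a b : Fin (n + 1)) : M.CP n := Quot.mk _ (loc n h a b)

/-- The `Z`-component of the patch over `f`, for given `Z`-components of the control points. -/
def zPatch {n : ℕ} (z : M.CP n → ℝ) (f : F) (u v : ℝ) : ℝ :=
  ∑ i : Fin (n + 1), ∑ j : Fin (n + 1),
    z (Quot.mk _ (f, i, j)) *
      ((bernsteinPolynomial ℝ n i).eval u * (bernsteinPolynomial ℝ n j).eval v)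

/-- The spline space of degree `n`, in terms of the `Z`-components of control points: together with
the in-plane parametrisation, the patches form the graph of a `C¹` function over the domain. -/
def FUN (n : ℕ) : Set (M.CP n → ℝ) :=
  {z | ∃ φ : ℝ × ℝ → ℝ, ContDiffOn ℝ 1 φ M.domain ∧
    ∀ f, ∀ u ∈ Icc (0 : ℝ) 1, ∀ v ∈ Icc (0 : ℝ) 1, φ (M.param f u v) = M.zPatch z f u v}

/-! ### Minimal determining sets -/

/-- `D` is a determining set: an element of the spline space that vanishes on `D` is zero. -/
def IsDetermining (n : ℕ) (D : Set (M.CP n)) : Prop :=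
  ∀ z ∈ M.FUN n, (∀ p ∈ D, z p = 0) → z = 0

/-- `D` is a minimal determining set: no determining set has smaller size. -/
def IsMDS (n : ℕ) (D : Set (M.CP n)) : Prop :=
  M.IsDetermining n D ∧ ∀ D', M.IsDetermining n D' → D.ncard ≤ D'.ncard

/-- In the spline space, the value at `p` depends only on the values at the points of `S`. -/
def DependsOnlyOn (n : ℕ) (p : M.CP n) (S : Set (M.CP n)) : Prop :=
  ∀ z ∈ M.FUN n, ∀ z' ∈ M.FUN n, (∀ q ∈ S, z q = z' q) → z p = z' p

/-- The minimal determining set `D` fits a constraint that fixes the control points of `P`: every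
fixed control point belongs to `D`, or depends only on fixed control points that belong to `D`. -/
def Fits (n : ℕ) (D P : Set (M.CP n)) : Prop :=
  ∀ p ∈ P, p ∈ D ∨ M.DependsOnlyOn n p (D ∩ P)

/-! ### The additional constraints -/

/-- A type of additional constraint: at which vertices the surface is to interpolate a given point,
or a given point and tangent plane; along which parts of the boundary (given through boundary
elements) a boundary curve, a simply-supported or a clamped boundary condition is imposed. -/
structure ConstraintType (V F : Type*) where
  vertexInterp : Set V
  tangentPlane : Set V
  boundaryCurve : Set F
  simplySupported : Set F
  clamped : Set F

/-- The control points fixed by an additional constraint: `V`-type control points for vertex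
interpolation; `V`- and `E`-type ones for tangent plane interpolation; the control points on the
boundary edge for boundary curve interpolation and for the simply-supported condition; those on
the boundary edge and those adjacent to it for the clamped condition. -/
def fixedPoints (n : ℕ) (K : ConstraintType V F) : Set (M.CP n) :=
  {p | ∃ h : F × Fin 4,
    (M.org h ∈ K.vertexInterp ∧ p = M.cp n h 0 0) ∨
    (M.org h ∈ K.tangentPlane ∧
      (p = M.cp n h 0 0 ∨ p = M.cp n h 1 0 ∨ p = M.cp n h 0 1)) ∨
    (M.IsBdEdge h ∧ h.1 ∈ K.boundaryCurve ∧ ∃ t, p = M.cp n h t 0) ∨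
    (M.IsBdEdge h ∧ h.1 ∈ K.simplySupported ∧ ∃ t, p = M.cp n h t 0) ∨
    (M.IsBdEdge h ∧ h.1 ∈ K.clamped ∧ ∃ t, p = M.cp n h t 0 ∨ p = M.cp n h t 1)}

/-! ### Local templates

In all of them `D` is the set of the basic control points. For an inner edge `h` with opposite
orientation `h'`, the central control points are `C_t = cp h t 0`, the side control points are
`L_t = cp h t 1` and `R_t = cp h' (n - t) 1`. -/

/-- The control point takes part in no smoothness condition: it neither lies on an inner edge nor
is adjacent to one. -/
def IsFree (n : ℕ) (p : M.CP n) : Prop :=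
  ∀ h, M.IsInnerEdge h → ∀ t, p ≠ M.cp n h t 0 ∧ p ≠ M.cp n h t 1

/-- The vector of a directed edge. -/
def dir (h : F × Fin 4) : ℝ × ℝ := M.pos (M.tgt h) - M.pos (M.org h)

/-- The two edges at the origin of `h` that are neighbours of the edge `h` are colinear. -/
def NeighboursColinear (h : F × Fin 4) : Prop :=
  ∃ h', M.Opp h h' ∧
    cross (M.pos (M.tgt (next h')) - M.pos (M.org h))
      (M.pos (M.org (prev h)) - M.pos (M.org h)) = 0

/-- `v` is a regular `4`-vertex: its edges form two colinear pairs. -/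
def IsRegularFour (v : V) : Prop :=
  M.valence v = 4 ∧ ∀ h, M.org h = v → M.NeighboursColinear h

/-- The `V`- and `E`-type control points at an inner vertex `v`: the `V`-type one and two `E`-type
ones, along two non-colinear edges, are basic. -/
def TemplateVE (n : ℕ) (D : Set (M.CP n)) (v : V) : Prop :=
  (∀ h, M.org h = v → M.cp n h 0 0 ∈ D) ∧
  ∃ k₁ k₂, M.org k₁ = v ∧ M.org k₂ = v ∧ cross (M.dir k₁) (M.dir k₂) ≠ 0 ∧
    ∀ h, M.org h = v → (M.cp n h 1 0 ∈ D ↔ h = k₁ ∨ h = k₂)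

/-- The `D`- and `T`-type control points at an inner vertex `v`. Odd vertex: all `D`-type ones are
basic, all `T`-type ones are dependent. Even vertex that is not `4`-regular: one `D`-type one, of an
edge whose neighbours are not colinear, is dependent, the others are basic, and one `T`-type one is
basic. Regular `4`-vertex: all `D`-type ones and one `T`-type one are basic. -/
def TemplateDT (n : ℕ) (D : Set (M.CP n)) (v : V) : Prop :=
  (Odd (M.valence v) ∧ ∀ h, M.org h = v → M.cp n h 2 0 ∈ D ∧ M.cp n h 1 1 ∉ D) ∨
  (Even (M.valence v) ∧ ¬ M.IsRegularFour v ∧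
    (∃ k, M.org k = v ∧ ¬ M.NeighboursColinear k ∧
      ∀ h, M.org h = v → (M.cp n h 2 0 ∈ D ↔ h ≠ k)) ∧
    ∃ k, M.org k = v ∧ ∀ h, M.org h = v → (M.cp n h 1 1 ∈ D ↔ h = k)) ∨
  (M.IsRegularFour v ∧ (∀ h, M.org h = v → M.cp n h 2 0 ∈ D) ∧
    ∃ k, M.org k = v ∧ ∀ h, M.org h = v → (M.cp n h 1 1 ∈ D ↔ h = k))

/-- `2 ≤ t ≤ n - 2`: the indices of the side middle control points. -/
def sideRange (n : ℕ) : Set (Fin (n + 1)) := {t | 2 ≤ (t : ℕ) ∧ (t : ℕ) + 2 ≤ n}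

/-- The indices `t` of the basic control points among `L_2, …, L_{n-2}`, if `h` is the edge with
`L` on its left. -/
def basicL (n : ℕ) (D : Set (M.CP n)) (h : F × Fin 4) : Set (Fin (n + 1)) :=
  {t | t ∈ sideRange n ∧ M.cp n h t 1 ∈ D}

/-- The indices `t` of the basic control points among `R_2, …, R_{n-2}`, if `h'` is the edge with
`R` on its left. -/
def basicR (n : ℕ) (D : Set (M.CP n)) (h' : F × Fin 4) : Set (Fin (n + 1)) :=
  {t | t ∈ sideRange n ∧ M.cp n h' t.rev 1 ∈ D}

/-- The coefficient of `ΔL_t` in the `s`-th equation of the linear system for one edge: the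
coefficient of the product of the Bernstein polynomials of degree `n` and `d`, where `w` are the
Bézier coefficients of the weight function of degree `d`. -/
def sideCoeff (n d : ℕ) (w : Fin (d + 1) → ℝ) (s : ℕ) (t : Fin (n + 1)) : ℝ :=
  ∑ k : Fin (d + 1),
    if (t : ℕ) + (k : ℕ) = s then (n.choose t : ℝ) * (d.choose k : ℝ) * w k else 0

/-- The dependent side middle control points can be computed from the (restricted) middle system,
that is, from the equations `2 ≤ s ≤ n + d - 2`: their columns in it are linearly independent. -/
def DependentSolvable (n d : ℕ) (l r : Fin (d + 1) → ℝ) (D : Set (M.CP n)) (h h' : F × Fin 4) :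
    Prop :=
  ∀ x y : Fin (n + 1) → ℝ,
    (∀ t, t ∉ sideRange n \ M.basicL n D h → x t = 0) →
    (∀ t, t ∉ sideRange n \ M.basicR n D h' → y t = 0) →
    (∀ s : ℕ, 2 ≤ s → s + 2 ≤ n + d →
      ∑ t, (sideCoeff n d l s t * x t + sideCoeff n d r s t * y t) = 0) →
    x = 0 ∧ y = 0

/-- In every pair `(L_t, R_t)`, `2 ≤ t ≤ n - 2`, exactly one control point is basic. -/
def OneOfEachPair (n : ℕ) (D : Set (M.CP n)) (h h' : F × Fin 4) : Prop :=
  ∀ t ∈ sideRange n, Xor (M.cp n h t 1 ∈ D) (M.cp n h' t.rev 1 ∈ D)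

/-! #### Edges with two inner vertices -/

/-- Bézier coefficients of the conventional weight function `l` (of degree one) for an edge with
two inner vertices. -/
def lBilinear (h h' : F × Fin 4) : Fin 2 → ℝ :=
  ![cross (M.pos (M.tgt (next h')) - M.pos (M.org h)) (M.dir h),
    cross (M.pos (M.org (prev h')) - M.pos (M.tgt h)) (M.dir h)]

/-- Bézier coefficients of the conventional weight function `r` (of degree one) for an edge with
two inner vertices. -/
def rBilinear (h : F × Fin 4) : Fin 2 → ℝ :=
  ![cross (M.pos (M.org (prev h)) - M.pos (M.org h)) (M.dir h),
    cross (M.pos (M.tgt (next h)) - M.pos (M.tgt h)) (M.dir h)]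

/-- The projections relation for an edge with two inner vertices. -/
def ProjectionsRelation (h h' : F × Fin 4) : Prop :=
  M.lBilinear h h' 0 * M.rBilinear h 1 - M.rBilinear h 0 * M.lBilinear h h' 1 = 0

/-- The middle control points for an edge with two inner vertices: the central ones `C_3, …,
C_{n-3}` are basic. Among the side ones, one in every pair `(L_t, R_t)` is basic if the projections
relation holds; otherwise `n - 4` are basic and the others are computed from the middle system. -/
def TemplateMiddleInner (n : ℕ) (D : Set (M.CP n)) (h h' : F × Fin 4) : Prop :=
  (∀ t : Fin (n + 1), 3 ≤ (t : ℕ) → (t : ℕ) + 3 ≤ n → M.cp n h t 0 ∈ D) ∧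
  (M.ProjectionsRelation h h' → M.OneOfEachPair n D h h') ∧
  (¬ M.ProjectionsRelation h h' →
    (M.basicL n D h).ncard + (M.basicR n D h').ncard + 4 = n ∧
    M.DependentSolvable n 1 (M.lBilinear h h') (M.rBilinear h) D h h')

/-! #### Edges with one boundary vertex -/

/-- Bézier coefficients of the cross derivative of the left parametrisation along an edge `h` from
an inner to a boundary vertex. -/
def lam (h : F × Fin 4) : Fin 3 → ℝ × ℝ :=
  ![M.pos (M.org h) - M.pos (M.org (prev h)),
    (1 / 2 : ℝ) • ((M.pos (M.org h) - M.pos (M.org (prev h))) +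
      (M.pos (M.tgt h) - M.pos (M.tgt (next h)))),
    (3 : ℝ) • (M.pos (M.tgt h) - M.bdCtrl h.1 1)]

/-- Bézier coefficients of the cross derivative of the right parametrisation along an edge from
an inner to a boundary vertex. -/
def rho (h h' : F × Fin 4) : Fin 3 → ℝ × ℝ :=
  ![M.pos (M.tgt (next h')) - M.pos (M.org h),
    (1 / 2 : ℝ) • ((M.pos (M.tgt (next h')) - M.pos (M.org h)) +
      (M.pos (M.org (prev h')) - M.pos (M.tgt h))),
    (3 : ℝ) • (M.bdCtrl h'.1 0 - M.pos (M.tgt h))]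

/-- Bézier coefficients of the conventional weight function `l`. -/
def lBicubic (h h' : F × Fin 4) : Fin 3 → ℝ := fun i => cross (M.rho h h' i) (M.dir h)

/-- Bézier coefficients of the conventional weight function `r`. -/
def rBicubic (h : F × Fin 4) : Fin 3 → ℝ := fun i => - cross (M.lam h i) (M.dir h)

/-- The polynomial with the given Bézier coefficients of degree two. -/
def bezier2 (w : Fin 3 → ℝ) : ℝ[X] := ∑ i : Fin 3, C (w i) * bernsteinPolynomial ℝ 2 i

/-- The conventional weight function `c`, the cross product of the two cross derivatives. -/
def cBicubic (h h' : F × Fin 4) : ℝ[X] :=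
  bezier2 (fun i => (M.lam h i).1) * bezier2 (fun i => (M.rho h h' i).2) -
    bezier2 (fun i => (M.lam h i).2) * bezier2 (fun i => (M.rho h h' i).1)

/-- `deg c - max (deg l) (deg r) = 2`, with actual degrees. -/
def DegreeGapTwo (h h' : F × Fin 4) : Prop :=
  (M.cBicubic h h').natDegree =
    max (bezier2 (M.lBicubic h h')).natDegree (bezier2 (M.rBicubic h)).natDegree + 2

/-- `g^{(ij)} = l_i r_j - l_j r_i`. -/
def g (h h' : F × Fin 4) (i j : Fin 3) : ℝ :=
  M.lBicubic h h' i * M.rBicubic h j - M.lBicubic h h' j * M.rBicubic h i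

def Case1 (h h' : F × Fin 4) : Prop :=
  M.g h h' 0 1 * M.g h h' 1 2 * M.g h h' 0 2 ≠ 0 ∧
    M.g h h' 0 2 ^ 2 = 4 * M.g h h' 0 1 * M.g h h' 1 2

def Case2 (h h' : F × Fin 4) : Prop :=
  M.g h h' 0 1 = 0 ∧ M.g h h' 1 2 = 0 ∧ M.g h h' 0 2 = 0

/-- The control points at the boundary vertex of the edge: the `V`-type one `C_n` and the `E`-type
one `C_{n-1}` of the edge itself are basic, one of the two boundary `E`-type ones `L_n`, `R_n` is
basic, and one of the two `T`-type ones `L_{n-1}`, `R_{n-1}` is basic. -/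
def TemplateBd (n : ℕ) (D : Set (M.CP n)) (h h' : F × Fin 4) : Prop :=
  M.cp n h' 0 0 ∈ D ∧ M.cp n h' 1 0 ∈ D ∧
  Xor (M.cp n h (Fin.last n) 1 ∈ D) (M.cp n h' 0 1 ∈ D) ∧
  Xor (M.cp n h (Fin.rev 1) 1 ∈ D) (M.cp n h' 1 1 ∈ D)

/-- The middle control points for an edge with one boundary vertex: the central ones `C_3, …,
C_{n-3}` are basic, and `C_{n-2}` is dependent exactly if `deg c - max (deg l) (deg r) = 2`.
Among the side ones, `n - 5`, `n - 4` or `n - 3` are basic, according to the case; the others are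
computed from the restricted middle system. -/
def TemplateMiddleBd (n : ℕ) (D : Set (M.CP n)) (h h' : F × Fin 4) : Prop :=
  (∀ t : Fin (n + 1), 3 ≤ (t : ℕ) → (t : ℕ) + 3 ≤ n → M.cp n h t 0 ∈ D) ∧
  (M.cp n h (Fin.rev 2) 0 ∈ D ↔ ¬ M.DegreeGapTwo h h') ∧
  (M.Case2 h h' → M.OneOfEachPair n D h h') ∧
  (M.Case1 h h' →
    (M.basicL n D h).ncard + (M.basicR n D h').ncard + 4 = n ∧
    M.DependentSolvable n 2 (M.lBicubic h h') (M.rBicubic h) D h h') ∧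
  (¬ M.Case1 h h' → ¬ M.Case2 h h' →
    (M.basicL n D h).ncard + (M.basicR n D h').ncard + 5 = n ∧
    M.DependentSolvable n 2 (M.lBicubic h h') (M.rBicubic h) D h h')

/-! ### The algorithm -/

/-- `D` is the set of the basic control points of a possible outcome of the algorithm for
degree `n ≥ 5`; the algorithm leaves some choices open. -/
structure IsAlgorithmOutput (n : ℕ) (D : Set (M.CP n)) : Prop where
  /-- Control points that take part in no smoothness condition are basic. -/
  free : ∀ p, M.IsFree n p → p ∈ D
  /-- Stage 1: the `V`-, `E`-, `D`- and `T`-type control points at the inner vertices. -/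
  stage1_VE : ∀ v, ¬ M.IsBdVertex v → M.TemplateVE n D v
  stage1_DT : ∀ v, ¬ M.IsBdVertex v → M.TemplateDT n D v
  /-- Stage 2: the middle control points for the edges with two inner vertices. -/
  stage2 : ∀ h h', M.Opp h h' → ¬ M.IsBdVertex (M.org h) → ¬ M.IsBdVertex (M.tgt h) →
    M.TemplateMiddleInner n D h h'
  /-- Stage 3, for the edges with one boundary vertex. Step 1: the control points at the boundary
  vertex. -/
  stage3_step1 : ∀ h h', M.EdgeToBd h h' → M.TemplateBd n D h h'
  /-- Step 2: the middle control points. -/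
  stage3_step2 : ∀ h h', M.EdgeToBd h h' → M.TemplateMiddleBd n D h h'

end Mesh

end SmoothQuadMesh

end

/-! ### Polynomials in Bernstein form. -/

noncomputable section
namespace SmoothQuadMesh

/-! The spline space is cut out by one polynomial identity per inner edge. On a straight edge with
vector e, let λ and ρ be the cross derivatives of the two parametrisations. Three plane vectors
satisfy (ρ×e)λ + (e×λ)ρ + (λ×ρ)e = 0, so applying the gradient of a smooth function gives l·(left
cross derivative of z) + r·(right cross derivative of z) + c·(derivative of z along the edge) = 0,
with weights l, r, c that depend only on the mesh. This is `smo z h h' = 0`. Conversely, regularity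
and the way elements meet allow values and gradients to be glued along edges and around vertices, so
these identities suffice (`mem_FUN_iff`).

For an output D of the algorithm, evaluation on D is shown to be a bijection from the spline space
to the functions on D. Injectivity means that D is determining; surjectivity gives |D| ≤ dim; and
every determining set has at least dim elements. Hence D is an MDS.

The system decouples into vertex systems and edge systems, and n ≥ 5 keeps their unknowns apart.

At an inner vertex each identity is considered modulo X². Its constant coefficients say that the
first differences along the edges come from one linear functional, so two non-colinear edges decide.
Once an affine spline with this tangent plane is subtracted, the linear coefficients become, after
rescaling, a cyclic system τ(σx) + τ(x) = b(x) for the twists, where σ is the rotation of the edges.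
For odd valence it is invertible. For even valence its kernel is a line, and b must satisfy one
alternating sum condition, in which the weight of the C₂ of an edge is nonzero exactly if the
neighbours of that edge are not colinear. Such an edge exists unless the vertex is a regular
4-vertex (`twistSystem_exists`, `twistSystem_unique`, `exists_not_neighboursColinear`).

Along an edge, cancel the common factor of l and r; let δ bound the degree of what remains. With
double zeros at both ends and degree at most n+δ, the edge polynomial lies in a space of dimension
n+δ-3. The reduced weights have no common zero, so the columns of the L_t, R_t with 2 ≤ t ≤ n-2 span
this space; n+δ-3 of these 2(n-3) points are dependent and n-3-δ basic (`exists_of_sideInjective`,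
`exists_sideInjective`). For linear weights δ is 0 or 1; for quadratic ones it is 0, 1 or 2,
according to the g^{(ij)} and to the resultant (g^{(02)})² - 4g^{(01)}g^{(12)}
(`exists_isReduction_two`). The product of c with the derivative along the edge can exceed the
degree n+δ only if c has the maximal degree gap 2; this one extra coefficient then determines
C_{n-2}. At a boundary vertex the G¹ condition makes c vanish, and the two conditions there are
solved by one of L_n, R_n and one of L_{n-1}, R_{n-1}.

For the fit with the constraints, the only delicate points are those pairs at the boundary vertices.
The basic partner is chosen such that whenever a dependent partner is fixed, so is the basic one
(`exists_isAlgorithmOutput_fits`). For an arbitrary fixed set P, the evaluation functionals form a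
matroid: a basis chosen within P extends to an MDS (`exists_isMDS_fits`). -/

/-- The polynomial with given Bernstein coefficients of degree `n`. -/
def bz (n : ℕ) : (Fin (n + 1) → ℝ) →ₗ[ℝ] ℝ[X] :=
  Fintype.linearCombination ℝ (fun t : Fin (n + 1) => bernsteinPolynomial ℝ n t)

theorem bz_apply (n : ℕ) (c : Fin (n + 1) → ℝ) :
    bz n c = ∑ t : Fin (n + 1), C (c t) * bernsteinPolynomial ℝ n t := by
  simp [bz, Fintype.linearCombination_apply, smul_eq_C_mul]

theorem bezier2_eq_bz (w : Fin 3 → ℝ) : Mesh.bezier2 w = bz 2 w := by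
  rw [bz_apply]; rfl

theorem eval_bz (n : ℕ) (c : Fin (n + 1) → ℝ) (x : ℝ) :
    (bz n c).eval x = ∑ t : Fin (n + 1), c t * (bernsteinPolynomial ℝ n t).eval x := by
  rw [bz_apply, eval_finsetSum]; simp

theorem coeff_bernsteinPolynomial_of_lt {n ν k : ℕ} (h : k < ν) :
    (bernsteinPolynomial ℝ n ν).coeff k = 0 := by
  unfold bernsteinPolynomial
  rw [mul_assoc, mul_comm (X ^ ν), ← mul_assoc, coeff_mul_X_pow', if_neg (by omega)]

theorem coeff_one_sub_X_pow (m k : ℕ) :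
    ((1 - X : ℝ[X]) ^ m).coeff k = (-1) ^ k * (m.choose k : ℝ) := by
  have : (1 - X : ℝ[X]) = (1 + X).comp (C (-1) * X) := by simp [sub_eq_add_neg]
  rw [this, ← pow_comp, comp_C_mul_X_coeff, coeff_one_add_X_pow, mul_comm]

theorem coeff_bernsteinPolynomial {n ν k : ℕ} (h : ν ≤ k) :
    (bernsteinPolynomial ℝ n ν).coeff k =
      n.choose ν * ((-1) ^ (k - ν) * ((n - ν).choose (k - ν) : ℝ)) := by
  unfold bernsteinPolynomial
  rw [mul_assoc, mul_comm (X ^ ν), ← C_eq_natCast, coeff_C_mul, coeff_mul_X_pow', if_pos h,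
    coeff_one_sub_X_pow]

theorem coeff_bz (n : ℕ) (c : Fin (n + 1) → ℝ) (k : ℕ) :
    (bz n c).coeff k = ∑ t : Fin (n + 1), c t * (bernsteinPolynomial ℝ n t).coeff k := by
  rw [bz_apply, finsetSum_coeff]; simp

/-- The passage to monomial coefficients is triangular: the Bernstein polynomial with index t starts
with X^t, and its coefficient there is a nonzero binomial. -/
theorem bz_injective (n : ℕ) : Function.Injective (bz n) := by
  rw [injective_iff_map_eq_zero]
  intro c hc
  have key : ∀ k : ℕ, ∀ hk : k < n + 1, c ⟨k, hk⟩ = 0 := by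
    intro k
    induction k using Nat.strong_induction_on with
    | _ k ih =>
      intro hk
      have h := coeff_bz n c k
      rw [hc, coeff_zero, Finset.sum_eq_single ⟨k, hk⟩] at h
      · rw [coeff_bernsteinPolynomial le_rfl] at h
        have : (n.choose k : ℝ) ≠ 0 := by
          exact_mod_cast (Nat.choose_pos (Nat.lt_succ_iff.1 hk)).ne'
        simpa [this] using h.symm
      · intro t _ ht
        rcases lt_or_gt_of_ne (fun h : (t : ℕ) = k => ht (Fin.ext h)) with h' | h'
        · rw [show t = ⟨t, t.2⟩ from rfl, ih t h' t.2, zero_mul]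
        · rw [coeff_bernsteinPolynomial_of_lt h', mul_zero]
      · simp
  exact funext fun t => key t t.2

theorem bz_eq_zero_iff {n : ℕ} {c : Fin (n + 1) → ℝ} : bz n c = 0 ↔ c = 0 :=
  map_eq_zero_iff _ (bz_injective n)

theorem natDegree_bernsteinPolynomial_le (n ν : ℕ) :
    (bernsteinPolynomial ℝ n ν).natDegree ≤ n := by
  rcases lt_or_ge n ν with h | h
  · simp [bernsteinPolynomial.eq_zero_of_lt ℝ h]
  · unfold bernsteinPolynomial
    have h1 : ((1 - X : ℝ[X]) ^ (n - ν)).natDegree ≤ n - ν := by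
      refine natDegree_pow_le.trans ?_
      have : (1 - X : ℝ[X]).natDegree ≤ 1 := by
        refine (natDegree_sub_le _ _).trans ?_
        simp
      nlinarith
    have h2 : ((n.choose ν : ℝ[X]) * X ^ ν).natDegree ≤ ν := by
      refine natDegree_mul_le.trans ?_
      simp
    refine natDegree_mul_le.trans ?_
    omega

theorem natDegree_bz_le (n : ℕ) (c : Fin (n + 1) → ℝ) : (bz n c).natDegree ≤ n := by
  rw [bz_apply]
  refine natDegree_sum_le_of_forall_le _ _ fun t _ => ?_
  exact (natDegree_C_mul_le _ _).trans (natDegree_bernsteinPolynomial_le n t)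

theorem mem_degreeLT_succ_iff {n : ℕ} {p : ℝ[X]} :
    p ∈ degreeLT ℝ (n + 1) ↔ p.natDegree ≤ n := by
  rw [mem_degreeLT, degree_lt_iff_coeff_zero, natDegree_le_iff_coeff_eq_zero]
  exact ⟨fun h N hN => h N hN, fun h N hN => h N hN⟩

theorem finrank_degreeLT (m : ℕ) : Module.finrank ℝ (degreeLT ℝ m) = m := by
  rw [(degreeLTEquiv ℝ m).finrank_eq]; simp

instance (m : ℕ) : FiniteDimensional ℝ (degreeLT ℝ m) :=
  (degreeLTEquiv ℝ m).symm.finiteDimensional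

/-- An injective linear map between spaces of dimension n+1 is onto. -/
theorem exists_bz {n : ℕ} {p : ℝ[X]} (hp : p.natDegree ≤ n) : ∃ c, bz n c = p := by
  have hle : LinearMap.range (bz n) ≤ degreeLT ℝ (n + 1) := by
    rintro _ ⟨c, rfl⟩
    exact mem_degreeLT_succ_iff.2 (natDegree_bz_le n c)
  have heq := Submodule.eq_of_le_of_finrank_eq hle (by
    rw [LinearMap.finrank_range_of_inj (bz_injective n), finrank_degreeLT]; simp)
  have := mem_degreeLT_succ_iff.2 hp
  rw [← heq] at this
  exact this

/-- Reflection moves conditions at the parameter 1 to the parameter 0, where the first Bézier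
coefficients can be read off from the lowest monomial coefficients. All end conditions are treated
in this way. -/
theorem bz_comp_one_sub_X (n : ℕ) (c : Fin (n + 1) → ℝ) :
    (bz n c).comp (1 - X) = bz n (fun t => c t.rev) := by
  rw [bz_apply, bz_apply, sum_comp]
  simp only [mul_comp, C_comp]
  rw [← Equiv.sum_comp Fin.revPerm]
  refine Finset.sum_congr rfl fun t _ => ?_
  have h : ((Fin.revPerm t : Fin (n + 1)) : ℕ) ≤ n := by omega
  rw [bernsteinPolynomial.flip ℝ n _ h]
  simp only [Fin.revPerm_apply, Fin.val_rev]
  congr 2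
  omega

theorem coeff_bz_zero (n : ℕ) (c : Fin (n + 1) → ℝ) : (bz n c).coeff 0 = c 0 := by
  rw [coeff_bz, Fin.sum_univ_succ, Finset.sum_eq_zero]
  · simp [coeff_bernsteinPolynomial]
  · intro i _
    rw [coeff_bernsteinPolynomial_of_lt (by simp), mul_zero]

theorem coeff_bz_one (n : ℕ) (hn : 1 ≤ n) (c : Fin (n + 1) → ℝ) :
    (bz n c).coeff 1 = n * (c 1 - c 0) := by
  obtain ⟨m, rfl⟩ := Nat.exists_eq_add_of_le' hn
  rw [coeff_bz, Fin.sum_univ_succ, Fin.sum_univ_succ, Finset.sum_eq_zero]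
  · simp [coeff_bernsteinPolynomial]
    ring
  · intro i _
    rw [coeff_bernsteinPolynomial_of_lt (by simp), mul_zero]

theorem coeff_bz_two (n : ℕ) (hn : 2 ≤ n) (c : Fin (n + 1) → ℝ) :
    (bz n c).coeff 2 = n.choose 2 * (c 2 - 2 * c 1 + c 0) := by
  obtain ⟨m, rfl⟩ := Nat.exists_eq_add_of_le' hn
  rw [coeff_bz, Fin.sum_univ_succ, Fin.sum_univ_succ, Fin.sum_univ_succ, Finset.sum_eq_zero]
  · have h2 : (Fin.succ (Fin.succ (0 : Fin (m + 1)))) = (2 : Fin (m + 2 + 1)) := rfl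
    have h3 : (((m + 2).choose 2 : ℕ) : ℝ) * 2 = (m + 2) * (m + 1) := by
      rw [Nat.choose_two_right]
      have := Nat.div_mul_cancel (Nat.even_mul_pred_self (m + 2)).two_dvd
      calc _ = ((((m + 2) * (m + 2 - 1) / 2 * 2 : ℕ)) : ℝ) := by push_cast; rfl
        _ = _ := by rw [this]; push_cast; simp
    have h4 : (m + 2 - 1) = m + 1 := rfl
    have h5 : ((2 : Fin (m + 2 + 1)) : ℕ) = 2 := rfl
    simp only [h2, h5, Fin.val_zero, Fin.val_succ, zero_add]
    rw [coeff_bernsteinPolynomial (by norm_num), coeff_bernsteinPolynomial (by norm_num),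
      coeff_bernsteinPolynomial (by norm_num)]
    simp [h4]
    linear_combination c 1 * h3
  · intro i _
    rw [coeff_bernsteinPolynomial_of_lt (by simp), mul_zero]

theorem coeff_bz_top (n : ℕ) (c : Fin (n + 1) → ℝ) :
    (bz n c).coeff n = ∑ t : Fin (n + 1), (-1) ^ (n - (t : ℕ)) * (n.choose t : ℝ) * c t := by
  rw [coeff_bz]
  refine Finset.sum_congr rfl fun t _ => ?_
  rw [coeff_bernsteinPolynomial (by omega)]
  simp
  ring

theorem X_sq_dvd_iff {p : ℝ[X]} : X ^ 2 ∣ p ↔ p.coeff 0 = 0 ∧ p.coeff 1 = 0 := by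
  rw [X_pow_dvd_iff]
  refine ⟨fun h => ⟨h 0 (by norm_num), h 1 (by norm_num)⟩, fun h d hd => ?_⟩
  interval_cases d
  exacts [h.1, h.2]

theorem comp_one_sub_X_involutive (p : ℝ[X]) : (p.comp (1 - X)).comp (1 - X) = p := by
  rw [comp_assoc]; simp

theorem one_sub_X_sq_dvd_iff {p : ℝ[X]} : (1 - X) ^ 2 ∣ p ↔ X ^ 2 ∣ p.comp (1 - X) := by
  constructor
  · rintro ⟨q, rfl⟩
    exact ⟨q.comp (1 - X), by simp⟩
  · rintro ⟨q, hq⟩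
    refine ⟨q.comp (1 - X), ?_⟩
    rw [← comp_one_sub_X_involutive p, hq]; simp

theorem isCoprime_X_sq_one_sub_X_sq : IsCoprime ((X : ℝ[X]) ^ 2) ((1 - X) ^ 2) := by
  apply IsCoprime.pow
  exact ⟨1, 1, by ring⟩

/-- A polynomial that does not vanish at `0` and `1` can be cancelled in a divisibility by
`X ^ 2 * (1 - X) ^ 2`. -/
theorem isCoprime_X_of_coeff_zero_ne {p : ℝ[X]} (hp : p.coeff 0 ≠ 0) :
    IsCoprime ((X : ℝ[X]) ^ 2) p := by
  apply IsCoprime.pow_left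
  refine (irreducible_X.coprime_iff_not_dvd).2 ?_
  rw [X_dvd_iff]; exact hp

theorem X_sq_dvd_of_mul {p q : ℝ[X]} (hp : p.coeff 0 ≠ 0) (h : X ^ 2 ∣ p * q) : X ^ 2 ∣ q :=
  (isCoprime_X_of_coeff_zero_ne hp).dvd_of_dvd_mul_left h

theorem natDegree_comp_one_sub_X (p : ℝ[X]) : (p.comp (1 - X)).natDegree = p.natDegree := by
  rw [natDegree_comp]
  have : (1 - X : ℝ[X]).natDegree = 1 := by
    have : (1 - X : ℝ[X]) = -(X - C 1) := by simp
    rw [this, natDegree_neg, natDegree_X_sub_C]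
  rw [this, mul_one]

end SmoothQuadMesh
end

/-! ### The unit square seen from each of its sides. -/

noncomputable section
namespace SmoothQuadMesh

theorem cross_neg_left (a b : ℝ × ℝ) : cross (-a) b = -cross a b := by
  simp [cross]; ring

theorem cross_swap (a b : ℝ × ℝ) : cross a b = -cross b a := by
  simp [cross]; ring

/-- Local coordinates of the unit square along its side number `s`. -/
def sq (s : Fin 4) (a b : ℝ) : ℝ × ℝ :=
  match s with
  | 0 => (a, b)
  | 1 => (1 - b, a)
  | 2 => (1 - a, 1 - b)
  | 3 => (b, 1 - a)

/-- The unit square. -/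
def unitSq : Set (ℝ × ℝ) := Icc 0 1 ×ˢ Icc 0 1

theorem sq_mem (s : Fin 4) {a b : ℝ} (ha : a ∈ Icc (0 : ℝ) 1) (hb : b ∈ Icc (0 : ℝ) 1) :
    sq s a b ∈ unitSq := by
  obtain ⟨h1, h2⟩ := ha
  obtain ⟨h3, h4⟩ := hb
  fin_cases s <;> simp only [sq, unitSq, mem_prod, mem_Icc] <;>
    refine ⟨⟨?_, ?_⟩, ?_, ?_⟩ <;> linarith

theorem sq_add_three (s : Fin 4) (a b : ℝ) : sq (s + 3) a b = sq s b (1 - a) := by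
  fin_cases s <;> simp [sq]

/-- The linear part of `sq`. -/
def sqDir (s : Fin 4) (a b : ℝ) : ℝ × ℝ :=
  match s with
  | 0 => (a, b)
  | 1 => (-b, a)
  | 2 => (-a, -b)
  | 3 => (b, -a)

/-- All four local frames are positively oriented, so the sign of the Jacobian determinant does not
depend on the side from which it is computed. -/
theorem cross_sqDir (s : Fin 4) : cross (sqDir s 1 0) (sqDir s 0 1) = 1 := by
  fin_cases s <;> simp [sqDir, cross]

theorem hasDerivAt_sq_left (s : Fin 4) (a b : ℝ) :
    HasDerivAt (fun x => sq s x b) (sqDir s 1 0) a := by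
  have h1 : HasDerivAt (fun x : ℝ => x) 1 a := hasDerivAt_id a
  have h2 : HasDerivAt (fun x : ℝ => 1 - x) (-1) a := by
    simpa using (hasDerivAt_id a).const_sub 1
  fin_cases s
  · exact h1.prodMk (hasDerivAt_const a b)
  · simpa [sq, sqDir] using (hasDerivAt_const a (1 - b)).prodMk h1
  · simpa [sq, sqDir] using h2.prodMk (hasDerivAt_const a (1 - b))
  · simpa [sq, sqDir] using (hasDerivAt_const a b).prodMk h2

theorem hasDerivAt_sq_right (s : Fin 4) (a b : ℝ) :
    HasDerivAt (fun x => sq s a x) (sqDir s 0 1) b := by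
  have h1 : HasDerivAt (fun x : ℝ => x) 1 b := hasDerivAt_id b
  have h2 : HasDerivAt (fun x : ℝ => 1 - x) (-1) b := by
    simpa using (hasDerivAt_id b).const_sub 1
  fin_cases s
  · simpa [sq, sqDir] using (hasDerivAt_const b a).prodMk h1
  · simpa [sq, sqDir] using h2.prodMk (hasDerivAt_const b a)
  · simpa [sq, sqDir] using (hasDerivAt_const b (1 - a)).prodMk h2
  · simpa [sq, sqDir] using h1.prodMk (hasDerivAt_const b (1 - a))

/-! ### Tensor product Bézier patches -/

section Patch

variable {E : Type*} [NormedAddCommGroup E] [NormedSpace ℝ E]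

/-- The tensor product Bézier patch with the given control net. -/
def patch (n : ℕ) (Q : Fin (n + 1) → Fin (n + 1) → E) (a b : ℝ) : E :=
  ∑ i : Fin (n + 1), ∑ j : Fin (n + 1),
    ((bernsteinPolynomial ℝ n i).eval a * (bernsteinPolynomial ℝ n j).eval b) • Q i j

theorem eval_bernsteinPolynomial_one_sub (n : ℕ) (i : Fin (n + 1)) (x : ℝ) :
    (bernsteinPolynomial ℝ n i).eval (1 - x) = (bernsteinPolynomial ℝ n i.rev).eval x := by
  have h : (i : ℕ) ≤ n := by omega
  have := bernsteinPolynomial.flip ℝ n i h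
  rw [Fin.val_rev, show n + 1 - (i + 1 : ℕ) = n - i by omega, ← this, eval_comp]
  simp

theorem patch_one_sub_left (n : ℕ) (Q : Fin (n + 1) → Fin (n + 1) → E) (a b : ℝ) :
    patch n Q (1 - a) b = patch n (fun i j => Q i.rev j) a b := by
  unfold patch
  rw [← Equiv.sum_comp Fin.revPerm]
  refine Finset.sum_congr rfl fun i _ => Finset.sum_congr rfl fun j _ => ?_
  rw [eval_bernsteinPolynomial_one_sub]
  simp

theorem patch_swap (n : ℕ) (Q : Fin (n + 1) → Fin (n + 1) → E) (a b : ℝ) :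
    patch n Q a b = patch n (fun i j => Q j i) b a := by
  unfold patch
  rw [Finset.sum_comm]
  refine Finset.sum_congr rfl fun i _ => Finset.sum_congr rfl fun j _ => ?_
  rw [mul_comm]

theorem patch_one_sub_right (n : ℕ) (Q : Fin (n + 1) → Fin (n + 1) → E) (a b : ℝ) :
    patch n Q a (1 - b) = patch n (fun i j => Q i j.rev) a b := by
  rw [patch_swap, patch_one_sub_left, patch_swap]

/-- The index change `loc` is the discrete counterpart of the coordinate change `sq`. Therefore
every side may be treated as if it were the side with second parameter 0. -/
theorem patch_sq {F : Type*} (n : ℕ) (Q : F × Fin (n + 1) × Fin (n + 1) → E) (h : F × Fin 4)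
    (a b : ℝ) :
    patch n (fun i j => Q (h.1, i, j)) (sq h.2 a b).1 (sq h.2 a b).2 =
      patch n (fun i j => Q (Mesh.loc n h i j)) a b := by
  obtain ⟨f, s⟩ := h
  fin_cases s
  · rfl
  · simp only [sq, Mesh.loc]
    rw [patch_one_sub_left, patch_swap]
  · simp only [sq, Mesh.loc]
    rw [patch_one_sub_left, patch_one_sub_right]
  · simp only [sq, Mesh.loc]
    rw [patch_one_sub_right, patch_swap]

theorem contDiff_eval (p : ℝ[X]) : ContDiff ℝ 1 (fun x : ℝ => p.eval x) := by
  simpa using Polynomial.contDiff_aeval (𝕜 := ℝ) p 1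

theorem contDiff_patch (n : ℕ) (Q : Fin (n + 1) → Fin (n + 1) → E) :
    ContDiff ℝ 1 (fun p : ℝ × ℝ => patch n Q p.1 p.2) := by
  unfold patch
  refine ContDiff.sum fun i _ => ContDiff.sum fun j _ => ?_
  refine ContDiff.smul (ContDiff.mul ?_ ?_) contDiff_const
  · exact (contDiff_eval _).comp contDiff_fst
  · exact (contDiff_eval _).comp contDiff_snd

theorem patch_right_zero (n : ℕ) (Q : Fin (n + 1) → Fin (n + 1) → E) (a : ℝ) :
    patch n Q a 0 = ∑ i : Fin (n + 1), (bernsteinPolynomial ℝ n i).eval a • Q i 0 := by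
  unfold patch
  refine Finset.sum_congr rfl fun i _ => ?_
  rw [Finset.sum_eq_single 0]
  · simp [bernsteinPolynomial.eval_at_0]
  · intro j _ hj
    rw [bernsteinPolynomial.eval_at_0, if_neg (show ¬ (j : ℕ) = 0 from fun h => hj (Fin.ext h))]
    simp
  · simp

/-- At 0 only the first two Bernstein polynomials have a nonzero derivative, namely -n and n. -/
theorem hasDerivAt_patch_right_zero (n : ℕ) (hn : 1 ≤ n) (Q : Fin (n + 1) → Fin (n + 1) → E)
    (a : ℝ) :
    HasDerivAt (fun b => patch n Q a b)
      (∑ i : Fin (n + 1), (bernsteinPolynomial ℝ n i).eval a • ((n : ℝ) • (Q i 1 - Q i 0))) 0 := by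
  obtain ⟨m, rfl⟩ := Nat.exists_eq_add_of_le' hn
  unfold patch
  refine HasDerivAt.fun_sum fun i _ => ?_
  have hd : ∀ j : Fin (m + 1 + 1), (derivative (bernsteinPolynomial ℝ (m + 1) j)).eval 0 =
      if j = 0 then -((m + 1 : ℕ) : ℝ) else if j = 1 then ((m + 1 : ℕ) : ℝ) else 0 := by
    intro j
    refine Fin.cases ?_ (fun j => ?_) j
    · simp [bernsteinPolynomial.derivative_zero, bernsteinPolynomial.eval_at_0]
    · rw [Fin.val_succ, bernsteinPolynomial.derivative_succ]
      simp only [Nat.add_sub_cancel, eval_mul, eval_natCast, eval_sub,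
        bernsteinPolynomial.eval_at_0, Nat.succ_ne_zero, if_false, Fin.succ_ne_zero]
      refine Fin.cases ?_ (fun j => ?_) j
      · simp
      · have : (Fin.succ (Fin.succ j)) ≠ (1 : Fin (m + 1 + 1)) := by
          rw [← Fin.succ_zero_eq_one]; exact (Fin.succ_injective _).ne (Fin.succ_ne_zero j)
        rw [if_neg this]; simp
  have : HasDerivAt (fun b => ∑ j : Fin (m + 1 + 1),
      ((bernsteinPolynomial ℝ (m + 1) i).eval a * (bernsteinPolynomial ℝ (m + 1) j).eval b) • Q i j)
      (∑ j : Fin (m + 1 + 1), ((bernsteinPolynomial ℝ (m + 1) i).eval a *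
        (derivative (bernsteinPolynomial ℝ (m + 1) j)).eval 0) • Q i j) 0 := by
    refine HasDerivAt.fun_sum fun j _ => ?_
    exact ((Polynomial.hasDerivAt _ _).const_mul _).smul_const _
  convert this using 1
  simp only [hd, Fin.sum_univ_succ, Fin.succ_zero_eq_one]
  rw [Finset.sum_eq_zero]
  · simp [mul_smul, sub_eq_add_neg, add_comm, ← neg_smul]
  · intro j _
    have : (Fin.succ (Fin.succ j)) ≠ (1 : Fin (m + 1 + 1)) := by
      rw [← Fin.succ_zero_eq_one]; exact (Fin.succ_injective _).ne (Fin.succ_ne_zero j)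
    rw [if_neg (Fin.succ_ne_zero _), if_neg this]; simp

end Patch

end SmoothQuadMesh
end

noncomputable section
namespace SmoothQuadMesh
namespace Mesh

variable {V F : Type*} (M : Mesh V F)

/-! ### Sides of an element -/

@[simp] theorem next_prev (h : F × Fin 4) : next (prev h) = h :=
  Prod.ext rfl ((by decide : ∀ s : Fin 4, s + 3 + 1 = s) h.2)

@[simp] theorem prev_next (h : F × Fin 4) : prev (next h) = h :=
  Prod.ext rfl ((by decide : ∀ s : Fin 4, s + 1 + 3 = s) h.2)

@[simp] theorem org_next (h : F × Fin 4) : M.org (next h) = M.tgt h := rfl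

@[simp] theorem tgt_prev (h : F × Fin 4) : M.tgt (prev h) = M.org h := by
  rw [← org_next, next_prev]

variable {M} in
theorem Opp.symm {h h' : F × Fin 4} (ho : M.Opp h h') : M.Opp h' h := ⟨ho.2.symm, ho.1.symm⟩

theorem sq_prev (h : F × Fin 4) (a b : ℝ) : sq (prev h).2 a b = sq h.2 b (1 - a) :=
  sq_add_three _ _ _

theorem loc_next (n : ℕ) (h : F × Fin 4) (a b : Fin (n + 1)) :
    loc n (next h) a b = loc n h b.rev a := by
  obtain ⟨f, s⟩ := h
  fin_cases s <;> simp [next, loc]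

theorem loc_prev (n : ℕ) (h : F × Fin 4) (a b : Fin (n + 1)) :
    loc n (prev h) a b = loc n h b a.rev := by
  obtain ⟨f, s⟩ := h
  fin_cases s <;> simp [prev, loc]

theorem loc_fst (n : ℕ) (h : F × Fin 4) (a b : Fin (n + 1)) : (loc n h a b).1 = h.1 := by
  obtain ⟨f, s⟩ := h
  fin_cases s <;> rfl

/-! ### All elements as bicubic patches -/

open Classical in
/-- The inner control points of the side from `D` to `C` of a bicubic representation of the
in-plane parametrisation. -/
def ctrl (f : F) : Fin 2 → ℝ × ℝ :=
  if M.IsBdFace f then M.bdCtrl f else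
    ![(1 / 3 : ℝ) • ((2 : ℝ) • M.pos (M.corner f 3) + M.pos (M.corner f 2)),
      (1 / 3 : ℝ) • (M.pos (M.corner f 3) + (2 : ℝ) • M.pos (M.corner f 2))]

/-- The control net of degree `3` of the in-plane parametrisation. -/
def net (p : F × Fin 4 × Fin 4) : ℝ × ℝ :=
  bicubicNet (M.pos (M.corner p.1 0)) (M.pos (M.corner p.1 1)) (M.pos (M.corner p.1 2))
    (M.pos (M.corner p.1 3)) (M.ctrl p.1 0) (M.ctrl p.1 1) p.2.1 p.2.2

theorem eval_bernstein_three (x : ℝ) :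
    (bernsteinPolynomial ℝ 3 0).eval x = (1 - x) ^ 3 ∧
    (bernsteinPolynomial ℝ 3 1).eval x = 3 * x * (1 - x) ^ 2 ∧
    (bernsteinPolynomial ℝ 3 2).eval x = 3 * x ^ 2 * (1 - x) ∧
    (bernsteinPolynomial ℝ 3 3).eval x = x ^ 3 := by
  refine ⟨?_, ?_, ?_, ?_⟩ <;> simp [bernsteinPolynomial, Nat.choose]

theorem eval_bernstein_two (x : ℝ) :
    (bernsteinPolynomial ℝ 2 0).eval x = (1 - x) ^ 2 ∧
    (bernsteinPolynomial ℝ 2 1).eval x = 2 * x * (1 - x) ∧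
    (bernsteinPolynomial ℝ 2 2).eval x = x ^ 2 := by
  refine ⟨?_, ?_, ?_⟩ <;> simp [bernsteinPolynomial, Nat.choose]

theorem sum_bernstein_three {E : Type*} [AddCommGroup E] [Module ℝ E] (Q : Fin (3 + 1) → E)
    (x : ℝ) : ∑ i : Fin (3 + 1), (bernsteinPolynomial ℝ 3 i).eval x • Q i =
      ((1 - x) ^ 3) • Q 0 + (3 * x * (1 - x) ^ 2) • Q 1 + (3 * x ^ 2 * (1 - x)) • Q 2
        + (x ^ 3) • Q 3 := by
  obtain ⟨h0, h1, h2, h3⟩ := eval_bernstein_three x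
  have e0 : ((0 : Fin 4) : ℕ) = 0 := rfl
  have e1 : ((1 : Fin 4) : ℕ) = 1 := rfl
  have e2 : ((2 : Fin 4) : ℕ) = 2 := rfl
  have e3 : ((3 : Fin 4) : ℕ) = 3 := rfl
  rw [Fin.sum_univ_four, e0, e1, e2, e3, h0, h1, h2, h3]

theorem sum_bernstein_two {E : Type*} [AddCommGroup E] [Module ℝ E] (Q : Fin 3 → E) (x : ℝ) :
    ∑ i : Fin 3, (bernsteinPolynomial ℝ 2 i).eval x • Q i =
      ((1 - x) ^ 2) • Q 0 + (2 * x * (1 - x)) • Q 1 + (x ^ 2) • Q 2 := by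
  obtain ⟨h0, h1, h2⟩ := eval_bernstein_two x
  have e0 : ((0 : Fin 3) : ℕ) = 0 := rfl
  have e1 : ((1 : Fin 3) : ℕ) = 1 := rfl
  have e2 : ((2 : Fin 3) : ℕ) = 2 := rfl
  rw [Fin.sum_univ_three, e0, e1, e2, h0, h1, h2]

theorem patch_eq_sum_sum {E : Type*} [NormedAddCommGroup E] [NormedSpace ℝ E] (n : ℕ)
    (Q : Fin (n + 1) → Fin (n + 1) → E) (u v : ℝ) :
    patch n Q u v = ∑ i : Fin (n + 1), (bernsteinPolynomial ℝ n i).eval u •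
      ∑ j : Fin (n + 1), (bernsteinPolynomial ℝ n j).eval v • Q i j := by
  unfold patch
  refine Finset.sum_congr rfl fun i _ => ?_
  rw [Finset.smul_sum]
  exact Finset.sum_congr rfl fun j _ => mul_smul _ _ _

/-- If E and F are the points that divide the side from D to C into thirds, `bicubicNet` is the
degree elevation of the bilinear patch. Inner and boundary elements can thus share one description.
-/
theorem param_eq_patch (f : F) (u v : ℝ) :
    M.param f u v = patch 3 (fun i j => M.net (f, i, j)) u v := by
  unfold param
  split_ifs with hf
  · simp only [patch, net, ctrl, if_pos hf]
  · rw [patch_eq_sum_sum]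
    simp only [sum_bernstein_three]
    simp only [net, ctrl, if_neg hf, bicubicNet]
    ext <;> simp <;> ring

/-- The parametrisation in the local coordinates of a side. -/
def paramL (h : F × Fin 4) (a b : ℝ) : ℝ × ℝ := M.param h.1 (sq h.2 a b).1 (sq h.2 a b).2

theorem paramL_eq_patch (h : F × Fin 4) (a b : ℝ) :
    M.paramL h a b = patch 3 (fun i j => M.net (loc 3 h i j)) a b := by
  unfold paramL
  rw [param_eq_patch]
  exact patch_sq 3 M.net h a b

/-- The side `h` is not a curved side. -/
def IsStraight (h : F × Fin 4) : Prop := h.2 = 2 → ¬ M.IsBdFace h.1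

/-- The Bézier coefficients of degree `2` of the cross derivative along a side. -/
def lamq (h : F × Fin 4) : Fin 3 → ℝ × ℝ :=
  ![if h.2 = 3 then (3 : ℝ) • (M.ctrl h.1 0 - M.pos (M.org h)) else
      M.pos (M.org (prev h)) - M.pos (M.org h),
    (1 / 2 : ℝ) • ((M.pos (M.org (prev h)) - M.pos (M.org h)) +
      (M.pos (M.tgt (next h)) - M.pos (M.tgt h))),
    if h.2 = 1 then (3 : ℝ) • (M.ctrl h.1 1 - M.pos (M.tgt h)) else
      M.pos (M.tgt (next h)) - M.pos (M.tgt h)]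

theorem net_loc_zero {h : F × Fin 4} (hs : M.IsStraight h) (i : Fin 4) :
    M.net (loc 3 h i 0) = ((3 - (i : ℕ)) / 3 : ℝ) • M.pos (M.org h) +
      (((i : ℕ) : ℝ) / 3) • M.pos (M.tgt h) := by
  obtain ⟨f, s⟩ := h
  fin_cases s
  · fin_cases i <;> ext <;> simp [loc, net, bicubicNet, org, tgt] <;> ring
  · fin_cases i <;> ext <;> simp [loc, net, bicubicNet, org, tgt] <;> ring
  · have hf : ¬ M.IsBdFace f := hs rfl
    fin_cases i <;> ext <;> simp [loc, net, bicubicNet, org, tgt, ctrl, hf] <;> ring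
  · fin_cases i <;> ext <;> simp [loc, net, bicubicNet, org, tgt] <;> ring

/-- The cross derivative along a straight side is a priori cubic; the inner control points of the
net are such that it is only quadratic. The right-hand side is the degree elevation of the quadratic
with coefficients `lamq`. -/
theorem net_loc_one {h : F × Fin 4} (hs : M.IsStraight h) (i : Fin 4) :
    (3 : ℝ) • (M.net (loc 3 h i 1) - M.net (loc 3 h i 0)) =
      (![M.lamq h 0, (1 / 3 : ℝ) • (M.lamq h 0 + (2 : ℝ) • M.lamq h 1),
        (1 / 3 : ℝ) • ((2 : ℝ) • M.lamq h 1 + M.lamq h 2), M.lamq h 2] : Fin 4 → ℝ × ℝ) i := by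
  obtain ⟨f, s⟩ := h
  fin_cases s
  · fin_cases i <;> ext <;> simp [loc, net, bicubicNet, org, tgt, lamq, next, prev] <;> ring
  · fin_cases i <;> ext <;> simp [loc, net, bicubicNet, org, tgt, lamq, next, prev] <;> ring
  · have hf : ¬ M.IsBdFace f := hs rfl
    fin_cases i <;> ext <;>
      simp [loc, net, bicubicNet, org, tgt, lamq, next, prev, ctrl, hf] <;> ring
  · fin_cases i <;> ext <;> simp [loc, net, bicubicNet, org, tgt, lamq, next, prev] <;> ring

theorem net_loc_corner (h : F × Fin 4) : M.net (loc 3 h 0 0) = M.pos (M.org h) := by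
  obtain ⟨f, s⟩ := h
  fin_cases s <;> simp [loc, net, bicubicNet, org]

theorem paramL_corner (h : F × Fin 4) : M.paramL h 0 0 = M.pos (M.org h) := by
  rw [paramL_eq_patch, patch_right_zero, ← net_loc_corner]
  rw [sum_bernstein_three]; simp

theorem paramL_zero {h : F × Fin 4} (hs : M.IsStraight h) (t : ℝ) :
    M.paramL h t 0 = M.pos (M.org h) + t • M.dir h := by
  rw [paramL_eq_patch, patch_right_zero]
  simp only [net_loc_zero M hs]
  rw [sum_bernstein_three]
  have e0 : ((0 : Fin 4) : ℕ) = 0 := rfl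
  have e1 : ((1 : Fin 4) : ℕ) = 1 := rfl
  have e2 : ((2 : Fin 4) : ℕ) = 2 := rfl
  have e3 : ((3 : Fin 4) : ℕ) = 3 := rfl
  rw [e0, e1, e2, e3]
  ext <;> simp [dir] <;> ring

/-- The components of the cross derivative along a side, as polynomials. -/
def lamX (h : F × Fin 4) : ℝ[X] := bz 2 fun i => (M.lamq h i).1

def lamY (h : F × Fin 4) : ℝ[X] := bz 2 fun i => (M.lamq h i).2

theorem hasDerivAt_paramL_right {h : F × Fin 4} (hs : M.IsStraight h) (t : ℝ) :
    HasDerivAt (fun b => M.paramL h t b) ((M.lamX h).eval t, (M.lamY h).eval t) 0 := by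
  have h1 := hasDerivAt_patch_right_zero 3 (by norm_num) (fun i j => M.net (loc 3 h i j)) t
  simp only [← paramL_eq_patch] at h1
  refine h1.congr_deriv (Eq.symm ?_)
  have h2 : ∀ i : Fin 4, ((3 : ℕ) : ℝ) • (M.net (loc 3 h i 1) - M.net (loc 3 h i 0)) = _ :=
    fun i => M.net_loc_one hs i
  rw [Finset.sum_congr rfl fun i _ => congrArg _ (h2 i), sum_bernstein_three]
  have h3 : ((M.lamX h).eval t, (M.lamY h).eval t) =
      ∑ i : Fin 3, (bernsteinPolynomial ℝ 2 i).eval t • M.lamq h i := by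
    simp only [lamX, lamY, eval_bz]
    ext
    · simp [Prod.fst_sum, mul_comm]
    · simp [Prod.snd_sum, mul_comm]
  rw [h3, sum_bernstein_two]
  ext <;> simp <;> ring

end Mesh
end SmoothQuadMesh
end

/-! ### Regularity of all elements; position of edges relative to the boundary. -/

noncomputable section
namespace SmoothQuadMesh
namespace Mesh

variable {V F : Type*} (M : Mesh V F)

theorem param_eq_bilinear {f : F} (hf : ¬ M.IsBdFace f) (u v : ℝ) :
    M.param f u v =
      ((1 - u) * (1 - v)) • M.pos (M.corner f 0) + (u * (1 - v)) • M.pos (M.corner f 1)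
      + (u * v) • M.pos (M.corner f 2) + ((1 - u) * v) • M.pos (M.corner f 3) := by
  unfold param
  rw [if_neg hf]

/-- The Jacobian determinant of a bilinear patch is positive if it is positive at the corners. -/
theorem cross_bilinear_pos {A B C D : ℝ × ℝ} (h0 : 0 < cross (B - A) (C - B))
    (h1 : 0 < cross (C - B) (D - C)) (h2 : 0 < cross (D - C) (A - D))
    (h3 : 0 < cross (A - D) (B - A)) {u v : ℝ} (hu : u ∈ Icc (0 : ℝ) 1) (hv : v ∈ Icc (0 : ℝ) 1) :
    0 < cross ((1 - v) • (B - A) + v • (C - D)) ((1 - u) • (D - A) + u • (C - B)) := by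
  -- The determinant is the bilinear interpolant of its values at the four corners.
  have e : cross ((1 - v) • (B - A) + v • (C - D)) ((1 - u) • (D - A) + u • (C - B)) =
      (1 - u) * ((1 - v) * cross (A - D) (B - A) + v * cross (D - C) (A - D)) +
      u * ((1 - v) * cross (B - A) (C - B) + v * cross (C - B) (D - C)) := by
    simp only [cross, Prod.fst_add, Prod.snd_add, Prod.smul_fst, Prod.smul_snd, Prod.fst_sub,
      Prod.snd_sub, smul_eq_mul]
    ring
  have aux : ∀ {x a b : ℝ}, x ∈ Icc (0 : ℝ) 1 → 0 < a → 0 < b → 0 < (1 - x) * a + x * b := by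
    intro x a b hx ha hb
    rcases hx.1.eq_or_lt with h | h
    · rw [← h]; linarith
    · have := mul_pos h hb
      have := mul_nonneg (sub_nonneg.2 hx.2) ha.le
      linarith
  rw [e]
  exact aux hu (aux hv h3 h2) (aux hv h0 h1)

/-- For a bilinear map the difference of two values is exactly the differential at the midpoint
applied to the difference of the arguments. Since the Jacobian determinant is positive at the
midpoint, equal values force equal arguments. -/
theorem isRegular_of_convex {f : F} (hf : ¬ M.IsBdFace f)
    (hc : ∀ s, 0 < cross (M.pos (M.corner f (s + 1)) - M.pos (M.corner f s))
      (M.pos (M.corner f (s + 2)) - M.pos (M.corner f (s + 1)))) : M.IsRegular f := by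
  have h0 := hc 0
  have h1 := hc 1
  have h2 := hc 2
  have h3 := hc 3
  simp only [show (0 : Fin 4) + 1 = 1 from rfl, show (0 : Fin 4) + 2 = 2 from rfl,
    show (1 : Fin 4) + 1 = 2 from rfl, show (1 : Fin 4) + 2 = 3 from rfl,
    show (2 : Fin 4) + 1 = 3 from rfl, show (2 : Fin 4) + 2 = 0 from rfl,
    show (3 : Fin 4) + 1 = 0 from rfl, show (3 : Fin 4) + 2 = 1 from rfl] at h0 h1 h2 h3
  have hp := M.param_eq_bilinear hf
  generalize M.pos (M.corner f 0) = A at *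
  generalize M.pos (M.corner f 1) = B at *
  generalize M.pos (M.corner f 2) = C at *
  generalize M.pos (M.corner f 3) = D at *
  constructor
  · rintro ⟨u, v⟩ ⟨hu, hv⟩ ⟨u', v'⟩ ⟨hu', hv'⟩ h
    simp only [hp] at h
    -- The midpoint of the two parameter pairs, which lies in the square again.
    have hJ := cross_bilinear_pos h0 h1 h2 h3 (u := (u + u') / 2) (v := (v + v') / 2)
      ⟨by linarith [hu.1, hu'.1], by linarith [hu.2, hu'.2]⟩
      ⟨by linarith [hv.1, hv'.1], by linarith [hv.2, hv'.2]⟩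
    have hx := congrArg Prod.fst h
    have hy := congrArg Prod.snd h
    simp only [cross, Prod.fst_add, Prod.snd_add, Prod.smul_fst, Prod.smul_snd, Prod.fst_sub,
      Prod.snd_sub, smul_eq_mul] at hx hy hJ
    set a1 := (1 - (v + v') / 2) * (B.1 - A.1) + (v + v') / 2 * (C.1 - D.1) with ha1
    set a2 := (1 - (v + v') / 2) * (B.2 - A.2) + (v + v') / 2 * (C.2 - D.2) with ha2
    set b1 := (1 - (u + u') / 2) * (D.1 - A.1) + (u + u') / 2 * (C.1 - B.1) with hb1
    set b2 := (1 - (u + u') / 2) * (D.2 - A.2) + (u + u') / 2 * (C.2 - B.2) with hb2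
    have e1 : (u - u') * a1 + (v - v') * b1 = 0 := by
      rw [ha1, hb1]; linear_combination hx
    have e2 : (u - u') * a2 + (v - v') * b2 = 0 := by
      rw [ha2, hb2]; linear_combination hy
    have e3 : (u - u') * (a1 * b2 - a2 * b1) = 0 := by linear_combination b2 * e1 - b1 * e2
    have e4 : (v - v') * (a1 * b2 - a2 * b1) = 0 := by linear_combination a1 * e2 - a2 * e1
    have e5 : u = u' := by
      rcases mul_eq_zero.1 e3 with h | h <;> linarith
    have e6 : v = v' := by
      rcases mul_eq_zero.1 e4 with h | h <;> linarith
    exact Prod.ext e5 e6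
  · intro u hu v hv
    have d1 : HasDerivAt (fun s => M.param f s v) ((1 - v) • (B - A) + v • (C - D)) u := by
      have : (fun s => M.param f s v) = fun s =>
          s • ((1 - v) • (B - A) + v • (C - D)) + ((1 - v) • A + v • D) := by
        funext s
        rw [hp]
        ext <;> simp <;> ring
      rw [this]
      simpa using ((hasDerivAt_id u).smul_const ((1 - v) • (B - A) + v • (C - D))).add_const
        ((1 - v) • A + v • D)
    have d2 : HasDerivAt (fun s => M.param f u s) ((1 - u) • (D - A) + u • (C - B)) v := by
      have : (fun s => M.param f u s) = fun s =>
          s • ((1 - u) • (D - A) + u • (C - B)) + ((1 - u) • A + u • B) := by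
        funext s
        rw [hp]
        ext <;> simp <;> ring
      rw [this]
      simpa using ((hasDerivAt_id v).smul_const ((1 - u) • (D - A) + u • (C - B))).add_const
        ((1 - u) • A + u • B)
    rw [d1.deriv, d2.deriv]
    exact cross_bilinear_pos h0 h1 h2 h3 hu hv

variable {M}

theorem IsSmoothMesh.isRegular (hM : M.IsSmoothMesh) (f : F) : M.IsRegular f := by
  by_cases hf : M.IsBdFace f
  · exact hM.regular f hf
  · exact M.isRegular_of_convex hf (hM.convex f hf)

variable (M) in
/-- The in-plane parametrisation as a function on the plane. -/
def paramP (f : F) (p : ℝ × ℝ) : ℝ × ℝ := M.param f p.1 p.2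

variable (M) in
theorem contDiff_paramP (f : F) : ContDiff ℝ 1 (M.paramP f) := by
  have := contDiff_patch 3 (fun i j => M.net (f, i, j))
  simp only [← param_eq_patch] at this
  exact this

variable (M) in
theorem differentiable_paramP (f : F) : Differentiable ℝ (M.paramP f) :=
  (M.contDiff_paramP f).differentiable (by norm_num)

variable (M) in
theorem paramL_eq_paramP (h : F × Fin 4) (a b : ℝ) : M.paramL h a b = M.paramP h.1 (sq h.2 a b) :=
  rfl

theorem cross_linearMap (D : ℝ × ℝ →L[ℝ] ℝ × ℝ) (x y : ℝ × ℝ) :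
    cross (D x) (D y) = cross x y * cross (D (1, 0)) (D (0, 1)) := by
  have h : ∀ z : ℝ × ℝ, D z = z.1 • D (1, 0) + z.2 • D (0, 1) := by
    intro z
    rw [← map_smul, ← map_smul, ← map_add]
    simp
  rw [h x, h y]
  simp [cross]
  ring

theorem IsSmoothMesh.jacobian_pos (hM : M.IsSmoothMesh) (f : F) {p : ℝ × ℝ} (hp : p ∈ unitSq) :
    0 < cross (fderiv ℝ (M.paramP f) p (1, 0)) (fderiv ℝ (M.paramP f) p (0, 1)) := by
  have hd := (M.differentiable_paramP f p).hasFDerivAt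
  have h := (hM.isRegular f).2 p.1 hp.1 p.2 hp.2
  have d1 : HasDerivAt (fun s => M.param f s p.2) (fderiv ℝ (M.paramP f) p (1, 0)) p.1 := by
    have := HasFDerivAt.comp_hasDerivAt (f := fun s : ℝ => (s, p.2)) p.1 hd
      ((hasDerivAt_id p.1).prodMk (hasDerivAt_const p.1 p.2))
    exact this
  have d2 : HasDerivAt (fun s => M.param f p.1 s) (fderiv ℝ (M.paramP f) p (0, 1)) p.2 := by
    have := HasFDerivAt.comp_hasDerivAt (f := fun s : ℝ => (p.1, s)) p.2 hd
      ((hasDerivAt_const p.2 p.1).prodMk (hasDerivAt_id p.2))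
    exact this
  rwa [d1.deriv, d2.deriv] at h

variable (M) in
theorem hasDerivAt_paramL_left' (h : F × Fin 4) (a b : ℝ) :
    HasDerivAt (fun x => M.paramL h x b)
      (fderiv ℝ (M.paramP h.1) (sq h.2 a b) (sqDir h.2 1 0)) a :=
  (M.differentiable_paramP h.1 _).hasFDerivAt.comp_hasDerivAt a (hasDerivAt_sq_left h.2 a b)

variable (M) in
theorem hasDerivAt_paramL_right' (h : F × Fin 4) (a b : ℝ) :
    HasDerivAt (fun x => M.paramL h a x)
      (fderiv ℝ (M.paramP h.1) (sq h.2 a b) (sqDir h.2 0 1)) b :=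
  (M.differentiable_paramP h.1 _).hasFDerivAt.comp_hasDerivAt b (hasDerivAt_sq_right h.2 a b)

variable (M) in
theorem hasDerivAt_paramL_left {h : F × Fin 4} (hs : M.IsStraight h) (t : ℝ) :
    HasDerivAt (fun x => M.paramL h x 0) (M.dir h) t := by
  simp only [M.paramL_zero hs]
  simpa using ((hasDerivAt_id t).smul_const (M.dir h)).const_add (M.pos (M.org h))

variable (M) in
theorem fderiv_sqDir_left {h : F × Fin 4} (hs : M.IsStraight h) (t : ℝ) :
    fderiv ℝ (M.paramP h.1) (sq h.2 t 0) (sqDir h.2 1 0) = M.dir h :=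
  (M.hasDerivAt_paramL_left' h t 0).unique (M.hasDerivAt_paramL_left hs t)

variable (M) in
theorem fderiv_sqDir_right {h : F × Fin 4} (hs : M.IsStraight h) (t : ℝ) :
    fderiv ℝ (M.paramP h.1) (sq h.2 t 0) (sqDir h.2 0 1) =
      ((M.lamX h).eval t, (M.lamY h).eval t) :=
  (M.hasDerivAt_paramL_right' h t 0).unique (M.hasDerivAt_paramL_right hs t)

variable (M) in
/-- The Jacobian determinant along a side of an element. -/
def jac (h : F × Fin 4) : ℝ[X] := C (M.dir h).1 * M.lamY h - C (M.dir h).2 * M.lamX h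

variable (M) in
theorem eval_jac (h : F × Fin 4) (t : ℝ) :
    (M.jac h).eval t = cross (M.dir h) ((M.lamX h).eval t, (M.lamY h).eval t) := by
  simp [jac, cross]

theorem IsSmoothMesh.eval_jac_pos (hM : M.IsSmoothMesh) {h : F × Fin 4} (hs : M.IsStraight h)
    {t : ℝ} (ht : t ∈ Icc (0 : ℝ) 1) : 0 < (M.jac h).eval t := by
  rw [eval_jac, ← M.fderiv_sqDir_left hs t, ← M.fderiv_sqDir_right hs t, cross_linearMap,
    cross_sqDir, one_mul]
  exact hM.jacobian_pos h.1 (sq_mem h.2 ht ⟨le_rfl, zero_le_one⟩)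

theorem IsSmoothMesh.paramP_injOn (hM : M.IsSmoothMesh) (f : F) : InjOn (M.paramP f) unitSq :=
  (hM.isRegular f).1

theorem IsSmoothMesh.corner_injective (hM : M.IsSmoothMesh) (f : F) :
    Function.Injective (M.corner f) := by
  intro s t hst
  have h1 := M.paramL_corner (f, s)
  have h2 := M.paramL_corner (f, t)
  have h3 : M.pos (M.org (f, s)) = M.pos (M.org (f, t)) := congrArg M.pos hst
  rw [← h1, ← h2] at h3
  have hz : (0 : ℝ) ∈ Icc (0 : ℝ) 1 := ⟨le_rfl, zero_le_one⟩
  have h4 := hM.paramP_injOn f (sq_mem s hz hz) (sq_mem t hz hz) h3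
  fin_cases s <;> fin_cases t <;> simp [sq] at h4 ⊢

theorem IsSmoothMesh.org_ne_tgt (hM : M.IsSmoothMesh) (h : F × Fin 4) : M.org h ≠ M.tgt h :=
  fun e => (by decide : ∀ s : Fin 4, s ≠ s + 1) h.2 (hM.corner_injective h.1 e)

theorem IsSmoothMesh.face_ne (hM : M.IsSmoothMesh) {h h' : F × Fin 4} (ho : M.Opp h h') :
    h.1 ≠ h'.1 := by
  intro e
  obtain ⟨f, s⟩ := h
  obtain ⟨g, t⟩ := h'
  obtain rfl : f = g := e
  have h1 := hM.corner_injective f ho.1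
  have h2 := hM.corner_injective f ho.2
  exact (by decide : ∀ s t : Fin 4, s = t + 1 → s + 1 = t → False) s t h1 h2

theorem IsSmoothMesh.opp_unique (hM : M.IsSmoothMesh) {h h₁ h₂ : F × Fin 4} (h1 : M.Opp h h₁)
    (h2 : M.Opp h h₂) : h₁ = h₂ :=
  hM.edge_unique _ _ (h1.2.symm.trans h2.2) (h1.1.symm.trans h2.1)

theorem Opp.isInnerEdge {h h' : F × Fin 4} (ho : M.Opp h h') : M.IsInnerEdge h := ⟨h', ho⟩

theorem isInnerEdge_of_org {h : F × Fin 4} (hv : ¬ M.IsBdVertex (M.org h)) : M.IsInnerEdge h := by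
  by_contra hn
  exact hv ⟨h, hn, Or.inl rfl⟩

theorem isInnerEdge_of_tgt {h : F × Fin 4} (hv : ¬ M.IsBdVertex (M.tgt h)) : M.IsInnerEdge h := by
  by_contra hn
  exact hv ⟨h, hn, Or.inr rfl⟩

theorem isInnerEdge_prev {h : F × Fin 4} (hv : ¬ M.IsBdVertex (M.org h)) :
    M.IsInnerEdge (prev h) :=
  isInnerEdge_of_tgt (by rwa [tgt_prev])

/-- By the labelling convention, the side with number 2 of a boundary element is its boundary edge,
so it cannot be an inner edge. -/
theorem IsSmoothMesh.isStraight (hM : M.IsSmoothMesh) {h : F × Fin 4} (hi : M.IsInnerEdge h) :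
    M.IsStraight h := by
  rintro h2 ⟨s, hs⟩
  have : s = 2 := hM.bd_label _ hs
  apply hs
  rwa [this, ← h2]

/-- Otherwise `next h` and `h'` would be two inner edges that leave the boundary vertex. They would
have to coincide, although they belong to different elements. -/
theorem IsSmoothMesh.edgeToBd_next (hM : M.IsSmoothMesh) {h h' : F × Fin 4}
    (hb : M.EdgeToBd h h') : M.IsBdEdge (next h) := by
  intro hi
  obtain ⟨ho, -, hv⟩ := hb
  obtain ⟨k, -, hk⟩ := hM.bd_vertex _ hv
  have e1 := hk (next h) ⟨rfl, hi⟩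
  have e2 := hk h' ⟨ho.2.symm, ho.symm.isInnerEdge⟩
  exact hM.face_ne ho (congrArg Prod.fst (e1.trans e2.symm) : (next h).1 = h'.1)

theorem IsSmoothMesh.edgeToBd_prev (hM : M.IsSmoothMesh) {h h' : F × Fin 4}
    (hb : M.EdgeToBd h h') : M.IsBdEdge (prev h') := by
  rintro ⟨k, hk⟩
  obtain ⟨ho, -, hv⟩ := hb
  obtain ⟨k₀, -, hk₀⟩ := hM.bd_vertex _ hv
  have e1 := hk₀ k ⟨by rw [← hk.2, tgt_prev]; exact ho.2.symm, hk.symm.isInnerEdge⟩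
  have e2 := hk₀ h' ⟨ho.2.symm, ho.symm.isInnerEdge⟩
  exact hM.face_ne hk (congrArg Prod.fst (e2.trans e1.symm) : h'.1 = k.1)

/-- The sides after `h` and before `h'` are boundary edges, hence have number 2; so the edge runs
from B to C in its left element and from D to A in its right one. -/
theorem IsSmoothMesh.edgeToBd_snd (hM : M.IsSmoothMesh) {h h' : F × Fin 4}
    (hb : M.EdgeToBd h h') : h.2 = 1 ∧ h'.2 = 3 :=
  ⟨(by decide : ∀ s : Fin 4, s + 1 = 2 → s = 1) _ (hM.bd_label _ (hM.edgeToBd_next hb)),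
    (by decide : ∀ s : Fin 4, s + 3 = 2 → s = 3) _ (hM.bd_label _ (hM.edgeToBd_prev hb))⟩

end Mesh
end SmoothQuadMesh
end

/-! ### First-order conditions across an inner edge: necessity. -/

noncomputable section
namespace SmoothQuadMesh
namespace Mesh

variable {V F : Type*} {M : Mesh V F}

/-! ### Control points -/

theorem cp_next (n : ℕ) (h : F × Fin 4) (a b : Fin (n + 1)) :
    M.cp n (next h) a b = M.cp n h b.rev a := by
  unfold cp; rw [loc_next]

theorem cp_prev (n : ℕ) (h : F × Fin 4) (a b : Fin (n + 1)) :
    M.cp n (prev h) a b = M.cp n h b a.rev := by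
  unfold cp; rw [loc_prev]

theorem Opp.cp_eq {h h' : F × Fin 4} (ho : M.Opp h h') (n : ℕ) (t : Fin (n + 1)) :
    M.cp n h t 0 = M.cp n h' t.rev 0 :=
  Quot.sound ⟨h, h', t, ho, rfl, rfl⟩

/-! ### Patches along an edge -/

variable {n : ℕ}

/-- The `Z`-component of the patch in local coordinates of a side. -/
def zL (z : M.CP n → ℝ) (h : F × Fin 4) (a b : ℝ) : ℝ :=
  M.zPatch z h.1 (sq h.2 a b).1 (sq h.2 a b).2

/-- The `Z`-component of the patch as a function on the plane. -/
def zP (z : M.CP n → ℝ) (f : F) (p : ℝ × ℝ) : ℝ := M.zPatch z f p.1 p.2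

theorem zPatch_eq_patch (z : M.CP n → ℝ) (f : F) (u v : ℝ) :
    M.zPatch z f u v = patch n (fun i j => z (Quot.mk _ (f, i, j))) u v := by
  unfold zPatch patch
  simp only [smul_eq_mul, mul_comm]

theorem zL_eq_patch (z : M.CP n → ℝ) (h : F × Fin 4) (a b : ℝ) :
    zL z h a b = patch n (fun i j => z (M.cp n h i j)) a b := by
  unfold zL
  rw [zPatch_eq_patch]
  exact patch_sq n (fun q => z (Quot.mk _ q)) h a b

theorem contDiff_zP (z : M.CP n → ℝ) (f : F) : ContDiff ℝ 1 (zP z f) := by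
  have := contDiff_patch n (fun i j => z (Quot.mk _ (f, i, j)))
  simp only [← zPatch_eq_patch] at this
  exact this

theorem differentiable_zP (z : M.CP n → ℝ) (f : F) : Differentiable ℝ (zP z f) :=
  (contDiff_zP z f).differentiable (by norm_num)

/-- The `Z`-component along a side. -/
def cen (z : M.CP n → ℝ) (h : F × Fin 4) : ℝ[X] := bz n fun t => z (M.cp n h t 0)

/-- The cross derivative of the `Z`-component along a side. -/
def nor (z : M.CP n → ℝ) (h : F × Fin 4) : ℝ[X] :=
  (n : ℝ) • bz n fun t => z (M.cp n h t 1) - z (M.cp n h t 0)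

theorem zL_zero (z : M.CP n → ℝ) (h : F × Fin 4) (t : ℝ) : zL z h t 0 = (cen z h).eval t := by
  rw [zL_eq_patch, patch_right_zero, cen, eval_bz]
  simp only [smul_eq_mul, mul_comm]

theorem hasDerivAt_zL_right (hn : 1 ≤ n) (z : M.CP n → ℝ) (h : F × Fin 4) (t : ℝ) :
    HasDerivAt (fun b => zL z h t b) ((nor z h).eval t) 0 := by
  have h1 := hasDerivAt_patch_right_zero n hn (fun i j => z (M.cp n h i j)) t
  simp only [← zL_eq_patch] at h1
  refine h1.congr_deriv ?_
  rw [nor, eval_smul, eval_bz, smul_eq_mul, Finset.mul_sum]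
  refine Finset.sum_congr rfl fun i _ => ?_
  simp only [smul_eq_mul]
  ring

theorem hasDerivAt_zL_left (z : M.CP n → ℝ) (h : F × Fin 4) (t : ℝ) :
    HasDerivAt (fun a => zL z h a 0) ((derivative (cen z h)).eval t) t := by
  simp only [zL_zero]
  exact Polynomial.hasDerivAt _ _

theorem Opp.cen_eq {h h' : F × Fin 4} (ho : M.Opp h h') (z : M.CP n → ℝ) :
    cen z h' = (cen z h).comp (1 - X) := by
  rw [cen, cen, bz_comp_one_sub_X]
  congr 1
  funext t
  rw [ho.symm.cp_eq]

theorem Opp.derivative_cen_eq {h h' : F × Fin 4} (ho : M.Opp h h') (z : M.CP n → ℝ) :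
    derivative (cen z h') = -(derivative (cen z h)).comp (1 - X) := by
  rw [ho.cen_eq, derivative_comp]
  simp

theorem Opp.dir_eq {h h' : F × Fin 4} (ho : M.Opp h h') : M.dir h' = -M.dir h := by
  unfold dir
  rw [ho.1, ho.2, neg_sub]

variable (M) in
/-- The cross product of the cross derivatives on the two sides of an edge. -/
def crossPol (h h' : F × Fin 4) : ℝ[X] :=
  M.lamX h * (M.lamY h').comp (1 - X) - M.lamY h * (M.lamX h').comp (1 - X)

/-- The expression whose vanishing is equivalent to `C¹`-smoothness across the edge. -/
def smo (z : M.CP n → ℝ) (h h' : F × Fin 4) : ℝ[X] :=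
  (M.jac h').comp (1 - X) * nor z h + M.jac h * (nor z h').comp (1 - X) +
    M.crossPol h h' * derivative (cen z h)

theorem Opp.smo_eq {h h' : F × Fin 4} (ho : M.Opp h h') (z : M.CP n → ℝ) :
    smo z h' h = (smo z h h').comp (1 - X) := by
  unfold smo
  rw [ho.derivative_cen_eq]
  simp only [add_comp, mul_comp, comp_one_sub_X_involutive, crossPol, sub_comp]
  ring

theorem mem_element_iff {f : F} {x : ℝ × ℝ} :
    x ∈ M.element f ↔ ∃ p ∈ unitSq, M.paramP f p = x :=
  ⟨fun ⟨u, hu, v, hv, e⟩ => ⟨(u, v), ⟨hu, hv⟩, e.symm⟩,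
    fun ⟨p, hp, e⟩ => ⟨p.1, hp.1, p.2, hp.2, e.symm⟩⟩

theorem paramP_mem_domain {f : F} {p : ℝ × ℝ} (hp : p ∈ unitSq) : M.paramP f p ∈ M.domain :=
  mem_iUnion.2 ⟨f, mem_element_iff.2 ⟨p, hp, rfl⟩⟩

theorem Opp.paramL_eq {h h' : F × Fin 4} (ho : M.Opp h h') (hs : M.IsStraight h)
    (hs' : M.IsStraight h') (t : ℝ) : M.paramL h t 0 = M.paramL h' (1 - t) 0 := by
  rw [M.paramL_zero hs, M.paramL_zero hs', ho.dir_eq, ← ho.2]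
  unfold dir
  ext <;> simp <;> ring

/-- The linear relation of three vectors in the plane, with coefficients from Cramer's rule.
Evaluated by a gradient, it becomes the smoothness equation. -/
theorem cross_identity (a b e : ℝ × ℝ) :
    cross b e • a + cross e a • b + cross a b • e = 0 := by
  ext <;> simp [cross] <;> ring

theorem linearMap_cross_identity (A : ℝ × ℝ →L[ℝ] ℝ) (a b e : ℝ × ℝ) :
    cross b e * A a + cross e a * A b + cross a b * A e = 0 := by
  have := congrArg A (cross_identity a b e)
  simpa using this

theorem eval_smo {h h' : F × Fin 4} (ho : M.Opp h h') (z : M.CP n → ℝ) (t : ℝ) :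
    (smo z h h').eval t =
      cross ((M.lamX h').eval (1 - t), (M.lamY h').eval (1 - t)) (M.dir h) * (nor z h).eval t +
      cross (M.dir h) ((M.lamX h).eval t, (M.lamY h).eval t) * (nor z h').eval (1 - t) +
      cross ((M.lamX h).eval t, (M.lamY h).eval t)
        ((M.lamX h').eval (1 - t), (M.lamY h').eval (1 - t)) * (derivative (cen z h)).eval t := by
  simp only [smo, eval_add, eval_mul, eval_comp, eval_sub, eval_one, eval_X, eval_jac, ho.dir_eq,
    crossPol]
  simp only [cross, Prod.fst_neg, Prod.snd_neg]
  ring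

theorem eq_zero_of_eval_eq_zero_on {p : ℝ[X]} (hp : ∀ t ∈ Icc (0 : ℝ) 1, p.eval t = 0) : p = 0 :=
  Polynomial.eq_zero_of_infinite_isRoot p ((Icc_infinite zero_lt_one).mono fun t ht => hp t ht)

/-- Smooth splines satisfy the smoothness equations. -/
theorem smo_eq_zero_of_mem_FUN (hM : M.IsSmoothMesh) (hn : 1 ≤ n) {z : M.CP n → ℝ}
    (hz : z ∈ M.FUN n) {h h' : F × Fin 4} (ho : M.Opp h h') : smo z h h' = 0 := by
  obtain ⟨φ, hφ, hφz⟩ := hz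
  have hs := hM.isStraight ho.isInnerEdge
  have hs' := hM.isStraight ho.symm.isInnerEdge
  refine eq_zero_of_eval_eq_zero_on fun t ht => ?_
  have h0 : (0 : ℝ) ∈ Icc (0 : ℝ) 1 := ⟨le_rfl, zero_le_one⟩
  have ht' : 1 - t ∈ Icc (0 : ℝ) 1 := ⟨by linarith [ht.2], by linarith [ht.1]⟩
  have hx : M.paramL h t 0 ∈ M.domain := paramP_mem_domain (sq_mem h.2 ht h0)
  have hA := ((hφ.differentiableOn (by norm_num)) _ hx).hasFDerivWithinAt
  set A := fderivWithin ℝ φ M.domain (M.paramL h t 0) with hAdef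
  -- Chain rule for `φ` along a curve in the domain. The derivative of `φ` exists only within the
  -- domain, and the curves start at an end point of `[0, 1]`; uniqueness of one-sided derivatives
  -- on this interval identifies the two expressions.
  have key : ∀ {γ : ℝ → ℝ × ℝ} {ζ : ℝ → ℝ} {γ' : ℝ × ℝ} {ζ' s : ℝ}, s ∈ Icc (0 : ℝ) 1 →
      γ s = M.paramL h t 0 → HasDerivAt γ γ' s → HasDerivAt ζ ζ' s →
      (∀ x ∈ Icc (0 : ℝ) 1, γ x ∈ M.domain ∧ φ (γ x) = ζ x) → A γ' = ζ' := by
    intro γ ζ γ' ζ' s hs1 hγs hγ hζ hγζ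
    rw [← hγs] at hA
    have c1 := hA.comp_hasDerivWithinAt s hγ.hasDerivWithinAt (fun x hx => (hγζ x hx).1)
    have c2 : HasDerivWithinAt (φ ∘ γ) ζ' (Icc 0 1) s :=
      hζ.hasDerivWithinAt.congr (fun x hx => (hγζ x hx).2) (hγζ s hs1).2
    exact (uniqueDiffOn_Icc_zero_one s hs1).eq_deriv _ c1 c2
  have k1 := key h0 rfl (M.hasDerivAt_paramL_right hs t) (hasDerivAt_zL_right hn z h t)
    (fun x hx => ⟨paramP_mem_domain (sq_mem h.2 ht hx),
      hφz h.1 _ (sq_mem h.2 ht hx).1 _ (sq_mem h.2 ht hx).2⟩)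
  have k2 := key h0 (ho.paramL_eq hs hs' t).symm (M.hasDerivAt_paramL_right hs' (1 - t))
    (hasDerivAt_zL_right hn z h' (1 - t))
    (fun x hx => ⟨paramP_mem_domain (sq_mem h'.2 ht' hx),
      hφz h'.1 _ (sq_mem h'.2 ht' hx).1 _ (sq_mem h'.2 ht' hx).2⟩)
  have k3 := key ht rfl (M.hasDerivAt_paramL_left hs t) (hasDerivAt_zL_left z h t)
    (fun x hx => ⟨paramP_mem_domain (sq_mem h.2 hx h0),
      hφz h.1 _ (sq_mem h.2 hx h0).1 _ (sq_mem h.2 hx h0).2⟩)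
  rw [eval_smo ho, ← k1, ← k2, ← k3]
  exact linearMap_cross_identity A _ _ _

end Mesh
end SmoothQuadMesh
end

/-! ### First-order conditions across the inner edges: sufficiency. -/

noncomputable section
namespace SmoothQuadMesh

/-- An endomorphism of the plane with nonzero determinant is invertible. -/
theorem exists_equiv_of_cross_ne_zero (D : ℝ × ℝ →L[ℝ] ℝ × ℝ)
    (hD : cross (D (1, 0)) (D (0, 1)) ≠ 0) : ∃ e : (ℝ × ℝ) ≃L[ℝ] (ℝ × ℝ), (e : _ →L[ℝ] _) = D := by
  have hinj : Function.Injective (D : ℝ × ℝ →ₗ[ℝ] ℝ × ℝ) := by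
    rw [injective_iff_map_eq_zero]
    intro z hz
    have hz' : D z = 0 := hz
    have h1 := Mesh.cross_linearMap D z (1, 0)
    have h2 := Mesh.cross_linearMap D z (0, 1)
    rw [hz'] at h1 h2
    have h3 : z.2 = 0 := by
      have : -z.2 * cross (D (1, 0)) (D (0, 1)) = 0 := by
        simpa [cross] using h1.symm
      simpa [hD] using this
    have h4 : z.1 = 0 := by
      have : z.1 * cross (D (1, 0)) (D (0, 1)) = 0 := by
        simpa [cross] using h2.symm
      simpa [hD] using this
    exact Prod.ext h4 h3
  exact ⟨(LinearEquiv.ofInjectiveEndo _ hinj).toContinuousLinearEquiv, by ext <;> rfl⟩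

theorem linearMap_eq_of_cross_ne_zero {A B : ℝ × ℝ →L[ℝ] ℝ} {x y : ℝ × ℝ} (h : cross x y ≠ 0)
    (hx : A x = B x) (hy : A y = B y) : A = B := by
  refine ContinuousLinearMap.ext fun v => ?_
  have hv : cross x y • v = cross v y • x + cross x v • y := by
    ext <;> simp [cross] <;> ring
  have hA := congrArg A hv
  have hB := congrArg B hv
  simp only [map_add, map_smul, hx, hy, smul_eq_mul] at hA hB
  exact mul_left_cancel₀ h (hA.trans hB.symm)

/-- A continuous map on a compact set into a Hausdorff space maps closed subsets to closed ones.
With a left inverse, these images are the preimages needed for continuity of the inverse. -/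
theorem continuousOn_leftInverse {X Y : Type*} [TopologicalSpace X] [TopologicalSpace Y] [T2Space Y]
    {K : Set X} (hK : IsCompact K) {P : X → Y} (hP : ContinuousOn P K) {g : Y → X}
    (hg : ∀ p ∈ K, g (P p) = p) : ContinuousOn g (P '' K) := by
  rw [continuousOn_iff_isClosed]
  intro t ht
  refine ⟨P '' (K ∩ t), ((hK.inter_right ht).image_of_continuousOn
    (hP.mono inter_subset_left)).isClosed, ?_⟩
  ext y
  constructor
  · rintro ⟨h1, p, hp, rfl⟩
    refine ⟨⟨p, ⟨hp, ?_⟩, rfl⟩, p, hp, rfl⟩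
    simpa [hg p hp] using h1
  · rintro ⟨⟨p, ⟨hp, hpt⟩, rfl⟩, -⟩
    exact ⟨by simpa [hg p hp] using hpt, p, hp, rfl⟩

theorem HasFDerivWithinAt.iUnion_finite {ι E G : Type*} [Finite ι] [NormedAddCommGroup E]
    [NormedSpace ℝ E] [NormedAddCommGroup G] [NormedSpace ℝ G] {f : E → G} {f' : E →L[ℝ] G}
    {s : ι → Set E} {x : E} (h : ∀ i, HasFDerivWithinAt f f' (s i) x) :
    HasFDerivWithinAt f f' (⋃ i, s i) x := by
  classical
  cases nonempty_fintype ι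
  have key : ∀ t : Finset ι, HasFDerivWithinAt f f' (⋃ i ∈ t, s i) x := by
    intro t
    induction t using Finset.induction_on with
    | empty => exact HasFDerivWithinAt.of_notMem_closure (by simp)
    | insert a t _ ih =>
      rw [Finset.set_biUnion_insert]
      exact (h a).union ih
  simpa using key Finset.univ

theorem isCompact_unitSq : IsCompact unitSq := isCompact_Icc.prod isCompact_Icc

namespace Mesh

variable {V F : Type*} {M : Mesh V F} {n : ℕ}

/-- The gradient of the `Z`-component with respect to the planar coordinates. -/
def grad (z : M.CP n → ℝ) (f : F) (p : ℝ × ℝ) : ℝ × ℝ →L[ℝ] ℝ :=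
  (fderiv ℝ (zP z f) p).comp (fderiv ℝ (M.paramP f) p).inverse

theorem IsSmoothMesh.exists_equiv (hM : M.IsSmoothMesh) (f : F) {p : ℝ × ℝ} (hp : p ∈ unitSq) :
    ∃ e : (ℝ × ℝ) ≃L[ℝ] (ℝ × ℝ), (e : _ →L[ℝ] _) = fderiv ℝ (M.paramP f) p :=
  exists_equiv_of_cross_ne_zero _ (hM.jacobian_pos f hp).ne'

theorem grad_fderiv (hM : M.IsSmoothMesh) (z : M.CP n → ℝ) (f : F) {p : ℝ × ℝ}
    (hp : p ∈ unitSq) (v : ℝ × ℝ) :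
    grad z f p (fderiv ℝ (M.paramP f) p v) = fderiv ℝ (zP z f) p v := by
  obtain ⟨e, he⟩ := hM.exists_equiv f hp
  unfold grad
  rw [← he, ContinuousLinearMap.inverse_equiv]
  simp

theorem fderiv_zP_left (z : M.CP n → ℝ) (h : F × Fin 4) (t : ℝ) :
    fderiv ℝ (zP z h.1) (sq h.2 t 0) (sqDir h.2 1 0) = (derivative (cen z h)).eval t :=
  ((differentiable_zP z h.1 _).hasFDerivAt.comp_hasDerivAt t
    (hasDerivAt_sq_left h.2 t 0)).unique (hasDerivAt_zL_left z h t)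

theorem fderiv_zP_right (hn : 1 ≤ n) (z : M.CP n → ℝ) (h : F × Fin 4) (t : ℝ) :
    fderiv ℝ (zP z h.1) (sq h.2 t 0) (sqDir h.2 0 1) = (nor z h).eval t :=
  ((differentiable_zP z h.1 _).hasFDerivAt.comp_hasDerivAt 0
    (hasDerivAt_sq_right h.2 t 0)).unique (hasDerivAt_zL_right hn z h t)

theorem sq_edge_mem (h : F × Fin 4) {t : ℝ} (ht : t ∈ Icc (0 : ℝ) 1) : sq h.2 t 0 ∈ unitSq :=
  sq_mem h.2 ht ⟨le_rfl, zero_le_one⟩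

theorem one_sub_mem {t : ℝ} (ht : t ∈ Icc (0 : ℝ) 1) : 1 - t ∈ Icc (0 : ℝ) 1 :=
  ⟨by linarith [ht.2], by linarith [ht.1]⟩

/-- The data of first order on both sides of an edge agree. -/
theorem edge_compat (hM : M.IsSmoothMesh) (hn : 1 ≤ n) {z : M.CP n → ℝ} {h h' : F × Fin 4}
    (ho : M.Opp h h') (hE : smo z h h' = 0) {t : ℝ} (ht : t ∈ Icc (0 : ℝ) 1) :
    zP z h.1 (sq h.2 t 0) = zP z h'.1 (sq h'.2 (1 - t) 0) ∧
    grad z h.1 (sq h.2 t 0) = grad z h'.1 (sq h'.2 (1 - t) 0) := by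
  have hs := hM.isStraight ho.isInnerEdge
  have hs' := hM.isStraight ho.symm.isInnerEdge
  have ht' := one_sub_mem ht
  constructor
  · have h1 := zL_zero z h t
    have h2 := zL_zero z h' (1 - t)
    rw [ho.cen_eq, eval_comp] at h2
    simp only [eval_sub, eval_one, eval_X, sub_sub_cancel] at h2
    exact h1.trans h2.symm
  · have g1 := grad_fderiv hM z h.1 (sq_edge_mem h ht) (sqDir h.2 1 0)
    have g2 := grad_fderiv hM z h.1 (sq_edge_mem h ht) (sqDir h.2 0 1)
    have g3 := grad_fderiv hM z h'.1 (sq_edge_mem h' ht') (sqDir h'.2 1 0)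
    have g4 := grad_fderiv hM z h'.1 (sq_edge_mem h' ht') (sqDir h'.2 0 1)
    rw [M.fderiv_sqDir_left hs, fderiv_zP_left] at g1
    rw [M.fderiv_sqDir_right hs, fderiv_zP_right hn] at g2
    rw [M.fderiv_sqDir_left hs', fderiv_zP_left, ho.derivative_cen_eq, ho.dir_eq] at g3
    rw [M.fderiv_sqDir_right hs', fderiv_zP_right hn] at g4
    have j1 := hM.eval_jac_pos hs ht
    have j2 := hM.eval_jac_pos hs' ht'
    rw [eval_jac] at j1 j2
    rw [ho.dir_eq, cross_neg_left] at j2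
    have hE' := congrArg (eval t) hE
    rw [eval_smo ho, eval_zero] at hE'
    simp only [eval_neg, eval_comp, eval_sub, eval_one, eval_X, sub_sub_cancel, map_neg,
      neg_inj] at g3
    set A := grad z h.1 (sq h.2 t 0)
    set B := grad z h'.1 (sq h'.2 (1 - t) 0)
    have hid := linearMap_cross_identity A ((M.lamX h).eval t, (M.lamY h).eval t)
      ((M.lamX h').eval (1 - t), (M.lamY h').eval (1 - t)) (M.dir h)
    rw [g2, g1] at hid
    -- The gradients agree along the edge because both patches have the same values there. The
    -- smoothness equation, after subtraction of the vector identity and division by the positive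
    -- Jacobian of the left element, yields agreement in the cross direction of the right element.
    -- These two directions are independent.
    refine linearMap_eq_of_cross_ne_zero
      (x := M.dir h) (y := ((M.lamX h').eval (1 - t), (M.lamY h').eval (1 - t)))
      (by linarith) (g1.trans g3.symm) ?_
    rw [g4]
    have := hid.trans hE'.symm
    have h5 : cross (M.dir h) ((M.lamX h).eval t, (M.lamY h).eval t) *
      (A ((M.lamX h').eval (1 - t), (M.lamY h').eval (1 - t)) - (nor z h').eval (1 - t)) = 0 := by
      linarith
    rcases mul_eq_zero.1 h5 with h | h <;> linarith

/-- Elements that meet only in a vertex share no edge. Agreement is transported along the chain of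
elements at the vertex, each link being `edge_compat` at the end of the shared edge. -/
theorem vertex_compat (hM : M.IsSmoothMesh) (hn : 1 ≤ n) {z : M.CP n → ℝ}
    (hE : ∀ h h', M.Opp h h' → smo z h h' = 0) {h h' : F × Fin 4} (hv : M.org h = M.org h') :
    zP z h.1 (sq h.2 0 0) = zP z h'.1 (sq h'.2 0 0) ∧
    grad z h.1 (sq h.2 0 0) = grad z h'.1 (sq h'.2 0 0) := by
  have key := hM.vertex_connected h h' hv
  induction key with
  | rel k k' ho =>
    have := edge_compat hM hn ho (hE _ _ ho) (t := 1) ⟨zero_le_one, le_rfl⟩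
    rw [sub_self, sq_prev, sub_self] at this
    exact this
  | refl k => exact ⟨rfl, rfl⟩
  | symm k k' _ ih =>
    have := ih hv.symm
    exact ⟨this.1.symm, this.2.symm⟩
  | trans k k' k'' h1 h2 ih1 ih2 =>
    have e : M.org k = M.org k' := by
      clear ih1 ih2 h2 hv
      induction h1 with
      | rel k k' ho => rw [← tgt_prev]; exact ho.2
      | refl k => rfl
      | symm _ _ _ ih => exact ih.symm
      | trans _ _ _ _ _ i1 i2 => exact i1.trans i2
    have a := ih1 e
    have b := ih2 (e.symm.trans hv)
    exact ⟨a.1.trans b.1, a.2.trans b.2⟩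

/-- The patches and their gradients agree wherever the elements meet. -/
theorem patch_compat (hM : M.IsSmoothMesh) (hn : 1 ≤ n) {z : M.CP n → ℝ}
    (hE : ∀ h h', M.Opp h h' → smo z h h' = 0) {f g : F} {p q : ℝ × ℝ} (hp : p ∈ unitSq)
    (hq : q ∈ unitSq) (hpq : M.paramP f p = M.paramP g q) :
    zP z f p = zP z g q ∧ grad z f p = grad z g q := by
  by_cases hfg : f = g
  · subst hfg
    obtain rfl := hM.paramP_injOn f hp hq hpq
    exact ⟨rfl, rfl⟩
  have h0 : (0 : ℝ) ∈ Icc (0 : ℝ) 1 := ⟨le_rfl, zero_le_one⟩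
  have hx : M.paramP f p ∈ M.element f ∩ M.element g :=
    ⟨mem_element_iff.2 ⟨p, hp, rfl⟩, mem_element_iff.2 ⟨q, hq, hpq.symm⟩⟩
  rcases hM.inter f g hfg with h | ⟨s, t, hst, h⟩ | ⟨s, t, ho, h⟩
  · rw [h] at hx; exact hx.elim
  · rw [h, mem_singleton_iff] at hx
    have e1 : M.paramP f p = M.paramP f (sq s 0 0) := hx.trans (M.paramL_corner (f, s)).symm
    have e2 : M.paramP g q = M.paramP g (sq t 0 0) := by
      rw [← hpq, hx, hst]; exact (M.paramL_corner (g, t)).symm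
    rw [hM.paramP_injOn f hp (sq_mem s h0 h0) e1, hM.paramP_injOn g hq (sq_mem t h0 h0) e2]
    exact vertex_compat hM hn hE (h := (f, s)) (h' := (g, t)) hst
  · rw [h] at hx
    have hs := hM.isStraight ho.isInnerEdge
    have hs' := hM.isStraight ho.symm.isInnerEdge
    rw [segment_eq_image'] at hx
    obtain ⟨x, hx01, hx⟩ := hx
    have e1 : M.paramP f p = M.paramP f (sq s x 0) :=
      hx.symm.trans (M.paramL_zero hs x).symm
    have e2 : M.paramP g q = M.paramP g (sq t (1 - x) 0) := by
      rw [← hpq, e1]; exact ho.paramL_eq hs hs' x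
    rw [hM.paramP_injOn f hp (sq_mem s hx01 h0) e1,
      hM.paramP_injOn g hq (sq_mem t (one_sub_mem hx01) h0) e2]
    exact edge_compat hM hn ho (hE _ _ ho) hx01

theorem element_eq_image (f : F) : M.element f = M.paramP f '' unitSq := by
  ext x; rw [mem_element_iff]; rfl

/-- Functions that satisfy the smoothness equations are smooth splines. -/
theorem mem_FUN_of_smo_eq_zero [Finite F] (hM : M.IsSmoothMesh) (hn : 1 ≤ n) {z : M.CP n → ℝ}
    (hE : ∀ h h', M.Opp h h' → smo z h h' = 0) : z ∈ M.FUN n := by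
  -- The disjoint union of the parameter squares maps onto the domain. The function and its gradient
  -- are defined by descent along this map; `patch_compat` makes both well defined.
  let π : {y : F × (ℝ × ℝ) // y.2 ∈ unitSq} → ℝ × ℝ := fun y => M.paramP y.1.1 y.1.2
  let φ : ℝ × ℝ → ℝ := Function.extend π (fun y => zP z y.1.1 y.1.2) 0
  let Γ : ℝ × ℝ → (ℝ × ℝ →L[ℝ] ℝ) := Function.extend π (fun y => grad z y.1.1 y.1.2) 0
  have hφ : ∀ f p, p ∈ unitSq → φ (M.paramP f p) = zP z f p := by
    intro f p hp
    have : Function.FactorsThrough (fun y : {y : F × (ℝ × ℝ) // y.2 ∈ unitSq} =>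
        zP z y.1.1 y.1.2) π := fun y y' h => (patch_compat hM hn hE y.2 y'.2 h).1
    exact this.extend_apply 0 ⟨(f, p), hp⟩
  have hΓ : ∀ f p, p ∈ unitSq → Γ (M.paramP f p) = grad z f p := by
    intro f p hp
    have : Function.FactorsThrough (fun y : {y : F × (ℝ × ℝ) // y.2 ∈ unitSq} =>
        grad z y.1.1 y.1.2) π := fun y y' h => (patch_compat hM hn hE y.2 y'.2 h).2
    exact this.extend_apply 0 ⟨(f, p), hp⟩
  refine ⟨φ, ?_, fun f u hu v hv => hφ f (u, v) ⟨hu, hv⟩⟩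
  have hinv : ∀ f, ∃ g : ℝ × ℝ → ℝ × ℝ, ∀ p ∈ unitSq, g (M.paramP f p) = p := fun f =>
    ⟨Function.invFunOn (M.paramP f) unitSq, (hM.paramP_injOn f).leftInvOn_invFunOn⟩
  choose g hg using hinv
  have hcont : ∀ f, ContinuousOn (g f) (M.element f) := fun f => by
    rw [element_eq_image]
    exact continuousOn_leftInverse isCompact_unitSq
      (M.contDiff_paramP f).continuous.continuousOn (hg f)
  have hclosed : ∀ f, IsClosed (M.element f) := fun f => by
    rw [element_eq_image]
    exact (isCompact_unitSq.image (M.contDiff_paramP f).continuous).isClosed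
  have hmaps : ∀ f, MapsTo (g f) (M.element f) unitSq := by
    rintro f x hx
    obtain ⟨p, hp, rfl⟩ := mem_element_iff.1 hx
    rwa [hg f p hp]
  have hder : ∀ f, ∀ x ∈ M.element f, HasFDerivWithinAt φ (Γ x) (M.element f) x := by
    intro f x hx
    obtain ⟨p, hp, rfl⟩ := mem_element_iff.1 hx
    obtain ⟨e, he⟩ := hM.exists_equiv f hp
    have hgp := hg f p hp
    have h1 : HasFDerivWithinAt (M.paramP f) (e : ℝ × ℝ →L[ℝ] ℝ × ℝ) unitSq
        (g f (M.paramP f p)) := by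
      rw [hgp, he]
      exact (M.differentiable_paramP f p).hasFDerivAt.hasFDerivWithinAt
    have h2 := h1.of_local_left_inverse (g := g f) (s := M.element f)
      (((hcont f) _ hx).tendsto_nhdsWithin (hmaps f)) hx (by
        filter_upwards [self_mem_nhdsWithin] with y hy
        obtain ⟨q, hq, rfl⟩ := mem_element_iff.1 hy
        rw [hg f q hq])
    have h3 := HasFDerivAt.comp_hasFDerivWithinAt (M.paramP f p)
      (differentiable_zP z f (g f (M.paramP f p))).hasFDerivAt h2
    rw [hΓ f p hp]
    have h4 : grad z f p = (fderiv ℝ (zP z f) (g f (M.paramP f p))).comp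
        (e.symm : ℝ × ℝ →L[ℝ] ℝ × ℝ) := by
      unfold grad
      rw [hgp, ← he, ContinuousLinearMap.inverse_equiv]
    rw [h4]
    refine h3.congr (fun y hy => ?_) ?_
    · obtain ⟨q, hq, rfl⟩ := mem_element_iff.1 hy
      simp only [Function.comp_apply]
      rw [hφ f q hq, hg f q hq]
    · simp only [Function.comp_apply]
      rw [hφ f p hp, hgp]
  have hΓcont : ∀ f, ContinuousOn Γ (M.element f) := by
    intro f
    have h1 : ContinuousOn (grad z f) unitSq := by
      unfold grad
      refine ContinuousOn.clm_comp
        ((contDiff_zP z f).continuous_fderiv (by norm_num)).continuousOn ?_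
      intro p hp
      obtain ⟨e, he⟩ := hM.exists_equiv f hp
      have h2 : ContinuousAt ContinuousLinearMap.inverse (fderiv ℝ (M.paramP f) p) := by
        rw [← he]
        exact (contDiffAt_map_inverse (n := 0) e).continuousAt
      exact (h2.comp (f := fderiv ℝ (M.paramP f)) (x := p)
        ((M.contDiff_paramP f).continuous_fderiv (by norm_num)).continuousAt).continuousWithinAt
    refine (h1.comp (hcont f) (hmaps f)).congr fun x hx => ?_
    obtain ⟨p, hp, rfl⟩ := mem_element_iff.1 hx
    simp only [Function.comp_apply]
    rw [hΓ f p hp, hg f p hp]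
  have hone : (1 : WithTop ℕ∞) = 0 + 1 := by norm_num
  rw [hone, contDiffOn_succ_iff_hasFDerivWithinAt (by simp)]
  intro x hx
  refine ⟨M.domain, by rw [insert_eq_of_mem hx]; exact self_mem_nhdsWithin, by simp, Γ, ?_, ?_⟩
  · intro y hy
    -- A derivative within each of finitely many elements is a derivative within their union. An
    -- element that does not contain the point is closed and imposes no condition.
    refine HasFDerivWithinAt.iUnion_finite fun f => ?_
    by_cases hyf : y ∈ M.element f
    · exact hder f y hyf
    · exact HasFDerivWithinAt.of_notMem_closure (by rwa [(hclosed f).closure_eq])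
  · rw [contDiffOn_zero]
    exact (locallyFinite_of_finite _).continuousOn_iUnion hclosed hΓcont

theorem mem_FUN_iff [Finite F] (hM : M.IsSmoothMesh) (hn : 1 ≤ n) {z : M.CP n → ℝ} :
    z ∈ M.FUN n ↔ ∀ h h', M.Opp h h' → smo z h h' = 0 :=
  ⟨fun hz _ _ ho => smo_eq_zero_of_mem_FUN hM hn hz ho, mem_FUN_of_smo_eq_zero hM hn⟩

end Mesh
end SmoothQuadMesh
end

noncomputable section
namespace SmoothQuadMesh
namespace Mesh

variable {V F : Type*} {M : Mesh V F} {n : ℕ}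

/-! ### Equality of control points -/

/-- The position of a control point on an edge, as a combination of the end points. -/
def edgeLab (n : ℕ) (o t : V) (a : ℕ) : V →₀ ℕ := Finsupp.single o (n - a) + Finsupp.single t a

theorem edgeLab_zero (n : ℕ) (o t : V) : edgeLab n o t 0 = Finsupp.single o n := by
  simp [edgeLab]

theorem edgeLab_self (n : ℕ) (o t : V) : edgeLab n o t n = Finsupp.single t n := by
  simp [edgeLab]

theorem edgeLab_swap {n a : ℕ} (h : a ≤ n) (o t : V) :
    edgeLab n o t a = edgeLab n t o (n - a) := by
  unfold edgeLab
  rw [Nat.sub_sub_self h, add_comm]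

open Classical in
-- For an index strictly between 0 and n the label has both end points in its support, and the
-- multiplicities give the index. So the edge is recovered up to its orientation.
theorem edgeLab_eq {n a b : ℕ} {o t o' t' : V} (ha : 0 < a) (han : a < n) (hbn : b ≤ n)
    (hne : o ≠ t) (h : edgeLab n o t a = edgeLab n o' t' b) :
    (o' = o ∧ t' = t ∧ b = a) ∨ (o' = t ∧ t' = o ∧ b = n - a) := by
  have h1 := DFunLike.congr_fun h o
  have h2 := DFunLike.congr_fun h t
  simp only [edgeLab, Finsupp.add_apply, Finsupp.single_apply, if_true, if_neg hne,
    if_neg hne.symm] at h1 h2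
  by_cases e1 : o' = o
  · by_cases e2 : t' = t
    · left
      refine ⟨e1, e2, ?_⟩
      subst e1 e2
      rw [if_pos rfl, if_neg hne.symm] at h1
      omega
    · subst e1
      rw [if_neg hne, if_neg e2] at h2
      omega
  · by_cases e2 : t' = o
    · by_cases e3 : o' = t
      · right
        refine ⟨e3, e2, ?_⟩
        rw [if_neg e1, if_pos e2] at h1
        omega
      · subst e2
        rw [if_neg e3, if_neg hne] at h2
        omega
    · rw [if_neg e1, if_neg e2] at h1
      omega

/-- A label of a control point that is the same in all elements that contain it. -/
def lab (M : Mesh V F) (n : ℕ) (p : F × Fin (n + 1) × Fin (n + 1)) :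
    (V →₀ ℕ) ⊕ (F × Fin (n + 1) × Fin (n + 1)) :=
  if (p.2.2 : ℕ) = 0 then Sum.inl (edgeLab n (M.corner p.1 0) (M.corner p.1 1) p.2.1)
  else if (p.2.1 : ℕ) = n then Sum.inl (edgeLab n (M.corner p.1 1) (M.corner p.1 2) p.2.2)
  else if (p.2.2 : ℕ) = n then Sum.inl (edgeLab n (M.corner p.1 3) (M.corner p.1 2) p.2.1)
  else if (p.2.1 : ℕ) = 0 then Sum.inl (edgeLab n (M.corner p.1 0) (M.corner p.1 3) p.2.2)
  else Sum.inr p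

theorem lab_loc_zero (hn : 1 ≤ n) (h : F × Fin 4) (t : Fin (n + 1)) :
    M.lab n (loc n h t 0) = Sum.inl (edgeLab n (M.org h) (M.tgt h) t) := by
  obtain ⟨f, s⟩ := h
  have ht := t.2
  have hr : ((t.rev : Fin (n + 1)) : ℕ) = n - t := by rw [Fin.val_rev]; omega
  have hr0 : ((Fin.rev 0 : Fin (n + 1)) : ℕ) = n := by simp
  fin_cases s
  · simp [lab, loc, org, tgt]
  · simp only [lab, loc, hr0, org, tgt]
    by_cases h0 : (t : ℕ) = 0
    · rw [if_pos h0, h0, edgeLab_zero, edgeLab_self]; rfl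
    · rw [if_neg h0, if_pos trivial]; rfl
  · simp only [lab, loc, hr0, org, tgt, hr]
    rw [if_neg (by omega)]
    by_cases h0 : (t : ℕ) = 0
    · rw [if_pos (by omega), h0, edgeLab_zero, edgeLab_self]; rfl
    · rw [if_neg (by omega), if_pos trivial]
      rw [edgeLab_swap (by omega), Nat.sub_sub_self (by omega)]; rfl
  · simp only [lab, loc, org, tgt, hr, Fin.val_zero]
    by_cases h0 : (t : ℕ) = n
    · rw [if_pos (by omega), h0, edgeLab_zero, edgeLab_self]; rfl
    · rw [if_neg (by omega), if_neg (by omega)]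
      by_cases h1 : (t : ℕ) = 0
      · rw [if_pos (by omega), h1, edgeLab_zero, edgeLab_zero]; rfl
      · rw [if_neg (by omega), if_pos trivial]
        rw [edgeLab_swap (by omega), Nat.sub_sub_self (by omega)]; rfl

theorem lab_of_interior {p : F × Fin (n + 1) × Fin (n + 1)} (h1 : (p.2.1 : ℕ) ≠ 0)
    (h2 : (p.2.1 : ℕ) ≠ n) (h3 : (p.2.2 : ℕ) ≠ 0) (h4 : (p.2.2 : ℕ) ≠ n) :
    M.lab n p = Sum.inr p := by
  rw [lab, if_neg h3, if_neg h2, if_neg h4, if_neg h1]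

theorem lab_loc_of_interior (h : F × Fin 4) {a b : Fin (n + 1)} (ha : 0 < (a : ℕ))
    (ha' : (a : ℕ) < n) (hb : 0 < (b : ℕ)) (hb' : (b : ℕ) < n) :
    M.lab n (loc n h a b) = Sum.inr (loc n h a b) := by
  obtain ⟨f, s⟩ := h
  have hr : ((a.rev : Fin (n + 1)) : ℕ) = n - a := by rw [Fin.val_rev]; omega
  have hr' : ((b.rev : Fin (n + 1)) : ℕ) = n - b := by rw [Fin.val_rev]; omega
  apply lab_of_interior <;> fin_cases s <;> simp only [loc, hr, hr'] <;> omega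

/-- The label of a control point. -/
def label (M : Mesh V F) (n : ℕ) (hn : 1 ≤ n) :
    M.CP n → (V →₀ ℕ) ⊕ (F × Fin (n + 1) × Fin (n + 1)) :=
  Quot.lift (M.lab n) (by
    rintro p q ⟨h, h', t, ho, rfl, rfl⟩
    rw [lab_loc_zero hn, lab_loc_zero hn, ← ho.1, ← ho.2, edgeLab_swap (by omega), Fin.val_rev]
    congr 2
    omega)

theorem label_edge (hn : 1 ≤ n) (h : F × Fin 4) (t : Fin (n + 1)) :
    M.label n hn (M.cp n h t 0) = Sum.inl (edgeLab n (M.org h) (M.tgt h) t) :=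
  lab_loc_zero hn h t

theorem label_interior (hn : 1 ≤ n) (h : F × Fin 4) {a b : Fin (n + 1)} (ha : 0 < (a : ℕ))
    (ha' : (a : ℕ) < n) (hb : 0 < (b : ℕ)) (hb' : (b : ℕ) < n) :
    M.label n hn (M.cp n h a b) = Sum.inr (loc n h a b) :=
  lab_loc_of_interior h ha ha' hb hb'

/-- Identification happens only on common edges, so the class of a control point inside an element
has one member. -/
theorem loc_eq_of_cp_eq {h k : F × Fin 4} {a b c d : Fin (n + 1)} (ha : 0 < (a : ℕ))
    (ha' : (a : ℕ) < n) (hb : 0 < (b : ℕ)) (hb' : (b : ℕ) < n) (hc : 0 < (c : ℕ))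
    (hc' : (c : ℕ) < n) (hd : 0 < (d : ℕ)) (hd' : (d : ℕ) < n)
    (e : M.cp n h a b = M.cp n k c d) : loc n h a b = loc n k c d := by
  have hn : 1 ≤ n := by omega
  have := congrArg (M.label n hn) e
  rwa [label_interior hn h ha ha' hb hb', label_interior hn k hc hc' hd hd', Sum.inr.injEq] at this

theorem cp_interior_ne_edge {h k : F × Fin 4} {a b t : Fin (n + 1)} (ha : 0 < (a : ℕ))
    (ha' : (a : ℕ) < n) (hb : 0 < (b : ℕ)) (hb' : (b : ℕ) < n) :
    M.cp n h a b ≠ M.cp n k t 0 := by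
  intro e
  have hn : 1 ≤ n := by omega
  have := congrArg (M.label n hn) e
  rw [label_interior hn h ha ha' hb hb', label_edge] at this
  exact Sum.inr_ne_inl this

theorem cp_edge_eq (hM : M.IsSmoothMesh) {h k : F × Fin 4} {a t : Fin (n + 1)}
    (ha : 0 < (a : ℕ)) (ha' : (a : ℕ) < n) (e : M.cp n h a 0 = M.cp n k t 0) :
    (k = h ∧ t = a) ∨ (M.Opp h k ∧ t = a.rev) := by
  have hn : 1 ≤ n := by omega
  have := congrArg (M.label n hn) e
  rw [label_edge, label_edge, Sum.inl.injEq] at this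
  rcases edgeLab_eq ha ha' (by omega) (hM.org_ne_tgt h) this with ⟨h1, h2, h3⟩ | ⟨h1, h2, h3⟩
  · exact Or.inl ⟨hM.edge_unique _ _ h1 h2, Fin.ext h3⟩
  · refine Or.inr ⟨⟨h2.symm, h1.symm⟩, Fin.ext ?_⟩
    rw [h3, Fin.val_rev]; omega

/-- Control points are glued only along edges; corners at a common vertex become equal through the
chain of elements there. -/
theorem cp_corner_eq (hM : M.IsSmoothMesh) {h k : F × Fin 4} (e : M.org h = M.org k) :
    M.cp n h 0 0 = M.cp n k 0 0 := by
  have key := hM.vertex_connected h k e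
  clear e
  induction key with
  | rel k k' ho =>
    have h1 := ho.cp_eq n (Fin.rev 0)
    rw [Fin.rev_rev, cp_prev, Fin.rev_rev] at h1
    exact h1
  | refl k => rfl
  | symm _ _ _ ih => exact ih.symm
  | trans _ _ _ _ _ i1 i2 => exact i1.trans i2

theorem val_one_of_le (hn : 1 ≤ n) : ((1 : Fin (n + 1)) : ℕ) = 1 := by
  rw [Fin.val_one', Nat.mod_eq_of_lt (by omega)]

theorem val_two_of_le (hn : 2 ≤ n) : ((2 : Fin (n + 1)) : ℕ) = 2 :=
  Nat.mod_eq_of_lt (show 2 < n + 1 by omega)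

/-- Side control points of an element that are adjacent to several sides. -/
theorem loc_one_eq (hn : 3 ≤ n) {h k : F × Fin 4} {a c : Fin (n + 1)}
    (e : loc n h a 1 = loc n k c 1) :
    (k = h ∧ c = a) ∨ (k = next h ∧ (a : ℕ) = n - 1 ∧ (c : ℕ) = 1) ∨
      (k = prev h ∧ (a : ℕ) = 1 ∧ (c : ℕ) = n - 1) := by
  obtain ⟨f, s⟩ := h
  obtain ⟨g, t⟩ := k
  have hf : f = g := by
    have := congrArg Prod.fst e
    rwa [loc_fst, loc_fst] at this
  subst hf
  have h1 := val_one_of_le (n := n) (by omega)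
  have hr := fun x : Fin (n + 1) => Fin.val_rev x
  fin_cases s <;> fin_cases t <;>
    simp only [loc, Prod.mk.injEq, true_and, Fin.ext_iff, hr, h1] at e <;>
    first
    | (exfalso; omega)
    | (refine Or.inl ⟨rfl, Fin.ext ?_⟩; omega)
    | (refine Or.inr (Or.inl ⟨rfl, ?_, ?_⟩) <;> omega)
    | (refine Or.inr (Or.inr ⟨rfl, ?_, ?_⟩) <;> omega)

end Mesh
end SmoothQuadMesh
end

noncomputable section
namespace SmoothQuadMesh

/-! ### Alternating sums along a cycle -/

section Cycle

variable {H : Type*} {σ : Equiv.Perm H}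

/-- The sum of the values at consecutive points. -/
def cycSum (σ : Equiv.Perm H) : (H → ℝ) →ₗ[ℝ] (H → ℝ) where
  toFun τ x := τ (σ x) + τ x
  map_add' τ τ' := by funext x; simp; ring
  map_smul' c τ := by funext x; simp; ring

theorem pow_apply_of_alternating {τ : H → ℝ} (hτ : ∀ x, τ (σ x) = -τ x) (i : ℕ) (x : H) :
    τ ((σ ^ i) x) = (-1) ^ i * τ x := by
  induction i with
  | zero => simp
  | succ i ih => rw [pow_succ', Equiv.Perm.mul_apply, hτ, ih]; ring

theorem cycSum_eq_zero_iff {τ : H → ℝ} : cycSum σ τ = 0 ↔ ∀ x, τ (σ x) = -τ x := by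
  rw [funext_iff]
  exact forall_congr' fun x => by simp [cycSum, add_eq_zero_iff_eq_neg]

variable [Fintype H]

theorem eq_zero_of_alternating (hσ : σ.IsCycleOn (Finset.univ : Finset H)) {τ : H → ℝ}
    (hτ : ∀ x, τ (σ x) = -τ x) {x₀ : H} (h0 : τ x₀ = 0) : τ = 0 := by
  funext x
  obtain ⟨i, -, hi⟩ := hσ.exists_pow_eq (Finset.mem_univ x₀) (Finset.mem_univ x)
  rw [← hi, pow_apply_of_alternating hτ, h0, mul_zero]; rfl

/-- A kernel element changes its sign at each step. After a full turn of odd length it equals its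
own negative. -/
theorem cycSum_injective_of_odd (hσ : σ.IsCycleOn (Finset.univ : Finset H))
    (hodd : Odd (Fintype.card H)) : Function.Injective (cycSum σ) := by
  rw [injective_iff_map_eq_zero]
  intro τ hτ
  rw [cycSum_eq_zero_iff] at hτ
  funext x
  have h1 := hσ.pow_card_apply (Finset.mem_univ x)
  have h2 := pow_apply_of_alternating hτ (Fintype.card H) x
  rw [Finset.card_univ] at h1
  rw [h1, hodd.neg_one_pow] at h2
  simp only [Pi.zero_apply]
  linarith

theorem cycSum_surjective_of_odd (hσ : σ.IsCycleOn (Finset.univ : Finset H))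
    (hodd : Odd (Fintype.card H)) : Function.Surjective (cycSum σ) :=
  LinearMap.injective_iff_surjective.1 (cycSum_injective_of_odd hσ hodd)

/-- On a cycle of even length, the parity of the distance to the base point is well defined; the
sign of this parity alternates. -/
theorem exists_alternating (hσ : σ.IsCycleOn (Finset.univ : Finset H))
    (heven : Even (Fintype.card H)) (x₀ : H) :
    ∃ ε : H → ℝ, (∀ x, ε (σ x) = -ε x) ∧ (∀ x, ε x ≠ 0) ∧ ε x₀ = 1 := by
  choose i hi using fun x => (hσ.exists_pow_eq (Finset.mem_univ x₀) (Finset.mem_univ x))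
  have hpar : ∀ {a b : ℕ}, (σ ^ a) x₀ = (σ ^ b) x₀ → (-1 : ℝ) ^ a = (-1) ^ b := by
    intro a b hab
    rw [hσ.pow_apply_eq_pow_apply (Finset.mem_univ x₀), Finset.card_univ] at hab
    have h2 : a ≡ b [MOD 2] := hab.of_dvd heven.two_dvd
    rw [neg_one_pow_eq_pow_mod_two, h2, ← neg_one_pow_eq_pow_mod_two]
  refine ⟨fun x => (-1) ^ i x, fun x => ?_, fun x => by positivity, ?_⟩
  · have : (σ ^ i (σ x)) x₀ = (σ ^ (i x + 1)) x₀ := by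
      rw [(hi (σ x)).2, pow_succ', Equiv.Perm.mul_apply, (hi x).2]
    simp only
    rw [hpar this]
    ring
  · have : (σ ^ i x₀) x₀ = (σ ^ 0) x₀ := by rw [(hi x₀).2]; simp
    simpa using hpar this

/-- With alternating signs the sum telescopes around the cycle. This is the only obstruction to
solvability in the even case. -/
theorem sum_alternating_mul_cycSum {ε : H → ℝ} (hε : ∀ x, ε (σ x) = -ε x) (τ : H → ℝ) :
    ∑ x, ε (σ x) * cycSum σ τ x = 0 := by
  have h1 : ∑ x, ε (σ x) * τ (σ x) = ∑ x, ε x * τ x :=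
    Equiv.sum_comp σ fun x => ε x * τ x
  have : ∀ x, ε (σ x) * cycSum σ τ x = ε (σ x) * τ (σ x) - ε x * τ x := by
    intro x
    have : cycSum σ τ x = τ (σ x) + τ x := rfl
    rw [this, mul_add, hε x]; ring
  simp only [this, Finset.sum_sub_distrib, h1, sub_self]

/-- The kernel has dimension at most one, and the range lies in the hyperplane on which the
alternating functional vanishes; by rank-nullity it is this hyperplane. Adding a multiple of `ε`,
which spans the kernel, adjusts the value at one point. -/
theorem exists_cycSum_eq_of_even (hσ : σ.IsCycleOn (Finset.univ : Finset H)) {ε : H → ℝ}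
    (hε : ∀ x, ε (σ x) = -ε x) (hε0 : ∀ x, ε x ≠ 0) {b : H → ℝ} (hb : ∑ x, ε (σ x) * b x = 0)
    (x₀ : H) (c : ℝ) : ∃ τ, τ x₀ = c ∧ cycSum σ τ = b := by
  let ℓ : (H → ℝ) →ₗ[ℝ] ℝ := Fintype.linearCombination ℝ fun x => ε (σ x)
  have hℓ : ∀ y, ℓ y = ∑ x, ε (σ x) * y x := fun y => by
    simp [ℓ, Fintype.linearCombination_apply, mul_comm]
  have hℓ0 : ℓ ≠ 0 := by
    intro h
    classical
    have := hℓ (Pi.single x₀ 1)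
    rw [h] at this
    simp only [LinearMap.zero_apply, Pi.single_apply, mul_ite, mul_one, mul_zero,
      Finset.sum_ite_eq', Finset.mem_univ, if_true] at this
    exact hε0 _ this.symm
  have hle : LinearMap.range (cycSum σ) ≤ LinearMap.ker ℓ := by
    rintro _ ⟨τ, rfl⟩
    rw [LinearMap.mem_ker, hℓ, sum_alternating_mul_cycSum hε]
  have hker : Module.finrank ℝ (LinearMap.ker (cycSum σ)) ≤ 1 := by
    have hinj : Function.Injective
        ((LinearMap.proj x₀ : (H → ℝ) →ₗ[ℝ] ℝ).domRestrict (LinearMap.ker (cycSum σ))) := by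
      rw [injective_iff_map_eq_zero]
      rintro ⟨τ, hτ⟩ h0
      rw [LinearMap.mem_ker, cycSum_eq_zero_iff] at hτ
      exact Subtype.ext (eq_zero_of_alternating hσ hτ h0)
    simpa using LinearMap.finrank_le_finrank_of_injective hinj
  have h1 := LinearMap.finrank_range_add_finrank_ker (cycSum σ)
  have h2 := Module.Dual.finrank_ker_add_one_of_ne_zero (f := ℓ) hℓ0
  have heq := Submodule.eq_of_le_of_finrank_le hle (by
    have h2' : Module.finrank ℝ (LinearMap.ker ℓ) + 1 = Module.finrank ℝ (H → ℝ) := h2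
    omega)
  have hbm : b ∈ LinearMap.range (cycSum σ) := by
    rw [heq, LinearMap.mem_ker, hℓ, hb]
  obtain ⟨τ, rfl⟩ := hbm
  refine ⟨τ + ((c - τ x₀) / ε x₀) • ε, ?_, ?_⟩
  · simp [hε0]
  · rw [map_add, map_smul, cycSum_eq_zero_iff.2 hε, smul_zero, add_zero]

end Cycle

namespace Mesh

variable {V F : Type*} {M : Mesh V F} {n : ℕ}

/-! ### The edges at an inner vertex -/

open Classical in
variable (M) in
/-- The other orientation of an inner edge. -/
def opp (h : F × Fin 4) : F × Fin 4 := if hi : M.IsInnerEdge h then hi.choose else h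

theorem opp_spec {h : F × Fin 4} (hi : M.IsInnerEdge h) : M.Opp h (M.opp h) := by
  unfold opp
  rw [dif_pos hi]
  exact hi.choose_spec

theorem IsSmoothMesh.opp_eq (hM : M.IsSmoothMesh) {h h' : F × Fin 4} (ho : M.Opp h h') :
    M.opp h = h' := hM.opp_unique (opp_spec ho.isInnerEdge) ho

variable (M) in
/-- The edges that emanate from a vertex. -/
abbrev Star (v : V) : Type _ := {h : F × Fin 4 // M.org h = v}

theorem org_opp_prev {v : V} (hv : ¬ M.IsBdVertex v) (h : M.Star v) :
    M.org (M.opp (prev h.1)) = v := by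
  have := opp_spec (isInnerEdge_prev (h := h.1) (by rwa [h.2]))
  rw [← this.2, tgt_prev, h.2]

/-- The next edge, in counter-clockwise order, at an inner vertex. -/
def rotFun {v : V} (hv : ¬ M.IsBdVertex v) (h : M.Star v) : M.Star v :=
  ⟨M.opp (prev h.1), org_opp_prev hv h⟩

theorem rotFun_injective (hM : M.IsSmoothMesh) {v : V} (hv : ¬ M.IsBdVertex v) :
    Function.Injective (rotFun hv) := by
  rintro ⟨h, hh⟩ ⟨k, hk⟩ e
  have e' : M.opp (prev h) = M.opp (prev k) := congrArg Subtype.val e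
  have h1 := opp_spec (isInnerEdge_prev (h := h) (by rwa [hh]))
  have h2 := opp_spec (isInnerEdge_prev (h := k) (by rwa [hk]))
  rw [e'] at h1
  have := hM.opp_unique h1.symm h2.symm
  apply Subtype.ext
  simp only
  rw [← next_prev h, this, next_prev]

section Rotation

variable [Finite F]

instance (v : V) : Fintype (M.Star v) := Fintype.ofFinite _

/-- The rotation of the edges at an inner vertex. -/
def rot (hM : M.IsSmoothMesh) {v : V} (hv : ¬ M.IsBdVertex v) : Equiv.Perm (M.Star v) :=
  Equiv.ofBijective _ (Finite.injective_iff_bijective.1 (rotFun_injective hM hv))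

theorem rot_val (hM : M.IsSmoothMesh) {v : V} (hv : ¬ M.IsBdVertex v) (h : M.Star v) :
    (rot hM hv h).1 = M.opp (prev h.1) := rfl

theorem opp_prev_rot (hM : M.IsSmoothMesh) {v : V} (hv : ¬ M.IsBdVertex v) (h : M.Star v) :
    M.Opp (prev h.1) (rot hM hv h).1 :=
  opp_spec (isInnerEdge_prev (h := h.1) (by rw [h.2]; exact hv))

/-- One link of the chain of elements at a vertex is one step of the rotation, so `vertex_connected`
says that the rotation has a single orbit. -/
theorem rot_isCycleOn (hM : M.IsSmoothMesh) {v : V} (hv : ¬ M.IsBdVertex v) :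
    (rot hM hv).IsCycleOn (Finset.univ : Finset (M.Star v)) := by
  refine ⟨by simp, ?_⟩
  have key : ∀ h k : F × Fin 4, Relation.EqvGen (fun k k' => M.Opp (prev k) k') h k →
      (M.org h = M.org k) ∧ ∀ (e1 : M.org h = v) (e2 : M.org k = v),
        (rot hM hv).SameCycle ⟨h, e1⟩ ⟨k, e2⟩ := by
    intro h k hk
    induction hk with
    | rel k k' ho =>
      refine ⟨by rw [← tgt_prev]; exact ho.2, fun e1 e2 => ⟨1, ?_⟩⟩
      rw [zpow_one]
      exact Subtype.ext (hM.opp_eq ho)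
    | refl k => exact ⟨rfl, fun _ _ => Equiv.Perm.SameCycle.refl _ _⟩
    | symm _ _ _ ih => exact ⟨ih.1.symm, fun e1 e2 => (ih.2 e2 e1).symm⟩
    | trans _ _ _ _ _ i1 i2 =>
      exact ⟨i1.1.trans i2.1, fun e1 e2 => (i1.2 e1 (i1.1 ▸ e1)).trans (i2.2 (i1.1 ▸ e1) e2)⟩
  rintro ⟨h, hh⟩ - ⟨k, hk⟩ -
  exact (key h k (hM.vertex_connected h k (hh.trans hk.symm))).2 hh hk

theorem card_star (v : V) : Fintype.card (M.Star v) = M.valence v := by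
  rw [← Nat.card_eq_fintype_card]; rfl

/-- The previous edge at the origin of `h`, expressed through the opposite edge. -/
theorem rot_next_opp (hM : M.IsSmoothMesh) {v : V} (hv : ¬ M.IsBdVertex v) {h h' : F × Fin 4}
    (ho : M.Opp h h') (hh : M.org h = v) :
    rot hM hv ⟨next h', by rw [org_next, ← ho.1, hh]⟩ = ⟨h, hh⟩ := by
  apply Subtype.ext
  rw [rot_val]
  simp only [prev_next]
  exact hM.opp_eq ho.symm

end Rotation

/-! ### Cross derivatives at an inner vertex -/

/-- The special formula for the side with number 3 concerns boundary elements only. Its origin would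
be the corner D, a boundary vertex; at an inner vertex, `ctrl` is the point at one third and the
usual difference is recovered. -/
theorem lamq_zero (hM : M.IsSmoothMesh) {h : F × Fin 4} (hv : ¬ M.IsBdVertex (M.org h)) :
    M.lamq h 0 = M.pos (M.org (prev h)) - M.pos (M.org h) := by
  obtain ⟨f, s⟩ := h
  by_cases hs : s = 3
  · subst hs
    have hf : ¬ M.IsBdFace f := by
      rintro ⟨s, hs⟩
      have : s = 2 := hM.bd_label _ hs
      subst this
      exact hv ⟨_, hs, Or.inr rfl⟩
    ext <;> simp [lamq, ctrl, hf, org, prev] <;> ring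
  · simp [lamq, hs]

theorem lamq_two (hM : M.IsSmoothMesh) {h : F × Fin 4} (hv : ¬ M.IsBdVertex (M.tgt h)) :
    M.lamq h 2 = M.pos (M.tgt (next h)) - M.pos (M.tgt h) := by
  obtain ⟨f, s⟩ := h
  by_cases hs : s = 1
  · subst hs
    have hf : ¬ M.IsBdFace f := by
      rintro ⟨s, hs⟩
      have : s = 2 := hM.bd_label _ hs
      subst this
      exact hv ⟨_, hs, Or.inl rfl⟩
    ext <;> simp [lamq, ctrl, hf, tgt, next] <;> ring
  · simp [lamq, hs]

theorem dir_rot {h k : F × Fin 4} (ho : M.Opp (prev h) k) :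
    M.dir k = M.pos (M.org (prev h)) - M.pos (M.org h) := by
  unfold dir
  rw [← ho.1, ← ho.2, tgt_prev]

variable (M) in
/-- The value of the cross derivative at the origin of a side. -/
theorem eval_lam_zero (h : F × Fin 4) :
    ((M.lamX h).eval 0, (M.lamY h).eval 0) = M.lamq h 0 := by
  rw [← coeff_zero_eq_eval_zero, ← coeff_zero_eq_eval_zero, lamX, lamY, coeff_bz_zero,
    coeff_bz_zero]

variable (M) in
theorem eval_lam_one (h : F × Fin 4) :
    ((M.lamX h).eval 1, (M.lamY h).eval 1) = M.lamq h 2 := by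
  have h1 : ∀ c, (bz 2 c).eval 1 = c 2 := by
    intro c
    have : (bz 2 c).eval 1 = ((bz 2 c).comp (1 - X)).eval 0 := by simp
    rw [this, bz_comp_one_sub_X, ← coeff_zero_eq_eval_zero, coeff_bz_zero]; rfl
  rw [lamX, lamY, h1, h1]

theorem eval_lam_zero_eq_dir (hM : M.IsSmoothMesh) {h k : F × Fin 4}
    (hv : ¬ M.IsBdVertex (M.org h)) (ho : M.Opp (prev h) k) :
    ((M.lamX h).eval 0, (M.lamY h).eval 0) = M.dir k := by
  rw [eval_lam_zero, lamq_zero hM hv, dir_rot ho]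

theorem eval_lam_one_eq_dir (hM : M.IsSmoothMesh) {h' : F × Fin 4}
    (hv : ¬ M.IsBdVertex (M.tgt h')) :
    ((M.lamX h').eval 1, (M.lamY h').eval 1) = M.dir (next h') := by
  rw [eval_lam_one, lamq_two hM hv]; rfl

variable (M) in
/-- The cross product of an edge and the next edge at its origin. -/
def turn (h : F × Fin 4) : ℝ := cross (M.dir h) (M.dir (M.opp (prev h)))

theorem turn_pos (hM : M.IsSmoothMesh) {h : F × Fin 4} (hv : ¬ M.IsBdVertex (M.org h)) :
    0 < M.turn h := by
  have := hM.eval_jac_pos (hM.isStraight (isInnerEdge_of_org hv)) (t := 0) ⟨le_rfl, zero_le_one⟩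
  rwa [eval_jac, eval_lam_zero_eq_dir hM hv (opp_spec (isInnerEdge_prev hv))] at this

theorem coeff_zero_jac (hM : M.IsSmoothMesh) {h : F × Fin 4} (hv : ¬ M.IsBdVertex (M.org h)) :
    (M.jac h).coeff 0 = M.turn h := by
  rw [coeff_zero_eq_eval_zero, eval_jac,
    eval_lam_zero_eq_dir hM hv (opp_spec (isInnerEdge_prev hv))]
  rfl

theorem coeff_zero_jac_comp (hM : M.IsSmoothMesh) {h h' : F × Fin 4} (ho : M.Opp h h')
    (hv : ¬ M.IsBdVertex (M.org h)) :
    ((M.jac h').comp (1 - X)).coeff 0 = M.turn (next h') := by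
  rw [coeff_zero_eq_eval_zero, eval_comp]
  simp only [eval_sub, eval_one, eval_X, sub_zero]
  rw [eval_jac, eval_lam_one_eq_dir hM (by rwa [← ho.1]), turn, prev_next, hM.opp_eq ho.symm,
    ho.dir_eq, cross_neg_left, cross_swap, neg_neg]

theorem coeff_zero_crossPol (hM : M.IsSmoothMesh) {h h' k : F × Fin 4} (ho : M.Opp h h')
    (hk : M.Opp (prev h) k) (hv : ¬ M.IsBdVertex (M.org h)) :
    (M.crossPol h h').coeff 0 = cross (M.dir k) (M.dir (next h')) := by
  rw [coeff_zero_eq_eval_zero, ← eval_lam_zero_eq_dir hM hv hk,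
    ← eval_lam_one_eq_dir hM (h' := h') (by rwa [← ho.1])]
  simp [crossPol, cross]

end Mesh
end SmoothQuadMesh
end

noncomputable section
namespace SmoothQuadMesh

/-! ### Degree elevation -/

theorem sum_bernstein_elevate {E : Type*} [AddCommGroup E] [Module ℝ E] {n m : ℕ}
    {e : Fin (m + 1) → Fin (n + 1) → ℝ}
    (he : ∀ i, bz n (e i) = bernsteinPolynomial ℝ m i) (Q : Fin (m + 1) → E) (x : ℝ) :
    ∑ k : Fin (n + 1), (bernsteinPolynomial ℝ n k).eval x • ∑ i : Fin (m + 1), e i k • Q i =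
      ∑ i : Fin (m + 1), (bernsteinPolynomial ℝ m i).eval x • Q i := by
  simp only [Finset.smul_sum]
  rw [Finset.sum_comm]
  refine Finset.sum_congr rfl fun i _ => ?_
  rw [← he i, eval_bz, Finset.sum_smul]
  refine Finset.sum_congr rfl fun k _ => ?_
  rw [smul_smul, mul_comm]

theorem patch_elevate {E : Type*} [NormedAddCommGroup E] [NormedSpace ℝ E] {n m : ℕ}
    {e : Fin (m + 1) → Fin (n + 1) → ℝ}
    (he : ∀ i, bz n (e i) = bernsteinPolynomial ℝ m i) (Q : Fin (m + 1) → Fin (m + 1) → E)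
    (u v : ℝ) :
    patch n (fun k l => ∑ i : Fin (m + 1), e i k • ∑ j : Fin (m + 1), e j l • Q i j) u v =
      patch m Q u v := by
  have swap : ∀ (b : Fin (n + 1) → ℝ) (c : Fin (m + 1) → ℝ) (S : Fin (m + 1) → Fin (n + 1) → E),
      ∑ l, b l • ∑ i, c i • S i l = ∑ i, c i • ∑ l, b l • S i l := by
    intro b c S
    simp only [Finset.smul_sum]
    rw [Finset.sum_comm]
    exact Finset.sum_congr rfl fun i _ => Finset.sum_congr rfl fun l _ => smul_comm _ _ _
  rw [Mesh.patch_eq_sum_sum, Mesh.patch_eq_sum_sum, ← sum_bernstein_elevate he]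
  refine Finset.sum_congr rfl fun k _ => ?_
  rw [swap]
  simp only [sum_bernstein_elevate he]

theorem sum_eval_bernstein (n : ℕ) (x : ℝ) :
    ∑ i : Fin (n + 1), (bernsteinPolynomial ℝ n i).eval x = 1 := by
  have := congrArg (eval x) (bernsteinPolynomial.sum ℝ n)
  rw [eval_finsetSum, eval_one] at this
  rw [← this, Finset.sum_range]

/-- Bernstein polynomials form a partition of unity, so affine maps commute with the formation of
patches. -/
theorem patch_affine {E : Type*} [NormedAddCommGroup E] [NormedSpace ℝ E] (n : ℕ) (c : ℝ)
    (G : E →L[ℝ] ℝ) (Q : Fin (n + 1) → Fin (n + 1) → E) (u v : ℝ) :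
    patch n (fun i j => c + G (Q i j)) u v = c + G (patch n Q u v) := by
  simp only [patch, smul_add, Finset.sum_add_distrib, map_sum, map_smul]
  congr 1
  simp only [smul_eq_mul, ← Finset.sum_mul, ← Finset.mul_sum, sum_eval_bernstein]
  ring

namespace Mesh

variable {V F : Type*} {M : Mesh V F} {n : ℕ}

theorem zPatch_mk_eq_patch {Q : F × Fin (n + 1) × Fin (n + 1) → ℝ}
    {hQ : ∀ p q, M.Glued n p q → Q p = Q q} (f : F) (u v : ℝ) :
    M.zPatch (Quot.lift Q hQ) f u v = patch n (fun i j => Q (f, i, j)) u v :=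
  zPatch_eq_patch _ f u v

/-- Affine functions belong to the spline space. -/
theorem exists_affine_spline (hM : M.IsSmoothMesh) (hn : 3 ≤ n) (c : ℝ)
    (G : ℝ × ℝ →L[ℝ] ℝ) : ∃ z ∈ M.FUN n, ∀ h, M.IsInnerEdge h →
      z (M.cp n h 0 0) = c + G (M.pos (M.org h)) ∧
      n * (z (M.cp n h 1 0) - z (M.cp n h 0 0)) = G (M.dir h) := by
  have he : ∀ i : Fin (3 + 1), ∃ e, bz n e = bernsteinPolynomial ℝ 3 i := fun i =>
    exists_bz ((natDegree_bernsteinPolynomial_le 3 i).trans hn)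
  choose e he using he
  set Q : F × Fin (n + 1) × Fin (n + 1) → ℝ := fun p =>
    ∑ i : Fin (3 + 1), e i p.2.1 • ∑ j : Fin (3 + 1), e j p.2.2 • (c + G (M.net (p.1, i, j)))
    with hQdef
  have hQ : ∀ f u v, patch n (fun i j => Q (f, i, j)) u v = c + G (M.param f u v) := by
    intro f u v
    rw [hQdef]
    simp only
    rw [patch_elevate he, param_eq_patch, patch_affine]
  have hL : ∀ h x, (bz n fun t => Q (loc n h t 0)).eval x = c + G (M.paramL h x 0) := by
    intro h x
    have h1 := patch_sq n Q h x 0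
    rw [hQ, patch_right_zero] at h1
    rw [eval_bz]
    simp only [smul_eq_mul] at h1
    simp only [mul_comm (Q _)]
    exact h1.symm
  -- Both elements induce the same polynomial on a common edge, as the affine function depends only
  -- on the position in the plane. Equal polynomials have equal Bézier coefficients.
  have hG : ∀ p q, M.Glued n p q → Q p = Q q := by
    rintro p q ⟨h, h', t, ho, rfl, rfl⟩
    have h1 : (bz n fun t => Q (loc n h t 0)) = bz n fun t => Q (loc n h' t.rev 0) := by
      apply Polynomial.funext
      intro x
      rw [← bz_comp_one_sub_X n (fun t => Q (loc n h' t 0)), eval_comp, hL, hL,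
        ho.paramL_eq (hM.isStraight ho.isInnerEdge) (hM.isStraight ho.symm.isInnerEdge)]
      simp
    exact congrFun (bz_injective n h1) t
  refine ⟨Quot.lift Q hG, ⟨fun x => c + G x, ?_, ?_⟩, ?_⟩
  · exact (contDiff_const.add G.contDiff).contDiffOn
  · intro f u _ v _
    rw [zPatch_mk_eq_patch, hQ]
  · intro h hi
    have h1 : (bz n fun t => Q (loc n h t 0)) =
        C (c + G (M.pos (M.org h))) + C (G (M.dir h)) * X := by
      apply Polynomial.funext
      intro x
      rw [hL, M.paramL_zero (hM.isStraight hi)]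
      simp
      ring
    have h2 := congrArg (fun p => coeff p 0) h1
    have h3 := congrArg (fun p => coeff p 1) h1
    simp only [coeff_bz_zero, coeff_bz_one n (by omega : 1 ≤ n)] at h2 h3
    simp only [coeff_add, coeff_C_zero, coeff_C_mul, coeff_X_zero, coeff_X_one, mul_zero, add_zero,
      mul_one, coeff_C_succ, zero_add] at h2 h3
    exact ⟨h2, h3⟩

theorem cen_add (z z' : M.CP n → ℝ) (h : F × Fin 4) : cen (z + z') h = cen z h + cen z' h := by
  unfold cen
  rw [← map_add]; rfl

theorem nor_add (z z' : M.CP n → ℝ) (h : F × Fin 4) : nor (z + z') h = nor z h + nor z' h := by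
  unfold nor
  rw [← smul_add, ← map_add]
  congr 2
  funext t
  simp only [Pi.add_apply]
  ring

theorem cen_smul (c : ℝ) (z : M.CP n → ℝ) (h : F × Fin 4) : cen (c • z) h = c • cen z h := by
  unfold cen
  rw [← map_smul]; rfl

theorem nor_smul (c : ℝ) (z : M.CP n → ℝ) (h : F × Fin 4) : nor (c • z) h = c • nor z h := by
  unfold nor
  rw [smul_comm c, ← map_smul (bz n) c]
  congr 2
  funext t
  simp only [Pi.smul_apply, smul_eq_mul]
  ring

theorem smo_add (z z' : M.CP n → ℝ) (h h' : F × Fin 4) :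
    smo (z + z') h h' = smo z h h' + smo z' h h' := by
  simp only [smo, nor_add, cen_add, add_comp, derivative_add]
  ring

theorem smo_smul (c : ℝ) (z : M.CP n → ℝ) (h h' : F × Fin 4) :
    smo (c • z) h h' = c • smo z h h' := by
  simp only [smo, nor_smul, cen_smul, smul_eq_C_mul, mul_comp, C_comp, derivative_C_mul]
  ring

theorem smo_sub (z z' : M.CP n → ℝ) (h h' : F × Fin 4) :
    smo (z - z') h h' = smo z h h' - smo z' h h' := by
  rw [eq_sub_iff_add_eq, ← smo_add, sub_add_cancel]

/-! ### Smoothness conditions at an inner vertex -/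

theorem cp_zero_one {h k : F × Fin 4} (hk : M.Opp (prev h) k) : M.cp n h 0 1 = M.cp n k 1 0 := by
  have h1 := hk.cp_eq n (Fin.rev 1)
  rw [Fin.rev_rev, cp_prev, Fin.rev_rev] at h1
  exact h1

theorem coeff_nor_zero (z : M.CP n → ℝ) {h k : F × Fin 4} (hk : M.Opp (prev h) k) :
    (nor z h).coeff 0 = n * (z (M.cp n k 1 0) - z (M.cp n h 0 0)) := by
  rw [nor, coeff_smul, coeff_bz_zero, smul_eq_mul, cp_zero_one hk]

theorem coeff_nor_one (hn : 1 ≤ n) (z : M.CP n → ℝ) {h k : F × Fin 4} (hk : M.Opp (prev h) k) :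
    (nor z h).coeff 1 = n * (n * ((z (M.cp n h 1 1) - z (M.cp n h 1 0)) -
      (z (M.cp n k 1 0) - z (M.cp n h 0 0)))) := by
  rw [nor, coeff_smul, coeff_bz_one n hn, smul_eq_mul, cp_zero_one hk]

theorem nor_comp_eq (z : M.CP n → ℝ) {h h' : F × Fin 4} (ho : M.Opp h h') :
    (nor z h').comp (1 - X) =
      (n : ℝ) • bz n fun t => z (M.cp n h' t.rev 1) - z (M.cp n h t 0) := by
  rw [nor, smul_comp, bz_comp_one_sub_X]
  congr 2
  funext t
  rw [ho.cp_eq]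

theorem coeff_nor_comp_zero (z : M.CP n → ℝ) {h h' : F × Fin 4} (ho : M.Opp h h') :
    ((nor z h').comp (1 - X)).coeff 0 =
      n * (z (M.cp n (next h') 1 0) - z (M.cp n h 0 0)) := by
  rw [nor_comp_eq z ho, coeff_smul, coeff_bz_zero, smul_eq_mul, cp_next]

theorem coeff_nor_comp_one (hn : 1 ≤ n) (z : M.CP n → ℝ) {h h' : F × Fin 4} (ho : M.Opp h h') :
    ((nor z h').comp (1 - X)).coeff 1 =
      n * (n * ((z (M.cp n (next h') 1 1) - z (M.cp n h 1 0)) -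
        (z (M.cp n (next h') 1 0) - z (M.cp n h 0 0)))) := by
  rw [nor_comp_eq z ho, coeff_smul, coeff_bz_one n hn, smul_eq_mul, cp_next, cp_next]

theorem coeff_derivative_cen_zero (hn : 1 ≤ n) (z : M.CP n → ℝ) (h : F × Fin 4) :
    (derivative (cen z h)).coeff 0 = n * (z (M.cp n h 1 0) - z (M.cp n h 0 0)) := by
  rw [coeff_derivative, cen, zero_add, coeff_bz_one n hn]
  simp

theorem coeff_derivative_cen_one (hn : 2 ≤ n) (z : M.CP n → ℝ) (h : F × Fin 4) :
    (derivative (cen z h)).coeff 1 =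
      n * (n - 1) * (z (M.cp n h 2 0) - 2 * z (M.cp n h 1 0) + z (M.cp n h 0 0)) := by
  rw [coeff_derivative, cen, coeff_bz_two n hn]
  have : ((n.choose 2 : ℕ) : ℝ) * 2 = n * (n - 1) := by
    rw [Nat.cast_choose_two]; ring
  push_cast
  linear_combination (z (M.cp n h 2 0) - 2 * z (M.cp n h 1 0) + z (M.cp n h 0 0)) * this

/-- The tangent plane condition: the first differences along three consecutive edges satisfy the
linear relation of the vectors of these edges. -/
theorem coeff_smo_zero (hM : M.IsSmoothMesh) (hn : 1 ≤ n) (z : M.CP n → ℝ) {h h' k : F × Fin 4}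
    (ho : M.Opp h h') (hk : M.Opp (prev h) k) (hv : ¬ M.IsBdVertex (M.org h)) :
    (smo z h h').coeff 0 = n * (
      M.turn (next h') * (z (M.cp n k 1 0) - z (M.cp n h 0 0)) +
      M.turn h * (z (M.cp n (next h') 1 0) - z (M.cp n h 0 0)) +
      cross (M.dir k) (M.dir (next h')) * (z (M.cp n h 1 0) - z (M.cp n h 0 0))) := by
  rw [smo, coeff_add, coeff_add, mul_coeff_zero, mul_coeff_zero, mul_coeff_zero,
    coeff_zero_jac_comp hM ho hv, coeff_zero_jac hM hv, coeff_zero_crossPol hM ho hk hv,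
    coeff_nor_zero z hk, coeff_nor_comp_zero z ho, coeff_derivative_cen_zero hn]
  ring

/-- The twist condition. In general the derivatives of the weight functions would enter; they are
multiplied by first-order data and drop out because these vanish. This is why an affine spline is
subtracted beforehand. -/
theorem coeff_smo_one (hM : M.IsSmoothMesh) (hn : 2 ≤ n) {z : M.CP n → ℝ} {h h' k : F × Fin 4}
    (ho : M.Opp h h') (hk : M.Opp (prev h) k) (hv : ¬ M.IsBdVertex (M.org h))
    (h0 : z (M.cp n h 0 0) = 0) (h1 : z (M.cp n h 1 0) = 0) (h2 : z (M.cp n k 1 0) = 0)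
    (h3 : z (M.cp n (next h') 1 0) = 0) :
    (smo z h h').coeff 1 = n * (n * (
      M.turn (next h') * z (M.cp n h 1 1) + M.turn h * z (M.cp n (next h') 1 1) +
      cross (M.dir k) (M.dir (next h')) * ((n - 1) / n) * z (M.cp n h 2 0))) := by
  have hn0 : (n : ℝ) ≠ 0 := by positivity
  rw [smo, coeff_add, coeff_add, mul_coeff_one, mul_coeff_one, mul_coeff_one,
    coeff_zero_jac_comp hM ho hv, coeff_zero_jac hM hv, coeff_zero_crossPol hM ho hk hv,
    coeff_nor_zero z hk, coeff_nor_comp_zero z ho, coeff_derivative_cen_zero (by omega),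
    coeff_nor_one (by omega) z hk, coeff_nor_comp_one (by omega) z ho,
    coeff_derivative_cen_one hn, h0, h1, h2, h3]
  field_simp
  ring

end Mesh
end SmoothQuadMesh
end

/-! ### The tangent plane and twist systems around an inner vertex. -/

noncomputable section
namespace SmoothQuadMesh
namespace Mesh

variable {V F : Type*} {M : Mesh V F} {n : ℕ}

theorem exists_linear_of_cross_ne_zero {a b : ℝ × ℝ} (h : cross a b ≠ 0) (α β : ℝ) :
    ∃ G : ℝ × ℝ →L[ℝ] ℝ, G a = α ∧ G b = β := by
  refine ⟨((α * b.2 - β * a.2) / cross a b) • ContinuousLinearMap.fst ℝ ℝ ℝ +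
    ((β * a.1 - α * b.1) / cross a b) • ContinuousLinearMap.snd ℝ ℝ ℝ, ?_, ?_⟩ <;>
  · have h' : a.1 * b.2 - a.2 * b.1 ≠ 0 := h
    simp only [add_apply, smul_apply,
      ContinuousLinearMap.coe_fst', ContinuousLinearMap.coe_snd', smul_eq_mul, cross]
    rw [div_mul_eq_mul_div, div_mul_eq_mul_div, ← add_div, div_eq_iff h']
    ring

theorem turn_pos_star (hM : M.IsSmoothMesh) {v : V} (hv : ¬ M.IsBdVertex v) (x : M.Star v) :
    0 < M.turn x.1 := turn_pos hM (by rw [x.2]; exact hv)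

variable [Finite F]

section

variable (hM : M.IsSmoothMesh) {v : V} (hv : ¬ M.IsBdVertex v)

theorem opp_rot (x : M.Star v) : M.Opp (rot hM hv x).1 (prev x.1) := (opp_prev_rot hM hv x).symm

theorem turn_eq (x : M.Star v) : M.turn x.1 = cross (M.dir x.1) (M.dir (rot hM hv x).1) := rfl

/-- The coefficient of the control point of index two in the twist equation. -/
def twistCoeff (x : M.Star v) : ℝ :=
  cross (M.dir (rot hM hv (rot hM hv x)).1) (M.dir x.1)

/-- Indexing by the preceding edge: the equation with index x belongs to the edge `rot x`, whose
neighbours are x and `rot (rot x)`. -/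
theorem twistCoeff_eq_zero_iff (x : M.Star v) :
    twistCoeff hM hv x = 0 ↔ M.NeighboursColinear (rot hM hv x).1 := by
  have ho := opp_rot hM hv x
  have ho2 := opp_prev_rot hM hv (rot hM hv x)
  have e1 : M.pos (M.tgt (next (prev x.1))) - M.pos (M.org (rot hM hv x).1) = M.dir x.1 := by
    rw [next_prev, (rot hM hv x).2, dir, x.2]
  have e2 := (dir_rot ho2).symm
  unfold twistCoeff NeighboursColinear
  rw [cross_swap, neg_eq_zero]
  constructor
  · intro h
    exact ⟨prev x.1, ho, by rw [e1, e2]; exact h⟩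
  · rintro ⟨h', ho', h⟩
    rw [← hM.opp_unique ho ho', e1, e2] at h
    exact h

theorem coeff_smo_rot_zero (hn : 1 ≤ n) (z : M.CP n → ℝ) (x : M.Star v) :
    (smo z (rot hM hv x).1 (prev x.1)).coeff 0 = n * (
      M.turn x.1 * (z (M.cp n (rot hM hv (rot hM hv x)).1 1 0) - z (M.cp n x.1 0 0)) +
      M.turn (rot hM hv x).1 * (z (M.cp n x.1 1 0) - z (M.cp n x.1 0 0)) +
      twistCoeff hM hv x * (z (M.cp n (rot hM hv x).1 1 0) - z (M.cp n x.1 0 0))) := by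
  rw [coeff_smo_zero hM hn z (opp_rot hM hv x) (opp_prev_rot hM hv _)
    (by rw [(rot hM hv x).2]; exact hv), next_prev,
    cp_corner_eq hM ((rot hM hv x).2.trans x.2.symm)]
  rfl

theorem coeff_smo_rot_one (hn : 2 ≤ n) {z : M.CP n → ℝ} (h0 : ∀ x : M.Star v, z (M.cp n x.1 0 0) = 0)
    (h1 : ∀ x : M.Star v, z (M.cp n x.1 1 0) = 0) (x : M.Star v) :
    (smo z (rot hM hv x).1 (prev x.1)).coeff 1 = n * (n * (
      M.turn x.1 * z (M.cp n (rot hM hv x).1 1 1) + M.turn (rot hM hv x).1 * z (M.cp n x.1 1 1) +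
      twistCoeff hM hv x * ((n - 1) / n) * z (M.cp n (rot hM hv x).1 2 0))) := by
  have := coeff_smo_one hM hn (z := z) (opp_rot hM hv x) (opp_prev_rot hM hv _)
    (by rw [(rot hM hv x).2]; exact hv) (h0 _) (h1 _) (h1 _) (by rw [next_prev]; exact h1 x)
  rw [this, next_prev]
  rfl

/-- Values that satisfy the tangent plane conditions vanish if they vanish along two non-colinear
edges. -/
theorem eq_zero_of_tangent {e : M.Star v → ℝ}
    (he : ∀ x, M.turn x.1 * e (rot hM hv (rot hM hv x)) + M.turn (rot hM hv x).1 * e x +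
      twistCoeff hM hv x * e (rot hM hv x) = 0) {k₁ k₂ : M.Star v}
    (hk : cross (M.dir k₁.1) (M.dir k₂.1) ≠ 0) (h1 : e k₁ = 0) (h2 : e k₂ = 0) : e = 0 := by
  obtain ⟨G, hG1, hG2⟩ := exists_linear_of_cross_ne_zero
    (a := M.dir k₁.1) (b := M.dir (rot hM hv k₁).1)
    (turn_pos_star hM hv k₁).ne' (e k₁) (e (rot hM hv k₁))
  -- The relation is a recursion of order two along the rotation, with positive leading coefficient.
  -- The values of a linear functional on the edge vectors satisfy it too, so agreement on two
  -- consecutive edges propagates to all of them.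
  have key : ∀ i : ℕ, e ((rot hM hv ^ i) k₁) = G (M.dir ((rot hM hv ^ i) k₁).1) ∧
      e ((rot hM hv ^ (i + 1)) k₁) = G (M.dir ((rot hM hv ^ (i + 1)) k₁).1) := by
    intro i
    induction i with
    | zero => exact ⟨hG1.symm, hG2.symm⟩
    | succ i ih =>
      refine ⟨ih.2, ?_⟩
      obtain ⟨ih1, ih2⟩ := ih
      rw [pow_succ', Equiv.Perm.mul_apply] at ih2 ⊢
      set x := (rot hM hv ^ i) k₁
      rw [pow_succ', Equiv.Perm.mul_apply] at ⊢
      have h3 := he x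
      have h4 := linearMap_cross_identity G (M.dir (rot hM hv (rot hM hv x)).1) (M.dir x.1)
        (M.dir (rot hM hv x).1)
      rw [← turn_eq, ← turn_eq] at h4
      rw [ih1, ih2] at h3
      have h5 := turn_pos_star hM hv x
      have h6 : M.turn x.1 * (e (rot hM hv (rot hM hv x)) -
          G (M.dir (rot hM hv (rot hM hv x)).1)) = 0 := by
        unfold twistCoeff at h3
        linarith
      rcases mul_eq_zero.1 h6 with h | h <;> linarith
  have hall : ∀ x : M.Star v, e x = G (M.dir x.1) := by
    intro x
    obtain ⟨i, -, hi⟩ := (rot_isCycleOn hM hv).exists_pow_eq (Finset.mem_univ k₁)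
      (Finset.mem_univ x)
    rw [← hi]
    exact (key i).1
  have hG0 : G = 0 := linearMap_eq_of_cross_ne_zero hk
    (by rw [← hall, h1]; simp) (by rw [← hall, h2]; simp)
  funext x
  rw [hall, hG0]; rfl

/-- The homogeneous twist equations at an inner vertex. -/
def TwistSystem (n : ℕ) (d τ : M.Star v → ℝ) : Prop :=
  ∀ x, M.turn x.1 * τ (rot hM hv x) + M.turn (rot hM hv x).1 * τ x +
    twistCoeff hM hv x * ((n - 1) / n) * d (rot hM hv x) = 0

/-- Division by the two positive turns makes the coefficients of the twists constant: in the
unknowns τ/turn, the left-hand side is the plain cyclic sum. -/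
theorem twistSystem_iff {d τ : M.Star v → ℝ} :
    TwistSystem hM hv n d τ ↔ cycSum (rot hM hv) (fun x => τ x / M.turn x.1) =
      fun x => -(twistCoeff hM hv x * ((n - 1) / n) / (M.turn x.1 * M.turn (rot hM hv x).1) *
        d (rot hM hv x)) := by
  rw [funext_iff]
  refine forall_congr' fun x => ?_
  have h1 := (turn_pos_star hM hv x).ne'
  have h2 := (turn_pos_star hM hv (rot hM hv x)).ne'
  have e : cycSum (rot hM hv) (fun x => τ x / M.turn x.1) x =
    τ (rot hM hv x) / M.turn (rot hM hv x).1 + τ x / M.turn x.1 := rfl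
  rw [e, ← add_eq_zero_iff_eq_neg]
  have e2 : τ (rot hM hv x) / M.turn (rot hM hv x).1 + τ x / M.turn x.1 +
      twistCoeff hM hv x * ((n - 1) / n) / (M.turn x.1 * M.turn (rot hM hv x).1) *
        d (rot hM hv x) = (M.turn x.1 * τ (rot hM hv x) + M.turn (rot hM hv x).1 * τ x +
    twistCoeff hM hv x * ((n - 1) / n) * d (rot hM hv x)) /
      (M.turn x.1 * M.turn (rot hM hv x).1) := by
    rw [add_div, add_div, mul_div_mul_left _ _ h1, mul_comm (M.turn x.1),
      mul_div_mul_left _ _ h2, div_mul_eq_mul_div]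
  rw [e2, div_eq_zero_iff]
  simp [h1, h2]

theorem twistSystem_exists_odd (hodd : Odd (M.valence v)) (d : M.Star v → ℝ) :
    ∃ τ, TwistSystem hM hv n d τ := by
  obtain ⟨τ, hτ⟩ := cycSum_surjective_of_odd (rot_isCycleOn hM hv) (by rwa [card_star])
    (fun x => -(twistCoeff hM hv x * ((n - 1) / n) / (M.turn x.1 * M.turn (rot hM hv x).1) *
        d (rot hM hv x)))
  refine ⟨fun x => τ x * M.turn x.1, (twistSystem_iff hM hv).2 ?_⟩
  rw [← hτ]
  congr 1
  funext x
  exact mul_div_cancel_right₀ _ (turn_pos_star hM hv x).ne'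

theorem twistSystem_unique_odd (hodd : Odd (M.valence v)) {τ : M.Star v → ℝ}
    (h : TwistSystem hM hv n 0 τ) : τ = 0 := by
  rw [twistSystem_iff] at h
  have h2 := cycSum_injective_of_odd (rot_isCycleOn hM hv) (by rwa [card_star])
    (a₁ := fun x => τ x / M.turn x.1) (a₂ := 0) (by rw [h, map_zero]; funext x; simp)
  funext x
  have := congrFun h2 x
  simpa [(turn_pos_star hM hv x).ne'] using this

theorem twistSystem_exists_even {d : M.Star v → ℝ}
    {ε : M.Star v → ℝ} (hε : ∀ x, ε (rot hM hv x) = -ε x) (hε0 : ∀ x, ε x ≠ 0)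
    (hd : ∑ x, ε (rot hM hv x) * -(twistCoeff hM hv x * ((n - 1) / n) /
      (M.turn x.1 * M.turn (rot hM hv x).1) * d (rot hM hv x)) = 0) (x₀ : M.Star v) (c : ℝ) :
    ∃ τ, τ x₀ = c ∧ TwistSystem hM hv n d τ := by
  obtain ⟨τ, hτ0, hτ⟩ := exists_cycSum_eq_of_even (rot_isCycleOn hM hv) hε hε0 hd x₀
    (c / M.turn x₀.1)
  refine ⟨fun x => τ x * M.turn x.1, ?_, (twistSystem_iff hM hv).2 ?_⟩
  · simp only
    rw [hτ0, div_mul_cancel₀ _ (turn_pos_star hM hv x₀).ne']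
  · rw [← hτ]
    congr 1
    funext x
    exact mul_div_cancel_right₀ _ (turn_pos_star hM hv x).ne'

theorem twistSystem_unique_even {τ : M.Star v → ℝ} (h : TwistSystem hM hv n 0 τ) {x₀ : M.Star v}
    (h0 : τ x₀ = 0) : τ = 0 := by
  rw [twistSystem_iff] at h
  have h1 : cycSum (rot hM hv) (fun x => τ x / M.turn x.1) = 0 := by
    rw [h]; funext x; simp
  have h2 := eq_zero_of_alternating (rot_isCycleOn hM hv) (cycSum_eq_zero_iff.1 h1) (x₀ := x₀)
    (by simp [h0])
  funext x
  have := congrFun h2 x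
  simpa [(turn_pos_star hM hv x).ne'] using this

/-- The twist equations can be solved with prescribed basic values. -/
theorem twistSystem_exists (hn : 2 ≤ n) {D : Set (M.CP n)} (hD : M.TemplateDT n D v)
    (d₀ τ₀ : M.Star v → ℝ) : ∃ d τ, TwistSystem hM hv n d τ ∧
      (∀ x, M.cp n x.1 2 0 ∈ D → d x = d₀ x) ∧ (∀ x, M.cp n x.1 1 1 ∈ D → τ x = τ₀ x) := by
  classical
  rcases hD with ⟨hodd, h⟩ | ⟨heven, -, ⟨k, hk, hkc, hkD⟩, k', hk', hkD'⟩ | ⟨hreg, -, k', hk', hkD'⟩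
  · obtain ⟨τ, hτ⟩ := twistSystem_exists_odd (n := n) hM hv hodd d₀
    exact ⟨d₀, τ, hτ, fun _ _ => rfl, fun x hx => absurd hx (h x.1 x.2).2⟩
  · obtain ⟨ε, hε, hε0, -⟩ := exists_alternating (rot_isCycleOn hM hv) (by rwa [card_star])
      ⟨k, hk⟩
    set γ : M.Star v → ℝ := fun x => twistCoeff hM hv x * ((n - 1) / n) /
      (M.turn x.1 * M.turn (rot hM hv x).1) with hγ
    obtain ⟨y, hy⟩ := (rot hM hv).surjective ⟨k, hk⟩
    have hγy : γ y ≠ 0 := by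
      have h1 : twistCoeff hM hv y ≠ 0 := by
        rw [Ne, twistCoeff_eq_zero_iff, hy]; exact hkc
      have h2 : ((n : ℝ) - 1) / n ≠ 0 := by
        have : (2 : ℝ) ≤ n := by exact_mod_cast hn
        exact div_ne_zero (by linarith) (by linarith)
      exact div_ne_zero (mul_ne_zero h1 h2) (mul_ne_zero (turn_pos_star hM hv _).ne'
        (turn_pos_star hM hv _).ne')
    -- The defect of the solvability condition. It is removed by changing the value of the one
    -- dependent control point of index two; its coefficient is nonzero because the neighbours of
    -- that edge are not colinear.
    set S : ℝ := ∑ x, ε (rot hM hv x) * -(γ x * d₀ (rot hM hv x)) with hS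
    set d : M.Star v → ℝ := d₀ + (S / (ε (rot hM hv y) * γ y)) • Pi.single (rot hM hv y) 1 with hd
    have hsum : ∑ x, ε (rot hM hv x) * -(γ x * d (rot hM hv x)) = 0 := by
      have h1 : ∀ x, ε (rot hM hv x) * -(γ x * d (rot hM hv x)) =
          ε (rot hM hv x) * -(γ x * d₀ (rot hM hv x)) - if x = y then S else 0 := by
        intro x
        by_cases hxy : x = y
        · subst hxy
          have h2 := hε0 (rot hM hv x)
          simp only [hd, Pi.add_apply, Pi.smul_apply, Pi.single_eq_same, smul_eq_mul, if_true]
          field_simp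
          ring
        · have : rot hM hv x ≠ rot hM hv y := (rot hM hv).injective.ne hxy
          simp [hd, this, hxy]
      simp only [h1, Finset.sum_sub_distrib, Finset.sum_ite_eq', Finset.mem_univ, if_true, ← hS,
        sub_self]
    obtain ⟨τ, hτ0, hτ⟩ := twistSystem_exists_even hM hv hε hε0 hsum ⟨k', hk'⟩ (τ₀ ⟨k', hk'⟩)
    refine ⟨d, τ, hτ, fun x hx => ?_, fun x hx => ?_⟩
    · have hne : x ≠ rot hM hv y := by
        intro e
        rw [hy] at e
        exact (hkD x.1 x.2).1 hx (congrArg Subtype.val e)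
      simp [hd, hne]
    · have := (hkD' x.1 x.2).1 hx
      obtain rfl : x = ⟨k', hk'⟩ := Subtype.ext this
      exact hτ0
  · have heven : Even (M.valence v) := by rw [hreg.1]; decide
    obtain ⟨ε, hε, hε0, -⟩ := exists_alternating (rot_isCycleOn hM hv) (by rwa [card_star])
      ⟨k', hk'⟩
    -- At a regular 4-vertex all coefficients of the points of index two vanish, and the solvability
    -- condition is void.
    have hsum : ∑ x, ε (rot hM hv x) * -(twistCoeff hM hv x * ((n - 1) / n) /
      (M.turn x.1 * M.turn (rot hM hv x).1) * d₀ (rot hM hv x)) = 0 := by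
      refine Finset.sum_eq_zero fun x _ => ?_
      rw [(twistCoeff_eq_zero_iff hM hv x).2 (hreg.2 _ (rot hM hv x).2)]
      simp
    obtain ⟨τ, hτ0, hτ⟩ := twistSystem_exists_even hM hv hε hε0 hsum ⟨k', hk'⟩ (τ₀ ⟨k', hk'⟩)
    refine ⟨d₀, τ, hτ, fun _ _ => rfl, fun x hx => ?_⟩
    have := (hkD' x.1 x.2).1 hx
    obtain rfl : x = ⟨k', hk'⟩ := Subtype.ext this
    exact hτ0

/-- Solutions of the twist equations are determined by the basic values. -/
theorem twistSystem_unique (hn : 2 ≤ n) {D : Set (M.CP n)} (hD : M.TemplateDT n D v)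
    {d τ : M.Star v → ℝ} (h : TwistSystem hM hv n d τ)
    (hd : ∀ x, M.cp n x.1 2 0 ∈ D → d x = 0) (hτ : ∀ x, M.cp n x.1 1 1 ∈ D → τ x = 0) :
    d = 0 ∧ τ = 0 := by
  rcases hD with ⟨hodd, h'⟩ | ⟨_, -, ⟨k, hk, hkc, hkD⟩, k', hk', hkD'⟩ | ⟨hreg, h', k', hk', hkD'⟩
  · have hd0 : d = 0 := funext fun x => hd x (h' x.1 x.2).1
    subst hd0
    exact ⟨rfl, twistSystem_unique_odd hM hv hodd h⟩
  · have hτ0 : τ ⟨k', hk'⟩ = 0 := hτ _ ((hkD' k' hk').2 rfl)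
    obtain ⟨ε, hε, hε0, -⟩ := exists_alternating (rot_isCycleOn hM hv) (by rwa [card_star])
      ⟨k, hk⟩
    obtain ⟨y, hy⟩ := (rot hM hv).surjective ⟨k, hk⟩
    -- The alternating sum eliminates all twists. Only the term of the dependent point of index two
    -- is left, with nonzero coefficient.
    have hd0 : d = 0 := by
      have h1 := sum_alternating_mul_cycSum hε (fun x => τ x / M.turn x.1)
      rw [(twistSystem_iff hM hv).1 h, Finset.sum_eq_single y] at h1
      · have h2 : twistCoeff hM hv y ≠ 0 := by
          rw [Ne, twistCoeff_eq_zero_iff, hy]; exact hkc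
        have h3 : ((n : ℝ) - 1) / n ≠ 0 := by
          have : (2 : ℝ) ≤ n := by exact_mod_cast hn
          exact div_ne_zero (by linarith) (by linarith)
        have h4 : d (rot hM hv y) = 0 := by
          rw [mul_neg, neg_eq_zero] at h1
          rcases mul_eq_zero.1 h1 with h5 | h5
          · exact absurd h5 (hε0 _)
          rcases mul_eq_zero.1 h5 with h6 | h6
          · exact absurd h6 (div_ne_zero (mul_ne_zero h2 h3)
              (mul_ne_zero (turn_pos_star hM hv _).ne' (turn_pos_star hM hv _).ne'))
          · exact h6
        funext x
        by_cases hx : x = ⟨k, hk⟩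
        · rw [hx, ← hy, h4]; rfl
        · exact hd x ((hkD x.1 x.2).2 fun e => hx (Subtype.ext e))
      · intro x _ hxy
        have : rot hM hv x ≠ ⟨k, hk⟩ := by
          rw [← hy]; exact (rot hM hv).injective.ne hxy
        have := hd _ ((hkD _ (rot hM hv x).2).2 fun e => this (Subtype.ext e))
        simp [this]
      · simp
    subst hd0
    exact ⟨rfl, twistSystem_unique_even hM hv h hτ0⟩
  · have hd0 : d = 0 := funext fun x => hd x (h' x.1 x.2)
    subst hd0
    exact ⟨rfl, twistSystem_unique_even hM hv h (hτ ⟨k', hk'⟩ ((hkD' k' hk').2 rfl))⟩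

end

end Mesh
end SmoothQuadMesh
end

noncomputable section
namespace SmoothQuadMesh
namespace Mesh

variable {V F : Type*} {M : Mesh V F} {n : ℕ}

/-! ### The control points close to the inner vertices -/

variable (M n) in
/-- The control points next to the origin of an edge that take part in the vertex conditions. -/
def vertexPt (p : (F × Fin 4) × Fin 3) : M.CP n :=
  ![M.cp n p.1 1 0, M.cp n p.1 2 0, M.cp n p.1 1 1] p.2

theorem cp_edge_eq_of_lt (hM : M.IsSmoothMesh) {h k : F × Fin 4} {a b : Fin (n + 1)}
    (ha : 0 < (a : ℕ)) (hab : (a : ℕ) + b < n) (e : M.cp n h a 0 = M.cp n k b 0) :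
    h = k ∧ a = b := by
  rcases cp_edge_eq hM ha (by omega) e with ⟨h1, h2⟩ | ⟨-, h2⟩
  · exact ⟨h1.symm, h2.symm⟩
  · rw [h2, Fin.val_rev] at hab; omega

/-- The indices 1 and 2 at one end of an edge do not reach the corresponding ones at the other end,
since 2 + 2 < n. Hence the systems of different vertices have disjoint unknowns. -/
theorem vertexPt_injective (hM : M.IsSmoothMesh) (hn : 5 ≤ n) :
    Function.Injective (M.vertexPt n) := by
  have h1 := val_one_of_le (n := n) (by omega)
  have h2 := val_two_of_le (n := n) (by omega)
  rintro ⟨h, i⟩ ⟨k, j⟩ e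
  have key : ∀ {a b : Fin (n + 1)} {i j : Fin 3}, 0 < (a : ℕ) → (a : ℕ) + b < n →
      (a = b → i = j) → M.cp n h a 0 = M.cp n k b 0 → (h, i) = (k, j) := by
    intro a b i j ha hab hij e
    obtain ⟨rfl, e2⟩ := cp_edge_eq_of_lt hM ha hab e
    rw [hij e2]
  have hne : (1 : Fin (n + 1)) ≠ 2 := by rw [Ne, Fin.ext_iff, h1, h2]; omega
  have hi : ∀ {h k : F × Fin 4} {t : Fin (n + 1)}, M.cp n h 1 1 ≠ M.cp n k t 0 := fun {h k t} =>
    cp_interior_ne_edge (by omega) (by omega) (by omega) (by omega)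
  fin_cases i <;> fin_cases j <;> simp only [vertexPt] at e
  · exact key (by omega) (by omega) (fun _ => rfl) e
  · exact key (by omega) (by omega) (fun h => absurd h hne) e
  · exact absurd e.symm hi
  · exact key (by omega) (by omega) (fun h => absurd h.symm hne) e
  · exact key (by omega) (by omega) (fun _ => rfl) e
  · exact absurd e.symm hi
  · exact absurd e hi
  · exact absurd e hi
  · have e' := loc_eq_of_cp_eq (by omega) (by omega) (by omega) (by omega) (by omega) (by omega)
      (by omega) (by omega) e
    rcases loc_one_eq (by omega) e' with ⟨rfl, -⟩ | ⟨-, h3, -⟩ | ⟨-, -, h3⟩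
    · rfl
    · omega
    · omega

theorem vertexPt_ne_corner (hM : M.IsSmoothMesh) (hn : 5 ≤ n) (p : (F × Fin 4) × Fin 3)
    (k : F × Fin 4) : M.vertexPt n p ≠ M.cp n k 0 0 := by
  have h1 := val_one_of_le (n := n) (by omega)
  have h2 := val_two_of_le (n := n) (by omega)
  obtain ⟨h, i⟩ := p
  intro e
  fin_cases i <;> simp only [vertexPt] at e
  · have := (cp_edge_eq_of_lt hM (by omega) (by rw [Fin.val_zero]; omega) e).2
    rw [Fin.ext_iff, h1] at this; simp at this
  · have := (cp_edge_eq_of_lt hM (by omega) (by rw [Fin.val_zero]; omega) e).2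
    rw [Fin.ext_iff, h2] at this; simp at this
  · exact cp_interior_ne_edge (by omega) (by omega) (by omega) (by omega) e

/-- The smoothness conditions of order zero and one at the origin of the edges at `v`. -/
def VertexOK (z : M.CP n → ℝ) (v : V) : Prop :=
  ∀ h h', M.org h = v → M.Opp h h' → X ^ 2 ∣ smo z h h'

theorem VertexOK.add {z z' : M.CP n → ℝ} {v : V} (h : VertexOK z v) (h' : VertexOK z' v) :
    VertexOK (z + z') v := fun k k' hk ho => by
  rw [smo_add]; exact dvd_add (h k k' hk ho) (h' k k' hk ho)

variable [Finite F]

theorem vertexOK_iff (hM : M.IsSmoothMesh) {v : V} (hv : ¬ M.IsBdVertex v) {z : M.CP n → ℝ} :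
    VertexOK z v ↔ ∀ x : M.Star v, X ^ 2 ∣ smo z (rot hM hv x).1 (prev x.1) := by
  refine ⟨fun h x => h _ _ (rot hM hv x).2 (opp_rot hM hv x), fun h k k' hk ho => ?_⟩
  have h1 := rot_next_opp hM hv ho hk
  have h2 := h ⟨next k', by rw [org_next, ← ho.1, hk]⟩
  rw [h1, prev_next] at h2
  exact h2

theorem vertexOK_iff_twistSystem (hM : M.IsSmoothMesh) (hn : 2 ≤ n) {v : V}
    (hv : ¬ M.IsBdVertex v) {z : M.CP n → ℝ} (h0 : ∀ x : M.Star v, z (M.cp n x.1 0 0) = 0)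
    (h1 : ∀ x : M.Star v, z (M.cp n x.1 1 0) = 0) :
    VertexOK z v ↔ TwistSystem hM hv n (fun x => z (M.cp n x.1 2 0))
      (fun x => z (M.cp n x.1 1 1)) := by
  rw [vertexOK_iff hM hv]
  refine forall_congr' fun x => ?_
  rw [X_sq_dvd_iff, coeff_smo_rot_zero hM hv (by omega), coeff_smo_rot_one hM hv hn h0 h1]
  have hn0 : (n : ℝ) ≠ 0 := by positivity
  simp [h0, h1, hn0]

theorem vertexOK_of_eq_zero (hM : M.IsSmoothMesh) (hn : 2 ≤ n) {v : V}
    (hv : ¬ M.IsBdVertex v) {z : M.CP n → ℝ} (h0 : ∀ x : M.Star v, z (M.cp n x.1 0 0) = 0)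
    (h1 : ∀ (x : M.Star v) i, z (M.vertexPt n (x.1, i)) = 0) : VertexOK z v := by
  rw [vertexOK_iff_twistSystem hM hn hv h0 fun x => h1 x 0]
  intro x
  have e1 : ∀ x : M.Star v, z (M.cp n x.1 2 0) = 0 := fun x => h1 x 1
  have e2 : ∀ x : M.Star v, z (M.cp n x.1 1 1) = 0 := fun x => h1 x 2
  simp [e1, e2]

/-- The conditions at an inner vertex can be satisfied with prescribed basic values. -/
theorem exists_vertexOK_at (hM : M.IsSmoothMesh) (hn : 5 ≤ n) {v : V} (hv : ¬ M.IsBdVertex v)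
    {D : Set (M.CP n)} (hVE : M.TemplateVE n D v) (hDT : M.TemplateDT n D v) (y : M.CP n → ℝ) :
    ∃ z, VertexOK z v ∧ (∀ p ∈ D, z p = y p) ∧
      ∀ p, (∀ (x : M.Star v) i, p ≠ M.vertexPt n (x.1, i)) → z p = y p := by
  obtain ⟨-, k₁, k₂, hk₁, hk₂, hk, hkD⟩ := hVE
  set a := y (M.cp n k₁ 0 0) with ha
  have hn0 : (n : ℝ) ≠ 0 := by positivity
  -- The factor n turns differences of Bézier coefficients into derivatives: `G` is the gradient
  -- prescribed by the three basic values of the tangent plane.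
  obtain ⟨G, hG1, hG2⟩ := exists_linear_of_cross_ne_zero hk (n * (y (M.cp n k₁ 1 0) - a))
    (n * (y (M.cp n k₂ 1 0) - a))
  obtain ⟨w, hw, hwv⟩ := exists_affine_spline hM (by omega : 3 ≤ n) (a - G (M.pos v)) G
  have hw0 : ∀ x : M.Star v, w (M.cp n x.1 0 0) = a := fun x => by
    rw [(hwv x.1 (isInnerEdge_of_org (by rw [x.2]; exact hv))).1, x.2]; ring
  have ha' : ∀ x : M.Star v, y (M.cp n x.1 0 0) = a := fun x => by
    rw [ha, cp_corner_eq hM (x.2.trans hk₁.symm)]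
  have hw1 : ∀ k, M.org k = v → G (M.dir k) = n * (y (M.cp n k 1 0) - a) →
      w (M.cp n k 1 0) = y (M.cp n k 1 0) := by
    intro k hk h
    have h1 := (hwv k (isInnerEdge_of_org (by rw [hk]; exact hv))).2
    rw [h, hw0 ⟨k, hk⟩] at h1
    linarith [mul_left_cancel₀ hn0 h1]
  -- The affine spline already satisfies all conditions; the homogeneous system takes care of the
  -- remaining difference, which has zero tangent plane.
  obtain ⟨d, τ, hdτ, hd, hτ⟩ := twistSystem_exists hM hv (by omega) hDT
    (fun x => y (M.cp n x.1 2 0) - w (M.cp n x.1 2 0))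
    (fun x => y (M.cp n x.1 1 1) - w (M.cp n x.1 1 1))
  set P : M.Star v × Fin 3 → M.CP n := fun q => M.vertexPt n (q.1.1, q.2) with hP
  have hPinj : Function.Injective P := by
    rintro ⟨x, i⟩ ⟨x', i'⟩ e
    have := vertexPt_injective hM hn e
    rw [Prod.mk.injEq] at this
    exact Prod.ext (Subtype.ext this.1) this.2
  set u : M.CP n → ℝ := Function.extend P (fun q => ![0, d q.1, τ q.1] q.2) (y - w) with hu
  have hu1 : ∀ q, u (P q) = ![0, d q.1, τ q.1] q.2 := fun q => hPinj.extend_apply _ _ q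
  have hu2 : ∀ p, (∀ (x : M.Star v) i, p ≠ M.vertexPt n (x.1, i)) → u p = y p - w p := by
    intro p hp
    exact Function.extend_apply' _ _ _ fun ⟨q, hq⟩ => hp q.1 q.2 hq.symm
  have huOK : VertexOK u v := by
    rw [vertexOK_iff_twistSystem hM (by omega) hv]
    · intro x
      have e1 : ∀ x : M.Star v, u (M.cp n x.1 2 0) = d x := fun x => hu1 (x, 1)
      have e2 : ∀ x : M.Star v, u (M.cp n x.1 1 1) = τ x := fun x => hu1 (x, 2)
      simp only [e1, e2]
      exact hdτ x
    · intro x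
      rw [hu2 _ fun x' i => (vertexPt_ne_corner hM hn _ _).symm, hw0, ha', sub_self]
    · exact fun x => hu1 (x, 0)
  refine ⟨u + w, huOK.add fun h h' _ ho => ?_, fun p hp => ?_, fun p hp => ?_⟩
  · rw [(mem_FUN_iff hM (by omega)).1 hw h h' ho]; exact dvd_zero _
  · by_cases hq : ∃ q, P q = p
    · obtain ⟨⟨x, i⟩, rfl⟩ := hq
      rw [Pi.add_apply, hu1]
      fin_cases i
      · have : w (M.cp n x.1 1 0) = y (M.cp n x.1 1 0) := by
          rcases (hkD x.1 x.2).1 hp with e | e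
          · exact hw1 _ x.2 (by rw [e, hG1])
          · exact hw1 _ x.2 (by rw [e, hG2])
        simpa [P, vertexPt] using this
      · have : d x = y (M.cp n x.1 2 0) - w (M.cp n x.1 2 0) := hd x hp
        simp [this, P, vertexPt]
      · have : τ x = y (M.cp n x.1 1 1) - w (M.cp n x.1 1 1) := hτ x hp
        simp [this, P, vertexPt]
    · rw [Pi.add_apply, hu2 p fun x i e => hq ⟨(x, i), e.symm⟩]; ring
  · rw [Pi.add_apply, hu2 p hp]; ring

/-- The conditions at all inner vertices can be satisfied with prescribed basic values. -/
theorem exists_vertexOK [Finite V] (hM : M.IsSmoothMesh) (hn : 5 ≤ n) {D : Set (M.CP n)}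
    (hVE : ∀ v, ¬ M.IsBdVertex v → M.TemplateVE n D v)
    (hDT : ∀ v, ¬ M.IsBdVertex v → M.TemplateDT n D v) (y : M.CP n → ℝ) :
    ∃ z, (∀ v, ¬ M.IsBdVertex v → VertexOK z v) ∧ ∀ p ∈ D, z p = y p := by
  classical
  cases nonempty_fintype V
  suffices ∀ s : Finset V, ∃ z, (∀ v ∈ s, ¬ M.IsBdVertex v → VertexOK z v) ∧
      ∀ p ∈ D, z p = y p by
    obtain ⟨z, h1, h2⟩ := this Finset.univ
    exact ⟨z, fun v => h1 v (Finset.mem_univ v), h2⟩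
  intro s
  induction s using Finset.induction_on with
  | empty => exact ⟨y, by simp, fun _ _ => rfl⟩
  | insert v s hvs ih =>
    obtain ⟨z, h1, h2⟩ := ih
    by_cases hv : M.IsBdVertex v
    · refine ⟨z, fun u hu hub => ?_, h2⟩
      rcases Finset.mem_insert.1 hu with rfl | hu
      · exact absurd hv hub
      · exact h1 u hu hub
    · obtain ⟨z', h3, h4, h5⟩ := exists_vertexOK_at hM hn hv (hVE v hv) (hDT v hv) z
      refine ⟨z', fun u hu hub => ?_, fun p hp => (h4 p hp).trans (h2 p hp)⟩
      rcases Finset.mem_insert.1 hu with rfl | hu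
      · exact h3
      · have huv : u ≠ v := fun e => hvs (e ▸ hu)
        -- The correction at `v` changes only points attached to edges that leave `v`. At `u` all
        -- relevant values of the difference vanish, so the condition obtained before persists.
        rw [← sub_add_cancel z' z]
        refine VertexOK.add (vertexOK_of_eq_zero hM (by omega) hub (fun x => ?_) fun x i => ?_)
          (h1 u hu hub)
        · rw [Pi.sub_apply, h5 _ fun x' i => (vertexPt_ne_corner hM hn _ _).symm, sub_self]
        · rw [Pi.sub_apply, h5 _ fun x' i e => ?_, sub_self]
          have := vertexPt_injective hM hn e
          rw [Prod.mk.injEq] at this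
          exact huv (by rw [← x.2, this.1, x'.2])

/-- The tangent plane at an inner vertex is determined by two non-colinear edges. -/
theorem VertexOK.eq_zero_of_tangent (hM : M.IsSmoothMesh) (hn : 1 ≤ n) {v : V}
    (hv : ¬ M.IsBdVertex v) {z : M.CP n → ℝ} (hz : VertexOK z v)
    (e0 : ∀ x : M.Star v, z (M.cp n x.1 0 0) = 0) {k₁ k₂ : F × Fin 4} (hk₁ : M.org k₁ = v)
    (hk₂ : M.org k₂ = v) (hk : cross (M.dir k₁) (M.dir k₂) ≠ 0) (h1 : z (M.cp n k₁ 1 0) = 0)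
    (h2 : z (M.cp n k₂ 1 0) = 0) (x : M.Star v) : z (M.cp n x.1 1 0) = 0 := by
  have hn0 : (n : ℝ) ≠ 0 := by positivity
  have e1 : (fun x : M.Star v => z (M.cp n x.1 1 0)) = 0 := by
    refine Mesh.eq_zero_of_tangent hM hv (fun x => ?_) (k₁ := ⟨k₁, hk₁⟩) (k₂ := ⟨k₂, hk₂⟩) hk h1 h2
    have := (X_sq_dvd_iff.1 ((vertexOK_iff hM hv).1 hz x)).1
    rw [coeff_smo_rot_zero hM hv (by omega), e0, mul_eq_zero, or_iff_right hn0] at this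
    simpa using this
  exact congrFun e1 x

/-- A function that satisfies the conditions at an inner vertex is determined there by its basic
values. -/
theorem eq_zero_of_vertexOK (hM : M.IsSmoothMesh) (hn : 5 ≤ n) {v : V} (hv : ¬ M.IsBdVertex v)
    {D : Set (M.CP n)} (hVE : M.TemplateVE n D v) (hDT : M.TemplateDT n D v) {z : M.CP n → ℝ}
    (hz : VertexOK z v) (h0 : ∀ p ∈ D, z p = 0) {h : F × Fin 4} (hh : M.org h = v) :
    z (M.cp n h 0 0) = 0 ∧ z (M.cp n h 1 0) = 0 ∧ z (M.cp n h 2 0) = 0 ∧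
      z (M.cp n h 1 1) = 0 := by
  obtain ⟨hV, k₁, k₂, hk₁, hk₂, hk, hkD⟩ := hVE
  have e0 : ∀ x : M.Star v, z (M.cp n x.1 0 0) = 0 := fun x => h0 _ (hV x.1 x.2)
  have e1' := hz.eq_zero_of_tangent hM (by omega) hv e0 hk₁ hk₂ hk
    (h0 _ ((hkD k₁ hk₁).2 (Or.inl rfl))) (h0 _ ((hkD k₂ hk₂).2 (Or.inr rfl)))
  obtain ⟨e2, e3⟩ := twistSystem_unique hM hv (by omega) hDT
    ((vertexOK_iff_twistSystem hM (by omega) hv e0 e1').1 hz) (fun x hx => h0 _ hx)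
    (fun x hx => h0 _ hx)
  exact ⟨e0 ⟨h, hh⟩, e1' ⟨h, hh⟩, congrFun e2 ⟨h, hh⟩, congrFun e3 ⟨h, hh⟩⟩

end Mesh
end SmoothQuadMesh
end

noncomputable section
namespace SmoothQuadMesh

/-! ### The smoothness equation of one edge -/

theorem dvd_bernsteinPolynomial {n t a b : ℕ} (ha : a ≤ t) (hb : b ≤ n - t) :
    X ^ a * (1 - X) ^ b ∣ bernsteinPolynomial ℝ n t := by
  unfold bernsteinPolynomial
  exact mul_dvd_mul (dvd_mul_of_dvd_right (pow_dvd_pow _ ha) _) (pow_dvd_pow _ hb)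

theorem dvd_bz {n a b : ℕ} {x : Fin (n + 1) → ℝ}
    (hx : ∀ t, x t ≠ 0 → a ≤ (t : ℕ) ∧ b ≤ n - t) : X ^ a * (1 - X) ^ b ∣ bz n x := by
  rw [bz_apply]
  refine Finset.dvd_sum fun t _ => ?_
  by_cases h : x t = 0
  · simp [h]
  · exact dvd_mul_of_dvd_right (dvd_bernsteinPolynomial (hx t h).1 (hx t h).2) _

theorem bz_single (n : ℕ) (t : Fin (n + 1)) (s : ℝ) :
    bz n (Pi.single t s) = C s * bernsteinPolynomial ℝ n t := by
  rw [bz_apply, Finset.sum_eq_single t]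
  · simp
  · intro b _ hb; simp [hb]
  · simp

/-- The left-hand side of the smoothness equation of an edge with weight functions `l`, `r`, `c`;
the central, left and right Bézier coefficients are `γ`, `x`, `y`. -/
def edgePol (n : ℕ) (l r c : ℝ[X]) (γ x y : Fin (n + 1) → ℝ) : ℝ[X] :=
  (n : ℝ) • (l * bz n (x - γ) + r * bz n (y - γ)) + c * derivative (bz n γ)

theorem edgePol_add (n : ℕ) (l r c : ℝ[X]) (γ x y γ' x' y' : Fin (n + 1) → ℝ) :
    edgePol n l r c (γ + γ') (x + x') (y + y') =
      edgePol n l r c γ x y + edgePol n l r c γ' x' y' := by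
  simp only [edgePol, map_add, add_sub_add_comm]
  simp only [smul_eq_C_mul]
  ring

/-- Common factors of the weight functions, and the degrees of the remaining factors. -/
structure IsReduction (δ : ℕ) (l r c D l' r' c' : ℝ[X]) : Prop where
  hl : l = D * l'
  hr : r = D * r'
  hc : c = D * c'
  coeff_zero : D.coeff 0 ≠ 0
  coeff_zero_comp : (D.comp (1 - X)).coeff 0 ≠ 0
  deg_l : l'.natDegree ≤ δ
  deg_r : r'.natDegree ≤ δ
  deg_c : c'.natDegree ≤ δ + 2

theorem IsReduction.ne_zero {δ : ℕ} {l r c D l' r' c' : ℝ[X]}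
    (H : IsReduction δ l r c D l' r' c') : D ≠ 0 := by
  rintro rfl
  exact H.coeff_zero (by simp)

theorem IsReduction.edgePol_eq {δ : ℕ} {l r c D l' r' c' : ℝ[X]}
    (H : IsReduction δ l r c D l' r' c') {n : ℕ} (γ x y : Fin (n + 1) → ℝ) :
    edgePol n l r c γ x y = D * edgePol n l' r' c' γ x y := by
  rw [edgePol, edgePol, H.hl, H.hr, H.hc]
  simp only [smul_eq_C_mul]
  ring

/-- The columns, in the smoothness equation, of the left and right coefficients with indices in `A`
and `B` are linearly independent. -/
def SideInjective (n : ℕ) (l r : ℝ[X]) (A B : Set (Fin (n + 1))) : Prop :=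
  ∀ x y : Fin (n + 1) → ℝ, (∀ t ∉ A, x t = 0) → (∀ t ∉ B, y t = 0) →
    l * bz n x + r * bz n y = 0 → x = 0 ∧ y = 0

/-- The linear map that extends a function on a subset by zero. -/
abbrev extendZero {ι : Type*} (A : Set ι) : (A → ℝ) →ₗ[ℝ] (ι → ℝ) :=
  Function.ExtendByZero.linearMap ℝ (Subtype.val : A → ι)

theorem extendZero_of_notMem {ι : Type*} {A : Set ι} (u : A → ℝ) {t : ι} (ht : t ∉ A) :
    extendZero A u t = 0 :=
  Function.extend_apply' _ _ _ fun ⟨a, ha⟩ => ht (ha ▸ a.2)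

theorem extendZero_injective {ι : Type*} (A : Set ι) : Function.Injective (extendZero A) := by
  intro u v h
  funext a
  have := congrFun h a.1
  simpa [Subtype.val_injective.extend_apply] using this

theorem natDegree_doubleZero : (X ^ 2 * (1 - X) ^ 2 : ℝ[X]).natDegree = 4 := by
  have : (1 - X : ℝ[X]).natDegree = 1 := by
    rw [show (1 - X : ℝ[X]) = -(X - C 1) by simp, natDegree_neg, natDegree_X_sub_C]
  have h0 : (1 - X : ℝ[X]) ≠ 0 := by rintro h; rw [h] at this; simp at this
  rw [natDegree_mul (by simp) (pow_ne_zero _ h0), natDegree_pow, natDegree_pow, this]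
  simp

theorem doubleZero_ne_zero : (X ^ 2 * (1 - X) ^ 2 : ℝ[X]) ≠ 0 := by
  intro h
  have := natDegree_doubleZero
  rw [h] at this
  simp at this

/-- The polynomials of degree at most `m + 3` with double zeros at `0` and `1`. -/
def doubleZeroLT (m : ℕ) : Submodule ℝ ℝ[X] :=
  (degreeLT ℝ m).map (LinearMap.mulLeft ℝ (X ^ 2 * (1 - X) ^ 2 : ℝ[X]))

theorem mulLeft_doubleZero_injective :
    Function.Injective (LinearMap.mulLeft ℝ (X ^ 2 * (1 - X) ^ 2 : ℝ[X])) :=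
  fun _ _ h => mul_left_cancel₀ doubleZero_ne_zero h

theorem finrank_doubleZeroLT (m : ℕ) : Module.finrank ℝ (doubleZeroLT m) = m := by
  rw [doubleZeroLT, (Submodule.equivMapOfInjective _ mulLeft_doubleZero_injective _).symm.finrank_eq,
    finrank_degreeLT]

theorem mem_doubleZeroLT {m : ℕ} {p : ℝ[X]} (hp : X ^ 2 * (1 - X) ^ 2 ∣ p)
    (hdeg : p.natDegree ≤ m + 3) : p ∈ doubleZeroLT m := by
  obtain ⟨q, rfl⟩ := hp
  refine ⟨q, ?_, rfl⟩
  by_cases h0 : q = 0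
  · rw [h0]; exact Submodule.zero_mem _
  · rw [natDegree_mul doubleZero_ne_zero h0, natDegree_doubleZero] at hdeg
    rw [SetLike.mem_coe, mem_degreeLT]
    exact (natDegree_lt_iff_degree_lt h0).1 (by omega)

theorem doubleZero_dvd_bz {n : ℕ} {x : Fin (n + 1) → ℝ} (hx : ∀ t ∉ Mesh.sideRange n, x t = 0) :
    X ^ 2 * (1 - X) ^ 2 ∣ bz n x :=
  dvd_bz fun t ht => by
    have := not_imp_comm.1 (hx t) ht
    exact ⟨this.1, by have := this.2; omega⟩

theorem mul_bz_mem_doubleZeroLT {n m δ : ℕ} (hm : m + 3 = n + δ) {l : ℝ[X]} (hl : l.natDegree ≤ δ)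
    {x : Fin (n + 1) → ℝ} (hx : ∀ t ∉ Mesh.sideRange n, x t = 0) :
    l * bz n x ∈ doubleZeroLT m := by
  refine mem_doubleZeroLT (dvd_mul_of_dvd_right (doubleZero_dvd_bz hx) _) ?_
  have := natDegree_bz_le n x
  exact natDegree_mul_le.trans (by omega)

/-- The polynomials of degree at most n+δ with double zeros at 0 and 1 form a space of dimension
n+δ-3. The independent columns lie in it, and by `hcard` there are as many of them as its dimension,
so they span it. -/
theorem exists_of_sideInjective {n δ : ℕ} {l r : ℝ[X]} {A B : Set (Fin (n + 1))}
    (hA : A ⊆ Mesh.sideRange n) (hB : B ⊆ Mesh.sideRange n)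
    (hcard : A.ncard + B.ncard + 3 = n + δ) (hl : l.natDegree ≤ δ) (hr : r.natDegree ≤ δ)
    (hinj : SideInjective n l r A B) {p : ℝ[X]} (hp : X ^ 2 * (1 - X) ^ 2 ∣ p)
    (hdeg : p.natDegree ≤ n + δ) :
    ∃ x y : Fin (n + 1) → ℝ, (∀ t ∉ A, x t = 0) ∧ (∀ t ∉ B, y t = 0) ∧
      l * bz n x + r * bz n y = p := by
  classical
  let Φ : (A → ℝ) × (B → ℝ) →ₗ[ℝ] ℝ[X] :=
    ((LinearMap.mulLeft ℝ l).comp ((bz n).comp (extendZero A))).coprod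
      ((LinearMap.mulLeft ℝ r).comp ((bz n).comp (extendZero B)))
  have hΦ : ∀ u v, Φ (u, v) = l * bz n (extendZero A u) + r * bz n (extendZero B v) :=
    fun u v => rfl
  have hΦinj : Function.Injective Φ := by
    rw [injective_iff_map_eq_zero]
    rintro ⟨u, v⟩ h
    rw [hΦ] at h
    obtain ⟨h1, h2⟩ := hinj _ _ (fun t => extendZero_of_notMem u)
      (fun t => extendZero_of_notMem v) h
    exact Prod.ext (extendZero_injective A (h1.trans (map_zero _).symm))
      (extendZero_injective B (h2.trans (map_zero _).symm))
  have hle : LinearMap.range Φ ≤ doubleZeroLT (A.ncard + B.ncard) := by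
    rintro _ ⟨⟨u, v⟩, rfl⟩
    rw [hΦ]
    exact Submodule.add_mem _
      (mul_bz_mem_doubleZeroLT hcard hl fun t ht => extendZero_of_notMem u fun h => ht (hA h))
      (mul_bz_mem_doubleZeroLT hcard hr fun t ht => extendZero_of_notMem v fun h => ht (hB h))
  have : FiniteDimensional ℝ (doubleZeroLT (A.ncard + B.ncard)) := by
    unfold doubleZeroLT; infer_instance
  have hfin : Module.finrank ℝ (LinearMap.range Φ) =
      Module.finrank ℝ (doubleZeroLT (A.ncard + B.ncard)) := by
    rw [LinearMap.finrank_range_of_inj hΦinj, finrank_doubleZeroLT]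
    simp [Module.finrank_prod, Set.ncard_eq_toFinset_card']
  have heq := Submodule.eq_of_le_of_finrank_eq hle hfin
  have := mem_doubleZeroLT hp (hdeg.trans_eq hcard.symm)
  rw [← heq] at this
  obtain ⟨⟨u, v⟩, huv⟩ := this
  exact ⟨extendZero A u, extendZero B v, fun t => extendZero_of_notMem u,
    fun t => extendZero_of_notMem v, huv⟩

theorem SideInjective.of_mul {n : ℕ} {l r D : ℝ[X]} {A B : Set (Fin (n + 1))}
    (h : SideInjective n (D * l) (D * r) A B) : SideInjective n l r A B := by
  intro x y hx hy e
  refine h x y hx hy ?_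
  rw [mul_assoc, mul_assoc, ← mul_add, e, mul_zero]

theorem natDegree_derivative_bz_le (n : ℕ) (γ : Fin (n + 1) → ℝ) :
    (derivative (bz n γ)).natDegree ≤ n - 1 :=
  (natDegree_derivative_le _).trans (Nat.sub_le_sub_right (natDegree_bz_le n γ) 1)

theorem natDegree_derivative_bz_le_of_coeff {n : ℕ} (hn : 1 ≤ n) {γ : Fin (n + 1) → ℝ}
    (h : (bz n γ).coeff n = 0) : (derivative (bz n γ)).natDegree ≤ n - 2 := by
  have : (bz n γ).natDegree ≤ n - 1 := by
    rw [natDegree_le_iff_coeff_eq_zero]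
    intro N hN
    rcases eq_or_lt_of_le (show n ≤ N by omega) with rfl | h'
    · exact h
    · exact coeff_eq_zero_of_natDegree_lt (lt_of_le_of_lt (natDegree_bz_le n γ) h')
  exact (natDegree_derivative_le _).trans (Nat.sub_le_sub_right this 1)

/-- The dependent side middle coefficients can be chosen such that the smoothness equation
holds. -/
theorem exists_edgePol_eq_zero {n δ : ℕ} (hn : 2 ≤ n) {l r c D l' r' c' : ℝ[X]}
    (H : IsReduction δ l r c D l' r' c') {A B : Set (Fin (n + 1))}
    (hA : A ⊆ Mesh.sideRange n) (hB : B ⊆ Mesh.sideRange n)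
    (hcard : A.ncard + B.ncard + 3 = n + δ) (hinj : SideInjective n l r A B)
    {γ x y : Fin (n + 1) → ℝ} (hgap : c'.natDegree ≤ δ + 1 ∨ (bz n γ).coeff n = 0)
    (h0 : X ^ 2 ∣ edgePol n l r c γ x y) (h1 : X ^ 2 ∣ (edgePol n l r c γ x y).comp (1 - X)) :
    ∃ x' y' : Fin (n + 1) → ℝ, (∀ t ∉ A, x' t = x t) ∧ (∀ t ∉ B, y' t = y t) ∧
      edgePol n l r c γ x' y' = 0 := by
  rw [H.edgePol_eq] at h0 h1
  rw [mul_comp] at h1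
  have h0' := X_sq_dvd_of_mul H.coeff_zero h0
  have h1' := one_sub_X_sq_dvd_iff.2 (X_sq_dvd_of_mul H.coeff_zero_comp h1)
  set p := edgePol n l' r' c' γ x y with hp
  -- The side terms always have this degree. The central term could have degree n+δ+1; either the
  -- degree of `c'` or the vanishing top coefficient of the central polynomial excludes it.
  have hdeg : p.natDegree ≤ n + δ := by
    have h2 : (c' * derivative (bz n γ)).natDegree ≤ n + δ := by
      refine natDegree_mul_le.trans ?_
      rcases hgap with h | h
      · have := natDegree_derivative_bz_le n γ
        omega
      · have := natDegree_derivative_bz_le_of_coeff (by omega) h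
        have := H.deg_c
        omega
    refine (natDegree_add_le _ _).trans (max_le ?_ h2)
    refine (natDegree_smul_le _ _).trans ((natDegree_add_le _ _).trans (max_le ?_ ?_)) <;>
    · refine natDegree_mul_le.trans ?_
      have := natDegree_bz_le n (x - γ)
      have := natDegree_bz_le n (y - γ)
      have := H.deg_l
      have := H.deg_r
      omega
  have hn0 : (n : ℝ) ≠ 0 := by positivity
  rw [H.hl, H.hr] at hinj
  -- The constant -1/n offsets the factor n in `edgePol`, so that the correction contributes exactly
  -- -p.
  obtain ⟨u, v, hu, hv, huv⟩ := exists_of_sideInjective hA hB hcard H.deg_l H.deg_r hinj.of_mul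
    (p := C (-(n : ℝ)⁻¹) * p)
    (dvd_mul_of_dvd_right (isCoprime_X_sq_one_sub_X_sq.mul_dvd h0' h1') _)
    ((natDegree_C_mul_le _ _).trans hdeg)
  refine ⟨x + u, y + v, fun t ht => by simp [hu t ht], fun t ht => by simp [hv t ht], ?_⟩
  have h3 : edgePol n l' r' c' 0 u v = -p := by
    rw [edgePol, sub_zero, sub_zero, huv, map_zero, derivative_zero, mul_zero, add_zero,
      smul_eq_C_mul, ← mul_assoc, ← C_mul, mul_neg, mul_inv_cancel₀ hn0]
    simp
  have h4 := edgePol_add n l' r' c' γ x y 0 u v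
  rw [add_zero] at h4
  rw [H.edgePol_eq, h4, h3, ← hp, add_neg_cancel, mul_zero]

/-- If all values with the possible exception of the dependent side middle ones vanish, then so do
these. -/
theorem eq_zero_of_edgePol_eq_zero {n : ℕ} (hn : 1 ≤ n) {l r c : ℝ[X]} {A B : Set (Fin (n + 1))}
    (hinj : SideInjective n l r A B) {x y : Fin (n + 1) → ℝ} (hx : ∀ t ∉ A, x t = 0)
    (hy : ∀ t ∉ B, y t = 0) (h : edgePol n l r c 0 x y = 0) : x = 0 ∧ y = 0 := by
  have hn0 : (n : ℝ) ≠ 0 := by positivity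
  refine hinj x y hx hy ?_
  simpa [edgePol, hn0, ← smul_add] using h

/-! ### Edges with a boundary vertex -/

theorem coeff_zero_derivative_bz_comp {n : ℕ} (hn : 1 ≤ n) (γ : Fin (n + 1) → ℝ) :
    ((derivative (bz n γ)).comp (1 - X)).coeff 0 = n * (γ (Fin.last n) - γ (Fin.rev 1)) := by
  have h2 : (derivative (bz n γ)).comp (1 - X) = -derivative ((bz n γ).comp (1 - X)) := by
    rw [derivative_comp]; simp
  rw [h2, coeff_neg, coeff_derivative, bz_comp_one_sub_X, zero_add, coeff_bz_one n hn]
  simp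
  ring

theorem coeff_zero_edgePol_comp {n : ℕ} (hn : 1 ≤ n) (l r c : ℝ[X]) (γ x y : Fin (n + 1) → ℝ) :
    ((edgePol n l r c γ x y).comp (1 - X)).coeff 0 = n * (
      (l.comp (1 - X)).coeff 0 * (x (Fin.last n) - γ (Fin.last n)) +
      (r.comp (1 - X)).coeff 0 * (y (Fin.last n) - γ (Fin.last n)) +
      (c.comp (1 - X)).coeff 0 * (γ (Fin.last n) - γ (Fin.rev 1))) := by
  simp only [edgePol, add_comp, mul_comp, smul_comp, coeff_add, coeff_smul, mul_coeff_zero,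
    coeff_zero_derivative_bz_comp hn,
    bz_comp_one_sub_X, coeff_bz_zero, Pi.sub_apply, Fin.rev_zero, smul_eq_mul]
  ring

/-- With the values at the end point and the first differences zero, only the twists remain. The
point of index n-2 would enter through the derivative of the central polynomial, but is multiplied
by c at the end point, which is zero unless γ is. -/
theorem coeff_one_edgePol_comp {n : ℕ} (hn : 1 ≤ n) {l r c : ℝ[X]} {γ x y : Fin (n + 1) → ℝ}
    (hc : (c.comp (1 - X)).coeff 0 = 0 ∨ γ = 0) (hγ : γ (Fin.last n) = 0)
    (hγ' : γ (Fin.rev 1) = 0) (hx : x (Fin.last n) = 0) (hy : y (Fin.last n) = 0) :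
    ((edgePol n l r c γ x y).comp (1 - X)).coeff 1 = n * (n * (
      (l.comp (1 - X)).coeff 0 * x (Fin.rev 1) + (r.comp (1 - X)).coeff 0 * y (Fin.rev 1))) := by
  have h1 : ((c * derivative (bz n γ)).comp (1 - X)).coeff 1 = 0 := by
    rcases hc with hc | rfl
    · rw [mul_comp, mul_coeff_one, hc, coeff_zero_derivative_bz_comp hn, hγ, hγ']
      ring
    · simp
  rw [edgePol, add_comp, coeff_add, h1]
  simp only [add_comp, mul_comp, smul_comp, coeff_add, coeff_smul, mul_coeff_one,
    bz_comp_one_sub_X, coeff_bz_zero, coeff_bz_one n hn, smul_eq_mul, Fin.rev_zero, hx,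
    hy, hγ, hγ', Pi.sub_apply, sub_zero, mul_zero]
  ring

/-- One scalar equation in two unknowns with nonzero coefficients is solved by whichever unknown is
free. -/
theorem exists_pair_single {n : ℕ} {A B : Set (Fin (n + 1))} {t : Fin (n + 1)}
    (ht : t ∈ A ∨ t ∈ B) {a b : ℝ} (ha : a ≠ 0) (hb : b ≠ 0) (κ : ℝ) :
    ∃ u v : Fin (n + 1) → ℝ, (∀ s ∉ A, u s = 0) ∧ (∀ s ∉ B, v s = 0) ∧
      (∀ s ≠ t, u s = 0 ∧ v s = 0) ∧ a * u t + b * v t = κ := by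
  rcases ht with ht | ht
  · refine ⟨Pi.single t (κ / a), 0, fun s hs => Pi.single_eq_of_ne (fun e => hs (by rwa [e])) _,
      fun _ _ => rfl, fun s hs => ⟨Pi.single_eq_of_ne hs _, rfl⟩, ?_⟩
    simp [mul_div_cancel₀, ha]
  · refine ⟨0, Pi.single t (κ / b), fun _ _ => rfl,
      fun s hs => Pi.single_eq_of_ne (fun e => hs (by rwa [e])) _,
      fun s hs => ⟨rfl, Pi.single_eq_of_ne hs _⟩, ?_⟩
    simp [mul_div_cancel₀, hb]

theorem X_sq_dvd_edgePol_zero {n : ℕ} (l r c : ℝ[X]) {x y : Fin (n + 1) → ℝ}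
    (h : ∀ t : Fin (n + 1), (t : ℕ) < 2 → x t = 0 ∧ y t = 0) :
    X ^ 2 ∣ edgePol n l r c 0 x y := by
  have key : ∀ {x : Fin (n + 1) → ℝ}, (∀ t : Fin (n + 1), (t : ℕ) < 2 → x t = 0) →
      X ^ 2 ∣ bz n x := by
    intro x hx
    have := dvd_bz (a := 2) (b := 0) (x := x) fun t ht =>
      ⟨by by_contra h'; exact ht (hx t (by omega)), by omega⟩
    simpa using this
  rw [edgePol, map_zero, derivative_zero, mul_zero, add_zero, sub_zero, sub_zero, smul_eq_C_mul]
  exact dvd_mul_of_dvd_right (dvd_add (dvd_mul_of_dvd_right (key fun t ht => (h t ht).1) _)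
    (dvd_mul_of_dvd_right (key fun t ht => (h t ht).2) _)) _

theorem coeff_bz_single_rev_two {n : ℕ} (hn : 2 ≤ n) (s : ℝ) :
    (bz n (Pi.single (Fin.rev 2) s)).coeff n = n.choose 2 * s := by
  have h2 : ((2 : Fin (n + 1)) : ℕ) = 2 := Nat.mod_eq_of_lt (show 2 < n + 1 by omega)
  rw [coeff_bz_top, Finset.sum_eq_single (Fin.rev 2)]
  · have h : n - ((Fin.rev 2 : Fin (n + 1)) : ℕ) = 2 := by rw [Fin.val_rev, h2]; omega
    have h' : ((Fin.rev 2 : Fin (n + 1)) : ℕ) = n - 2 := by rw [Fin.val_rev, h2]; omega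
    rw [h, h', Nat.choose_symm hn]
    simp
  · intro b _ hb; simp [hb]
  · simp

/-- Since n-2 ≥ 3, the Bernstein polynomial with index n-2 vanishes to order three at 0 and its
derivative to order two. Changing C_{n-2} therefore does not disturb the conditions at the inner
vertex. -/
theorem X_sq_dvd_edgePol_single_rev_two {n : ℕ} (hn : 5 ≤ n) (l r c : ℝ[X]) (s : ℝ) :
    X ^ 2 ∣ edgePol n l r c (Pi.single (Fin.rev 2) s) 0 0 := by
  have h2 : ((2 : Fin (n + 1)) : ℕ) = 2 := Nat.mod_eq_of_lt (show 2 < n + 1 by omega)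
  have h3 : X ^ 3 ∣ bz n (Pi.single (Fin.rev 2) s) := by
    rw [bz_single]
    have := dvd_bernsteinPolynomial (n := n) (t := (Fin.rev 2 : Fin (n + 1))) (a := 3) (b := 0)
      (by rw [Fin.val_rev, h2]; omega) (by omega)
    rw [pow_zero, mul_one] at this
    exact dvd_mul_of_dvd_right this _
  obtain ⟨q, hq⟩ := h3
  rw [edgePol, zero_sub, map_neg, hq, smul_eq_C_mul]
  refine ⟨C (n : ℝ) * (l * -(X * q) + r * -(X * q)) + c * (C 3 * q + X * derivative q), ?_⟩
  simp only [derivative_mul, derivative_X_pow]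
  simp
  ring

variable {n δ : ℕ} {l r c D l' r' c' : ℝ[X]} {A B : Set (Fin (n + 1))}

/-- The dependent coefficients of an edge with a boundary vertex can be chosen such that the
smoothness equation holds. -/
theorem exists_edgePol_eq_zero_bd (hn : 5 ≤ n) (H : IsReduction δ l r c D l' r' c')
    (hcard : (A ∩ Mesh.sideRange n).ncard + (B ∩ Mesh.sideRange n).ncard + 3 = n + δ)
    (hinj : SideInjective n l r (A ∩ Mesh.sideRange n) (B ∩ Mesh.sideRange n))
    (hlast : Fin.last n ∈ A ∨ Fin.last n ∈ B) (hrev : Fin.rev 1 ∈ A ∨ Fin.rev 1 ∈ B)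
    (hl : (l.comp (1 - X)).coeff 0 ≠ 0) (hr : (r.comp (1 - X)).coeff 0 ≠ 0)
    (hc : (c.comp (1 - X)).coeff 0 = 0) {γ x y : Fin (n + 1) → ℝ}
    (h0 : X ^ 2 ∣ edgePol n l r c γ x y) :
    ∃ γ' x' y' : Fin (n + 1) → ℝ, (∀ t ≠ Fin.rev 2, γ' t = γ t) ∧
      (c'.natDegree ≤ δ + 1 → γ' = γ) ∧ (∀ t ∉ A, x' t = x t) ∧ (∀ t ∉ B, y' t = y t) ∧
      edgePol n l r c γ' x' y' = 0 := by
  have e1 : ((1 : Fin (n + 1)) : ℕ) = 1 := Nat.mod_eq_of_lt (show 1 < n + 1 by omega)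
  have hn0 : (n : ℝ) ≠ 0 := by positivity
  -- If `c'` has the excessive degree δ+2, the value of C_{n-2} is changed such that the top
  -- coefficient of the central polynomial vanishes. The divisor is the leading coefficient of the
  -- Bernstein polynomial with index n-2.
  obtain ⟨γ', hγ1, hγ2, hγ3, hγ4⟩ : ∃ γ' : Fin (n + 1) → ℝ, (∀ t ≠ Fin.rev 2, γ' t = γ t) ∧
      (c'.natDegree ≤ δ + 1 → γ' = γ) ∧ (c'.natDegree ≤ δ + 1 ∨ (bz n γ').coeff n = 0) ∧
      X ^ 2 ∣ edgePol n l r c γ' x y := by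
    by_cases hgap : c'.natDegree ≤ δ + 1
    · exact ⟨γ, fun _ _ => rfl, fun _ => rfl, Or.inl hgap, h0⟩
    · refine ⟨γ + Pi.single (Fin.rev 2) (-(bz n γ).coeff n / n.choose 2), fun t ht => ?_,
        fun h => absurd h hgap, Or.inr ?_, ?_⟩
      · simp [ht]
      · have : (n.choose 2 : ℝ) ≠ 0 := by exact_mod_cast (Nat.choose_pos (by omega)).ne'
        rw [map_add, coeff_add, coeff_bz_single_rev_two (by omega), mul_div_cancel₀ _ this,
          add_neg_cancel]
      · have := edgePol_add n l r c γ x y (Pi.single (Fin.rev 2) (-(bz n γ).coeff n / n.choose 2))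
          0 0
        rw [add_zero, add_zero] at this
        rw [this]
        exact dvd_add h0 (X_sq_dvd_edgePol_single_rev_two hn _ _ _ _)
  -- One of L_n, R_n removes the value of the edge polynomial at the boundary end.
  obtain ⟨u, v, hu, hv, huv, huv'⟩ := exists_pair_single hlast hl hr
    (-(((edgePol n l r c γ' x y).comp (1 - X)).coeff 0 / n))
  have h1 : X ^ 2 ∣ edgePol n l r c γ' (x + u) (y + v) := by
    have := edgePol_add n l r c γ' x y 0 u v
    rw [add_zero] at this
    rw [this]
    exact dvd_add hγ4 (X_sq_dvd_edgePol_zero _ _ _ fun t ht => huv t fun e => by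
      rw [e, Fin.val_last] at ht; omega)
  have h2 : ((edgePol n l r c γ' (x + u) (y + v)).comp (1 - X)).coeff 0 = 0 := by
    have := edgePol_add n l r c γ' x y 0 u v
    rw [add_zero] at this
    rw [this, add_comp, coeff_add, coeff_zero_edgePol_comp (by omega) l r c 0 u v, hc]
    simp only [Pi.zero_apply, sub_zero, mul_zero, add_zero]
    rw [huv']
    field_simp
    ring
  set x₁ := x + u with hx₁
  set y₁ := y + v with hy₁
  -- One of L_{n-1}, R_{n-1} removes the first-order coefficient there without changing the value.
  -- Both ends then have double zeros, and the side middle points can be solved for.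
  obtain ⟨u', v', hu', hv', huv1, huv2⟩ := exists_pair_single hrev hl hr
    (-(((edgePol n l r c γ' x₁ y₁).comp (1 - X)).coeff 1 / n / n))
  have hlr : Fin.last n ≠ Fin.rev 1 := by
    rw [Ne, Fin.ext_iff, Fin.val_rev, Fin.val_last, e1]; omega
  have h3 : X ^ 2 ∣ edgePol n l r c γ' (x₁ + u') (y₁ + v') := by
    have := edgePol_add n l r c γ' x₁ y₁ 0 u' v'
    rw [add_zero] at this
    rw [this]
    exact dvd_add h1 (X_sq_dvd_edgePol_zero _ _ _ fun t ht => huv1 t fun e => by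
      rw [e, Fin.val_rev, e1] at ht; omega)
  have h4 : X ^ 2 ∣ (edgePol n l r c γ' (x₁ + u') (y₁ + v')).comp (1 - X) := by
    have := edgePol_add n l r c γ' x₁ y₁ 0 u' v'
    rw [add_zero] at this
    rw [this, add_comp, X_sq_dvd_iff, coeff_add, coeff_add, h2,
      coeff_zero_edgePol_comp (by omega) l r c 0 u' v',
      coeff_one_edgePol_comp (by omega) (Or.inr rfl) rfl rfl (huv1 _ hlr).1 (huv1 _ hlr).2, huv2,
      (huv1 _ hlr).1, (huv1 _ hlr).2]
    refine ⟨by simp, ?_⟩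
    field_simp
    ring
  obtain ⟨x', y', hx', hy', hxy⟩ := exists_edgePol_eq_zero (by omega) H inter_subset_right
    inter_subset_right hcard hinj hγ3 h3 h4
  refine ⟨γ', x', y', hγ1, hγ2, fun t ht => ?_, fun t ht => ?_, hxy⟩
  · rw [hx' t fun h => ht h.1, Pi.add_apply, hx₁, Pi.add_apply, hu t ht, hu' t ht, add_zero,
      add_zero]
  · rw [hy' t fun h => ht h.1, Pi.add_apply, hy₁, Pi.add_apply, hv t ht, hv' t ht, add_zero,
      add_zero]

/-- If the basic coefficients of an edge with a boundary vertex vanish, then so do the dependent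
ones. -/
theorem eq_zero_of_edgePol_eq_zero_bd (hn : 5 ≤ n) (H : IsReduction δ l r c D l' r' c')
    (hinj : SideInjective n l r (A ∩ Mesh.sideRange n) (B ∩ Mesh.sideRange n))
    (hA : ∀ t ∈ A, 2 ≤ (t : ℕ)) (hB : ∀ t ∈ B, 2 ≤ (t : ℕ))
    (hlast : Fin.last n ∉ A ∨ Fin.last n ∉ B) (hrev : Fin.rev 1 ∉ A ∨ Fin.rev 1 ∉ B)
    (hl : (l.comp (1 - X)).coeff 0 ≠ 0) (hr : (r.comp (1 - X)).coeff 0 ≠ 0)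
    {γ x y : Fin (n + 1) → ℝ} (hγ : ∀ t ≠ Fin.rev 2, γ t = 0)
    (hγ' : c'.natDegree ≤ δ + 1 → γ = 0) (hx : ∀ t ∉ A, x t = 0) (hy : ∀ t ∉ B, y t = 0)
    (h : edgePol n l r c γ x y = 0) : γ = 0 ∧ x = 0 ∧ y = 0 := by
  have e1 : ((1 : Fin (n + 1)) : ℕ) = 1 := Nat.mod_eq_of_lt (show 1 < n + 1 by omega)
  have hn0 : (n : ℝ) ≠ 0 := by positivity
  have hγ0 : γ = 0 := by
    by_cases hgap : c'.natDegree ≤ δ + 1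
    · exact hγ' hgap
    have hcd : c'.natDegree = δ + 2 := le_antisymm H.deg_c (by omega)
    have hγs : γ = Pi.single (Fin.rev 2) (γ (Fin.rev 2)) := by
      funext t
      by_cases ht : t = Fin.rev 2
      · rw [ht, Pi.single_eq_same]
      · rw [hγ t ht, Pi.single_eq_of_ne ht]
    have h' := h
    rw [H.edgePol_eq, mul_eq_zero, or_iff_right H.ne_zero, edgePol,
      add_eq_zero_iff_neg_eq] at h'
    -- The side terms bound the degree of the central term. As `c'` has degree δ+2, the derivative
    -- of the central polynomial has degree at most n-2, so its coefficient of degree n-1 is zero.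
    -- That coefficient is a nonzero multiple of C_{n-2}.
    have hdeg : (c' * derivative (bz n γ)).natDegree ≤ n + δ := by
      rw [← h', natDegree_neg]
      refine (natDegree_smul_le _ _).trans ((natDegree_add_le _ _).trans (max_le ?_ ?_)) <;>
      · refine natDegree_mul_le.trans ?_
        have := natDegree_bz_le n (x - γ)
        have := natDegree_bz_le n (y - γ)
        have := H.deg_l
        have := H.deg_r
        omega
    have hc0 : c' ≠ 0 := by rintro rfl; simp at hcd
    have hcoeff : (bz n γ).coeff n = 0 := by
      have h2 : (derivative (bz n γ)).coeff (n - 1) = 0 := by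
        by_cases hq : derivative (bz n γ) = 0
        · rw [hq, coeff_zero]
        · rw [natDegree_mul hc0 hq, hcd] at hdeg
          exact coeff_eq_zero_of_natDegree_lt (by omega)
      rw [coeff_derivative, show n - 1 + 1 = n by omega, mul_eq_zero] at h2
      refine h2.resolve_right ?_
      positivity
    rw [hγs, coeff_bz_single_rev_two (by omega), mul_eq_zero, or_iff_right (by
      exact_mod_cast (Nat.choose_pos (by omega)).ne')] at hcoeff
    rw [hγs, hcoeff, Pi.single_zero]
  subst hγ0
  have key : ∀ t : Fin (n + 1), (t ∉ A ∨ t ∉ B) →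
      (l.comp (1 - X)).coeff 0 * x t + (r.comp (1 - X)).coeff 0 * y t = 0 →
      x t = 0 ∧ y t = 0 := by
    rintro t (ht | ht) e
    · rw [hx t ht, mul_zero, zero_add, mul_eq_zero, or_iff_right hr] at e
      exact ⟨hx t ht, e⟩
    · rw [hy t ht, mul_zero, add_zero, mul_eq_zero, or_iff_right hl] at e
      exact ⟨e, hy t ht⟩
  have hz : ((edgePol n l r c 0 x y).comp (1 - X)) = 0 := by rw [h, zero_comp]
  have h1 := congrArg (fun p => coeff p 0) hz
  simp only [coeff_zero_edgePol_comp (show 1 ≤ n by omega), coeff_zero, Pi.zero_apply, sub_zero,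
    mul_zero, add_zero, mul_eq_zero, hn0, false_or] at h1
  obtain ⟨h2, h3⟩ := key _ hlast h1
  have h4 := congrArg (fun p => coeff p 1) hz
  simp only [coeff_one_edgePol_comp (show 1 ≤ n by omega) (Or.inr rfl) rfl rfl h2 h3, coeff_zero,
    mul_eq_zero, hn0, false_or] at h4
  obtain ⟨h5, h6⟩ := key _ hrev h4
  have htop : ∀ t : Fin (n + 1), 2 ≤ (t : ℕ) → t ∉ Mesh.sideRange n →
      t = Fin.last n ∨ t = Fin.rev 1 := by
    intro t ht ht'
    have : ¬ ((t : ℕ) + 2 ≤ n) := fun h => ht' ⟨ht, h⟩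
    rw [Fin.ext_iff, Fin.ext_iff, Fin.val_rev, Fin.val_last, e1]
    omega
  refine ⟨rfl, eq_zero_of_edgePol_eq_zero (by omega) hinj (fun t ht => ?_) (fun t ht => ?_) h⟩
  · by_cases hA' : t ∈ A
    · rcases htop t (hA t hA') (fun h => ht ⟨hA', h⟩) with rfl | rfl
      exacts [h2, h5]
    · exact hx t hA'
  · by_cases hB' : t ∈ B
    · rcases htop t (hB t hB') (fun h => ht ⟨hB', h⟩) with rfl | rfl
      exacts [h3, h6]
    · exact hy t hB'

end SmoothQuadMesh
end

noncomputable section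
namespace SmoothQuadMesh

/-! ### The linear system of the side middle control points -/

/-- The basis X^s(1-X)^{n+d-s}, without binomial factors, is the one in which the coefficients of
the product are the rows of the linear system. -/
theorem bz_mul_bz (n d : ℕ) (w : Fin (d + 1) → ℝ) (x : Fin (n + 1) → ℝ) :
    bz d w * bz n x = ∑ s ∈ Finset.range (n + d + 1),
      C (∑ t, Mesh.sideCoeff n d w s t * x t) * (X ^ s * (1 - X) ^ (n + d - s)) := by
  have h1 : ∀ (s : ℕ), C (∑ t, Mesh.sideCoeff n d w s t * x t) * (X ^ s * (1 - X) ^ (n + d - s)) =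
      ∑ t : Fin (n + 1), ∑ k : Fin (d + 1), if (t : ℕ) + (k : ℕ) = s then
        C ((n.choose t : ℝ) * (d.choose k : ℝ) * w k * x t) *
          (X ^ s * (1 - X : ℝ[X]) ^ (n + d - s)) else 0 := by
    intro s
    rw [map_sum, Finset.sum_mul]
    refine Finset.sum_congr rfl fun t _ => ?_
    rw [Mesh.sideCoeff, Finset.sum_mul, map_sum, Finset.sum_mul]
    refine Finset.sum_congr rfl fun k _ => ?_
    split_ifs <;> simp
  simp only [h1]
  rw [Finset.sum_comm, bz_apply, bz_apply, Finset.sum_mul_sum, Finset.sum_comm]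
  refine Finset.sum_congr rfl fun t _ => ?_
  rw [Finset.sum_comm]
  refine Finset.sum_congr rfl fun k _ => ?_
  rw [Finset.sum_ite_eq, if_pos (Finset.mem_range.2 (by omega))]
  have e : n + d - ((t : ℕ) + k) = (d - k) + (n - t) := by omega
  rw [e, pow_add, pow_add]
  simp only [bernsteinPolynomial, map_mul, map_natCast]
  ring

theorem sum_X_pow_eq_zero_iff (N : ℕ) (e : ℕ → ℝ) :
    ∑ s ∈ Finset.range (N + 1), C (e s) * (X ^ s * (1 - X) ^ (N - s)) = 0 ↔
      ∀ s ≤ N, e s = 0 := by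
  have hch : ∀ s : Fin (N + 1), (N.choose s : ℝ) ≠ 0 := fun s => by
    exact_mod_cast (Nat.choose_pos (by omega)).ne'
  have : ∑ s ∈ Finset.range (N + 1), C (e s) * (X ^ s * (1 - X) ^ (N - s)) =
      bz N fun s => e s / N.choose s := by
    rw [bz_apply, Finset.sum_range]
    refine Finset.sum_congr rfl fun s _ => ?_
    rw [bernsteinPolynomial, ← map_natCast (C : ℝ →+* ℝ[X]), mul_assoc, ← mul_assoc (C _) (C _),
      ← C_mul, div_mul_cancel₀ _ (hch s)]
  rw [this, bz_eq_zero_iff, funext_iff]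
  constructor
  · intro h s hs
    have := h ⟨s, by omega⟩
    simpa [hch ⟨s, by omega⟩] using this
  · intro h s
    simp [h s (by omega)]

theorem sideCoeff_eq_zero {n d : ℕ} (w : Fin (d + 1) → ℝ) {s : ℕ} {t : Fin (n + 1)}
    (ht : t ∈ Mesh.sideRange n) (hs : ¬ (2 ≤ s ∧ s + 2 ≤ n + d)) :
    Mesh.sideCoeff n d w s t = 0 := by
  refine Finset.sum_eq_zero fun k _ => if_neg ?_
  have := ht.1
  have := ht.2
  omega

theorem mul_bz_add_mul_bz_eq_zero_iff {n d : ℕ} (w w' : Fin (d + 1) → ℝ)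
    {x y : Fin (n + 1) → ℝ} (hx : ∀ t ∉ Mesh.sideRange n, x t = 0)
    (hy : ∀ t ∉ Mesh.sideRange n, y t = 0) :
    bz d w * bz n x + bz d w' * bz n y = 0 ↔ ∀ s : ℕ, 2 ≤ s → s + 2 ≤ n + d →
      ∑ t, (Mesh.sideCoeff n d w s t * x t + Mesh.sideCoeff n d w' s t * y t) = 0 := by
  rw [bz_mul_bz, bz_mul_bz, ← Finset.sum_add_distrib]
  simp only [← add_mul, ← C_add, ← Finset.sum_add_distrib]
  rw [sum_X_pow_eq_zero_iff]
  refine ⟨fun h s _ hs => h s (by omega), fun h s _ => ?_⟩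
  by_cases hs : 2 ≤ s ∧ s + 2 ≤ n + d
  · exact h s hs.1 hs.2
  · refine Finset.sum_eq_zero fun t _ => ?_
    by_cases ht : t ∈ Mesh.sideRange n
    · rw [sideCoeff_eq_zero w ht hs, sideCoeff_eq_zero w' ht hs]; ring
    · rw [hx t ht, hy t ht]; ring

/-- Comparison of coefficients. The equations with s < 2 or s > n+d-2 are missing from the system
since side middle points do not occur in them. -/
theorem dependentSolvable_iff {V F : Type*} {M : Mesh V F} {n d : ℕ} {l r : Fin (d + 1) → ℝ}
    {D : Set (M.CP n)} {h h' : F × Fin 4} :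
    M.DependentSolvable n d l r D h h' ↔ SideInjective n (bz d l) (bz d r)
      (Mesh.sideRange n \ M.basicL n D h) (Mesh.sideRange n \ M.basicR n D h') := by
  refine forall_congr' fun x => forall_congr' fun y => forall_congr' fun hx =>
    forall_congr' fun hy => imp_congr_left ?_
  exact (mul_bz_add_mul_bz_eq_zero_iff l r (fun t ht => hx t fun h => ht h.1)
    (fun t ht => hy t fun h => ht h.1)).symm

/-- Bridges a sign convention: the Jacobian of the left element is the negative of the conventional
weight function r. -/
theorem sideInjective_neg_iff {n : ℕ} {l r : ℝ[X]} {A B : Set (Fin (n + 1))} :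
    SideInjective n l (-r) A B ↔ SideInjective n l r A B := by
  have key : ∀ {r : ℝ[X]}, SideInjective n l r A B → SideInjective n l (-r) A B := by
    intro r h x y hx hy e
    have := h x (-y) hx (fun t ht => by simp [hy t ht]) (by rw [map_neg]; linear_combination e)
    exact ⟨this.1, neg_eq_zero.1 this.2⟩
  exact ⟨fun h => by simpa using key h, key⟩

theorem ncard_sideRange {n : ℕ} (hn : 3 ≤ n) : (Mesh.sideRange n).ncard + 3 = n := by
  have : Mesh.sideRange n = (Finset.univ.filter fun t : Fin (n + 1) =>
      2 ≤ (t : ℕ) ∧ (t : ℕ) + 2 ≤ n : Finset (Fin (n + 1))) := by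
    ext t; simp [Mesh.sideRange]
  rw [this, Set.ncard_coe_finset]
  have h2 : ((Finset.univ.filter fun t : Fin (n + 1) => 2 ≤ (t : ℕ) ∧ (t : ℕ) + 2 ≤ n).map
      Fin.valEmbedding) = Finset.Icc 2 (n - 2) := by
    ext k
    simp only [Finset.mem_map, Finset.mem_filter, Finset.mem_univ, true_and,
      Fin.valEmbedding_apply, Finset.mem_Icc]
    constructor
    · rintro ⟨t, ht, rfl⟩; omega
    · intro hk; exact ⟨⟨k, by omega⟩, ⟨hk.1, by simp only; omega⟩, rfl⟩
  rw [← Finset.card_map Fin.valEmbedding, h2, Nat.card_Icc]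
  omega

/-- From basic to dependent points: 2(n-3) minus n-m is n+δ-3 for m = 3+δ. -/
theorem ncard_sideRange_diff {n m : ℕ} (hn : 3 ≤ n) {A B : Set (Fin (n + 1))}
    (hA : A ⊆ Mesh.sideRange n) (hB : B ⊆ Mesh.sideRange n) {δ : ℕ}
    (h : A.ncard + B.ncard + m = n) (hm : m = 3 + δ) :
    (Mesh.sideRange n \ A).ncard + (Mesh.sideRange n \ B).ncard + 3 = n + δ := by
  have h1 := Set.ncard_sdiff_add_ncard_of_subset hA
  have h2 := Set.ncard_sdiff_add_ncard_of_subset hB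
  have h3 := ncard_sideRange hn
  omega

/-- Proportional weight functions, one side coefficient of each pair being dependent. -/
theorem sideInjective_of_pairs {n : ℕ} {l : ℝ[X]} (hl : l ≠ 0) {κ : ℝ} (hκ : κ ≠ 0)
    {A B : Set (Fin (n + 1))} (hAB : ∀ t, t ∉ A ∨ t ∉ B) : SideInjective n l (C κ * l) A B := by
  intro x y hx hy e
  have h1 : l * bz n (x + κ • y) = 0 := by
    rw [map_add, map_smul, smul_eq_C_mul]; linear_combination e
  rw [mul_eq_zero, or_iff_right hl, bz_eq_zero_iff, funext_iff] at h1
  have h2 : ∀ t, x t = 0 ∧ y t = 0 := by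
    intro t
    have := h1 t
    simp only [Pi.add_apply, Pi.smul_apply, smul_eq_mul, Pi.zero_apply] at this
    rcases hAB t with h | h
    · rw [hx t h, zero_add, mul_eq_zero, or_iff_right hκ] at this
      exact ⟨hx t h, this⟩
    · rw [hy t h, mul_zero, add_zero] at this
      exact ⟨this, hy t h⟩
  exact ⟨funext fun t => (h2 t).1, funext fun t => (h2 t).2⟩

theorem ncard_sideRange_pairs {n : ℕ} (hn : 3 ≤ n) {A B : Set (Fin (n + 1))}
    (h : ∀ t ∈ Mesh.sideRange n, Xor (t ∈ A) (t ∈ B)) :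
    (Mesh.sideRange n \ (Mesh.sideRange n ∩ A)).ncard +
      (Mesh.sideRange n \ (Mesh.sideRange n ∩ B)).ncard + 3 = n + 0 := by
  have e : Mesh.sideRange n \ (Mesh.sideRange n ∩ B) = Mesh.sideRange n ∩ A := by
    ext t
    constructor
    · rintro ⟨h1, h2⟩
      refine ⟨h1, ?_⟩
      rcases h t h1 with h3 | h3
      · exact h3.1
      · exact absurd ⟨h1, h3.1⟩ h2
    · rintro ⟨h1, h2⟩
      refine ⟨h1, fun h3 => ?_⟩
      rcases h t h1 with h4 | h4
      · exact h4.2 h3.2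
      · exact h4.2 h2
  rw [e, Set.ncard_sdiff_add_ncard_of_subset inter_subset_left, ncard_sideRange hn, add_zero]

/-! ### Reduction of the weight functions -/

/-- The degree of the common factor cancels in the degree gap. What remains is whether `c'` attains
its bound δ+2. -/
theorem IsReduction.gap_iff {δ : ℕ} {l r c D l' r' c' : ℝ[X]}
    (H : IsReduction δ l r c D l' r' c') (hl : l ≠ 0) (hr : r ≠ 0)
    (hδ : max l'.natDegree r'.natDegree = δ) :
    c.natDegree = max l.natDegree r.natDegree + 2 ↔ ¬ c'.natDegree ≤ δ + 1 := by
  have hD := H.ne_zero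
  have hl' : l' ≠ 0 := by rintro rfl; exact hl (by rw [H.hl, mul_zero])
  have hr' : r' ≠ 0 := by rintro rfl; exact hr (by rw [H.hr, mul_zero])
  have := H.deg_c
  by_cases hc : c' = 0
  · rw [H.hc, hc, mul_zero]
    simp
  · rw [H.hl, H.hr, H.hc, natDegree_mul hD hl', natDegree_mul hD hr', natDegree_mul hD hc]
    omega

theorem bz_two (a : Fin 3 → ℝ) :
    bz 2 a = C (a 0) * (1 - X) ^ 2 + C (2 * a 1) * (X * (1 - X)) + C (a 2) * X ^ 2 := by
  have h2 : (C 2 : ℝ[X]) = 2 := rfl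
  rw [bz_apply, Fin.sum_univ_three, C_mul, h2]
  simp [bernsteinPolynomial]
  ring

theorem bz_one (a : Fin 2 → ℝ) : bz 1 a = C (a 0) * (1 - X) + C (a 1) * X := by
  rw [bz_apply, Fin.sum_univ_two]
  simp [bernsteinPolynomial]

theorem natDegree_add_mul_le {α β l r : ℝ[X]} {d e : ℕ} (hα : α.natDegree ≤ d)
    (hβ : β.natDegree ≤ d) (hl : l.natDegree ≤ e) (hr : r.natDegree ≤ e) :
    (α * l + β * r).natDegree ≤ d + e :=
  (natDegree_add_le _ _).trans (max_le (natDegree_mul_le.trans (by omega))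
    (natDegree_mul_le.trans (by omega)))

/-- Proportional weight functions. -/
theorem isReduction_of_proportional {d : ℕ} (hd : d ≤ 2) {l c α β : ℝ[X]} {κ ε : ℝ} (hε : ε ≠ 0)
    (hc : C ε * c = α * l + β * (C κ * l)) (hα : α.natDegree ≤ d) (hβ : β.natDegree ≤ d)
    (h0 : l.coeff 0 ≠ 0) (h1 : (l.comp (1 - X)).coeff 0 ≠ 0) :
    IsReduction 0 l (C κ * l) c l 1 (C κ) (C ε⁻¹ * (α * 1 + β * C κ)) ∧
      (C ε⁻¹ * (α * 1 + β * C κ)).natDegree ≤ d := by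
  have h2 : (C ε⁻¹ * (α * 1 + β * C κ)).natDegree ≤ d :=
    (natDegree_C_mul_le _ _).trans ((natDegree_add_mul_le hα hβ (by simp) (by simp)).trans
      (by omega : d + 0 ≤ d))
  refine ⟨⟨by rw [mul_one], mul_comm _ _, ?_, h0, h1, by simp, by simp, h2.trans (by omega)⟩, h2⟩
  have : C ε⁻¹ * (C ε * c) = c := by
    rw [← mul_assoc, ← C_mul, inv_mul_cancel₀ hε, C_1, one_mul]
  rw [← this, hc]
  ring

/-- Weight functions without common factor. -/
theorem isReduction_one {d e : ℕ} {l r c α β : ℝ[X]} {ε : ℝ} (hε : ε ≠ 0)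
    (hc : C ε * c = α * l + β * r) (hα : α.natDegree ≤ d) (hβ : β.natDegree ≤ d)
    (hl : l.natDegree ≤ e) (hr : r.natDegree ≤ e) (hd : d ≤ 2) :
    IsReduction e l r c 1 l r c ∧ c.natDegree ≤ d + e := by
  have h1 : c.natDegree ≤ d + e := by
    rw [← natDegree_C_mul hε, hc]
    exact natDegree_add_mul_le hα hβ hl hr
  exact ⟨⟨(one_mul _).symm, (one_mul _).symm, (one_mul _).symm, by simp, by simp, hl, hr,
    h1.trans (by omega)⟩, h1⟩

/-- The resultant of the two quadratics is g₀₂² - 4g₀₁g₁₂. If it vanishes they have a common linear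
factor, which can be taken to be g₀₂(1-X) + 2g₁₂X; it is the same for both up to sign. -/
theorem C_mul_bz_two_eq (a b : Fin 3 → ℝ) {g₀₁ g₁₂ g₀₂ : ℝ} (h01 : g₀₁ = a 0 * b 1 - a 1 * b 0)
    (h12 : g₁₂ = a 1 * b 2 - a 2 * b 1) (h02 : g₀₂ = a 0 * b 2 - a 2 * b 0) (hg : g₀₂ ≠ 0)
    (h : g₀₂ ^ 2 = 4 * g₀₁ * g₁₂) :
    bz 2 a = (C g₀₂ * (1 - X) + C (2 * g₁₂) * X) *
      (C (a 0 / g₀₂) * (1 - X) + C (2 * g₀₁ * a 2 / g₀₂ ^ 2) * X) := by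
  have e1 : 2 * a 1 = g₀₂ * (2 * g₀₁ * a 2 / g₀₂ ^ 2) + 2 * g₁₂ * (a 0 / g₀₂) := by
    field_simp
    rw [h01, h12, h02]
    ring
  have e2 : a 2 = 2 * g₁₂ * (2 * g₀₁ * a 2 / g₀₂ ^ 2) := by
    field_simp
    rw [h]
    ring
  have e0 : a 0 = g₀₂ * (a 0 / g₀₂) := by field_simp
  have c0 := congrArg (C : ℝ → ℝ[X]) e0
  have c1 := congrArg (C : ℝ → ℝ[X]) e1
  have c2 := congrArg (C : ℝ → ℝ[X]) e2
  generalize a 0 / g₀₂ = u at *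
  generalize 2 * g₀₁ * a 2 / g₀₂ ^ 2 = v at *
  rw [C_add, map_mul C g₀₂ v, map_mul C (2 * g₁₂) u] at c1
  rw [map_mul C g₀₂ u] at c0
  rw [map_mul C (2 * g₁₂) v] at c2
  rw [bz_two]
  linear_combination (1 - X) ^ 2 * c0 + X * (1 - X) * c1 + X ^ 2 * c2

/-- The combinations of two polynomials with coefficients of degree at most `m`. -/
def combos (l r : ℝ[X]) (m : ℕ) : Submodule ℝ ℝ[X] :=
  (degreeLT ℝ (m + 1)).map (LinearMap.mulLeft ℝ l) ⊔
    (degreeLT ℝ (m + 1)).map (LinearMap.mulLeft ℝ r)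

theorem mem_combos_iff {l r p : ℝ[X]} {m : ℕ} : p ∈ combos l r m ↔
    ∃ q q' : ℝ[X], q.natDegree ≤ m ∧ q'.natDegree ≤ m ∧ l * q + r * q' = p := by
  simp only [combos, Submodule.mem_sup, Submodule.mem_map, mem_degreeLT_succ_iff,
    LinearMap.mulLeft_apply]
  constructor
  · rintro ⟨_, ⟨q, hq, rfl⟩, _, ⟨q', hq', rfl⟩, e⟩
    exact ⟨q, q', hq, hq', e⟩
  · rintro ⟨q, q', hq, hq', e⟩
    exact ⟨_, ⟨q, hq, rfl⟩, _, ⟨q', hq', rfl⟩, e⟩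

theorem C_mul_mem_combos {l r p : ℝ[X]} {m : ℕ} (c : ℝ) (h : p ∈ combos l r m) :
    C c * p ∈ combos l r m := by
  rw [← smul_eq_C_mul]; exact Submodule.smul_mem _ _ h

theorem mem_combos_of_C_mul {l r p : ℝ[X]} {m : ℕ} {c : ℝ} (hc : c ≠ 0)
    (h : C c * p ∈ combos l r m) : p ∈ combos l r m := by
  have := C_mul_mem_combos c⁻¹ h
  rwa [← mul_assoc, ← C_mul, inv_mul_cancel₀ hc, C_1, one_mul] at this

theorem mul_left_mem_combos {l r q : ℝ[X]} {m : ℕ} (h : q.natDegree ≤ m) :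
    q * l ∈ combos l r m := mem_combos_iff.2 ⟨q, 0, h, by simp, by ring⟩

theorem mul_right_mem_combos {l r q : ℝ[X]} {m : ℕ} (h : q.natDegree ≤ m) :
    q * r ∈ combos l r m := mem_combos_iff.2 ⟨0, q, by simp, h, by ring⟩

/-- All polynomials of degree at most `m + δ` are combinations with coefficients of degree at most
`m`. -/
def Spans (δ m : ℕ) (l r : ℝ[X]) : Prop := ∀ p : ℝ[X], p.natDegree ≤ m + δ → p ∈ combos l r m

/-- Split p into X times a polynomial of smaller degree and a constant, and multiply the
combinations for these two by X and by the constant. -/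
theorem Spans.succ {δ m : ℕ} {l r : ℝ[X]} (h : Spans δ m l r) : Spans δ (m + 1) l r := by
  have key : ∀ {p}, p ∈ combos l r m → ∀ {s : ℝ[X]}, s.natDegree ≤ 1 →
      s * p ∈ combos l r (m + 1) := by
    intro p hp s hs
    obtain ⟨q, q', hq, hq', rfl⟩ := mem_combos_iff.1 hp
    exact mem_combos_iff.2 ⟨s * q, s * q', natDegree_mul_le.trans (by omega),
      natDegree_mul_le.trans (by omega), by ring⟩
  intro p hp
  rw [← divX_mul_X_add p]
  refine Submodule.add_mem _ ?_ ?_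
  · rw [mul_comm]
    refine key (h _ ?_) (by simp)
    rw [natDegree_divX_eq_natDegree_tsub_one]
    omega
  · rw [← mul_one (C _)]
    exact key (h 1 (by simp)) (by simp)

theorem Spans.of_le {δ k m : ℕ} {l r : ℝ[X]} (h : Spans δ k l r) (hkm : k ≤ m) :
    Spans δ m l r := by
  induction m, hkm using Nat.le_induction with
  | base => exact h
  | succ m _ ih => exact ih.succ

theorem spans_zero (r : ℝ[X]) (m : ℕ) : Spans 0 m 1 r := fun p hp => by
  rw [← mul_one p]; exact mul_left_mem_combos hp

/-- Cramer's rule in the two-dimensional space of linear polynomials. -/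
theorem spans_one {u v : Fin 2 → ℝ} (h : u 0 * v 1 - v 0 * u 1 ≠ 0) :
    Spans 1 0 (bz 1 u) (bz 1 v) := by
  intro p hp
  obtain ⟨c, rfl⟩ := exists_bz (n := 1) hp
  refine mem_combos_of_C_mul h ?_
  have : C (u 0 * v 1 - v 0 * u 1) * bz 1 c =
      C (c 0 * v 1 - c 1 * v 0) * bz 1 u + C (c 1 * u 0 - c 0 * u 1) * bz 1 v := by
    simp only [bz_one, C_sub, C_mul]; ring
  rw [this]
  exact Submodule.add_mem _ (mul_left_mem_combos (natDegree_C _).le)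
    (mul_right_mem_combos (natDegree_C _).le)

theorem bz_three (a : Fin 4 → ℝ) :
    bz 3 a = C (a 0) * (1 - X) ^ 3 + C (3 * a 1) * (X * (1 - X) ^ 2) +
      C (3 * a 2) * (X ^ 2 * (1 - X)) + C (a 3) * X ^ 3 := by
  have h3 : (C 3 : ℝ[X]) = 3 := rfl
  rw [bz_apply, Fin.sum_univ_four, C_mul, C_mul, h3]
  simp [bernsteinPolynomial, Nat.choose]
  ring

/-- The nonzero factor is the resultant, so the Sylvester matrix is invertible. The two inner cubic
basis polynomials are given by explicit rows of its adjugate; the outer two follow from (1-X)·a and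
X·a, because the end coefficients of a are nonzero. -/
theorem spans_two {a b : Fin 3 → ℝ} (ha0 : a 0 ≠ 0) (ha2 : a 2 ≠ 0) {g₀₁ g₁₂ g₀₂ : ℝ}
    (h01 : g₀₁ = a 0 * b 1 - a 1 * b 0) (h12 : g₁₂ = a 1 * b 2 - a 2 * b 1)
    (h02 : g₀₂ = a 0 * b 2 - a 2 * b 0) (h : g₀₂ ^ 2 ≠ 4 * g₀₁ * g₁₂) :
    Spans 2 1 (bz 2 a) (bz 2 b) := by
  set S := combos (bz 2 a) (bz 2 b) 1
  have hR : g₀₂ ^ 2 - 4 * g₀₁ * g₁₂ ≠ 0 := sub_ne_zero.2 h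
  have hY : (1 - X : ℝ[X]).natDegree ≤ 1 := (natDegree_sub_le _ _).trans (by simp)
  have h2 : (C 2 : ℝ[X]) = 2 := rfl
  have h4 : (C 4 : ℝ[X]) = 4 := rfl
  have mem : ∀ {s s' : ℝ[X]}, s.natDegree ≤ 1 → s'.natDegree ≤ 1 →
      s * bz 2 a + s' * bz 2 b ∈ S := fun hs hs' =>
    Submodule.add_mem _ (mul_left_mem_combos hs) (mul_right_mem_combos hs')
  have dg : ∀ u v : ℝ, (C u * (1 - X) + C v * X : ℝ[X]).natDegree ≤ 1 := fun u v =>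
    (natDegree_add_le _ _).trans (max_le ((natDegree_C_mul_le _ _).trans hY)
      ((natDegree_C_mul_le _ _).trans (by simp)))
  have e1 : X * (1 - X) ^ 2 ∈ S := by
    refine mem_combos_of_C_mul hR ?_
    have : C (g₀₂ ^ 2 - 4 * g₀₁ * g₁₂) * (X * (1 - X) ^ 2) =
        (C (2 * g₁₂ * b 0) * (1 - X) + C (g₀₂ * b 2) * X) * bz 2 a +
        (C (-2 * g₁₂ * a 0) * (1 - X) + C (-g₀₂ * a 2) * X) * bz 2 b := by
      simp only [bz_two, h01, h12, h02, C_sub, C_mul, C_neg, C_pow, h2, h4]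
      ring
    rw [this]
    exact mem (dg _ _) (dg _ _)
  have e2 : X ^ 2 * (1 - X) ∈ S := by
    refine mem_combos_of_C_mul hR ?_
    have : C (g₀₂ ^ 2 - 4 * g₀₁ * g₁₂) * (X ^ 2 * (1 - X)) =
        (C (-g₀₂ * b 0) * (1 - X) + C (-2 * g₀₁ * b 2) * X) * bz 2 a +
        (C (g₀₂ * a 0) * (1 - X) + C (2 * g₀₁ * a 2) * X) * bz 2 b := by
      simp only [bz_two, h01, h12, h02, C_sub, C_mul, C_neg, C_pow, h2, h4]
      ring
    rw [this]
    exact mem (dg _ _) (dg _ _)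
  have e0 : (1 - X) ^ 3 ∈ S := by
    refine mem_combos_of_C_mul ha0 ?_
    have : C (a 0) * (1 - X) ^ 3 = (1 - X) * bz 2 a - C (2 * a 1) * (X * (1 - X) ^ 2) -
        C (a 2) * (X ^ 2 * (1 - X)) := by rw [bz_two]; ring
    rw [this]
    exact Submodule.sub_mem _ (Submodule.sub_mem _ (mul_left_mem_combos hY)
      (C_mul_mem_combos _ e1)) (C_mul_mem_combos _ e2)
  have e3 : X ^ 3 ∈ S := by
    refine mem_combos_of_C_mul ha2 ?_
    have : C (a 2) * X ^ 3 = X * bz 2 a - C (2 * a 1) * (X ^ 2 * (1 - X)) -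
        C (a 0) * (X * (1 - X) ^ 2) := by rw [bz_two]; ring
    rw [this]
    exact Submodule.sub_mem _ (Submodule.sub_mem _ (mul_left_mem_combos (by simp))
      (C_mul_mem_combos _ e2)) (C_mul_mem_combos _ e1)
  intro p hp
  obtain ⟨c, rfl⟩ := exists_bz (n := 3) hp
  rw [bz_three]
  exact Submodule.add_mem _ (Submodule.add_mem _ (Submodule.add_mem _ (C_mul_mem_combos _ e0)
    (C_mul_mem_combos _ e1)) (C_mul_mem_combos _ e2)) (C_mul_mem_combos _ e3)

end SmoothQuadMesh
end

/-! ### Classification of pairs of weight functions of degree one and two. -/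

noncomputable section
namespace SmoothQuadMesh

theorem coeff_zero_bz_comp (n : ℕ) (a : Fin (n + 1) → ℝ) :
    ((bz n a).comp (1 - X)).coeff 0 = a (Fin.last n) := by
  rw [bz_comp_one_sub_X, coeff_bz_zero, Fin.rev_zero]

theorem bz_ne_zero {n : ℕ} {a : Fin (n + 1) → ℝ} (h : a 0 ≠ 0) : bz n a ≠ 0 := by
  intro e
  rw [bz_eq_zero_iff] at e
  exact h (by rw [e]; rfl)

theorem natDegree_bz_one_eq {a : Fin 2 → ℝ} (h : a 0 ≠ a 1) : (bz 1 a).natDegree = 1 := by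
  refine le_antisymm (natDegree_bz_le 1 a) (le_natDegree_of_ne_zero ?_)
  rw [coeff_bz_one 1 le_rfl]
  simpa [sub_eq_zero] using h.symm

theorem natDegree_bz_two_eq {a : Fin 3 → ℝ} (h : a 2 - 2 * a 1 + a 0 ≠ 0) :
    (bz 2 a).natDegree = 2 := by
  refine le_antisymm (natDegree_bz_le 2 a) (le_natDegree_of_ne_zero ?_)
  rw [coeff_bz_two 2 le_rfl]
  simpa using h

/-- Reduction of weight functions of degree two. -/
theorem exists_isReduction_two {a b : Fin 3 → ℝ} (ha0 : a 0 ≠ 0) (ha2 : a 2 ≠ 0) (hb0 : b 0 ≠ 0)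
    {c α β : ℝ[X]} {ε : ℝ} (hε : ε ≠ 0) (hc : C ε * c = α * bz 2 a + β * bz 2 b)
    (hα : α.natDegree ≤ 2) (hβ : β.natDegree ≤ 2) {g₀₁ g₁₂ g₀₂ : ℝ}
    (h01 : g₀₁ = a 0 * b 1 - a 1 * b 0) (h12 : g₁₂ = a 1 * b 2 - a 2 * b 1)
    (h02 : g₀₂ = a 0 * b 2 - a 2 * b 0) :
    ∃ δ D l' r' c', IsReduction δ (bz 2 a) (bz 2 b) c D l' r' c' ∧
      (c.natDegree = max (bz 2 a).natDegree (bz 2 b).natDegree + 2 ↔ ¬ c'.natDegree ≤ δ + 1) ∧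
      (∀ m, 1 ≤ m → Spans δ m l' r') ∧
      (((g₀₁ = 0 ∧ g₁₂ = 0 ∧ g₀₂ = 0) ∧ δ = 0 ∧ ∃ κ, κ ≠ 0 ∧ bz 2 b = C κ * bz 2 a) ∨
      ((g₀₁ * g₁₂ * g₀₂ ≠ 0 ∧ g₀₂ ^ 2 = 4 * g₀₁ * g₁₂) ∧ δ = 1) ∨
      (¬ (g₀₁ * g₁₂ * g₀₂ ≠ 0 ∧ g₀₂ ^ 2 = 4 * g₀₁ * g₁₂) ∧
        ¬ (g₀₁ = 0 ∧ g₁₂ = 0 ∧ g₀₂ = 0) ∧ δ = 2)) := by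
  have hl0 := bz_ne_zero ha0
  have hr0 := bz_ne_zero hb0
  by_cases hP2 : g₀₁ = 0 ∧ g₁₂ = 0 ∧ g₀₂ = 0
  · have hκ : b 0 / a 0 ≠ 0 := div_ne_zero hb0 ha0
    have hb : b = (b 0 / a 0) • a := by
      obtain ⟨h1, h2, h3⟩ := hP2
      rw [h01] at h1
      rw [h02] at h3
      funext i
      rw [Pi.smul_apply, smul_eq_mul]
      field_simp
      fin_cases i
      · simp
      · simp; linarith
      · simp; linarith
    have hr : bz 2 b = C (b 0 / a 0) * bz 2 a := by
      conv_lhs => rw [hb]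
      rw [map_smul, smul_eq_C_mul]
    rw [hr] at hc hr0 ⊢
    obtain ⟨H, -⟩ := isReduction_of_proportional le_rfl hε hc hα hβ
      (by rwa [coeff_bz_zero]) (by rw [coeff_zero_bz_comp]; exact ha2)
    exact ⟨0, _, _, _, _, H, H.gap_iff hl0 hr0 (by simp), fun m _ => spans_zero _ m,
      Or.inl ⟨hP2, rfl, _, hκ, rfl⟩⟩
  by_cases hP1 : g₀₁ * g₁₂ * g₀₂ ≠ 0 ∧ g₀₂ ^ 2 = 4 * g₀₁ * g₁₂
  · have hg : g₀₂ ≠ 0 := right_ne_zero_of_mul hP1.1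
    have hg' : g₀₁ ≠ 0 := left_ne_zero_of_mul (left_ne_zero_of_mul hP1.1)
    have hg'' : g₁₂ ≠ 0 := right_ne_zero_of_mul (left_ne_zero_of_mul hP1.1)
    have e1 := C_mul_bz_two_eq a b h01 h12 h02 hg hP1.2
    have e2 := C_mul_bz_two_eq b a (g₀₁ := -g₀₁) (g₁₂ := -g₁₂) (g₀₂ := -g₀₂) (by rw [h01]; ring)
      (by rw [h12]; ring) (by rw [h02]; ring) (neg_ne_zero.2 hg) (by linear_combination hP1.2)
    set u : Fin 2 → ℝ := ![a 0 / g₀₂, 2 * g₀₁ * a 2 / g₀₂ ^ 2] with hu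
    set v : Fin 2 → ℝ := ![b 0 / g₀₂, 2 * g₀₁ * b 2 / g₀₂ ^ 2] with hv
    set m : ℝ[X] := C g₀₂ * (1 - X) + C (2 * g₁₂) * X with hm
    have e1' : bz 2 a = m * bz 1 u := by rw [e1, bz_one]; rfl
    have e2' : bz 2 b = m * bz 1 v := by
      rw [e2, bz_one]
      simp only [hm, hv, Matrix.cons_val_zero, Matrix.cons_val_one, mul_neg, C_neg, div_neg,
        neg_mul, neg_div, neg_sq]
      ring
    have hdet : u 0 * v 1 - v 0 * u 1 ≠ 0 := by
      have : u 0 * v 1 - v 0 * u 1 = 2 * g₀₁ / g₀₂ ^ 2 := by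
        simp only [hu, hv, Matrix.cons_val_zero, Matrix.cons_val_one]
        field_simp
        rw [h02]; ring
      rw [this]
      positivity
    have hm0 : m.coeff 0 ≠ 0 := by simpa [hm] using hg
    have hm1 : (m.comp (1 - X)).coeff 0 ≠ 0 := by simpa [hm] using hg''
    have hcm : C ε * c = m * (α * bz 1 u + β * bz 1 v) := by rw [hc, e1', e2']; ring
    have hdeg : (C ε⁻¹ * (α * bz 1 u + β * bz 1 v)).natDegree ≤ 1 + 2 :=
      (natDegree_C_mul_le _ _).trans ((natDegree_add_mul_le hα hβ (natDegree_bz_le 1 u)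
        (natDegree_bz_le 1 v)).trans (by omega))
    have H : IsReduction 1 (bz 2 a) (bz 2 b) c m (bz 1 u) (bz 1 v)
        (C ε⁻¹ * (α * bz 1 u + β * bz 1 v)) := by
      refine ⟨e1', e2', ?_, hm0, hm1, natDegree_bz_le 1 u, natDegree_bz_le 1 v, hdeg⟩
      rw [mul_left_comm, ← hcm, ← mul_assoc, ← C_mul, inv_mul_cancel₀ hε, C_1, one_mul]
    have hmax : max (bz 1 u).natDegree (bz 1 v).natDegree = 1 := by
      refine le_antisymm (max_le (natDegree_bz_le 1 u) (natDegree_bz_le 1 v)) ?_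
      by_cases huu : u 0 = u 1
      · by_cases hvv : v 0 = v 1
        · exact absurd (by rw [huu, hvv]; ring) hdet
        · exact (natDegree_bz_one_eq hvv).ge.trans (le_max_right _ _)
      · exact (natDegree_bz_one_eq huu).ge.trans (le_max_left _ _)
    exact ⟨1, _, _, _, _, H, H.gap_iff hl0 hr0 hmax,
      fun k _ => (spans_one hdet).of_le (Nat.zero_le k), Or.inr (Or.inl ⟨hP1, rfl⟩)⟩
  · obtain ⟨H, -⟩ := isReduction_one hε hc hα hβ (natDegree_bz_le 2 a) (natDegree_bz_le 2 b) le_rfl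
    -- Outside the two special cases the resultant is nonzero: if it vanished with some minor equal
    -- to zero, the relation a₀g₁₂ + a₂g₀₁ = a₁g₀₂ with a₀, a₂ ≠ 0 would make all minors vanish.
    have hres : g₀₂ ^ 2 ≠ 4 * g₀₁ * g₁₂ := by
      intro hsq
      have h3 : g₀₂ = 0 := by
        by_contra h
        refine hP1 ⟨mul_ne_zero ?_ h, hsq⟩
        intro h'
        rw [mul_assoc, h', mul_zero] at hsq
        exact h (pow_eq_zero_iff two_ne_zero |>.1 hsq)
      have h4 : g₀₁ = 0 ∨ g₁₂ = 0 := by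
        rw [h3] at hsq
        rw [← mul_eq_zero]
        linarith
      have key : a 0 * g₁₂ + a 2 * g₀₁ = a 1 * g₀₂ := by rw [h01, h12, h02]; ring
      rw [h3, mul_zero] at key
      rcases h4 with h | h
      · rw [h, mul_zero, add_zero, mul_eq_zero, or_iff_right ha0] at key
        exact hP2 ⟨h, key, h3⟩
      · rw [h, mul_zero, zero_add, mul_eq_zero, or_iff_right ha2] at key
        exact hP2 ⟨key, h, h3⟩
    -- Two quadratics of actual degree at most one share the root at infinity, so their resultant
    -- vanishes.
    have hmax : max (bz 2 a).natDegree (bz 2 b).natDegree = 2 := by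
      refine le_antisymm (max_le (natDegree_bz_le 2 a) (natDegree_bz_le 2 b)) ?_
      by_cases haa : a 2 - 2 * a 1 + a 0 = 0
      · by_cases hbb : b 2 - 2 * b 1 + b 0 = 0
        · refine absurd ?_ hres
          have k1 : a 1 = (a 0 + a 2) / 2 := by linarith
          have k2 : b 1 = (b 0 + b 2) / 2 := by linarith
          rw [h01, h12, h02, k1, k2]
          ring
        · exact (natDegree_bz_two_eq hbb).ge.trans (le_max_right _ _)
      · exact (natDegree_bz_two_eq haa).ge.trans (le_max_left _ _)
    exact ⟨2, _, _, _, _, H, H.gap_iff hl0 hr0 hmax,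
      fun k hk => (spans_two ha0 ha2 h01 h12 h02 hres).of_le hk,
      Or.inr (Or.inr ⟨hP1, hP2, rfl⟩)⟩

/-- Reduction of weight functions of degree one. -/
theorem exists_isReduction_one {a b : Fin 2 → ℝ} (ha0 : a 0 ≠ 0) (ha1 : a 1 ≠ 0) (hb0 : b 0 ≠ 0)
    {c α β : ℝ[X]} {ε : ℝ} (hε : ε ≠ 0) (hc : C ε * c = α * bz 1 a + β * bz 1 b)
    (hα : α.natDegree ≤ 1) (hβ : β.natDegree ≤ 1) :
    ∃ δ D l' r' c', IsReduction δ (bz 1 a) (bz 1 b) c D l' r' c' ∧ c'.natDegree ≤ δ + 1 ∧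
      (∀ m, 1 ≤ m → Spans δ m l' r') ∧
      ((a 0 * b 1 - b 0 * a 1 = 0 ∧ δ = 0 ∧ ∃ κ, κ ≠ 0 ∧ bz 1 b = C κ * bz 1 a) ∨
        (a 0 * b 1 - b 0 * a 1 ≠ 0 ∧ δ = 1)) := by
  by_cases hP : a 0 * b 1 - b 0 * a 1 = 0
  · have hκ : b 0 / a 0 ≠ 0 := div_ne_zero hb0 ha0
    have hb : b = (b 0 / a 0) • a := by
      funext i
      rw [Pi.smul_apply, smul_eq_mul]
      field_simp
      fin_cases i
      · simp
      · simp; linarith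
    have hr : bz 1 b = C (b 0 / a 0) * bz 1 a := by
      conv_lhs => rw [hb]
      rw [map_smul, smul_eq_C_mul]
    rw [hr] at hc ⊢
    obtain ⟨H, hdeg⟩ := isReduction_of_proportional (by norm_num) hε hc hα hβ
      (by rwa [coeff_bz_zero]) (by rw [coeff_zero_bz_comp]; exact ha1)
    exact ⟨0, _, _, _, _, H, hdeg, fun m _ => spans_zero _ m, Or.inl ⟨hP, rfl, _, hκ, rfl⟩⟩
  · obtain ⟨H, hdeg⟩ := isReduction_one hε hc hα hβ (natDegree_bz_le 1 a) (natDegree_bz_le 1 b)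
      (by norm_num)
    exact ⟨1, _, _, _, _, H, hdeg, fun k _ => (spans_one hP).of_le (Nat.zero_le k),
      Or.inr ⟨hP, rfl⟩⟩

end SmoothQuadMesh
end

noncomputable section
namespace SmoothQuadMesh
namespace Mesh

variable {V F : Type*} {M : Mesh V F} {n : ℕ}

/-! ### The weight functions of an edge -/

theorem smo_eq_edgePol {h h' : F × Fin 4} (ho : M.Opp h h') (z : M.CP n → ℝ) :
    smo z h h' = edgePol n ((M.jac h').comp (1 - X)) (M.jac h) (M.crossPol h h')
      (fun t => z (M.cp n h t 0)) (fun t => z (M.cp n h t 1))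
      (fun t => z (M.cp n h' t.rev 1)) := by
  rw [smo, nor_comp_eq z ho, nor, cen, edgePol]
  simp only [smul_eq_C_mul]
  have e1 : (fun t => z (M.cp n h t 1)) - (fun t => z (M.cp n h t 0)) =
    fun t => z (M.cp n h t 1) - z (M.cp n h t 0) := rfl
  have e2 : (fun t : Fin (n + 1) => z (M.cp n h' t.rev 1)) - (fun t => z (M.cp n h t 0)) =
    fun t => z (M.cp n h' t.rev 1) - z (M.cp n h t 0) := rfl
  rw [e1, e2]
  ring

theorem bz_linear (n : ℕ) (a b : ℝ) (x y : Fin (n + 1) → ℝ) :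
    C a * bz n x + C b * bz n y = bz n fun i => a * x i + b * y i := by
  rw [← smul_eq_C_mul, ← smul_eq_C_mul, ← map_smul, ← map_smul, ← map_add]
  rfl

variable (M) in
theorem jac_eq_bz (h : F × Fin 4) : M.jac h = bz 2 fun i => cross (M.dir h) (M.lamq h i) := by
  have := bz_linear 2 (M.dir h).1 (-(M.dir h).2) (fun i => (M.lamq h i).2) fun i => (M.lamq h i).1
  rw [jac, lamX, lamY, sub_eq_add_neg, ← neg_mul, ← C_neg, this]
  congr 1
  funext i
  simp only [cross]
  ring

theorem jac_comp_eq_bz {h h' : F × Fin 4} (ho : M.Opp h h') :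
    (M.jac h').comp (1 - X) = bz 2 fun i => cross (M.lamq h' i.rev) (M.dir h) := by
  rw [jac_eq_bz, bz_comp_one_sub_X]
  congr 1
  funext i
  rw [ho.dir_eq, cross_neg_left, ← cross_swap]

/-- The conventional cross derivatives λ and ρ both point from left to right, whereas `lamq` always
points into its own element. This is the source of the signs here and below. -/
theorem lam_eq {h h' : F × Fin 4} (hM : M.IsSmoothMesh) (hb : M.EdgeToBd h h') (i : Fin 3) :
    M.lam h i = -M.lamq h i := by
  obtain ⟨h1, -⟩ := hM.edgeToBd_snd hb
  have hf : M.IsBdFace h.1 := ⟨_, hM.edgeToBd_next hb⟩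
  have h3 : ¬ h.2 = 3 := by rw [h1]; decide
  fin_cases i <;> ext <;> simp [lam, lamq, h1, ctrl, hf] <;> ring

theorem rho_eq {h h' : F × Fin 4} (hM : M.IsSmoothMesh) (hb : M.EdgeToBd h h') (i : Fin 3) :
    M.rho h h' i = M.lamq h' i.rev := by
  obtain ⟨-, h3⟩ := hM.edgeToBd_snd hb
  have hf : M.IsBdFace h'.1 := ⟨_, hM.edgeToBd_prev hb⟩
  have e : (Fin.rev 1 : Fin 3) = 1 := rfl
  have e' : (Fin.rev 2 : Fin 3) = 0 := rfl
  have e0 : (Fin.rev 0 : Fin 3) = 2 := rfl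
  fin_cases i <;> ext <;> simp [rho, lamq, h3, ctrl, hf, hb.1.1, hb.1.2, e, e'] <;> ring

theorem jac_comp_eq_bicubic {h h' : F × Fin 4} (hM : M.IsSmoothMesh) (hb : M.EdgeToBd h h') :
    (M.jac h').comp (1 - X) = bz 2 (M.lBicubic h h') := by
  rw [jac_comp_eq_bz hb.1]
  congr 1
  funext i
  rw [lBicubic, rho_eq hM hb]

theorem jac_eq_bicubic {h h' : F × Fin 4} (hM : M.IsSmoothMesh) (hb : M.EdgeToBd h h') :
    M.jac h = bz 2 (-M.rBicubic h) := by
  rw [jac_eq_bz]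
  congr 1
  funext i
  rw [Pi.neg_apply, rBicubic, lam_eq hM hb, cross_neg_left, neg_neg, cross_swap]

theorem crossPol_eq_bicubic {h h' : F × Fin 4} (hM : M.IsSmoothMesh) (hb : M.EdgeToBd h h') :
    M.crossPol h h' = -M.cBicubic h h' := by
  have e1 : ∀ w : Fin 3 → ℝ, bz 2 (fun i => -w i) = -bz 2 w := fun w => map_neg (bz 2) w
  rw [crossPol, cBicubic, lamX, lamY, lamX, lamY, bz_comp_one_sub_X, bz_comp_one_sub_X]
  simp only [bezier2_eq_bz, lam_eq hM hb, rho_eq hM hb, Prod.fst_neg, Prod.snd_neg, e1]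
  ring

/-- A quadratic whose middle coefficient is the mean of the outer ones is a degree-elevated linear
polynomial. This happens along edges with two inner vertices. -/
theorem bz_two_of_mean {w : Fin 3 → ℝ} (h : w 1 = (w 0 + w 2) / 2) :
    bz 2 w = bz 1 ![w 0, w 2] := by
  rw [bz_two, bz_one, h, mul_div_cancel₀ _ two_ne_zero]
  simp only [C_add, Matrix.cons_val_zero, Matrix.cons_val_one]
  ring

variable (M) in
theorem lamq_one (h : F × Fin 4) (ho : ¬ M.IsBdVertex (M.org h)) (ht : ¬ M.IsBdVertex (M.tgt h))
    (hM : M.IsSmoothMesh) : M.lamq h 1 = (1 / 2 : ℝ) • (M.lamq h 0 + M.lamq h 2) := by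
  rw [lamq_zero hM ho, lamq_two hM ht]; rfl

theorem jac_eq_bilinear {h : F × Fin 4} (hM : M.IsSmoothMesh) (ho : ¬ M.IsBdVertex (M.org h))
    (ht : ¬ M.IsBdVertex (M.tgt h)) : M.jac h = bz 1 (-M.rBilinear h) := by
  rw [jac_eq_bz, bz_two_of_mean]
  · congr 1
    funext i
    fin_cases i
    · simp [rBilinear, lamq_zero hM ho, cross_swap (M.dir h)]
    · simp [rBilinear, lamq_two hM ht, cross_swap (M.dir h)]
  · rw [M.lamq_one h ho ht hM]
    simp [cross]
    ring

theorem jac_comp_eq_bilinear {h h' : F × Fin 4} (hM : M.IsSmoothMesh) (hopp : M.Opp h h')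
    (ho : ¬ M.IsBdVertex (M.org h)) (ht : ¬ M.IsBdVertex (M.tgt h)) :
    (M.jac h').comp (1 - X) = bz 1 (M.lBilinear h h') := by
  have ho' : ¬ M.IsBdVertex (M.org h') := by rwa [← hopp.2]
  have ht' : ¬ M.IsBdVertex (M.tgt h') := by rwa [← hopp.1]
  have e : (Fin.rev 1 : Fin 3) = 1 := rfl
  have e' : (Fin.rev 2 : Fin 3) = 0 := rfl
  have e0 : (Fin.rev 0 : Fin 3) = 2 := rfl
  rw [jac_comp_eq_bz hopp, bz_two_of_mean]
  · congr 1
    funext i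
    fin_cases i
    · simp [lBilinear, e0, lamq_two hM ht', hopp.1]
    · simp [lBilinear, e', lamq_zero hM ho', hopp.2]
  · rw [e, e', e0, M.lamq_one h' ho' ht' hM]
    simp [cross]
    ring

theorem natDegree_lam_le_one {h : F × Fin 4} (hM : M.IsSmoothMesh) (ho : ¬ M.IsBdVertex (M.org h))
    (ht : ¬ M.IsBdVertex (M.tgt h)) :
    (M.lamX h).natDegree ≤ 1 ∧ (M.lamY h).natDegree ≤ 1 := by
  have := M.lamq_one h ho ht hM
  constructor
  · rw [lamX, bz_two_of_mean (by rw [this]; simp; ring)]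
    exact natDegree_bz_le 1 _
  · rw [lamY, bz_two_of_mean (by rw [this]; simp; ring)]
    exact natDegree_bz_le 1 _

/-- The weight function of the central control points is a combination of the other two. -/
theorem exists_crossPol_eq {h h' : F × Fin 4} (hM : M.IsSmoothMesh) (ho : M.Opp h h') {d : ℕ}
    (h1 : (M.lamX h).natDegree ≤ d ∧ (M.lamY h).natDegree ≤ d)
    (h2 : (M.lamX h').natDegree ≤ d ∧ (M.lamY h').natDegree ≤ d) :
    ∃ (ε : ℝ) (α β : ℝ[X]), ε ≠ 0 ∧
      C ε * M.crossPol h h' = α * (M.jac h').comp (1 - X) + β * M.jac h ∧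
      α.natDegree ≤ d ∧ β.natDegree ≤ d := by
  have dg : ∀ (u v : ℝ) (p q : ℝ[X]), p.natDegree ≤ d → q.natDegree ≤ d →
      (C u * p + C v * q).natDegree ≤ d := fun u v p q hp hq =>
    (natDegree_add_le _ _).trans (max_le ((natDegree_C_mul_le _ _).trans hp)
      ((natDegree_C_mul_le _ _).trans hq))
  -- The scalar product of the vector identity for λ, ρ and e with e itself: |e|²c is expressed by l
  -- and r, with coefficients -λ·e and -ρ·e up to the convention on signs.
  refine ⟨(M.dir h).1 ^ 2 + (M.dir h).2 ^ 2,
    C (-(M.dir h).1) * M.lamX h + C (-(M.dir h).2) * M.lamY h,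
    C (-(M.dir h).1) * (M.lamX h').comp (1 - X) + C (-(M.dir h).2) * (M.lamY h').comp (1 - X),
    ?_, ?_, dg _ _ _ _ h1.1 h1.2, dg _ _ _ _ ?_ ?_⟩
  · intro e
    have e1 : (M.dir h).1 = 0 := by nlinarith [sq_nonneg (M.dir h).1, sq_nonneg (M.dir h).2]
    have e2 : (M.dir h).2 = 0 := by nlinarith [sq_nonneg (M.dir h).1, sq_nonneg (M.dir h).2]
    have : M.dir h = 0 := Prod.ext e1 e2
    exact hM.org_ne_tgt h (hM.pos_injective (sub_eq_zero.1 this).symm)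
  · rw [jac, jac, ho.dir_eq, crossPol]
    simp only [sub_comp, mul_comp, neg_comp, C_comp, Prod.fst_neg, Prod.snd_neg, C_neg, C_add,
      C_pow]
    ring
  · rw [natDegree_comp_one_sub_X]; exact h2.1
  · rw [natDegree_comp_one_sub_X]; exact h2.2

theorem coeff_zero_jac_pos {h : F × Fin 4} (hM : M.IsSmoothMesh) (hi : M.IsInnerEdge h) :
    0 < (M.jac h).coeff 0 := by
  rw [coeff_zero_eq_eval_zero]
  exact hM.eval_jac_pos (hM.isStraight hi) ⟨le_rfl, zero_le_one⟩

theorem coeff_zero_jac_comp_pos {h : F × Fin 4} (hM : M.IsSmoothMesh) (hi : M.IsInnerEdge h) :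
    0 < ((M.jac h).comp (1 - X)).coeff 0 := by
  rw [coeff_zero_eq_eval_zero, eval_comp]
  simp only [eval_sub, eval_one, eval_X, sub_zero]
  exact hM.eval_jac_pos (hM.isStraight hi) ⟨zero_le_one, le_rfl⟩

/-- At the boundary vertex both cross derivatives are tangent to the boundary curve; by `bd_smooth`
they are parallel there. -/
theorem coeff_zero_crossPol_comp {h h' : F × Fin 4} (hM : M.IsSmoothMesh)
    (hb : M.EdgeToBd h h') : ((M.crossPol h h').comp (1 - X)).coeff 0 = 0 := by
  obtain ⟨-, k, -, hk⟩ := hM.bd_smooth h h' hb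
  have h1 : M.lam h 2 = (3 : ℝ) • (M.pos (M.tgt h) - M.bdCtrl h.1 1) := rfl
  have h2 : M.rho h h' 2 = (3 : ℝ) • (M.bdCtrl h'.1 0 - M.pos (M.tgt h)) := rfl
  rw [crossPol_eq_bicubic hM hb, cBicubic]
  simp only [bezier2_eq_bz, neg_comp, sub_comp, mul_comp, coeff_neg, coeff_sub, mul_coeff_zero]
  have e : ∀ w : Fin 3 → ℝ, ((bz 2 w).comp (1 - X)).coeff 0 = w 2 := coeff_zero_bz_comp 2
  rw [e, e, e, e, h1, h2, hk]
  simp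
  ring

/-- Reduction of the weight functions of an edge with two inner vertices. -/
theorem exists_isReduction_bilinear {h h' : F × Fin 4} (hM : M.IsSmoothMesh) (ho : M.Opp h h')
    (h1 : ¬ M.IsBdVertex (M.org h)) (h2 : ¬ M.IsBdVertex (M.tgt h)) :
    ∃ δ D l' r' c', IsReduction δ ((M.jac h').comp (1 - X)) (M.jac h) (M.crossPol h h')
      D l' r' c' ∧ c'.natDegree ≤ δ + 1 ∧ (∀ m, 1 ≤ m → Spans δ m l' r') ∧
      ((M.ProjectionsRelation h h' ∧ δ = 0 ∧
        ∃ κ, κ ≠ 0 ∧ M.jac h = C κ * (M.jac h').comp (1 - X)) ∨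
        (¬ M.ProjectionsRelation h h' ∧ δ = 1)) := by
  have h1' : ¬ M.IsBdVertex (M.org h') := by rwa [← ho.2]
  have h2' : ¬ M.IsBdVertex (M.tgt h') := by rwa [← ho.1]
  obtain ⟨ε, α, β, hε, hc, hα, hβ⟩ := exists_crossPol_eq hM ho
    (natDegree_lam_le_one hM h1 h2) (natDegree_lam_le_one hM h1' h2')
  have p1 := coeff_zero_jac_comp_pos hM ho.symm.isInnerEdge
  have p2 := coeff_zero_jac_pos hM ho.symm.isInnerEdge
  have p3 := coeff_zero_jac_pos hM ho.isInnerEdge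
  rw [← comp_one_sub_X_involutive (M.jac h')] at p2
  rw [jac_comp_eq_bilinear hM ho h1 h2] at hc p1 p2 ⊢
  rw [jac_eq_bilinear hM h1 h2] at hc p3 ⊢
  rw [coeff_bz_zero] at p1 p3
  rw [coeff_zero_bz_comp] at p2
  obtain ⟨δ, D, l', r', c', H1, H2, H3, H4⟩ := exists_isReduction_one p1.ne' p2.ne' p3.ne' hε hc
    hα hβ
  refine ⟨δ, D, l', r', c', H1, H2, H3, ?_⟩
  have e : M.lBilinear h h' 0 * (-M.rBilinear h) 1 - (-M.rBilinear h) 0 * M.lBilinear h h' 1 =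
      -(M.lBilinear h h' 0 * M.rBilinear h 1 - M.rBilinear h 0 * M.lBilinear h h' 1) := by
    simp only [Pi.neg_apply]; ring
  rw [e, neg_ne_zero, neg_eq_zero] at H4
  exact H4

/-- Reduction of the weight functions of an edge with a boundary vertex. -/
theorem exists_isReduction_bicubic {h h' : F × Fin 4} (hM : M.IsSmoothMesh)
    (hb : M.EdgeToBd h h') :
    ∃ δ D l' r' c', IsReduction δ ((M.jac h').comp (1 - X)) (M.jac h) (M.crossPol h h')
      D l' r' c' ∧ (M.DegreeGapTwo h h' ↔ ¬ c'.natDegree ≤ δ + 1) ∧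
      (∀ m, 1 ≤ m → Spans δ m l' r') ∧
      ((M.Case2 h h' ∧ δ = 0 ∧ ∃ κ, κ ≠ 0 ∧ M.jac h = C κ * (M.jac h').comp (1 - X)) ∨
        (M.Case1 h h' ∧ δ = 1) ∨ (¬ M.Case1 h h' ∧ ¬ M.Case2 h h' ∧ δ = 2)) := by
  have ho := hb.1
  obtain ⟨ε, α, β, hε, hc, hα, hβ⟩ := exists_crossPol_eq hM ho (d := 2)
    ⟨natDegree_bz_le 2 _, natDegree_bz_le 2 _⟩ ⟨natDegree_bz_le 2 _, natDegree_bz_le 2 _⟩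
  have p1 := coeff_zero_jac_comp_pos hM ho.symm.isInnerEdge
  have p2 := coeff_zero_jac_pos hM ho.symm.isInnerEdge
  have p3 := coeff_zero_jac_pos hM ho.isInnerEdge
  rw [← comp_one_sub_X_involutive (M.jac h')] at p2
  rw [jac_comp_eq_bicubic hM hb] at hc p1 p2 ⊢
  rw [jac_eq_bicubic hM hb] at hc p3 ⊢
  rw [coeff_bz_zero] at p1 p3
  rw [coeff_zero_bz_comp] at p2
  have eg : ∀ i j, -M.g h h' i j = M.lBicubic h h' i * (-M.rBicubic h) j -
      M.lBicubic h h' j * (-M.rBicubic h) i := fun i j => by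
    simp only [g, Pi.neg_apply]; ring
  obtain ⟨δ, D, l', r', c', H1, H2, H3, H4⟩ := exists_isReduction_two p1.ne' p2.ne' p3.ne' hε hc
    hα hβ (eg 0 1) (eg 1 2) (eg 0 2)
  refine ⟨δ, D, l', r', c', H1, ?_, H3, ?_⟩
  · rw [← H2, DegreeGapTwo, crossPol_eq_bicubic hM hb, natDegree_neg, bezier2_eq_bz, bezier2_eq_bz,
      map_neg, natDegree_neg]
  · have e1 : -M.g h h' 0 1 * -M.g h h' 1 2 * -M.g h h' 0 2 =
      -(M.g h h' 0 1 * M.g h h' 1 2 * M.g h h' 0 2) := by ring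
    have e2 : 4 * -M.g h h' 0 1 * -M.g h h' 1 2 = 4 * M.g h h' 0 1 * M.g h h' 1 2 := by ring
    rw [e1, e2, neg_ne_zero, neg_sq, neg_eq_zero, neg_eq_zero, neg_eq_zero] at H4
    exact H4

end Mesh
end SmoothQuadMesh
end

noncomputable section
namespace SmoothQuadMesh
namespace Mesh

variable {V F : Type*} {M : Mesh V F} {n : ℕ}

/-! ### The control points close to an edge -/

variable (M) in
theorem cp_zero_one_eq (n : ℕ) (h : F × Fin 4) :
    M.cp n h 0 1 = M.cp n (prev h) (Fin.rev 1) 0 := by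
  rw [cp_prev, Fin.rev_rev]

variable (M) in
theorem cp_last_one_eq (n : ℕ) (h : F × Fin 4) :
    M.cp n h (Fin.last n) 1 = M.cp n (next h) 1 0 := by
  rw [cp_next, Fin.rev_zero]

theorem next_injective : Function.Injective (next : F × Fin 4 → F × Fin 4) :=
  Function.LeftInverse.injective prev_next

theorem prev_injective : Function.Injective (prev : F × Fin 4 → F × Fin 4) :=
  Function.LeftInverse.injective next_prev

theorem cp_bd_edge_eq (hM : M.IsSmoothMesh) {h k : F × Fin 4} (hh : M.IsBdEdge h)
    {a t : Fin (n + 1)} (ha : 0 < (a : ℕ)) (ha' : (a : ℕ) < n) (e : M.cp n h a 0 = M.cp n k t 0) :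
    k = h ∧ t = a := by
  rcases cp_edge_eq hM ha ha' e with h1 | ⟨h1, -⟩
  · exact h1
  · exact absurd ⟨k, h1⟩ hh

/-- The control points adjacent to an edge of which those close to the end points are on the
boundary. -/
theorem cp_one_eq (hM : M.IsSmoothMesh) (hn : 5 ≤ n) {h k : F × Fin 4} {u s : Fin (n + 1)}
    (h0 : (u : ℕ) < 2 → M.IsBdEdge (prev h)) (h1 : n < (u : ℕ) + 2 → M.IsBdEdge (next h))
    (hk : M.IsInnerEdge k) (e : M.cp n h u 1 = M.cp n k s 1) : k = h ∧ s = u := by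
  have e1 := val_one_of_le (n := n) (by omega)
  have er : ((Fin.rev 1 : Fin (n + 1)) : ℕ) = n - 1 := by rw [Fin.val_rev, e1]; omega
  have hs0 : (s : ℕ) = 0 → s = 0 := fun h => Fin.ext h
  have hsn : (s : ℕ) = n → s = Fin.last n := fun h => Fin.ext h
  have hne : (Fin.rev 1 : Fin (n + 1)) ≠ 1 := by rw [Ne, Fin.ext_iff, er, e1]; omega
  rcases Nat.eq_zero_or_pos (u : ℕ) with hu | hu
  · obtain rfl : u = 0 := Fin.ext hu
    have hb := h0 (by omega)
    rw [cp_zero_one_eq] at e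
    rcases Nat.eq_zero_or_pos (s : ℕ) with hs | hs
    · rw [hs0 hs, cp_zero_one_eq] at e
      exact ⟨prev_injective (cp_bd_edge_eq hM hb (by omega) (by omega) e).1, hs0 hs⟩
    · rcases eq_or_lt_of_le (Nat.lt_succ_iff.1 s.2) with hs' | hs'
      · rw [hsn hs', cp_last_one_eq] at e
        exact absurd (cp_bd_edge_eq hM hb (by omega) (by omega) e).2.symm hne
      · exact absurd e.symm (cp_interior_ne_edge hs hs' (by omega) (by omega))
  · rcases eq_or_lt_of_le (Nat.lt_succ_iff.1 u.2) with hu' | hu'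
    · obtain rfl : u = Fin.last n := Fin.ext hu'
      have hb := h1 (by omega)
      rw [cp_last_one_eq] at e
      rcases Nat.eq_zero_or_pos (s : ℕ) with hs | hs
      · rw [hs0 hs, cp_zero_one_eq] at e
        exact absurd (cp_bd_edge_eq hM hb (by omega) (by omega) e).2 hne
      · rcases eq_or_lt_of_le (Nat.lt_succ_iff.1 s.2) with hs' | hs'
        · rw [hsn hs', cp_last_one_eq] at e
          exact ⟨next_injective (cp_bd_edge_eq hM hb (by omega) (by omega) e).1, hsn hs'⟩
        · exact absurd e.symm (cp_interior_ne_edge hs hs' (by omega) (by omega))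
    · rcases Nat.eq_zero_or_pos (s : ℕ) with hs | hs
      · rw [hs0 hs, cp_zero_one_eq] at e
        exact absurd e (cp_interior_ne_edge hu hu' (by omega) (by omega))
      · rcases eq_or_lt_of_le (Nat.lt_succ_iff.1 s.2) with hs' | hs'
        · rw [hsn hs', cp_last_one_eq] at e
          exact absurd e (cp_interior_ne_edge hu hu' (by omega) (by omega))
        · have e' := loc_eq_of_cp_eq hu hu' (by omega) (by omega) hs hs' (by omega) (by omega) e
          rcases loc_one_eq (by omega) e' with h2 | ⟨rfl, h3, -⟩ | ⟨rfl, h3, -⟩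
          · exact h2
          · exact absurd hk (h1 (by omega))
          · exact absurd hk (h0 (by omega))

theorem cp_one_ne_edge (hM : M.IsSmoothMesh) (hn : 5 ≤ n) {h k : F × Fin 4} {u s : Fin (n + 1)}
    (h0 : (u : ℕ) < 2 → M.IsBdEdge (prev h)) (h1 : n < (u : ℕ) + 2 → M.IsBdEdge (next h))
    (hk : M.IsInnerEdge k) : M.cp n h u 1 ≠ M.cp n k s 0 := by
  have e1 := val_one_of_le (n := n) (by omega)
  have er : ((Fin.rev 1 : Fin (n + 1)) : ℕ) = n - 1 := by rw [Fin.val_rev, e1]; omega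
  intro e
  rcases Nat.eq_zero_or_pos (u : ℕ) with hu | hu
  · obtain rfl : u = 0 := Fin.ext hu
    have hb := h0 (by omega)
    rw [cp_zero_one_eq] at e
    exact hb ((cp_bd_edge_eq hM hb (by omega) (by omega) e).1 ▸ hk)
  · rcases eq_or_lt_of_le (Nat.lt_succ_iff.1 u.2) with hu' | hu'
    · obtain rfl : u = Fin.last n := Fin.ext hu'
      have hb := h1 (by omega)
      rw [cp_last_one_eq] at e
      exact hb ((cp_bd_edge_eq hM hb (by omega) (by omega) e).1 ▸ hk)
    · exact cp_interior_ne_edge hu hu' (by omega) (by omega) e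

theorem cp_middle_ne_one (hM : M.IsSmoothMesh) (hn : 3 ≤ n) {h k : F × Fin 4}
    {u s : Fin (n + 1)} (h0 : 2 ≤ (u : ℕ)) (h1 : (u : ℕ) + 2 ≤ n) :
    M.cp n h u 0 ≠ M.cp n k s 1 := by
  have e1 := val_one_of_le (n := n) (by omega)
  have er : ((Fin.rev 1 : Fin (n + 1)) : ℕ) = n - 1 := by rw [Fin.val_rev, e1]; omega
  intro e
  rcases Nat.eq_zero_or_pos (s : ℕ) with hs | hs
  · obtain rfl : s = 0 := Fin.ext hs
    rw [cp_zero_one_eq] at e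
    rcases cp_edge_eq hM (by omega) (by omega) e with ⟨-, h2⟩ | ⟨-, h2⟩
    · have := congrArg Fin.val h2; omega
    · have := congrArg Fin.val h2
      rw [er, Fin.val_rev] at this; omega
  · rcases eq_or_lt_of_le (Nat.lt_succ_iff.1 s.2) with hs' | hs'
    · obtain rfl : s = Fin.last n := Fin.ext hs'
      rw [cp_last_one_eq] at e
      rcases cp_edge_eq hM (by omega) (by omega) e with ⟨-, h2⟩ | ⟨-, h2⟩
      · have := congrArg Fin.val h2; omega
      · have := congrArg Fin.val h2
        rw [e1, Fin.val_rev] at this; omega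
    · exact cp_interior_ne_edge hs hs' (by omega) (by omega) e.symm

variable (M n) in
/-- The control points that occur in the smoothness condition of an edge: on the edge, on its left
and on its right. -/
def edgePt (h h' : F × Fin 4) (q : Fin (n + 1) × Fin 3) : M.CP n :=
  ![M.cp n h q.1 0, M.cp n h q.1 1, M.cp n h' q.1.rev 1] q.2

variable (M n) in
/-- The indices of the left and right control points that occur in the smoothness condition of an
edge, but in no vertex condition. -/
def edgeRange (h : F × Fin 4) : Set (Fin (n + 1)) :=
  {t | 2 ≤ (t : ℕ) ∧ (¬ M.IsBdVertex (M.tgt h) → (t : ℕ) + 2 ≤ n)}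

variable (M n) in
/-- The control points that are changed in order to satisfy the smoothness condition of an edge. -/
def edgeBlock (h : F × Fin 4) : Set (Fin (n + 1) × Fin 3) :=
  {q | (q.2 = 0 → q.1 = Fin.rev 2 ∧ M.IsBdVertex (M.tgt h)) ∧
    (q.2 ≠ 0 → q.1 ∈ M.edgeRange n h)}

/-- A point that may be changed for the sake of one edge occurs in the condition of no other edge.
The second alternative is the same edge with the opposite orientation. This allows the edges to be
treated one after another. -/
theorem edgePt_eq (hM : M.IsSmoothMesh) (hn : 5 ≤ n) {h h' k k' : F × Fin 4} (ho : M.Opp h h')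
    (hv : ¬ M.IsBdVertex (M.org h)) (hok : M.Opp k k') {p q : Fin (n + 1) × Fin 3}
    (hq : q ∈ M.edgeBlock n h) (e : M.edgePt n k k' p = M.edgePt n h h' q) :
    (k = h ∧ p = q) ∨ (k = h' ∧ p.1 = q.1.rev ∧ (q.2 = 0 ↔ p.2 = 0)) := by
  have e2 := val_two_of_le (n := n) (by omega)
  obtain ⟨s, i⟩ := p
  obtain ⟨t, j⟩ := q
  obtain ⟨hq0, hq1⟩ := hq
  have hopp : ∀ {x}, k' = x → M.Opp x k := fun {x} hx => hx ▸ hok.symm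
  have hL : j = 1 → ∀ {x : F × Fin 4} {s : Fin (n + 1)}, M.IsInnerEdge x →
      (M.cp n h t 1 = M.cp n x s 1 → x = h ∧ s = t) ∧ M.cp n h t 1 ≠ M.cp n x s 0 := by
    rintro rfl x s hx
    obtain ⟨h1, h2⟩ := hq1 (by decide : (1 : Fin 3) ≠ 0)
    have hp : (t : ℕ) < 2 → M.IsBdEdge (prev h) := fun h' => by simp only at h1; omega
    have hn' : n < (t : ℕ) + 2 → M.IsBdEdge (next h) := fun h3 => by
      by_cases hb : M.IsBdVertex (M.tgt h)
      · exact hM.edgeToBd_next ⟨ho, hv, hb⟩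
      · have := h2 hb; simp only at this; omega
    exact ⟨cp_one_eq hM hn hp hn' hx, cp_one_ne_edge hM hn hp hn' hx⟩
  have hR : j = 2 → ∀ {x : F × Fin 4} {s : Fin (n + 1)}, M.IsInnerEdge x →
      (M.cp n h' t.rev 1 = M.cp n x s 1 → x = h' ∧ s = t.rev) ∧
        M.cp n h' t.rev 1 ≠ M.cp n x s 0 := by
    rintro rfl x s hx
    obtain ⟨h1, h2⟩ := hq1 (by decide : (2 : Fin 3) ≠ 0)
    simp only at h1 h2
    have hp : ((t.rev : Fin (n + 1)) : ℕ) < 2 → M.IsBdEdge (prev h') := fun h3 => by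
      by_cases hb : M.IsBdVertex (M.tgt h)
      · exact hM.edgeToBd_prev ⟨ho, hv, hb⟩
      · have := h2 hb
        rw [Fin.val_rev] at h3; omega
    have hn' : n < ((t.rev : Fin (n + 1)) : ℕ) + 2 → M.IsBdEdge (next h') := fun h3 => by
      rw [Fin.val_rev] at h3; omega
    exact ⟨cp_one_eq hM hn hp hn' hx, cp_one_ne_edge hM hn hp hn' hx⟩
  have hki := hok.isInnerEdge
  have hki' := hok.symm.isInnerEdge
  have hC : j = 0 → 2 ≤ (t : ℕ) ∧ (t : ℕ) + 2 ≤ n := by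
    intro hj
    have h1 := (hq0 hj).1
    simp only at h1
    rw [h1, Fin.val_rev, e2]
    omega
  fin_cases j
  · obtain ⟨h1, h2⟩ := hC rfl
    fin_cases i <;> simp only [edgePt] at e
    · rcases cp_edge_eq hM (by omega) (by omega) e.symm with ⟨rfl, rfl⟩ | ⟨h3, h4⟩
      · exact Or.inl ⟨rfl, rfl⟩
      · exact Or.inr ⟨hM.opp_unique h3 ho, h4, Iff.rfl⟩
    · exact absurd e.symm (cp_middle_ne_one hM (by omega) h1 h2)
    · exact absurd e.symm (cp_middle_ne_one hM (by omega) h1 h2)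
  · fin_cases i <;> simp only [edgePt] at e
    · exact absurd e.symm (hL rfl hki).2
    · obtain ⟨rfl, rfl⟩ := (hL rfl hki).1 e.symm
      exact Or.inl ⟨rfl, rfl⟩
    · obtain ⟨h1, h2⟩ := (hL rfl hki').1 e.symm
      exact Or.inr ⟨hM.opp_unique (hopp h1) ho, by rw [← h2, Fin.rev_rev],
        iff_of_false (by decide : (1 : Fin 3) ≠ 0) (by decide : (2 : Fin 3) ≠ 0)⟩
  · fin_cases i <;> simp only [edgePt] at e
    · exact absurd e.symm (hR rfl hki).2
    · obtain ⟨h1, h2⟩ := (hR rfl hki).1 e.symm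
      exact Or.inr ⟨h1, h2,
        iff_of_false (by decide : (2 : Fin 3) ≠ 0) (by decide : (1 : Fin 3) ≠ 0)⟩
    · obtain ⟨h1, h2⟩ := (hR rfl hki').1 e.symm
      have h3 := hM.opp_unique (hopp h1) ho.symm
      exact Or.inl ⟨h3, by rw [Fin.rev_injective h2]⟩

theorem exists_extend {ι T : Type*} {E : ι → T} {I : Set ι}
    (hI : ∀ q ∈ I, ∀ p, E p = E q → p = q) (z : T → ℝ) {v : ι → ℝ}
    (hv : ∀ p ∉ I, v p = z (E p)) :
    ∃ z' : T → ℝ, (∀ p, z' (E p) = v p) ∧ ∀ x, (∀ q ∈ I, x ≠ E q) → z' x = z x := by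
  have hinj : Function.Injective fun q : I => E q := fun q q' e =>
    Subtype.ext (hI q' q'.2 q e)
  refine ⟨Function.extend (fun q : I => E q) (fun q => v q) z, fun p => ?_, fun x hx => ?_⟩
  · by_cases hp : p ∈ I
    · exact hinj.extend_apply _ _ ⟨p, hp⟩
    · rw [Function.extend_apply', hv p hp]
      rintro ⟨q, hq⟩
      exact hp (hI q q.2 p hq.symm ▸ q.2)
  · exact Function.extend_apply' _ _ _ fun ⟨q, hq⟩ => hx q q.2 hq.symm

theorem smo_congr {h h' : F × Fin 4} (ho : M.Opp h h') {z z' : M.CP n → ℝ}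
    (e : ∀ q, z (M.edgePt n h h' q) = z' (M.edgePt n h h' q)) : smo z h h' = smo z' h h' := by
  rw [smo_eq_edgePol ho, smo_eq_edgePol ho]
  congr 1
  · exact funext fun t => e (t, 0)
  · exact funext fun t => e (t, 1)
  · exact funext fun t => e (t, 2)

/-- Changing the values at the control points of an edge. -/
theorem exists_edge_update (hM : M.IsSmoothMesh) (hn : 5 ≤ n) {h h' : F × Fin 4}
    (ho : M.Opp h h') (hv : ¬ M.IsBdVertex (M.org h)) {D : Set (M.CP n)} (z : M.CP n → ℝ)
    {γ x y : Fin (n + 1) → ℝ}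
    (hγ : ∀ t, γ t ≠ z (M.cp n h t 0) →
      t = Fin.rev 2 ∧ M.IsBdVertex (M.tgt h) ∧ M.cp n h t 0 ∉ D)
    (hx : ∀ t, x t ≠ z (M.cp n h t 1) → t ∈ M.edgeRange n h ∧ M.cp n h t 1 ∉ D)
    (hy : ∀ t, y t ≠ z (M.cp n h' t.rev 1) → t ∈ M.edgeRange n h ∧ M.cp n h' t.rev 1 ∉ D)
    (h0 : edgePol n ((M.jac h').comp (1 - X)) (M.jac h) (M.crossPol h h') γ x y = 0) :
    ∃ z' : M.CP n → ℝ, smo z' h h' = 0 ∧ (∀ p ∈ D, z' p = z p) ∧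
      ∀ k k', M.Opp k k' → k ≠ h → k ≠ h' → smo z' k k' = smo z k k' := by
  set v : Fin (n + 1) × Fin 3 → ℝ := fun q => ![γ q.1, x q.1, y q.1] q.2 with hvdef
  have hvI : ∀ q, v q ≠ z (M.edgePt n h h' q) →
      q ∈ M.edgeBlock n h ∧ M.edgePt n h h' q ∉ D := by
    rintro ⟨t, i⟩ hq
    fin_cases i
    · obtain ⟨h1, h2, h3⟩ := hγ t hq
      exact ⟨⟨fun _ => ⟨h1, h2⟩, fun h => absurd rfl h⟩, h3⟩
    · obtain ⟨h1, h2⟩ := hx t hq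
      exact ⟨⟨fun h => absurd h (by decide : (1 : Fin 3) ≠ 0), fun _ => h1⟩, h2⟩
    · obtain ⟨h1, h2⟩ := hy t hq
      exact ⟨⟨fun h => absurd h (by decide : (2 : Fin 3) ≠ 0), fun _ => h1⟩, h2⟩
  have hhh : h ≠ h' := fun e => hM.face_ne ho (congrArg Prod.fst e)
  obtain ⟨z', hz1, hz2⟩ := exists_extend (E := M.edgePt n h h') (I := M.edgeBlock n h)
    (fun q hq p e => by
      rcases edgePt_eq hM hn ho hv ho hq e with h1 | h1
      · exact h1.2
      · exact absurd h1.1 hhh) z (v := v)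
    (fun p hp => by
      by_contra h
      exact hp (hvI p h).1)
  refine ⟨z', ?_, fun p hp => ?_, fun k k' hok hk hk' => smo_congr hok fun q => hz2 _ fun q' hq' e => ?_⟩
  · rw [smo_eq_edgePol ho]
    convert h0 using 2
    · exact funext fun t => hz1 (t, 0)
    · exact funext fun t => hz1 (t, 1)
    · exact funext fun t => hz1 (t, 2)
  · by_cases hq : ∃ q, p = M.edgePt n h h' q
    · obtain ⟨q, rfl⟩ := hq
      rw [hz1]
      by_contra h
      exact (hvI q h).2 hp
    · exact hz2 p fun q _ e => hq ⟨q, e⟩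
  · rcases edgePt_eq hM hn ho hv hok hq' e with h1 | h1
    · exact hk h1.1
    · exact hk' h1.1

end Mesh
end SmoothQuadMesh
end

noncomputable section
namespace SmoothQuadMesh
namespace Mesh

variable {V F : Type*} {M : Mesh V F} {n : ℕ}

/-! ### The conditions along the edges -/

/-- For proportional weights δ is 0, and L_t, R_t have proportional columns. The columns for
different t are independent, so one point per pair is dependent. -/
theorem solvable_of_pairs (hn : 3 ≤ n) {h h' : F × Fin 4} {D : Set (M.CP n)} {l r : ℝ[X]}
    (hl : l ≠ 0) {κ : ℝ} (hκ : κ ≠ 0) (hr : r = C κ * l) (hp : M.OneOfEachPair n D h h') :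
    (sideRange n \ M.basicL n D h).ncard + (sideRange n \ M.basicR n D h').ncard + 3 = n + 0 ∧
      SideInjective n l r (sideRange n \ M.basicL n D h) (sideRange n \ M.basicR n D h') := by
  refine ⟨ncard_sideRange_pairs hn (A := {t | M.cp n h t 1 ∈ D})
    (B := {t | M.cp n h' t.rev 1 ∈ D}) hp, ?_⟩
  rw [hr]
  refine sideInjective_of_pairs hl hκ fun t => ?_
  by_cases ht : t ∈ sideRange n
  · rcases hp t ht with h1 | h1
    · exact Or.inl fun h2 => h2.2 ⟨ht, h1.1⟩
    · exact Or.inr fun h2 => h2.2 ⟨ht, h1.1⟩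
  · exact Or.inl fun h2 => ht h2.1

theorem jac_comp_ne_zero (hM : M.IsSmoothMesh) {h : F × Fin 4} (hi : M.IsInnerEdge h) :
    (M.jac h).comp (1 - X) ≠ 0 := fun e => by
  have := coeff_zero_jac_comp_pos hM hi
  rw [e, coeff_zero] at this
  exact lt_irrefl _ this

/-- The dependent side control points of an edge with two inner vertices are determined by the
smoothness condition. -/
theorem TemplateMiddleInner.solvable (hM : M.IsSmoothMesh) (hn : 5 ≤ n) {h h' : F × Fin 4}
    (ho : M.Opp h h') (h1 : ¬ M.IsBdVertex (M.org h)) (h2 : ¬ M.IsBdVertex (M.tgt h))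
    {D : Set (M.CP n)} (hD : M.TemplateMiddleInner n D h h') :
    ∃ δ E l' r' c', IsReduction δ ((M.jac h').comp (1 - X)) (M.jac h) (M.crossPol h h')
      E l' r' c' ∧ c'.natDegree ≤ δ + 1 ∧
      (sideRange n \ M.basicL n D h).ncard + (sideRange n \ M.basicR n D h').ncard + 3 = n + δ ∧
      SideInjective n ((M.jac h').comp (1 - X)) (M.jac h) (sideRange n \ M.basicL n D h)
        (sideRange n \ M.basicR n D h') := by
  obtain ⟨δ, E, l', r', c', H1, H2, -, H3⟩ := exists_isReduction_bilinear hM ho h1 h2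
  refine ⟨δ, E, l', r', c', H1, H2, ?_⟩
  rcases H3 with ⟨hP, rfl, κ, hκ, hr⟩ | ⟨hP, rfl⟩
  · exact solvable_of_pairs (by omega) (jac_comp_ne_zero hM ho.symm.isInnerEdge) hκ hr (hD.2.1 hP)
  · obtain ⟨h3, h4⟩ := hD.2.2 hP
    refine ⟨ncard_sideRange_diff (by omega) (fun _ h => h.1) (fun _ h => h.1) h3 rfl, ?_⟩
    rw [jac_comp_eq_bilinear hM ho h1 h2, jac_eq_bilinear hM h1 h2, map_neg,
      sideInjective_neg_iff]
    exact dependentSolvable_iff.1 h4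

/-- The dependent side control points of an edge with a boundary vertex are determined by the
smoothness condition. -/
theorem TemplateMiddleBd.solvable (hM : M.IsSmoothMesh) (hn : 5 ≤ n) {h h' : F × Fin 4}
    (hb : M.EdgeToBd h h') {D : Set (M.CP n)} (hD : M.TemplateMiddleBd n D h h') :
    ∃ δ E l' r' c', IsReduction δ ((M.jac h').comp (1 - X)) (M.jac h) (M.crossPol h h')
      E l' r' c' ∧ (M.DegreeGapTwo h h' ↔ ¬ c'.natDegree ≤ δ + 1) ∧
      (sideRange n \ M.basicL n D h).ncard + (sideRange n \ M.basicR n D h').ncard + 3 = n + δ ∧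
      SideInjective n ((M.jac h').comp (1 - X)) (M.jac h) (sideRange n \ M.basicL n D h)
        (sideRange n \ M.basicR n D h') := by
  obtain ⟨δ, E, l', r', c', H1, H2, -, H3⟩ := exists_isReduction_bicubic hM hb
  refine ⟨δ, E, l', r', c', H1, H2, ?_⟩
  have key : M.DependentSolvable n 2 (M.lBicubic h h') (M.rBicubic h) D h h' →
      SideInjective n ((M.jac h').comp (1 - X)) (M.jac h) (sideRange n \ M.basicL n D h)
        (sideRange n \ M.basicR n D h') := fun h4 => by
    rw [jac_comp_eq_bicubic hM hb, jac_eq_bicubic hM hb, map_neg, sideInjective_neg_iff]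
    exact dependentSolvable_iff.1 h4
  rcases H3 with ⟨hP, rfl, κ, hκ, hr⟩ | ⟨hP, rfl⟩ | ⟨hP1, hP2, rfl⟩
  · exact solvable_of_pairs (by omega) (jac_comp_ne_zero hM hb.1.symm.isInnerEdge) hκ hr
      (hD.2.2.1 hP)
  · obtain ⟨h3, h4⟩ := hD.2.2.2.1 hP
    exact ⟨ncard_sideRange_diff (by omega) (fun _ h => h.1) (fun _ h => h.1) h3 rfl, key h4⟩
  · obtain ⟨h3, h4⟩ := hD.2.2.2.2 hP1 hP2
    exact ⟨ncard_sideRange_diff (by omega) (fun _ h => h.1) (fun _ h => h.1) h3 rfl, key h4⟩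

theorem sideRange_subset_edgeRange (h : F × Fin 4) : sideRange n ⊆ M.edgeRange n h :=
  fun _ ht => ⟨ht.1, fun _ => ht.2⟩

theorem not_mem_of_mem_sideRange_diff_basicL {D : Set (M.CP n)} {h : F × Fin 4}
    {t : Fin (n + 1)} (ht : t ∈ sideRange n \ M.basicL n D h) : M.cp n h t 1 ∉ D :=
  fun h1 => ht.2 ⟨ht.1, h1⟩

theorem not_mem_of_mem_sideRange_diff_basicR {D : Set (M.CP n)} {h' : F × Fin 4}
    {t : Fin (n + 1)} (ht : t ∈ sideRange n \ M.basicR n D h') : M.cp n h' t.rev 1 ∉ D :=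
  fun h1 => ht.2 ⟨ht.1, h1⟩

/-- The conditions at the two inner vertices supply the double zeros at both ends, the second one
through the reversed edge. The rest is solved by the dependent side middle points. -/
theorem exists_smo_eq_zero_inner (hM : M.IsSmoothMesh) (hn : 5 ≤ n) {h h' : F × Fin 4}
    (ho : M.Opp h h') (h1 : ¬ M.IsBdVertex (M.org h)) (h2 : ¬ M.IsBdVertex (M.tgt h))
    {D : Set (M.CP n)} (hD : M.TemplateMiddleInner n D h h') {z : M.CP n → ℝ}
    (hz : VertexOK z (M.org h)) (hz' : VertexOK z (M.tgt h)) :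
    ∃ z' : M.CP n → ℝ, smo z' h h' = 0 ∧ (∀ p ∈ D, z' p = z p) ∧
      ∀ k k', M.Opp k k' → k ≠ h → k ≠ h' → smo z' k k' = smo z k k' := by
  obtain ⟨δ, E, l', r', c', H1, H2, H3, H4⟩ := hD.solvable hM hn ho h1 h2
  have hX := hz h h' rfl ho
  have hX' := hz' h' h ho.2.symm ho.symm
  rw [ho.smo_eq, smo_eq_edgePol ho] at hX'
  rw [smo_eq_edgePol ho] at hX
  obtain ⟨x, y, hx, hy, hxy⟩ := exists_edgePol_eq_zero (by omega) H1 sdiff_subset sdiff_subset H3 H4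
    (Or.inl H2) hX hX'
  refine exists_edge_update hM hn ho h1 z (fun t ht => absurd rfl ht) (fun t ht => ?_)
    (fun t ht => ?_) hxy
  · have := not_imp_comm.1 (hx t) ht
    exact ⟨sideRange_subset_edgeRange h this.1, not_mem_of_mem_sideRange_diff_basicL this⟩
  · have := not_imp_comm.1 (hy t) ht
    exact ⟨sideRange_subset_edgeRange h this.1, not_mem_of_mem_sideRange_diff_basicR this⟩

theorem TemplateBd.xor {D : Set (M.CP n)} {h h' : F × Fin 4} (hD : M.TemplateBd n D h h') :
    Xor (M.cp n h (Fin.last n) 1 ∈ D) (M.cp n h' (Fin.rev (Fin.last n)) 1 ∈ D) ∧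
      Xor (M.cp n h (Fin.rev 1) 1 ∈ D) (M.cp n h' (Fin.rev (Fin.rev 1)) 1 ∈ D) := by
  rw [Fin.rev_last, Fin.rev_rev]
  exact hD.2.2

theorem inter_sideRange_eq_left (D : Set (M.CP n)) (h : F × Fin 4) :
    {t : Fin (n + 1) | 2 ≤ (t : ℕ) ∧ M.cp n h t 1 ∉ D} ∩ sideRange n =
      sideRange n \ M.basicL n D h := by
  ext t
  exact ⟨fun h1 => ⟨h1.2, fun h2 => h1.1.2 h2.2⟩, fun h1 => ⟨⟨h1.1.1, fun h2 => h1.2 ⟨h1.1, h2⟩⟩, h1.1⟩⟩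

theorem inter_sideRange_eq_right (D : Set (M.CP n)) (h' : F × Fin 4) :
    {t : Fin (n + 1) | 2 ≤ (t : ℕ) ∧ M.cp n h' t.rev 1 ∉ D} ∩ sideRange n =
      sideRange n \ M.basicR n D h' := by
  ext t
  exact ⟨fun h1 => ⟨h1.2, fun h2 => h1.1.2 h2.2⟩, fun h1 => ⟨⟨h1.1.1, fun h2 => h1.2 ⟨h1.1, h2⟩⟩, h1.1⟩⟩

/-- Only the inner end comes with a double zero. The one at the boundary end is produced by the
dependent points with the indices n and n-1, after C_{n-2} has been corrected for the degree. -/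
theorem exists_smo_eq_zero_bd (hM : M.IsSmoothMesh) (hn : 5 ≤ n) {h h' : F × Fin 4}
    (hb : M.EdgeToBd h h') {D : Set (M.CP n)} (hD : M.TemplateMiddleBd n D h h')
    (hD' : M.TemplateBd n D h h') {z : M.CP n → ℝ} (hz : VertexOK z (M.org h)) :
    ∃ z' : M.CP n → ℝ, smo z' h h' = 0 ∧ (∀ p ∈ D, z' p = z p) ∧
      ∀ k k', M.Opp k k' → k ≠ h → k ≠ h' → smo z' k k' = smo z k k' := by
  have ho := hb.1
  have e1 := val_one_of_le (n := n) (by omega)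
  obtain ⟨δ, E, l', r', c', H1, H2, H3, H4⟩ := hD.solvable hM hn hb
  have hX := hz h h' rfl ho
  rw [smo_eq_edgePol ho] at hX
  rw [← inter_sideRange_eq_left, ← inter_sideRange_eq_right] at H3 H4
  obtain ⟨h5, h6⟩ := hD'.xor
  have hpos := coeff_zero_jac_pos hM ho.symm.isInnerEdge
  rw [← comp_one_sub_X_involutive (M.jac h')] at hpos
  obtain ⟨γ, x, y, hγ, hγ', hx, hy, hxy⟩ := exists_edgePol_eq_zero_bd hn H1 H3 H4
    (by
      rcases h5 with h | h
      · exact Or.inr ⟨by rw [Fin.val_last]; omega, h.2⟩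
      · exact Or.inl ⟨by rw [Fin.val_last]; omega, h.2⟩)
    (by
      rcases h6 with h | h
      · exact Or.inr ⟨by rw [Fin.val_rev, e1]; omega, h.2⟩
      · exact Or.inl ⟨by rw [Fin.val_rev, e1]; omega, h.2⟩)
    hpos.ne' (coeff_zero_jac_comp_pos hM ho.isInnerEdge).ne' (coeff_zero_crossPol_comp hM hb) hX
  refine exists_edge_update hM hn ho hb.2.1 z (fun t ht => ?_) (fun t ht => ?_) (fun t ht => ?_) hxy
  · have h1 := not_imp_comm.1 (hγ t) ht
    refine ⟨h1, hb.2.2, ?_⟩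
    rw [h1]
    intro h7
    -- If C_{n-2} were basic, there would be no degree gap and the central values would not have
    -- been changed.
    have h8 := hγ' (not_not.1 fun h9 => hD.2.1.1 h7 (H2.2 h9))
    exact ht (congrFun h8 t)
  · have h1 := not_imp_comm.1 (hx t) ht
    exact ⟨⟨h1.1, fun h => absurd hb.2.2 h⟩, h1.2⟩
  · have h1 := not_imp_comm.1 (hy t) ht
    exact ⟨⟨h1.1, fun h => absurd hb.2.2 h⟩, h1.2⟩

variable [Finite F]

/-- Splines with prescribed basic values exist. -/
theorem IsAlgorithmOutput.exists_mem_FUN [Finite V] (hM : M.IsSmoothMesh) (hn : 5 ≤ n)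
    {D : Set (M.CP n)} (hD : M.IsAlgorithmOutput n D) (y : M.CP n → ℝ) :
    ∃ z ∈ M.FUN n, ∀ p ∈ D, z p = y p := by
  classical
  cases nonempty_fintype F
  obtain ⟨z₀, hz₀, hz₀D⟩ := exists_vertexOK hM hn hD.stage1_VE hD.stage1_DT y
  -- Starting from a function that satisfies the vertex conditions, the edges are corrected one by
  -- one. The vertex conditions are part of the invariant since they are needed for the edges still
  -- to come.
  have key : ∀ s : Finset (F × Fin 4), ∃ z : M.CP n → ℝ,
      (∀ v, ¬ M.IsBdVertex v → VertexOK z v) ∧ (∀ p ∈ D, z p = y p) ∧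
      ∀ h ∈ s, ¬ M.IsBdVertex (M.org h) → smo z h (M.opp h) = 0 := by
    intro s
    induction s using Finset.induction_on with
    | empty => exact ⟨z₀, hz₀, hz₀D, by simp⟩
    | insert h s hs ih =>
      obtain ⟨z, h1, h2, h3⟩ := ih
      by_cases hv : M.IsBdVertex (M.org h)
      · refine ⟨z, h1, h2, fun k hk hkv => ?_⟩
        rcases Finset.mem_insert.1 hk with rfl | hk
        · exact absurd hv hkv
        · exact h3 k hk hkv
      · have ho := opp_spec (isInnerEdge_of_org hv)
        obtain ⟨z', h4, h5, h6⟩ : ∃ z' : M.CP n → ℝ, smo z' h (M.opp h) = 0 ∧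
            (∀ p ∈ D, z' p = z p) ∧
            ∀ k k', M.Opp k k' → k ≠ h → k ≠ M.opp h → smo z' k k' = smo z k k' := by
          by_cases ht : M.IsBdVertex (M.tgt h)
          · exact exists_smo_eq_zero_bd hM hn ⟨ho, hv, ht⟩ (hD.stage3_step2 _ _ ⟨ho, hv, ht⟩)
              (hD.stage3_step1 _ _ ⟨ho, hv, ht⟩) (h1 _ hv)
          · exact exists_smo_eq_zero_inner hM hn ho hv ht (hD.stage2 _ _ ho hv ht) (h1 _ hv)
              (h1 _ ht)
        have h7 : smo z' (M.opp h) h = 0 := by rw [ho.smo_eq, h4, zero_comp]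
        -- Every edge polynomial is either zero now or the same as before, so no condition already
        -- achieved is lost.
        have h8 : ∀ k k', M.Opp k k' → smo z' k k' = 0 ∨ smo z' k k' = smo z k k' := by
          intro k k' hok
          by_cases hk : k = h
          · subst hk
            rw [hM.opp_unique hok ho]
            exact Or.inl h4
          by_cases hk' : k = M.opp h
          · subst hk'
            rw [hM.opp_unique hok ho.symm]
            exact Or.inl h7
          · exact Or.inr (h6 k k' hok hk hk')
        refine ⟨z', fun v hv k k' hk hok => ?_, fun p hp => (h5 p hp).trans (h2 p hp),
          fun k hk hkv => ?_⟩
        · rcases h8 k k' hok with h9 | h9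
          · rw [h9]; exact dvd_zero _
          · rw [h9]; exact h1 v hv k k' hk hok
        · rcases Finset.mem_insert.1 hk with rfl | hk
          · exact h4
          · rcases h8 k _ (opp_spec (isInnerEdge_of_org hkv)) with h9 | h9
            · exact h9
            · rw [h9]; exact h3 k hk hkv
  obtain ⟨z, -, h2, h3⟩ := key Finset.univ
  refine ⟨z, (mem_FUN_iff hM (by omega)).2 fun h h' ho => ?_, h2⟩
  -- Only edges that start at an inner vertex have been treated. An inner edge has at most one
  -- boundary vertex, so one of its orientations is among them.
  by_cases hv : M.IsBdVertex (M.org h)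
  · have hv' : ¬ M.IsBdVertex (M.org h') := by
      rw [← ho.2]
      exact fun h4 => hM.inner_edge h ho.isInnerEdge ⟨hv, h4⟩
    rw [ho.symm.smo_eq, ← hM.opp_eq ho.symm, h3 h' (Finset.mem_univ _) hv', zero_comp]
  · rw [← hM.opp_eq ho]
    exact h3 h (Finset.mem_univ _) hv

/-- Splines that vanish at the basic control points vanish at all control points that take part in
a smoothness condition. -/
theorem IsAlgorithmOutput.eq_zero_of_edge (hM : M.IsSmoothMesh) (hn : 5 ≤ n)
    {D : Set (M.CP n)} (hD : M.IsAlgorithmOutput n D) {z : M.CP n → ℝ} (hz : z ∈ M.FUN n)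
    (h0 : ∀ p ∈ D, z p = 0) {h h' : F × Fin 4} (ho : M.Opp h h')
    (hv : ¬ M.IsBdVertex (M.org h)) (t : Fin (n + 1)) :
    z (M.cp n h t 0) = 0 ∧ z (M.cp n h t 1) = 0 ∧ z (M.cp n h' t.rev 1) = 0 := by
  have e1 := val_one_of_le (n := n) (by omega)
  have e2 := val_two_of_le (n := n) (by omega)
  have hE := (mem_FUN_iff hM (by omega)).1 hz
  have hOK : ∀ v, VertexOK z v := fun v k k' _ hok => by rw [hE k k' hok]; exact dvd_zero _
  have hvert : ∀ {k : F × Fin 4}, ¬ M.IsBdVertex (M.org k) → z (M.cp n k 0 0) = 0 ∧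
      z (M.cp n k 1 0) = 0 ∧ z (M.cp n k 2 0) = 0 ∧ z (M.cp n k 1 1) = 0 := fun {k} hk =>
    eq_zero_of_vertexOK hM hn hk (hD.stage1_VE _ hk) (hD.stage1_DT _ hk) (hOK _) h0 rfl
  have hside : ∀ {k k' : F × Fin 4}, M.Opp k k' → ¬ M.IsBdVertex (M.org k) →
      ∀ t : Fin (n + 1), (t : ℕ) < 2 → z (M.cp n k t 1) = 0 ∧ z (M.cp n k' t.rev 1) = 0 := by
    intro k k' hok hk t ht
    have hnext : ¬ M.IsBdVertex (M.org (next k')) := by rwa [org_next, ← hok.1]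
    rcases (by omega : (t : ℕ) = 0 ∨ (t : ℕ) = 1) with h1 | h1
    · obtain rfl : t = 0 := Fin.ext h1
      have hop := opp_spec (isInnerEdge_prev hk)
      rw [cp_zero_one hop, ← cp_next]
      refine ⟨(hvert ?_).2.1, (hvert hnext).2.1⟩
      rwa [← hop.2, tgt_prev]
    · obtain rfl : t = 1 := Fin.ext (h1.trans e1.symm)
      rw [← cp_next]
      exact ⟨(hvert hk).2.2.2, (hvert hnext).2.2.2⟩
  have hcen : ∀ {k : F × Fin 4}, ¬ M.IsBdVertex (M.org k) → ∀ t : Fin (n + 1), (t : ℕ) < 3 →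
      z (M.cp n k t 0) = 0 := by
    intro k hk t ht
    rcases (by omega : (t : ℕ) = 0 ∨ (t : ℕ) = 1 ∨ (t : ℕ) = 2) with h1 | h1 | h1
    · obtain rfl : t = 0 := Fin.ext h1
      exact (hvert hk).1
    · obtain rfl : t = 1 := Fin.ext (h1.trans e1.symm)
      exact (hvert hk).2.1
    · obtain rfl : t = 2 := Fin.ext (h1.trans e2.symm)
      exact (hvert hk).2.2.1
  have hS := hE h h' ho
  rw [smo_eq_edgePol ho] at hS
  have hrev : ∀ t : Fin (n + 1), ((t.rev : Fin (n + 1)) : ℕ) = n - t := fun t => by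
    rw [Fin.val_rev]; omega
  by_cases hw : M.IsBdVertex (M.tgt h)
  · have hb : M.EdgeToBd h h' := ⟨ho, hv, hw⟩
    have hD1 := hD.stage3_step1 h h' hb
    have hD2 := hD.stage3_step2 h h' hb
    obtain ⟨δ, E, l', r', c', H1, H2, -, H4⟩ := hD2.solvable hM hn hb
    rw [← inter_sideRange_eq_left, ← inter_sideRange_eq_right] at H4
    obtain ⟨h5, h6⟩ := hD1.xor
    have hpos := coeff_zero_jac_pos hM ho.symm.isInnerEdge
    rw [← comp_one_sub_X_involutive (M.jac h')] at hpos
    have hγ : ∀ t ≠ Fin.rev 2, z (M.cp n h t 0) = 0 := by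
      intro t ht
      by_cases h7 : (t : ℕ) < 3
      · exact hcen hv t h7
      by_cases h8 : (t : ℕ) + 3 ≤ n
      · exact h0 _ (hD2.1 t (by omega) h8)
      have h9 : (t : ℕ) ≠ n - 2 := fun h => ht (Fin.ext (by rw [h, hrev, e2]))
      rw [ho.cp_eq]
      rcases (by omega : (t : ℕ) = n ∨ (t : ℕ) = n - 1) with h10 | h10
      · rw [show t.rev = 0 from Fin.ext (by rw [hrev, h10]; simp)]
        exact h0 _ hD1.1
      · rw [show t.rev = 1 from Fin.ext (by rw [hrev, h10, e1]; omega)]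
        exact h0 _ hD1.2.1
    obtain ⟨k1, k2, k3⟩ := eq_zero_of_edgePol_eq_zero_bd hn H1 H4 (fun t ht => ht.1)
      (fun t ht => ht.1)
      (by
        rcases h5 with h | h
        · exact Or.inl fun h7 => h7.2 h.1
        · exact Or.inr fun h7 => h7.2 h.1)
      (by
        rcases h6 with h | h
        · exact Or.inl fun h7 => h7.2 h.1
        · exact Or.inr fun h7 => h7.2 h.1)
      hpos.ne' (coeff_zero_jac_comp_pos hM ho.isInnerEdge).ne' hγ
      (fun h7 => funext fun t => by
        by_cases ht : t = Fin.rev 2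
        · rw [ht]
          exact h0 _ (hD2.2.1.2 fun h8 => H2.1 h8 h7)
        · exact hγ t ht)
      (fun t ht => by
        by_cases h7 : (t : ℕ) < 2
        · exact (hside ho hv t h7).1
        · exact h0 _ (not_not.1 fun h8 => ht ⟨by omega, h8⟩))
      (fun t ht => by
        by_cases h7 : (t : ℕ) < 2
        · exact (hside ho hv t h7).2
        · exact h0 _ (not_not.1 fun h8 => ht ⟨by omega, h8⟩)) hS
    exact ⟨congrFun k1 t, congrFun k2 t, congrFun k3 t⟩
  · have hw' : ¬ M.IsBdVertex (M.org h') := by rwa [← ho.2]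
    have hD2 := hD.stage2 h h' ho hv hw
    obtain ⟨δ, E, l', r', c', H1, H2, -, H4⟩ := hD2.solvable hM hn ho hv hw
    have hγ : (fun t => z (M.cp n h t 0)) = 0 := by
      funext t
      by_cases h7 : (t : ℕ) < 3
      · exact hcen hv t h7
      by_cases h8 : (t : ℕ) + 3 ≤ n
      · exact h0 _ (hD2.1 t (by omega) h8)
      · rw [ho.cp_eq]
        exact hcen hw' _ (by rw [hrev]; omega)
    rw [hγ] at hS
    have hside' := fun t : Fin (n + 1) => hside ho.symm hw' t.rev
    simp only [Fin.rev_rev, hrev] at hside'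
    obtain ⟨k2, k3⟩ := eq_zero_of_edgePol_eq_zero (by omega) H4 (fun t ht => by
        by_cases h7 : t ∈ sideRange n
        · exact h0 _ (not_not.1 fun h8 => ht ⟨h7, fun h9 => h8 h9.2⟩)
        · by_cases h8 : (t : ℕ) < 2
          · exact (hside ho hv t h8).1
          · have : ¬ ((t : ℕ) + 2 ≤ n) := fun h9 => h7 ⟨by omega, h9⟩
            exact (hside' t (by omega)).2)
      (fun t ht => by
        by_cases h7 : t ∈ sideRange n
        · exact h0 _ (not_not.1 fun h8 => ht ⟨h7, fun h9 => h8 h9.2⟩)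
        · by_cases h8 : (t : ℕ) < 2
          · exact (hside ho hv t h8).2
          · have : ¬ ((t : ℕ) + 2 ≤ n) := fun h9 => h7 ⟨by omega, h9⟩
            exact (hside' t (by omega)).1) hS
    exact ⟨congrFun hγ t, congrFun k2 t, congrFun k3 t⟩

/-- A control point that is not free lies on or next to an inner edge; oriented from an inner
vertex, that edge forces the value to be zero. -/
theorem IsAlgorithmOutput.isDetermining (hM : M.IsSmoothMesh) (hn : 5 ≤ n)
    {D : Set (M.CP n)} (hD : M.IsAlgorithmOutput n D) : M.IsDetermining n D := by
  intro z hz h0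
  funext p
  by_cases hp : M.IsFree n p
  · exact h0 p (hD.free p hp)
  · simp only [IsFree, not_forall, not_and_or, not_not] at hp
    obtain ⟨h, hi, t, ht⟩ := hp
    have ho := opp_spec hi
    by_cases hv : M.IsBdVertex (M.org h)
    · have hv' : ¬ M.IsBdVertex (M.org (M.opp h)) := by
        rw [← ho.2]
        exact fun h4 => hM.inner_edge h hi ⟨hv, h4⟩
      have := hD.eq_zero_of_edge hM hn hz h0 ho.symm hv' t.rev
      rw [Fin.rev_rev] at this
      rcases ht with rfl | rfl
      · rw [ho.cp_eq]; exact this.1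
      · exact this.2.2
    · have := hD.eq_zero_of_edge hM hn hz h0 ho hv t
      rcases ht with rfl | rfl
      · exact this.1
      · exact this.2.1

end Mesh
end SmoothQuadMesh
end

noncomputable section
namespace SmoothQuadMesh
namespace Mesh

variable {V F : Type*} {M : Mesh V F} {n : ℕ} [Finite F]

/-! ### Minimal determining sets -/

instance : Finite (M.CP n) := inferInstanceAs (Finite (Quot (M.Glued n)))

/-- The spline space as a linear subspace. -/
def funSpace (hM : M.IsSmoothMesh) (hn : 1 ≤ n) : Submodule ℝ (M.CP n → ℝ) where
  carrier := M.FUN n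
  add_mem' {z z'} h h' := (mem_FUN_iff hM hn).2 fun k k' ho => by
    rw [smo_add, (mem_FUN_iff hM hn).1 h k k' ho, (mem_FUN_iff hM hn).1 h' k k' ho, add_zero]
  zero_mem' := (mem_FUN_iff hM hn).2 fun k k' ho => by
    have := smo_smul (n := n) (M := M) 0 0 k k'
    rwa [zero_smul, zero_smul] at this
  smul_mem' c z h := (mem_FUN_iff hM hn).2 fun k k' ho => by
    rw [smo_smul, (mem_FUN_iff hM hn).1 h k k' ho, smul_zero]

/-- The values at the points of a set. -/
def evalOn (hM : M.IsSmoothMesh) (hn : 1 ≤ n) (D : Set (M.CP n)) :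
    funSpace hM hn →ₗ[ℝ] (D → ℝ) where
  toFun z p := z.1 p
  map_add' _ _ := rfl
  map_smul' _ _ := rfl

theorem finrank_fun_eq_ncard (D : Set (M.CP n)) : Module.finrank ℝ (D → ℝ) = D.ncard := by
  have := Fintype.ofFinite D
  rw [Module.finrank_fintype_fun_eq_card, ← Nat.card_eq_fintype_card]
  rfl

/-- Determining means that evaluation on the set is injective on the spline space. -/
theorem IsDetermining.finrank_le (hM : M.IsSmoothMesh) (hn : 1 ≤ n) {D : Set (M.CP n)}
    (hD : M.IsDetermining n D) : Module.finrank ℝ (funSpace hM hn) ≤ D.ncard := by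
  rw [← finrank_fun_eq_ncard]
  refine LinearMap.finrank_le_finrank_of_injective (f := evalOn hM hn D) ?_
  rw [injective_iff_map_eq_zero]
  intro z hz
  exact Subtype.ext (hD z.1 z.2 fun p hp => congrFun hz ⟨p, hp⟩)

theorem IsDetermining.isMDS (hM : M.IsSmoothMesh) (hn : 1 ≤ n) {D : Set (M.CP n)}
    (hD : M.IsDetermining n D) (hcard : D.ncard ≤ Module.finrank ℝ (funSpace hM hn)) :
    M.IsMDS n D :=
  ⟨hD, fun _ hD' => hcard.trans (hD'.finrank_le hM hn)⟩

/-- Every output of the algorithm is a minimal determining set. -/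
theorem IsAlgorithmOutput.isMDS [Finite V] (hM : M.IsSmoothMesh) (hn : 5 ≤ n)
    {D : Set (M.CP n)} (hD : M.IsAlgorithmOutput n D) : M.IsMDS n D := by
  classical
  refine (hD.isDetermining hM hn).isMDS hM (by omega : 1 ≤ n) ?_
  rw [← finrank_fun_eq_ncard]
  -- Basic values can be prescribed arbitrarily, so evaluation is onto and `D` has at most as many
  -- points as the dimension.
  refine LinearMap.finrank_le_finrank_of_surjective (f := evalOn hM (by omega) D) fun y => ?_
  obtain ⟨z, hz, hzy⟩ := hD.exists_mem_FUN hM hn fun p => if h : p ∈ D then y ⟨p, h⟩ else 0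
  refine ⟨⟨z, hz⟩, funext fun p => ?_⟩
  have := hzy p p.2
  rw [dif_pos p.2] at this
  exact this

/-- Every set of control points is fitted by a minimal determining set. -/
theorem exists_isMDS_fits (hM : M.IsSmoothMesh) (hn : 1 ≤ n) (P : Set (M.CP n)) :
    ∃ D : Set (M.CP n), M.IsMDS n D ∧ M.Fits n D P := by
  let e : M.CP n → Module.Dual ℝ (funSpace hM hn) := fun p =>
    (LinearMap.proj p).comp (funSpace hM hn).subtype
  have key : ∀ {z z' : M.CP n → ℝ} {S : Set (M.CP n)} {p : M.CP n}, z ∈ M.FUN n → z' ∈ M.FUN n →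
      e p ∈ Submodule.span ℝ (e '' S) → (∀ q ∈ S, z q = z' q) → z p = z' p := by
    intro z z' S p hz hz' hp hS
    have : ∀ f ∈ Submodule.span ℝ (e '' S), f ⟨z, hz⟩ = f ⟨z', hz'⟩ := by
      intro f hf
      induction hf using Submodule.span_induction with
      | mem f hf =>
        obtain ⟨q, hq, rfl⟩ := hf
        exact hS q hq
      | zero => rfl
      | add f g _ _ h1 h2 => rw [LinearMap.add_apply, LinearMap.add_apply, h1, h2]
      | smul c f _ h1 => rw [LinearMap.smul_apply, LinearMap.smul_apply, h1]
    exact this _ hp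
  -- A maximal independent set of evaluation functionals within `P`, then its extension within all
  -- control points. The functionals of `P` lie in the span of those of `B`, which gives the fit.
  obtain ⟨B, hBP, -, hB, hBi⟩ := exists_linearIndepOn_extension
    (linearIndepOn_empty ℝ e) (empty_subset P)
  obtain ⟨D, -, hBD, hD, hDi⟩ := exists_linearIndepOn_extension hBi (subset_univ B)
  refine ⟨D, IsDetermining.isMDS hM hn (fun z hz h0 => ?_) ?_, fun p hp => ?_⟩
  · funext p
    exact key hz (funSpace hM hn).zero_mem (hD ⟨p, mem_univ p, rfl⟩) h0
  · have := Fintype.ofFinite D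
    have h1 := LinearIndependent.fintype_card_le_finrank hDi
    rw [Subspace.dual_finrank_eq, ← Nat.card_eq_fintype_card] at h1
    exact h1
  · refine or_iff_not_imp_left.2 fun _ z hz z' hz' hq => key hz hz' (hB ⟨p, hp, rfl⟩) ?_
    exact fun q hqB => hq q ⟨hBD hqB, hBP hqB⟩

end Mesh
end SmoothQuadMesh
end

noncomputable section
namespace SmoothQuadMesh

/-! ### Selection of the dependent side control points -/

theorem exists_bz_eq_of_doubleZero_dvd {n : ℕ} (hn : 4 ≤ n) {p : ℝ[X]}
    (hp : X ^ 2 * (1 - X) ^ 2 ∣ p) (hdeg : p.natDegree ≤ n) :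
    ∃ x : Fin (n + 1) → ℝ, (∀ t ∉ Mesh.sideRange n, x t = 0) ∧ bz n x = p := by
  obtain ⟨x, rfl⟩ := exists_bz hdeg
  refine ⟨x, ?_, rfl⟩
  have h0 := X_sq_dvd_iff.1 (dvd_of_mul_right_dvd hp)
  have h1 := X_sq_dvd_iff.1 (one_sub_X_sq_dvd_iff.1 (dvd_of_mul_left_dvd hp))
  have hn0 : (n : ℝ) ≠ 0 := by positivity
  rw [coeff_bz_zero, coeff_bz_one n (by omega), mul_eq_zero, or_iff_right hn0, sub_eq_zero] at h0
  rw [bz_comp_one_sub_X, coeff_bz_zero, coeff_bz_one n (by omega), mul_eq_zero,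
    or_iff_right hn0, sub_eq_zero] at h1
  have e1 : ((1 : Fin (n + 1)) : ℕ) = 1 := Nat.mod_eq_of_lt (show 1 < n + 1 by omega)
  intro t ht
  have ht' : ¬ (2 ≤ (t : ℕ) ∧ (t : ℕ) + 2 ≤ n) := ht
  have : t = 0 ∨ t = 1 ∨ t = Fin.rev 0 ∨ t = Fin.rev 1 := by
    simp only [Fin.ext_iff, Fin.val_rev, e1, Fin.val_zero]
    omega
  rcases this with rfl | rfl | rfl | rfl
  exacts [h0.1, h0.2.trans h0.1, h1.1, h1.2.trans h1.1]

theorem SideInjective.mul {n : ℕ} {l r D : ℝ[X]} {A B : Set (Fin (n + 1))} (hD : D ≠ 0)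
    (h : SideInjective n l r A B) : SideInjective n (D * l) (D * r) A B := by
  intro x y hx hy e
  refine h x y hx hy (mul_left_cancel₀ hD ?_)
  rw [mul_zero, ← e]; ring

/-- The columns of the side middle coefficients contain a basis. -/
theorem exists_sideInjective {n δ : ℕ} (hn : 4 ≤ n) {l r : ℝ[X]} (hl : l.natDegree ≤ δ)
    (hr : r.natDegree ≤ δ) (hs : Spans δ (n - 4) l r) :
    ∃ A B : Set (Fin (n + 1)), A ⊆ Mesh.sideRange n ∧ B ⊆ Mesh.sideRange n ∧
      A.ncard + B.ncard + 3 = n + δ ∧ SideInjective n l r A B := by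
  classical
  let v : Fin (n + 1) ⊕ Fin (n + 1) → ℝ[X] :=
    Sum.elim (fun t => l * bernsteinPolynomial ℝ n t) fun t => r * bernsteinPolynomial ℝ n t
  have hsum : ∀ x y : Fin (n + 1) → ℝ,
      ∑ i, (Sum.elim x y i) • v i = l * bz n x + r * bz n y := by
    intro x y
    rw [Fintype.sum_sum_type, bz_apply, bz_apply, Finset.mul_sum, Finset.mul_sum]
    congr 1 <;> refine Finset.sum_congr rfl fun t _ => ?_ <;>
      simp only [v, Sum.elim_inl, Sum.elim_inr, smul_eq_C_mul] <;> ring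
  let S : Set (Fin (n + 1) ⊕ Fin (n + 1)) :=
    {i | Sum.elim (· ∈ Mesh.sideRange n) (· ∈ Mesh.sideRange n) i}
  -- The dependent points are a maximal independent set of columns; their number follows once the
  -- columns are known to span.
  obtain ⟨b, hbS, -, hspan, hli⟩ :=
    exists_linearIndepOn_extension (linearIndepOn_empty ℝ v) (empty_subset S)
  refine ⟨Sum.inl ⁻¹' b, Sum.inr ⁻¹' b, fun t ht => hbS ht, fun t ht => hbS ht, ?_, ?_⟩
  · have hT : Submodule.span ℝ (v '' b) = doubleZeroLT (n + δ - 3) := by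
      refine le_antisymm (Submodule.span_le.2 ?_) ?_
      · rintro _ ⟨i, hi, rfl⟩
        have hside : ∀ {w : ℝ[X]} {t : Fin (n + 1)}, w.natDegree ≤ δ → t ∈ Mesh.sideRange n →
            w * bernsteinPolynomial ℝ n t ∈ doubleZeroLT (n + δ - 3) := by
          intro w t hw ht
          have := mul_bz_mem_doubleZeroLT (n := n) (m := n + δ - 3) (by omega) hw
            (x := Pi.single t 1) fun s hs => Pi.single_eq_of_ne (fun e => hs (by rwa [e])) _
          rwa [bz_single, C_1, one_mul] at this
        rcases i with t | t
        · exact hside hl (hbS hi)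
        · exact hside hr (hbS hi)
      · rintro _ ⟨q, hq, rfl⟩
        have hq' : q.natDegree ≤ n - 4 + δ := by
          rw [SetLike.mem_coe, show n + δ - 3 = n - 4 + δ + 1 by omega,
            mem_degreeLT_succ_iff] at hq
          exact hq
        -- Write the cofactor of X²(1-X)² as a combination of l and r with coefficients of degree at
        -- most n-4. Multiplied by X²(1-X)², these coefficients have degree at most n and double
        -- zeros at both ends, hence involve only side middle Bernstein polynomials.
        obtain ⟨a, a', ha, ha', e⟩ := mem_combos_iff.1 (hs q hq')
        have hdeg : ∀ {a : ℝ[X]}, a.natDegree ≤ n - 4 →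
            (X ^ 2 * (1 - X) ^ 2 * a).natDegree ≤ n := fun ha =>
          natDegree_mul_le.trans (by rw [natDegree_doubleZero]; omega)
        obtain ⟨x, hx, ex⟩ := exists_bz_eq_of_doubleZero_dvd hn (dvd_mul_right _ a) (hdeg ha)
        obtain ⟨y, hy, ey⟩ := exists_bz_eq_of_doubleZero_dvd hn (dvd_mul_right _ a') (hdeg ha')
        have e2 : LinearMap.mulLeft ℝ (X ^ 2 * (1 - X) ^ 2 : ℝ[X]) q =
            ∑ i, (Sum.elim x y i) • v i := by
          rw [hsum, ex, ey, LinearMap.mulLeft_apply, ← e]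
          ring
        rw [e2]
        refine Submodule.sum_mem _ fun i _ => ?_
        by_cases hi : i ∈ S
        · exact Submodule.smul_mem _ _ (hspan ⟨i, hi, rfl⟩)
        · have : Sum.elim x y i = 0 := by
            rcases i with t | t
            exacts [hx t hi, hy t hi]
          rw [this, zero_smul]
          exact Submodule.zero_mem _
    have hrange : v '' b = Set.range fun i : b => v i := image_eq_range v b
    have h1 := finrank_doubleZeroLT (n + δ - 3)
    rw [← hT, hrange, finrank_span_eq_card (b := fun i : b => v i) hli, ← Nat.card_eq_fintype_card,
      Nat.card_coe_set_eq] at h1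
    have h2 : b = Sum.inl '' (Sum.inl ⁻¹' b) ∪ Sum.inr '' (Sum.inr ⁻¹' b) :=
      (image_preimage_inl_union_image_preimage_inr b).symm
    have h3 : b.ncard = (Sum.inl ⁻¹' b).ncard + (Sum.inr ⁻¹' b).ncard := by
      conv_lhs => rw [h2]
      rw [ncard_union_eq, ncard_image_of_injective _ Sum.inl_injective,
        ncard_image_of_injective _ Sum.inr_injective]
      rw [disjoint_left]
      rintro _ ⟨a, -, rfl⟩ ⟨c, -, e⟩
      exact Sum.inr_ne_inl e
    omega
  · intro x y hx hy e
    rw [linearIndepOn_iff] at hli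
    have := hli (Finsupp.equivFunOnFinite.symm (Sum.elim x y)) ?_ ?_
    · have h' : Sum.elim x y = 0 := by
        funext i
        exact DFunLike.congr_fun this i
      exact ⟨funext fun t => congrFun h' (Sum.inl t), funext fun t => congrFun h' (Sum.inr t)⟩
    · rw [Finsupp.mem_supported']
      rintro (t | t) ht
      exacts [hx t ht, hy t ht]
    · rw [← e, ← hsum, Finsupp.linearCombination_apply, Finsupp.sum_fintype _ _ (by simp)]
      rfl

/-- The set of dependent side coefficients can be chosen. -/
theorem IsReduction.exists_sideInjective {n δ : ℕ} (hn : 4 ≤ n) {l r c D l' r' c' : ℝ[X]}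
    (H : IsReduction δ l r c D l' r' c') (hs : Spans δ (n - 4) l' r') :
    ∃ A B : Set (Fin (n + 1)), A ⊆ Mesh.sideRange n ∧ B ⊆ Mesh.sideRange n ∧
      A.ncard + B.ncard + 3 = n + δ ∧ SideInjective n l r A B := by
  obtain ⟨A, B, hA, hB, h1, h2⟩ := SmoothQuadMesh.exists_sideInjective hn H.deg_l H.deg_r hs
  refine ⟨A, B, hA, hB, h1, ?_⟩
  rw [H.hl, H.hr]
  exact h2.mul H.ne_zero

/-- Reversing an edge interchanges left and right and reflects the parameter. -/
theorem SideInjective.comp {n : ℕ} {l r : ℝ[X]} {A B : Set (Fin (n + 1))}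
    (h : SideInjective n l r A B) : SideInjective n (r.comp (1 - X)) (l.comp (1 - X))
      (Fin.rev ⁻¹' B) (Fin.rev ⁻¹' A) := by
  intro x y hx hy e
  have h1 := h (fun t => y t.rev) (fun t => x t.rev)
    (fun t ht => hy _ fun h => ht (by rwa [mem_preimage, Fin.rev_rev] at h))
    (fun t ht => hx _ fun h => ht (by rwa [mem_preimage, Fin.rev_rev] at h)) (by
      rw [← bz_comp_one_sub_X, ← bz_comp_one_sub_X]
      have h2 := congrArg (fun p : ℝ[X] => p.comp (1 - X)) e
      simp only [add_comp, mul_comp, comp_one_sub_X_involutive, zero_comp] at h2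
      rw [add_comm]
      exact h2)
  constructor
  · funext t
    have := congrFun h1.2 t.rev
    rwa [Fin.rev_rev] at this
  · funext t
    have := congrFun h1.1 t.rev
    rwa [Fin.rev_rev] at this

namespace Mesh

variable {V F : Type*} {M : Mesh V F} {n : ℕ}

theorem rev_mem_sideRange {t : Fin (n + 1)} : t.rev ∈ sideRange n ↔ t ∈ sideRange n := by
  simp only [sideRange, mem_ofPred_eq, Fin.val_rev]
  omega

theorem basicL_eq_preimage (D : Set (M.CP n)) (h : F × Fin 4) :
    M.basicL n D h = Fin.rev ⁻¹' M.basicR n D h := by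
  ext t
  simp only [basicL, basicR, mem_preimage, mem_ofPred_eq, rev_mem_sideRange, Fin.rev_rev]

theorem basicR_eq_preimage (D : Set (M.CP n)) (h : F × Fin 4) :
    M.basicR n D h = Fin.rev ⁻¹' M.basicL n D h := by
  ext t
  simp only [basicL, basicR, mem_preimage, mem_ofPred_eq, rev_mem_sideRange]

theorem ncard_basicL_eq (D : Set (M.CP n)) (h : F × Fin 4) :
    (M.basicL n D h).ncard = (M.basicR n D h).ncard := by
  rw [basicL_eq_preimage]
  exact ncard_preimage_of_injective_subset_range Fin.rev_injective fun t _ =>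
    ⟨t.rev, Fin.rev_rev t⟩

theorem lBilinear_swap {h h' : F × Fin 4} (ho : M.Opp h h') (i : Fin 2) :
    M.lBilinear h' h i = -M.rBilinear h i.rev := by
  have e : (Fin.rev 1 : Fin 2) = 0 := rfl
  have e0 : (Fin.rev 0 : Fin 2) = 1 := rfl
  fin_cases i <;> simp [lBilinear, rBilinear, e, e0, ho.dir_eq, ho.1, ho.2, cross] <;> ring

theorem rBilinear_swap {h h' : F × Fin 4} (ho : M.Opp h h') (i : Fin 2) :
    M.rBilinear h' i = -M.lBilinear h h' i.rev := by
  rw [lBilinear_swap ho.symm, neg_neg, Fin.rev_rev]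

/-- The conditions on an edge with two inner vertices do not depend on its orientation. -/
theorem TemplateMiddleInner.symm {h h' : F × Fin 4} (ho : M.Opp h h') {D : Set (M.CP n)}
    (hD : M.TemplateMiddleInner n D h h') : M.TemplateMiddleInner n D h' h := by
  have e : (Fin.rev 1 : Fin 2) = 0 := rfl
  have e0 : (Fin.rev 0 : Fin 2) = 1 := rfl
  have hP : M.ProjectionsRelation h' h ↔ M.ProjectionsRelation h h' := by
    unfold ProjectionsRelation
    rw [lBilinear_swap ho, lBilinear_swap ho, rBilinear_swap ho, rBilinear_swap ho, e, e0]
    constructor <;> intro h <;> linarith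
  refine ⟨fun t h1 h2 => ?_, fun h1 t ht => ?_, fun h1 => ?_⟩
  · rw [ho.symm.cp_eq]
    exact hD.1 _ (by rw [Fin.val_rev]; omega) (by rw [Fin.val_rev]; omega)
  · have := hD.2.1 (hP.1 h1) t.rev (rev_mem_sideRange.2 ht)
    rw [Fin.rev_rev] at this
    exact this.symm
  · obtain ⟨h2, h3⟩ := hD.2.2 fun h => h1 (hP.2 h)
    refine ⟨by rw [ncard_basicL_eq D h', ← ncard_basicL_eq D h]; omega, ?_⟩
    rw [dependentSolvable_iff] at h3 ⊢
    have h4 := h3.comp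
    have key : ∀ w w' : Fin 2 → ℝ, (∀ i, w i = -w' i.rev) → bz 1 w = -(bz 1 w').comp (1 - X) := by
      intro w w' hw
      rw [bz_comp_one_sub_X, ← map_neg]
      exact congrArg _ (funext hw)
    have h5 : ∀ {l r : ℝ[X]} {A B : Set (Fin (n + 1))}, SideInjective n l r A B →
        SideInjective n (-l) (-r) A B := by
      intro l r A B h x y hx hy e
      exact h x y hx hy (by linear_combination -e)
    have h6 : ∀ s : Set (Fin (n + 1)), Fin.rev ⁻¹' (sideRange n \ s) =
        sideRange n \ (Fin.rev ⁻¹' s) := fun s => by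
      ext t
      simp only [mem_preimage, mem_sdiff, rev_mem_sideRange]
    rw [key _ _ (lBilinear_swap ho), key _ _ (rBilinear_swap ho), basicL_eq_preimage D h',
      basicR_eq_preimage D h, ← h6, ← h6]
    exact h5 h4

end Mesh
end SmoothQuadMesh
end

noncomputable section
namespace SmoothQuadMesh

theorem sq_zero_injective {s s' : Fin 4} {a b : ℝ} (ha : 0 < a) (ha' : a < 1)
    (h : sq s a 0 = sq s' b 0) : s = s' := by
  fin_cases s <;> fin_cases s' <;> simp only [sq, Prod.mk.injEq] at h <;>
    first | rfl | (exfalso; linarith [h.1, h.2])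

/-- From a to b and from b to c there are left turns of less than π each. If c is colinear with a,
the total turn is π, so c points in the opposite direction. -/
theorem exists_eq_smul_of_cross_eq_zero {a b c : ℝ × ℝ} (h1 : 0 < cross a b) (h2 : 0 < cross b c)
    (h3 : cross c a = 0) : ∃ μ : ℝ, μ < 0 ∧ c = μ • a := by
  have key : cross a b • c = (-cross b c) • a := by
    have e : c.1 * a.2 = c.2 * a.1 := by unfold cross at h3; linarith
    ext
    · simp only [cross, Prod.smul_fst, smul_eq_mul]
      linear_combination (-b.1) * e
    · simp only [cross, Prod.smul_snd, smul_eq_mul]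
      linear_combination (-b.2) * e
  refine ⟨-cross b c / cross a b, div_neg_of_neg_of_pos (neg_neg_of_pos h2) h1, ?_⟩
  rw [div_eq_inv_mul, mul_smul, ← key, inv_smul_smul₀ h1.ne']

namespace Mesh

variable {V F : Type*} {M : Mesh V F} {n : ℕ}

/-! ### Choices at an inner vertex -/

theorem dir_ne_zero (hM : M.IsSmoothMesh) (h : F × Fin 4) : M.dir h ≠ 0 := fun e =>
  hM.org_ne_tgt h (hM.pos_injective (sub_eq_zero.1 e).symm)

/-- The point of the edge `h` with the parameter `t`. -/
theorem pos_add_smul_dir_mem_element {h : F × Fin 4} (hs : M.IsStraight h) {t : ℝ}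
    (ht : t ∈ Icc (0 : ℝ) 1) : M.pos (M.org h) + t • M.dir h ∈ M.element h.1 := by
  rw [element_eq_image, ← M.paramL_zero hs t, paramL_eq_paramP]
  exact mem_image_of_mem _ (sq_mem h.2 ht ⟨le_rfl, zero_le_one⟩)

theorem eq_of_mem_segment (hM : M.IsSmoothMesh) {h k : F × Fin 4} (hs : M.IsStraight h)
    (hk : M.IsStraight k) (hf : h.1 = k.1) {t : ℝ} (ht : 0 < t) (ht' : t < 1)
    (hm : M.pos (M.org h) + t • M.dir h ∈ segment ℝ (M.pos (M.org k)) (M.pos (M.tgt k))) :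
    h = k := by
  rw [segment_eq_image'] at hm
  obtain ⟨b, hb, e⟩ := hm
  have e' : M.paramL k b 0 = M.paramL h t 0 := by
    rw [M.paramL_zero hk, M.paramL_zero hs]; exact e
  rw [paramL_eq_paramP, paramL_eq_paramP, ← hf] at e'
  have hz : (0 : ℝ) ∈ Icc (0 : ℝ) 1 := ⟨le_rfl, zero_le_one⟩
  have := hM.paramP_injOn h.1 (sq_mem k.2 hb hz) (sq_mem h.2 ⟨ht.le, ht'.le⟩ hz) e'
  exact Prod.ext hf (sq_zero_injective ht ht' this.symm)

/-- Two edges at a vertex do not have the same direction. -/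
theorem eq_of_dir_eq_smul (hM : M.IsSmoothMesh) {h k : F × Fin 4} (hv : M.org h = M.org k)
    (hs : M.IsStraight h) (hs' : M.IsStraight k) {μ : ℝ} (hμ : 0 < μ)
    (e : M.dir k = μ • M.dir h) : h = k := by
  by_cases hf : h.1 = k.1
  · refine Prod.ext hf (hM.corner_injective h.1 ?_)
    rw [show M.corner h.1 h.2 = M.org h from rfl, hv, hf]
    rfl
  exfalso
  set t := min 1 μ with htdef
  have ht : 0 < t := lt_min one_pos hμ
  have ht1 : t ≤ 1 := min_le_left _ _
  have htμ : t / μ ≤ 1 := (div_le_one hμ).2 (min_le_right _ _)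
  have hmem : ∀ s : ℝ, 0 ≤ s → s ≤ t →
      M.pos (M.org h) + s • M.dir h ∈ M.element h.1 ∩ M.element k.1 := by
    intro s hs0 hst
    refine ⟨pos_add_smul_dir_mem_element hs ⟨hs0, hst.trans ht1⟩, ?_⟩
    have := pos_add_smul_dir_mem_element hs' (t := s / μ) ⟨by positivity,
      (div_le_div_of_nonneg_right hst hμ.le).trans htμ⟩
    rwa [e, smul_smul, div_mul_cancel₀ _ hμ.ne', ← hv] at this
  -- The two elements contain a common initial piece of the edges, so they share more than one point
  -- and meet in an edge. This common edge contains inner points of both h and k; hence h and k are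
  -- its two orientations, which do not have the same origin.
  rcases hM.inter h.1 k.1 hf with h0 | ⟨a, b, -, h0⟩ | ⟨a, b, ho, h0⟩ <;> rw [h0] at hmem
  · exact hmem 0 le_rfl ht.le
  · have e1 := (mem_singleton_iff.1 (hmem 0 le_rfl ht.le)).trans
      (mem_singleton_iff.1 (hmem t ht.le le_rfl)).symm
    rw [add_right_inj, zero_smul] at e1
    exact (smul_ne_zero ht.ne' (dir_ne_zero hM h)) e1.symm
  · have h2 := hmem (t / 2) (by positivity) (by linarith)
    have e1 := eq_of_mem_segment hM (k := (h.1, a)) hs (hM.isStraight ho.isInnerEdge) rfl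
      (by positivity) (by linarith) h2
    rw [← e1] at ho h2
    have hseg : segment ℝ (M.pos (M.org h)) (M.pos (M.tgt h)) =
        segment ℝ (M.pos (M.org (k.1, b))) (M.pos (M.tgt (k.1, b))) := by
      rw [segment_symm, ho.1, ho.2]
    rw [hseg] at h2
    have h3 : M.pos (M.org k) + (t / μ / 2) • M.dir k ∈
        segment ℝ (M.pos (M.org (k.1, b))) (M.pos (M.tgt (k.1, b))) := by
      rw [e, smul_smul, ← hv, show t / μ / 2 * μ = t / 2 by field_simp]
      exact h2
    have e2 := eq_of_mem_segment hM (k := (k.1, b)) hs' (hM.isStraight ho.symm.isInnerEdge) rfl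
      (by positivity) (by linarith) h3
    rw [← e2] at ho
    exact hM.org_ne_tgt k (hv.symm.trans ho.1)

variable [Finite F]

/-- If the neighbours of every edge were colinear, two steps of the rotation would reverse the
direction and four would restore it, so the valence would divide 4. Valence 2 would make an edge
opposite to itself, and valence 4 gives a regular 4-vertex. -/
theorem exists_not_neighboursColinear (hM : M.IsSmoothMesh) {v : V} (hv : ¬ M.IsBdVertex v)
    (heven : Even (M.valence v)) (hreg : ¬ M.IsRegularFour v) :
    ∃ k, M.org k = v ∧ ¬ M.NeighboursColinear k := by
  by_contra hcon
  push Not at hcon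
  obtain ⟨h, hh⟩ := hM.vertex_used v
  let x : M.Star v := ⟨h, hh⟩
  have hst : ∀ x : M.Star v, M.IsStraight x.1 := fun x =>
    hM.isStraight (isInnerEdge_of_org (by rw [x.2]; exact hv))
  have key : ∀ x : M.Star v, ∃ μ : ℝ, μ < 0 ∧
      M.dir (rot hM hv (rot hM hv x)).1 = μ • M.dir x.1 := fun x =>
    exists_eq_smul_of_cross_eq_zero (turn_pos_star hM hv x) (turn_pos_star hM hv (rot hM hv x))
      ((twistCoeff_eq_zero_iff hM hv x).2 (hcon _ (rot hM hv x).2))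
  have h4 : (rot hM hv ^ 4) x = x := by
    obtain ⟨μ, hμ, e⟩ := key x
    obtain ⟨μ', hμ', e'⟩ := key (rot hM hv (rot hM hv x))
    rw [e, smul_smul] at e'
    refine Subtype.ext (eq_of_dir_eq_smul hM ?_ (hst _) (hst _) (mul_pos_of_neg_of_neg hμ' hμ)
      e').symm
    exact x.2.trans (rot hM hv (rot hM hv (rot hM hv (rot hM hv x)))).2.symm
  have hdvd := ((rot_isCycleOn hM hv).pow_apply_eq (Finset.mem_univ x)).1 h4
  rw [Finset.card_univ, card_star] at hdvd
  have hle := Nat.le_of_dvd (by norm_num) hdvd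
  have h2 : M.valence v ≠ 2 := by
    intro h2
    have e2 := (rot_isCycleOn hM hv).pow_card_apply (Finset.mem_univ x)
    rw [Finset.card_univ, card_star, h2] at e2
    obtain ⟨μ, hμ, e⟩ := key x
    have e3 : rot hM hv (rot hM hv x) = x := e2
    rw [e3] at e
    have h5 : (1 - μ) • M.dir x.1 = 0 := by rw [sub_smul, one_smul, ← e, sub_self]
    exact smul_ne_zero (by linarith : (1 - μ) ≠ 0) (dir_ne_zero hM _) h5
  have hne4 : M.valence v ≠ 4 := fun h => hreg ⟨h, fun k hk => hcon k hk⟩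
  obtain ⟨m, hm⟩ := heven
  have : M.valence v ≠ 0 := fun h => by rw [h] at hdvd; omega
  omega

/-- Admissible choices of the control points of index two along the edges and of the adjacent ones
at an inner vertex. -/
theorem exists_templateDT (hM : M.IsSmoothMesh) (n : ℕ) {v : V} (hv : ¬ M.IsBdVertex v) :
    ∃ S T : Set (F × Fin 4), ∀ D : Set (M.CP n), (∀ h, M.org h = v →
      (M.cp n h 2 0 ∈ D ↔ h ∉ S) ∧ (M.cp n h 1 1 ∈ D ↔ h ∉ T)) → M.TemplateDT n D v := by
  obtain ⟨k', hk'⟩ := hM.vertex_used v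
  rcases Nat.even_or_odd (M.valence v) with he | ho
  · by_cases hreg : M.IsRegularFour v
    · exact ⟨∅, {k'}ᶜ, fun D hD => Or.inr (Or.inr ⟨hreg, fun h hh => (hD h hh).1.2 (notMem_empty _),
        k', hk', fun h hh => (hD h hh).2.trans notMem_compl_iff⟩)⟩
    · obtain ⟨k, hk, hkc⟩ := exists_not_neighboursColinear hM hv he hreg
      exact ⟨{k}, {k'}ᶜ, fun D hD => Or.inr (Or.inl ⟨he, hreg,
        ⟨k, hk, hkc, fun h hh => (hD h hh).1⟩,
        k', hk', fun h hh => (hD h hh).2.trans notMem_compl_iff⟩)⟩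
  · exact ⟨∅, univ, fun D hD => Or.inl ⟨ho, fun h hh => ⟨(hD h hh).1.2 (notMem_empty _),
      fun h1 => (hD h hh).2.1 h1 (mem_univ _)⟩⟩⟩

/-- Two consecutive edges at an inner vertex are not colinear. -/
theorem exists_templateVE (hM : M.IsSmoothMesh) (n : ℕ) {v : V} (hv : ¬ M.IsBdVertex v) :
    ∃ S : Set (F × Fin 4), ∀ D : Set (M.CP n), (∀ h, M.org h = v →
      M.cp n h 0 0 ∈ D ∧ (M.cp n h 1 0 ∈ D ↔ h ∉ S)) → M.TemplateVE n D v := by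
  obtain ⟨h, hh⟩ := hM.vertex_used v
  let x : M.Star v := ⟨h, hh⟩
  refine ⟨{k | ¬ (k = x.1 ∨ k = (rot hM hv x).1)}, fun D hD => ⟨fun k hk => (hD k hk).1, x.1,
    (rot hM hv x).1, x.2, (rot hM hv x).2, (turn_pos_star hM hv x).ne', fun k hk => ?_⟩⟩
  exact (hD k hk).2.trans not_not

end Mesh
end SmoothQuadMesh
end

noncomputable section
namespace SmoothQuadMesh
namespace Mesh

variable {V F : Type*} {M : Mesh V F} {n : ℕ}

/-! ### Choices along an edge -/

theorem oneOfEachPair_of_iff {h h' : F × Fin 4} {D : Set (M.CP n)} {A B : Set (Fin (n + 1))}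
    (hA : ∀ t ∈ sideRange n, M.cp n h t 1 ∈ D ↔ t ∉ A)
    (hB : ∀ t ∈ sideRange n, M.cp n h' t.rev 1 ∈ D ↔ t ∉ B)
    (hAB : ∀ t ∈ sideRange n, Xor (t ∈ A) (t ∈ B)) : M.OneOfEachPair n D h h' := by
  intro t ht
  rw [hA t ht, hB t ht]
  rcases hAB t ht with h | h
  · exact Or.inr ⟨h.2, not_not.2 h.1⟩
  · exact Or.inl ⟨h.2, not_not.2 h.1⟩

theorem basicL_eq {h : F × Fin 4} {D : Set (M.CP n)} {A : Set (Fin (n + 1))}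
    (hA : ∀ t ∈ sideRange n, M.cp n h t 1 ∈ D ↔ t ∉ A) : M.basicL n D h = sideRange n \ A := by
  ext t
  exact and_congr_right fun ht => hA t ht

theorem basicR_eq {h' : F × Fin 4} {D : Set (M.CP n)} {B : Set (Fin (n + 1))}
    (hB : ∀ t ∈ sideRange n, M.cp n h' t.rev 1 ∈ D ↔ t ∉ B) :
    M.basicR n D h' = sideRange n \ B := by
  ext t
  exact and_congr_right fun ht => hB t ht

theorem ncard_sdiff_add {δ m : ℕ} (hn : 3 ≤ n) {A B : Set (Fin (n + 1))} (hA : A ⊆ sideRange n)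
    (hB : B ⊆ sideRange n) (h : A.ncard + B.ncard + 3 = n + δ) (hm : m = 3 + δ) :
    (sideRange n \ A).ncard + (sideRange n \ B).ncard + m = n := by
  have h1 := Set.ncard_sdiff_add_ncard_of_subset hA
  have h2 := Set.ncard_sdiff_add_ncard_of_subset hB
  have h3 := ncard_sideRange hn
  omega

/-- `A` and `B` are the indices of the dependent left and right points. For proportional weights all
left ones are taken to be dependent; otherwise a maximal independent set of columns is used. -/
theorem exists_templateMiddleInner_sets (hM : M.IsSmoothMesh) (hn : 5 ≤ n) {h h' : F × Fin 4}
    (ho : M.Opp h h') (h1 : ¬ M.IsBdVertex (M.org h)) (h2 : ¬ M.IsBdVertex (M.tgt h)) :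
    ∃ A B : Set (Fin (n + 1)), ∀ D : Set (M.CP n),
      (∀ t : Fin (n + 1), 3 ≤ (t : ℕ) → (t : ℕ) + 3 ≤ n → M.cp n h t 0 ∈ D) →
      (∀ t ∈ sideRange n, M.cp n h t 1 ∈ D ↔ t ∉ A) →
      (∀ t ∈ sideRange n, M.cp n h' t.rev 1 ∈ D ↔ t ∉ B) → M.TemplateMiddleInner n D h h' := by
  obtain ⟨δ, E, l', r', c', H1, -, H3, H4⟩ := exists_isReduction_bilinear hM ho h1 h2
  rcases H4 with ⟨hP, -⟩ | ⟨hP, rfl⟩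
  · exact ⟨univ, ∅, fun D hC hA hB => ⟨hC, fun _ => oneOfEachPair_of_iff hA hB fun t _ =>
      Or.inl ⟨mem_univ t, notMem_empty t⟩, fun h => absurd hP h⟩⟩
  · obtain ⟨A, B, hA, hB, hcard, hinj⟩ := H1.exists_sideInjective (n := n) (by omega)
      (H3 _ (by omega))
    refine ⟨A, B, fun D hC hA' hB' => ⟨hC, fun h => absurd h hP, fun _ => ?_⟩⟩
    rw [dependentSolvable_iff, basicL_eq hA', basicR_eq hB',
      sdiff_sdiff_cancel_left hA, sdiff_sdiff_cancel_left hB]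
    refine ⟨ncard_sdiff_add (by omega) hA hB hcard rfl, ?_⟩
    rwa [jac_comp_eq_bilinear hM ho h1 h2, jac_eq_bilinear hM h1 h2, map_neg,
      sideInjective_neg_iff] at hinj

theorem exists_templateMiddleBd_sets (hM : M.IsSmoothMesh) (hn : 5 ≤ n) {h h' : F × Fin 4}
    (hb : M.EdgeToBd h h') :
    ∃ A B : Set (Fin (n + 1)), ∀ D : Set (M.CP n),
      (∀ t : Fin (n + 1), 3 ≤ (t : ℕ) → (t : ℕ) + 3 ≤ n → M.cp n h t 0 ∈ D) →
      (M.cp n h (Fin.rev 2) 0 ∈ D ↔ ¬ M.DegreeGapTwo h h') →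
      (∀ t ∈ sideRange n, M.cp n h t 1 ∈ D ↔ t ∉ A) →
      (∀ t ∈ sideRange n, M.cp n h' t.rev 1 ∈ D ↔ t ∉ B) → M.TemplateMiddleBd n D h h' := by
  obtain ⟨δ, E, l', r', c', H1, -, H3, H4⟩ := exists_isReduction_bicubic hM hb
  have h21 : M.Case2 h h' → ¬ M.Case1 h h' := fun h2 h1 => h1.1 (by rw [h2.1]; ring)
  have key : 1 ≤ δ → ∃ A B : Set (Fin (n + 1)), A ⊆ sideRange n ∧ B ⊆ sideRange n ∧
      A.ncard + B.ncard + 3 = n + δ ∧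
      SideInjective n (bz 2 (M.lBicubic h h')) (bz 2 (M.rBicubic h)) A B := by
    intro _
    obtain ⟨A, B, hA, hB, hcard, hinj⟩ := H1.exists_sideInjective (n := n) (by omega)
      (H3 _ (by omega))
    refine ⟨A, B, hA, hB, hcard, ?_⟩
    rwa [jac_comp_eq_bicubic hM hb, jac_eq_bicubic hM hb, map_neg, sideInjective_neg_iff] at hinj
  rcases H4 with ⟨hP, -⟩ | ⟨hP, rfl⟩ | ⟨hP1, hP2, rfl⟩
  · exact ⟨univ, ∅, fun D hC hG hA hB => ⟨hC, hG, fun _ => oneOfEachPair_of_iff hA hB fun t _ =>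
      Or.inl ⟨mem_univ t, notMem_empty t⟩, fun h => absurd h (h21 hP), fun _ h => absurd hP h⟩⟩
  · obtain ⟨A, B, hA, hB, hcard, hinj⟩ := key le_rfl
    refine ⟨A, B, fun D hC hG hA' hB' => ⟨hC, hG, fun h => absurd hP (h21 h), fun _ => ?_,
      fun h => absurd hP h⟩⟩
    rw [dependentSolvable_iff, basicL_eq hA', basicR_eq hB',
      sdiff_sdiff_cancel_left hA, sdiff_sdiff_cancel_left hB]
    exact ⟨ncard_sdiff_add (by omega) hA hB hcard rfl, hinj⟩
  · obtain ⟨A, B, hA, hB, hcard, hinj⟩ := key (by omega)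
    refine ⟨A, B, fun D hC hG hA' hB' => ⟨hC, hG, fun h => absurd h hP2, fun h => absurd h hP1,
      fun _ _ => ?_⟩⟩
    rw [dependentSolvable_iff, basicL_eq hA', basicR_eq hB',
      sdiff_sdiff_cancel_left hA, sdiff_sdiff_cancel_left hB]
    exact ⟨ncard_sdiff_add (by omega) hA hB hcard rfl, hinj⟩

theorem mem_edgeBlock_of_mem_sideRange (h : F × Fin 4) {t : Fin (n + 1)} (ht : t ∈ sideRange n)
    {i : Fin 3} (hi : i ≠ 0) : (t, i) ∈ M.edgeBlock n h :=
  ⟨fun h0 => absurd h0 hi, fun _ => sideRange_subset_edgeRange h ht⟩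

/-- Admissible choices of the dependent control points of an edge with two inner vertices. -/
theorem exists_templateMiddleInner (hM : M.IsSmoothMesh) (hn : 5 ≤ n) {h h' : F × Fin 4}
    (ho : M.Opp h h') (h1 : ¬ M.IsBdVertex (M.org h)) (h2 : ¬ M.IsBdVertex (M.tgt h)) :
    ∃ S : Set (Fin (n + 1) × Fin 3), ∀ D : Set (M.CP n),
      (∀ t : Fin (n + 1), 3 ≤ (t : ℕ) → (t : ℕ) + 3 ≤ n → M.cp n h t 0 ∈ D) →
      (∀ q ∈ M.edgeBlock n h, M.edgePt n h h' q ∈ D ↔ q ∉ S) →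
      M.TemplateMiddleInner n D h h' := by
  obtain ⟨A, B, hAB⟩ := exists_templateMiddleInner_sets hM hn ho h1 h2
  refine ⟨{q | ![False, q.1 ∈ A, q.1 ∈ B] q.2}, fun D hC hS => hAB D hC (fun t ht => ?_)
    fun t ht => ?_⟩
  · exact hS (t, 1) (mem_edgeBlock_of_mem_sideRange h ht (by decide))
  · exact hS (t, 2) (mem_edgeBlock_of_mem_sideRange h ht (by decide))

/-- Admissible choices of the dependent control points of an edge with a boundary vertex; those
close to the boundary vertex are prescribed. -/
theorem exists_templateMiddleBd (hM : M.IsSmoothMesh) (hn : 5 ≤ n) {h h' : F × Fin 4}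
    (hb : M.EdgeToBd h h') (b₁ b₂ : Prop) :
    ∃ S : Set (Fin (n + 1) × Fin 3), ∀ D : Set (M.CP n),
      (∀ t : Fin (n + 1), 3 ≤ (t : ℕ) → (t : ℕ) + 3 ≤ n → M.cp n h t 0 ∈ D) →
      M.cp n h' 0 0 ∈ D → M.cp n h' 1 0 ∈ D →
      (∀ q ∈ M.edgeBlock n h, M.edgePt n h h' q ∈ D ↔ q ∉ S) →
      M.TemplateMiddleBd n D h h' ∧ M.TemplateBd n D h h' ∧
        (M.cp n h (Fin.last n) 1 ∈ D ↔ b₁) ∧ (M.cp n h (Fin.rev 1) 1 ∈ D ↔ b₂) := by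
  have e1 := val_one_of_le (n := n) (by omega)
  obtain ⟨A, B, hAB⟩ := exists_templateMiddleBd_sets hM hn hb
  have hlr : Fin.last n ≠ Fin.rev 1 := by
    rw [Ne, Fin.ext_iff, Fin.val_rev, Fin.val_last, e1]; omega
  have hnl : ∀ {t : Fin (n + 1)}, t ∈ sideRange n → t ≠ Fin.last n ∧ t ≠ Fin.rev 1 := by
    rintro t ⟨h1, h2⟩
    simp only [Ne, Fin.ext_iff, Fin.val_rev, Fin.val_last, e1]
    omega
  refine ⟨{q | ![M.DegreeGapTwo h h',
    (q.1 ∈ sideRange n ∧ q.1 ∈ A) ∨ (q.1 = Fin.last n ∧ ¬ b₁) ∨ (q.1 = Fin.rev 1 ∧ ¬ b₂),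
    (q.1 ∈ sideRange n ∧ q.1 ∈ B) ∨ (q.1 = Fin.last n ∧ b₁) ∨ (q.1 = Fin.rev 1 ∧ b₂)] q.2},
    fun D hC hD0 hD1 hS => ?_⟩
  have hlast : ∀ i : Fin 3, i ≠ 0 → (Fin.last n, i) ∈ M.edgeBlock n h := fun i hi =>
    ⟨fun h0 => absurd h0 hi, fun _ => ⟨by simp only [Fin.val_last]; omega,
      fun h0 => absurd hb.2.2 h0⟩⟩
  have hrev : ∀ i : Fin 3, i ≠ 0 → (Fin.rev 1, i) ∈ M.edgeBlock n h := fun i hi =>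
    ⟨fun h0 => absurd h0 hi, fun _ => ⟨by simp only [Fin.val_rev, e1]; omega,
      fun h0 => absurd hb.2.2 h0⟩⟩
  have hls : Fin.last n ∉ sideRange n := fun h => (hnl h).1 rfl
  have hrs : Fin.rev 1 ∉ sideRange n := fun h => (hnl h).2 rfl
  have k1 : M.cp n h (Fin.last n) 1 ∈ D ↔ b₁ :=
    (hS (Fin.last n, 1) (hlast 1 (by decide))).trans (by simp [hls, hlr])
  have k2 : M.cp n h (Fin.rev 1) 1 ∈ D ↔ b₂ :=
    (hS (Fin.rev 1, 1) (hrev 1 (by decide))).trans (by simp [hrs, hlr.symm])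
  have k3 : M.cp n h' (Fin.rev (Fin.last n)) 1 ∈ D ↔ ¬ b₁ :=
    (hS (Fin.last n, 2) (hlast 2 (by decide))).trans (by simp [hls, hlr])
  have k4 : M.cp n h' (Fin.rev (Fin.rev 1)) 1 ∈ D ↔ ¬ b₂ :=
    (hS (Fin.rev 1, 2) (hrev 2 (by decide))).trans (by simp [hrs, hlr.symm])
  rw [Fin.rev_last] at k3
  rw [Fin.rev_rev] at k4
  have hxor : ∀ {p q b : Prop}, (p ↔ b) → (q ↔ ¬ b) → Xor p q := by
    intro p q b hp hq
    rw [hp, hq]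
    by_cases hb : b
    · exact Or.inl ⟨hb, not_not.2 hb⟩
    · exact Or.inr ⟨hb, hb⟩
  refine ⟨hAB D hC ?_ (fun t ht => ?_) fun t ht => ?_,
    ⟨hD0, hD1, hxor k1 k3, hxor k2 k4⟩, k1, k2⟩
  · exact hS (Fin.rev 2, 0) ⟨fun _ => ⟨rfl, hb.2.2⟩, fun h0 => absurd rfl h0⟩
  · have := hnl ht
    exact (hS (t, 1) (mem_edgeBlock_of_mem_sideRange h ht (by decide))).trans
      (by simp [ht, this.1, this.2])
  · have := hnl ht
    exact (hS (t, 2) (mem_edgeBlock_of_mem_sideRange h ht (by decide))).trans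
      (by simp [ht, this.1, this.2])

end Mesh
end SmoothQuadMesh
end

noncomputable section
namespace SmoothQuadMesh
namespace Mesh

variable {V F : Type*} {M : Mesh V F} {n : ℕ}

/-! ### An output of the algorithm with given choices -/

/-- The control points that can be dependent because of an edge condition. -/
theorem edgeBlock_cases (hn : 5 ≤ n) {h : F × Fin 4} {q : Fin (n + 1) × Fin 3}
    (hq : q ∈ M.edgeBlock n h) :
    (q.2 ≠ 0 ∧ q.1 ∈ sideRange n) ∨ (M.IsBdVertex (M.tgt h) ∧
      ((q.1 = Fin.rev 2 ∧ q.2 = 0) ∨ (q.2 ≠ 0 ∧ (q.1 = Fin.last n ∨ q.1 = Fin.rev 1)))) := by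
  have e1 := val_one_of_le (n := n) (by omega)
  by_cases h2 : q.2 = 0
  · exact Or.inr ⟨(hq.1 h2).2, Or.inl ⟨(hq.1 h2).1, h2⟩⟩
  · obtain ⟨h3, h4⟩ := hq.2 h2
    by_cases h5 : (q.1 : ℕ) + 2 ≤ n
    · exact Or.inl ⟨h2, h3, h5⟩
    · refine Or.inr ⟨by_contra fun h6 => h5 (h4 h6), Or.inr ⟨h2, ?_⟩⟩
      rw [Fin.ext_iff, Fin.ext_iff, Fin.val_last, Fin.val_rev, e1]
      omega

/-- Points that are decided at vertices and points that are decided along edges are different, so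
the two kinds of choices can be made independently. -/
theorem vertexPt_ne_edgePt (hM : M.IsSmoothMesh) (hn : 5 ≤ n) {h k k' : F × Fin 4} {i : Fin 3}
    (hv : ¬ M.IsBdVertex (M.org h)) (hk : M.Opp k k') (hkv : ¬ M.IsBdVertex (M.org k))
    {q : Fin (n + 1) × Fin 3} (hq : q ∈ M.edgeBlock n k) :
    M.vertexPt n (h, i) ≠ M.edgePt n k k' q := by
  have e1 := val_one_of_le (n := n) (by omega)
  have e2 := val_two_of_le (n := n) (by omega)
  obtain ⟨h', ho⟩ := isInnerEdge_of_org hv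
  intro e
  obtain ⟨s, j⟩ := q
  obtain ⟨hq0, hq1⟩ := hq
  have key : ∀ {t : Fin (n + 1)} {l : Fin 3}, (t : ℕ) ≤ 2 → (l = 1 → (t : ℕ) = 1) →
      (l = 0 ∨ l = 1) → M.edgePt n h h' (t, l) ≠ M.edgePt n k k' (s, j) := by
    intro t l ht hl hl' e
    rcases edgePt_eq hM hn hk hkv ho (q := (s, j)) ⟨hq0, hq1⟩ e with ⟨-, h2⟩ | ⟨h1, h2, h3⟩
    · obtain ⟨rfl, rfl⟩ := Prod.mk.inj h2
      rcases hl' with rfl | rfl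
      · have := (hq0 rfl).1
        simp only [Fin.ext_iff, Fin.val_rev, e2] at this
        omega
      · have := (hq1 (by decide : (1 : Fin 3) ≠ 0)).1
        have := hl rfl
        simp only at *
        omega
    · have hti : ¬ M.IsBdVertex (M.tgt k) := by rwa [hk.2, ← h1]
      simp only at h2 h3
      have hj : j ≠ 0 := fun hj => hti (hq0 hj).2
      have hs := (hq1 hj).2 hti
      simp only at hs
      rcases hl' with rfl | rfl
      · exact hj (h3.2 rfl)
      · have := hl rfl
        rw [h2, Fin.val_rev] at this
        omega
  fin_cases i
  · exact key (t := 1) (l := 0) (by omega) (fun _ => e1) (Or.inl rfl) e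
  · exact key (t := 2) (l := 0) (by omega) (fun h => absurd h (by decide)) (Or.inl rfl) e
  · exact key (t := 1) (l := 1) (by omega) (fun _ => e1) (Or.inr rfl) e

/-- Central control points that are dependent for no edge. -/
theorem cp_zero_ne_edgePt (hM : M.IsSmoothMesh) (hn : 5 ≤ n) {h h' k k' : F × Fin 4}
    (ho : M.Opp h h') {t : Fin (n + 1)} (ht : (t : ℕ) ≠ 2) (ht' : (t : ℕ) + 2 ≠ n)
    (hk : M.Opp k k') (hkv : ¬ M.IsBdVertex (M.org k))
    {q : Fin (n + 1) × Fin 3} (hq : q ∈ M.edgeBlock n k) :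
    M.cp n h t 0 ≠ M.edgePt n k k' q := by
  have e2 := val_two_of_le (n := n) (by omega)
  intro e
  rcases edgePt_eq hM hn hk hkv ho hq (p := (t, 0)) e with ⟨-, h2⟩ | ⟨-, h2, h3⟩
  · subst h2
    have := (hq.1 rfl).1
    simp only [Fin.ext_iff, Fin.val_rev, e2] at this
    omega
  · have := (hq.1 (h3.2 rfl)).1
    simp only [this, Fin.rev_rev, Fin.ext_iff, e2] at h2
    omega

theorem cp_middle_ne_vertexPt (hM : M.IsSmoothMesh) (hn : 5 ≤ n) {h : F × Fin 4}
    {t : Fin (n + 1)} (ht : 3 ≤ (t : ℕ)) (ht' : (t : ℕ) + 3 ≤ n) (q : (F × Fin 4) × Fin 3) :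
    M.cp n h t 0 ≠ M.vertexPt n q := by
  have e1 := val_one_of_le (n := n) (by omega)
  have e2 := val_two_of_le (n := n) (by omega)
  obtain ⟨k, i⟩ := q
  have key : ∀ {a : Fin (n + 1)}, 0 < (a : ℕ) → (a : ℕ) ≤ 2 → M.cp n h t 0 ≠ M.cp n k a 0 := by
    intro a ha ha' e
    have h1 := cp_edge_eq hM (by omega) (by omega) e
    simp only [Fin.ext_iff, Fin.val_rev] at h1
    omega
  fin_cases i
  · exact key (a := 1) (by omega) (by omega)
  · exact key (a := 2) (by omega) (by omega)
  · exact cp_middle_ne_one hM (by omega) (by omega) (by omega)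

variable (M) in
/-- An orientation of the edges with an inner vertex. -/
theorem exists_orientation [Finite F] (hM : M.IsSmoothMesh) : ∃ O : Set (F × Fin 4),
    (∀ h ∈ O, M.IsInnerEdge h ∧ ¬ M.IsBdVertex (M.org h)) ∧
    (∀ h h', M.Opp h h' → h ∈ O → h' ∉ O) ∧
    (∀ h h', M.EdgeToBd h h' → h ∈ O) ∧
    ∀ h h', M.Opp h h' → ¬ M.IsBdVertex (M.org h) → ¬ M.IsBdVertex (M.tgt h) →
      h ∈ O ∨ h' ∈ O := by
  -- An arbitrary numbering selects one orientation of each edge with two inner vertices; an edge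
  -- with a boundary vertex is oriented towards it.
  obtain ⟨N, ⟨e⟩⟩ := Finite.exists_equiv_fin (F × Fin 4)
  refine ⟨{h | ¬ M.IsBdVertex (M.org h) ∧ (M.IsBdVertex (M.tgt h) ∨ e h < e (M.opp h))},
    fun h hh => ⟨isInnerEdge_of_org hh.1, hh.1⟩, ?_, fun h h' hb => ⟨hb.2.1, Or.inl hb.2.2⟩, ?_⟩
  · rintro h h' ho ⟨h1, h2⟩ ⟨h3, h4⟩
    rw [← ho.2] at h3
    rw [← ho.1] at h4
    rw [hM.opp_eq ho] at h2
    rw [hM.opp_eq ho.symm] at h4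
    exact lt_asymm (h2.resolve_left h3) (h4.resolve_left h1)
  · intro h h' ho h1 h2
    simp only [mem_ofPred_eq, hM.opp_eq ho, hM.opp_eq ho.symm, ← ho.1, ← ho.2]
    have hne : h ≠ h' := fun e => hM.face_ne ho (by rw [e])
    rcases lt_or_gt_of_ne (e.injective.ne hne) with h3 | h3
    · exact Or.inl ⟨h1, Or.inr h3⟩
    · exact Or.inr ⟨h2, Or.inr h3⟩

/-- The algorithm has an output in which, at the boundary vertices, the choices are prescribed. -/
theorem exists_isAlgorithmOutput [Finite F] (hM : M.IsSmoothMesh) (hn : 5 ≤ n)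
    (b₁ b₂ : F × Fin 4 → Prop) : ∃ D : Set (M.CP n), M.IsAlgorithmOutput n D ∧
      (∀ p ∉ D, (∃ h i, ¬ M.IsBdVertex (M.org h) ∧ p = M.vertexPt n (h, i)) ∨
        ∃ h h' q, M.Opp h h' ∧ ¬ M.IsBdVertex (M.org h) ∧ q ∈ M.edgeBlock n h ∧
          p = M.edgePt n h h' q) ∧
      ∀ h h', M.EdgeToBd h h' →
        (M.cp n h (Fin.last n) 1 ∈ D ↔ b₁ h) ∧ (M.cp n h (Fin.rev 1) 1 ∈ D ↔ b₂ h) := by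
  classical
  have e1 := val_one_of_le (n := n) (by omega)
  obtain ⟨O, hO1, hO2, hO3, hO4⟩ := M.exists_orientation hM
  have hVE : ∀ v, ∃ S : Set (F × Fin 4), ¬ M.IsBdVertex v → ∀ D : Set (M.CP n),
      (∀ h, M.org h = v → M.cp n h 0 0 ∈ D ∧ (M.cp n h 1 0 ∈ D ↔ h ∉ S)) →
        M.TemplateVE n D v := fun v => by
    by_cases hv : M.IsBdVertex v
    · exact ⟨∅, fun h => absurd hv h⟩
    · obtain ⟨S, hS⟩ := exists_templateVE hM n hv
      exact ⟨S, fun _ => hS⟩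
  have hDT : ∀ v, ∃ S T : Set (F × Fin 4), ¬ M.IsBdVertex v → ∀ D : Set (M.CP n),
      (∀ h, M.org h = v → (M.cp n h 2 0 ∈ D ↔ h ∉ S) ∧ (M.cp n h 1 1 ∈ D ↔ h ∉ T)) →
        M.TemplateDT n D v := fun v => by
    by_cases hv : M.IsBdVertex v
    · exact ⟨∅, ∅, fun h => absurd hv h⟩
    · obtain ⟨S, T, hS⟩ := exists_templateDT hM n hv
      exact ⟨S, T, fun _ => hS⟩
  have hE : ∀ h, ∃ S : Set (Fin (n + 1) × Fin 3), ∀ h', M.Opp h h' →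
      (¬ M.IsBdVertex (M.org h) → ¬ M.IsBdVertex (M.tgt h) → ∀ D : Set (M.CP n),
        (∀ t : Fin (n + 1), 3 ≤ (t : ℕ) → (t : ℕ) + 3 ≤ n → M.cp n h t 0 ∈ D) →
        (∀ q ∈ M.edgeBlock n h, M.edgePt n h h' q ∈ D ↔ q ∉ S) →
        M.TemplateMiddleInner n D h h') ∧
      (M.EdgeToBd h h' → ∀ D : Set (M.CP n),
        (∀ t : Fin (n + 1), 3 ≤ (t : ℕ) → (t : ℕ) + 3 ≤ n → M.cp n h t 0 ∈ D) →
        M.cp n h' 0 0 ∈ D → M.cp n h' 1 0 ∈ D →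
        (∀ q ∈ M.edgeBlock n h, M.edgePt n h h' q ∈ D ↔ q ∉ S) →
        M.TemplateMiddleBd n D h h' ∧ M.TemplateBd n D h h' ∧
          (M.cp n h (Fin.last n) 1 ∈ D ↔ b₁ h) ∧ (M.cp n h (Fin.rev 1) 1 ∈ D ↔ b₂ h)) := by
    intro h
    by_cases hi : M.IsInnerEdge h
    · obtain ⟨h', ho⟩ := hi
      by_cases hv : M.IsBdVertex (M.org h)
      · exact ⟨∅, fun k hk => ⟨fun h1 => absurd hv h1, fun h1 => absurd hv h1.2.1⟩⟩
      by_cases hw : M.IsBdVertex (M.tgt h)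
      · obtain ⟨S, hS⟩ := exists_templateMiddleBd hM hn ⟨ho, hv, hw⟩ (b₁ h) (b₂ h)
        refine ⟨S, fun k hk => ⟨fun _ h1 => absurd hw h1, fun _ => ?_⟩⟩
        rw [hM.opp_unique hk ho]
        exact hS
      · obtain ⟨S, hS⟩ := exists_templateMiddleInner hM hn ho hv hw
        refine ⟨S, fun k hk => ⟨fun _ _ => ?_, fun h1 => absurd h1.2.2 hw⟩⟩
        rw [hM.opp_unique hk ho]
        exact hS
    · exact ⟨∅, fun h' ho => absurd ho.isInnerEdge hi⟩
  choose SE hSE using hVE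
  choose SD ST hSD using hDT
  choose S hS using hE
  let SV : Set ((F × Fin 4) × Fin 3) :=
    {q | ![q.1 ∈ SE (M.org q.1), q.1 ∈ SD (M.org q.1), q.1 ∈ ST (M.org q.1)] q.2}
  -- Only dependent points are listed, each edge being used in its chosen orientation. Everything
  -- else is basic, including the free points.
  let D : Set (M.CP n) := {p | ¬ ((∃ h i, ¬ M.IsBdVertex (M.org h) ∧ (h, i) ∈ SV ∧
      p = M.vertexPt n (h, i)) ∨
    ∃ h h' q, M.Opp h h' ∧ h ∈ O ∧ q ∈ M.edgeBlock n h ∧ q ∈ S h ∧ p = M.edgePt n h h' q)}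
  have hDv : ∀ {h i}, ¬ M.IsBdVertex (M.org h) → (M.vertexPt n (h, i) ∈ D ↔ (h, i) ∉ SV) := by
    intro h i hv
    refine not_congr ⟨?_, fun h1 => Or.inl ⟨h, i, hv, h1, rfl⟩⟩
    rintro (⟨k, j, -, hq, e⟩ | ⟨k, k', q, ho, hk, hq, -, e⟩)
    · rwa [vertexPt_injective hM hn e]
    · exact absurd e (vertexPt_ne_edgePt hM hn hv ho (hO1 k hk).2 hq)
  have hDe : ∀ {h h' q}, M.Opp h h' → h ∈ O → q ∈ M.edgeBlock n h →
      (M.edgePt n h h' q ∈ D ↔ q ∉ S h) := by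
    intro h h' q ho hh hq
    refine not_congr ⟨?_, fun h1 => Or.inr ⟨h, h', q, ho, hh, hq, h1, rfl⟩⟩
    rintro (⟨k, j, hv, -, e⟩ | ⟨k, k', q', hok, hk, -, hq', e⟩)
    · exact absurd e.symm (vertexPt_ne_edgePt hM hn hv ho (hO1 h hh).2 hq)
    · rcases edgePt_eq hM hn ho (hO1 h hh).2 hok hq e.symm with ⟨rfl, rfl⟩ | ⟨rfl, -⟩
      · exact hq'
      · exact absurd hk (hO2 h _ ho hh)
  have hDc : ∀ {h}, M.IsInnerEdge h → M.cp n h 0 0 ∈ D := by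
    rintro h ⟨h', ho⟩ (⟨k, j, -, -, e⟩ | ⟨k, k', q', hok, hk, hq, -, e⟩)
    · exact vertexPt_ne_corner hM hn _ _ e.symm
    · exact cp_zero_ne_edgePt hM hn ho (t := 0) (by simp) (by simp; omega) hok (hO1 k hk).2 hq e
  have hDm : ∀ {h}, M.IsInnerEdge h → ∀ t : Fin (n + 1), 3 ≤ (t : ℕ) → (t : ℕ) + 3 ≤ n →
      M.cp n h t 0 ∈ D := by
    rintro h ⟨h', ho⟩ t h1 h2 (⟨k, j, -, -, e⟩ | ⟨k, k', q', hok, hk, hq, -, e⟩)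
    · exact cp_middle_ne_vertexPt hM hn h1 h2 _ e
    · exact cp_zero_ne_edgePt hM hn ho (by omega) (by omega) hok (hO1 k hk).2 hq e
  have hDb : ∀ {h h'}, M.EdgeToBd h h' → M.cp n h' 1 0 ∈ D := by
    rintro h h' hb (⟨k, j, hv, -, e⟩ | ⟨k, k', q', hok, hk, hq, -, e⟩)
    · have e' : M.vertexPt n (h', 0) = M.vertexPt n (k, j) := e
      obtain ⟨rfl, -⟩ := Prod.mk.inj (vertexPt_injective hM hn e')
      exact hv (hb.1.2 ▸ hb.2.2)
    · exact cp_zero_ne_edgePt hM hn hb.1.symm (by omega) (by omega) hok (hO1 k hk).2 hq e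
  have hbd : ∀ h h', M.EdgeToBd h h' → M.TemplateMiddleBd n D h h' ∧ M.TemplateBd n D h h' ∧
      (M.cp n h (Fin.last n) 1 ∈ D ↔ b₁ h) ∧ (M.cp n h (Fin.rev 1) 1 ∈ D ↔ b₂ h) :=
    fun h h' hb => (hS h h' hb.1).2 hb D (hDm hb.1.isInnerEdge) (hDc hb.1.symm.isInnerEdge)
      (hDb hb) fun q hq => hDe hb.1 (hO3 h h' hb) hq
  have hin : ∀ {h h'}, M.Opp h h' → h ∈ O → ¬ M.IsBdVertex (M.tgt h) →
      M.TemplateMiddleInner n D h h' := fun {h h'} ho hh hw =>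
    (hS h h' ho).1 (hO1 h hh).2 hw D (hDm ho.isInnerEdge) fun q hq => hDe ho hh hq
  refine ⟨D, ⟨?_, fun v hv => hSE v hv D fun h hh => ?_, fun v hv => hSD v hv D fun h hh => ?_,
    fun h h' ho h1 h2 => ?_, fun h h' hb => (hbd h h' hb).2.1, fun h h' hb => (hbd h h' hb).1⟩,
    fun p hp => ?_, fun h h' hb => (hbd h h' hb).2.2⟩
  · rintro p hp (⟨k, j, hv, -, rfl⟩ | ⟨k, k', ⟨t, j⟩, hok, -, -, -, rfl⟩)
    · have hk := isInnerEdge_of_org hv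
      fin_cases j
      · exact (hp k hk 1).1 rfl
      · exact (hp k hk 2).1 rfl
      · exact (hp k hk 1).2 rfl
    · fin_cases j
      · exact (hp k hok.isInnerEdge t).1 rfl
      · exact (hp k hok.isInnerEdge t).2 rfl
      · exact (hp k' hok.symm.isInnerEdge t.rev).2 rfl
  · subst hh
    exact ⟨hDc (isInnerEdge_of_org hv), hDv (i := 0) hv⟩
  · subst hh
    exact ⟨hDv (i := 1) hv, hDv (i := 2) hv⟩
  -- The choice was made for one orientation; `TemplateMiddleInner.symm` transfers it to the other.
  · rcases hO4 h h' ho h1 h2 with h3 | h3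
    · exact hin ho h3 h2
    · exact (hin ho.symm h3 (by rwa [← ho.1])).symm ho.symm
  · rcases not_not.1 hp with ⟨h, i, hv, -, e⟩ | ⟨h, h', q, ho, hh, hq, -, e⟩
    · exact Or.inl ⟨h, i, hv, e⟩
    · exact Or.inr ⟨h, h', q, ho, (hO1 h hh).2, hq, e⟩

end Mesh
end SmoothQuadMesh
end

noncomputable section
namespace SmoothQuadMesh
namespace Mesh

variable {V F : Type*} {M : Mesh V F} {n : ℕ}

/-! ### The control points fixed by a constraint -/

/-- The possible positions of a control point that is fixed by a constraint. -/
theorem mem_fixedPoints_cases {K : ConstraintType V F} {p : M.CP n}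
    (hp : p ∈ M.fixedPoints n K) : (∃ k, p = M.cp n k 0 0) ∨
      (∃ k, M.org k ∈ K.tangentPlane ∧ (p = M.cp n k 1 0 ∨ p = M.cp n (prev k) (Fin.rev 1) 0)) ∨
      (∃ k, M.IsBdEdge k ∧ (∀ t, M.cp n k t 0 ∈ M.fixedPoints n K) ∧ ∃ t, p = M.cp n k t 0) ∨
      ∃ k, M.IsBdEdge k ∧ (∀ t, M.cp n k t 0 ∈ M.fixedPoints n K ∧
        M.cp n k t 1 ∈ M.fixedPoints n K) ∧ (p = M.cp n (prev k) (Fin.rev 1) 0 ∨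
          p = M.cp n (next k) 1 0 ∨ ∃ t : Fin (n + 1), 0 < (t : ℕ) ∧ (t : ℕ) < n ∧
            p = M.cp n k t 1) := by
  obtain ⟨k, h⟩ := hp
  rcases h with ⟨-, h⟩ | ⟨h1, h2 | h2 | h2⟩ | ⟨h1, h2, h3⟩ | ⟨h1, h2, h3⟩ | ⟨h1, h2, t, h3 | h3⟩
  · exact Or.inl ⟨k, h⟩
  · exact Or.inl ⟨k, h2⟩
  · exact Or.inr (Or.inl ⟨k, h1, Or.inl h2⟩)
  · exact Or.inr (Or.inl ⟨k, h1, Or.inr (by rw [h2, cp_zero_one_eq])⟩)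
  · exact Or.inr (Or.inr (Or.inl ⟨k, h1, fun t =>
      ⟨k, Or.inr (Or.inr (Or.inl ⟨h1, h2, t, rfl⟩))⟩, h3⟩))
  · exact Or.inr (Or.inr (Or.inl ⟨k, h1, fun t =>
      ⟨k, Or.inr (Or.inr (Or.inr (Or.inl ⟨h1, h2, t, rfl⟩)))⟩, h3⟩))
  · exact Or.inr (Or.inr (Or.inl ⟨k, h1, fun t =>
      ⟨k, Or.inr (Or.inr (Or.inr (Or.inr ⟨h1, h2, t, Or.inl rfl⟩)))⟩, t, h3⟩))
  · refine Or.inr (Or.inr (Or.inr ⟨k, h1, fun t =>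
      ⟨⟨k, Or.inr (Or.inr (Or.inr (Or.inr ⟨h1, h2, t, Or.inl rfl⟩)))⟩,
      k, Or.inr (Or.inr (Or.inr (Or.inr ⟨h1, h2, t, Or.inr rfl⟩)))⟩, ?_⟩))
    rcases Nat.eq_zero_or_pos (t : ℕ) with ht | ht
    · obtain rfl : t = 0 := Fin.ext ht
      exact Or.inl (by rw [h3, cp_zero_one_eq])
    · rcases eq_or_lt_of_le (Nat.lt_succ_iff.1 t.2) with ht' | ht'
      · obtain rfl : t = Fin.last n := Fin.ext ht'
        exact Or.inr (Or.inl (by rw [h3, cp_last_one_eq]))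
      · exact Or.inr (Or.inr ⟨t, ht, ht', h3⟩)

variable {K : ConstraintType V F}

/-- The point lies on an inner edge next to an inner vertex, hence neither on a boundary edge nor
adjacent to one. Only tangent plane interpolation at this vertex can fix it. -/
theorem cp_one_mem_fixedPoints (hM : M.IsSmoothMesh) (hn : 5 ≤ n) {h : F × Fin 4}
    (hv : ¬ M.IsBdVertex (M.org h)) (hp : M.cp n h 1 0 ∈ M.fixedPoints n K) :
    M.org h ∈ K.tangentPlane := by
  have e1 := val_one_of_le (n := n) (by omega)
  have hi := isInnerEdge_of_org hv
  have hne : (Fin.rev 1 : Fin (n + 1)) ≠ 1 := by rw [Ne, Fin.ext_iff, Fin.val_rev, e1]; omega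
  have hbd : ∀ {k : F × Fin 4} {t : Fin (n + 1)}, M.cp n h 1 0 = M.cp n k t 0 →
      ¬ M.IsBdEdge k := by
    rintro k t e hk
    rcases cp_edge_eq hM (by omega) (by omega) e with ⟨rfl, -⟩ | ⟨h1, -⟩
    · exact hk hi
    · exact hk h1.symm.isInnerEdge
  have hprev : ∀ {k : F × Fin 4}, M.cp n h 1 0 = M.cp n (prev k) (Fin.rev 1) 0 →
      M.org k = M.org h := by
    intro k e
    rcases cp_edge_eq hM (by omega) (by omega) e with ⟨-, h1⟩ | ⟨h1, -⟩
    · exact absurd h1 hne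
    · rw [h1.1, tgt_prev]
  have hnext : ∀ {k : F × Fin 4}, M.cp n h 1 0 = M.cp n k 1 0 → k = h := by
    intro k e
    rcases cp_edge_eq hM (by omega) (by omega) e with ⟨h1, -⟩ | ⟨-, h1⟩
    · exact h1
    · exact absurd h1.symm hne
  rcases mem_fixedPoints_cases hp with ⟨k, e⟩ | ⟨k, hk, e | e⟩ | ⟨k, hk, -, t, e⟩ |
    ⟨k, hk, -, e | e | ⟨t, h1, h2, e⟩⟩
  · exact absurd e (vertexPt_ne_corner hM hn (h, 0) k)
  · rwa [← hnext e]
  · rwa [← hprev e]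
  · exact absurd hk (hbd e)
  · exact absurd ⟨k, hk, Or.inl rfl⟩ ((hprev e).symm ▸ hv)
  · exact absurd ⟨k, hk, Or.inr (by rw [← org_next, hnext e])⟩ hv
  · exact absurd e.symm (cp_interior_ne_edge h1 h2 (by omega) (by omega))

/-- On an inner edge, constraints reach the indices 0 and 1 counted from either end; 2 is neither of
these nor n-1 or n, because n ≥ 5. -/
theorem cp_two_notMem_fixedPoints (hM : M.IsSmoothMesh) (hn : 5 ≤ n) {h : F × Fin 4}
    (hi : M.IsInnerEdge h) : M.cp n h 2 0 ∉ M.fixedPoints n K := by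
  have e1 := val_one_of_le (n := n) (by omega)
  have e2 := val_two_of_le (n := n) (by omega)
  have key : ∀ {k : F × Fin 4} {t : Fin (n + 1)}, M.cp n h 2 0 = M.cp n k t 0 →
      ¬ M.IsBdEdge k ∧ (t : ℕ) ≠ 1 ∧ (t : ℕ) + 1 ≠ n := by
    rintro k t e
    have h2 := cp_edge_eq hM (by omega) (by omega) e
    refine ⟨fun hk => ?_, ?_, ?_⟩
    · rcases h2 with ⟨rfl, -⟩ | ⟨h1, -⟩
      · exact hk hi
      · exact hk h1.symm.isInnerEdge
    all_goals
      simp only [Fin.ext_iff, Fin.val_rev, e2] at h2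
      omega
  have er : ((Fin.rev 1 : Fin (n + 1)) : ℕ) + 1 = n := by rw [Fin.val_rev, e1]; omega
  intro hp
  rcases mem_fixedPoints_cases hp with ⟨k, e⟩ | ⟨k, hk, e | e⟩ | ⟨k, hk, -, t, e⟩ |
    ⟨k, hk, -, e | e | ⟨t, h1, h2, e⟩⟩
  · exact vertexPt_ne_corner hM hn (h, 1) k e
  · exact (key e).2.1 e1
  · exact (key e).2.2 er
  · exact (key e).1 hk
  · exact (key e).2.2 er
  · exact (key e).2.1 e1
  · exact cp_interior_ne_edge h1 h2 (by omega) (by omega) e.symm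

/-- An inner control point adjacent to an inner edge is fixed only by a clamped condition on the
next or on the previous edge. -/
theorem cp_side_mem_fixedPoints (hn : 5 ≤ n) {h : F × Fin 4}
    (hi : M.IsInnerEdge h) {t : Fin (n + 1)} (ht : 0 < (t : ℕ)) (ht' : (t : ℕ) < n)
    (hp : M.cp n h t 1 ∈ M.fixedPoints n K) :
    ∃ k, M.IsBdEdge k ∧ (∀ t, M.cp n k t 0 ∈ M.fixedPoints n K ∧
      M.cp n k t 1 ∈ M.fixedPoints n K) ∧
      ((k = next h ∧ (t : ℕ) = n - 1) ∨ (k = prev h ∧ (t : ℕ) = 1)) := by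
  have e1 := val_one_of_le (n := n) (by omega)
  have hne : ∀ {k : F × Fin 4} {s : Fin (n + 1)}, M.cp n h t 1 ≠ M.cp n k s 0 := fun {k s} =>
    cp_interior_ne_edge ht ht' (by omega) (by omega)
  rcases mem_fixedPoints_cases hp with ⟨k, e⟩ | ⟨k, hk, e | e⟩ | ⟨k, hk, -, t, e⟩ |
    ⟨k, hk, hK, e | e | ⟨s, h1, h2, e⟩⟩
  any_goals exact absurd e hne
  refine ⟨k, hk, hK, ?_⟩
  rcases loc_one_eq (by omega) (loc_eq_of_cp_eq ht ht' (by omega) (by omega) h1 h2 (by omega)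
    (by omega) e) with ⟨rfl, -⟩ | ⟨h3, h4, -⟩ | ⟨h3, h4, -⟩
  · exact absurd hi hk
  · exact Or.inl ⟨h3, h4⟩
  · exact Or.inr ⟨h3, h4⟩

theorem cp_one_one_notMem_fixedPoints (hn : 5 ≤ n) {h : F × Fin 4}
    (hv : ¬ M.IsBdVertex (M.org h)) : M.cp n h 1 1 ∉ M.fixedPoints n K := by
  have e1 := val_one_of_le (n := n) (by omega)
  intro hp
  obtain ⟨k, hk, -, ⟨-, h1⟩ | ⟨rfl, -⟩⟩ := cp_side_mem_fixedPoints hn (isInnerEdge_of_org hv)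
    (by omega) (by omega) hp
  · omega
  · exact hk (isInnerEdge_prev hv)

theorem cp_sideRange_notMem_fixedPoints (hn : 5 ≤ n) {h : F × Fin 4}
    (hi : M.IsInnerEdge h) {t : Fin (n + 1)} (ht : t ∈ sideRange n) :
    M.cp n h t 1 ∉ M.fixedPoints n K := by
  intro hp
  obtain ⟨h1, h2⟩ := ht
  obtain ⟨k, hk, -, ⟨-, h1⟩ | ⟨-, h1⟩⟩ := cp_side_mem_fixedPoints hn hi (by omega) (by omega) hp
  all_goals omega

/-- Two fixed control points on a boundary curve next to a boundary vertex. -/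
theorem cp_corner_mem_fixedPoints (hM : M.IsSmoothMesh) (hn : 5 ≤ n) {h' : F × Fin 4}
    (hb : M.IsBdEdge (prev h')) (hp : M.cp n h' 0 1 ∈ M.fixedPoints n K) :
    M.cp n h' 0 0 ∈ M.fixedPoints n K := by
  have e1 := val_one_of_le (n := n) (by omega)
  have er : ((Fin.rev 1 : Fin (n + 1)) : ℕ) + 1 = n := by rw [Fin.val_rev, e1]; omega
  have e0 : M.cp n h' 0 0 = M.cp n (prev h') (Fin.last n) 0 := by rw [cp_prev, Fin.rev_last]
  have key : ∀ {k : F × Fin 4} {t : Fin (n + 1)}, M.cp n h' 0 1 = M.cp n k t 0 →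
      k = prev h' ∧ (t : ℕ) + 1 = n := by
    intro k t e
    rw [cp_zero_one_eq] at e
    obtain ⟨h1, rfl⟩ := cp_bd_edge_eq hM hb (by omega) (by omega) e
    exact ⟨h1, er⟩
  rcases mem_fixedPoints_cases hp with ⟨k, e⟩ | ⟨k, hk, e | e⟩ | ⟨k, hk, hK, t, e⟩ |
    ⟨k, hk, -, e | e | ⟨t, h1, h2, e⟩⟩
  · have := (key e).2
    rw [Fin.val_zero] at this
    omega
  · have := (key e).2
    omega
  · have := prev_injective (key e).1
    subst this
    exact ⟨k, Or.inr (Or.inl ⟨hk, Or.inl rfl⟩)⟩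
  · rw [e0, ← (key e).1]
    exact hK _
  · have h1 : (prev h').2 = 2 := hM.bd_label _ hb
    have h2 : k.2 = 2 := hM.bd_label _ hk
    have h3 : (prev k).2 = 2 := by rw [(key e).1]; exact h1
    simp only [prev, h2] at h3
    exact absurd h3 (by decide)
  · have := (key e).2
    omega
  · rw [cp_zero_one_eq] at e
    exact absurd e.symm (cp_interior_ne_edge h1 h2 (by omega) (by omega))

end Mesh
end SmoothQuadMesh
end

noncomputable section
namespace SmoothQuadMesh
namespace Mesh

variable {V F : Type*} {M : Mesh V F} {n : ℕ} [Finite F]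

/-! ### Outputs of the algorithm that fit a constraint -/

theorem dependsOnlyOn_of_sub (hM : M.IsSmoothMesh) (hn : 1 ≤ n) {p : M.CP n} {S : Set (M.CP n)}
    (h : ∀ w ∈ M.FUN n, (∀ q ∈ S, w q = 0) → w p = 0) : M.DependsOnlyOn n p S := by
  intro z hz z' hz' e
  refine sub_eq_zero.1 (h (z - z') ((mem_FUN_iff hM hn).2 fun k k' ho => ?_) fun q hq => ?_)
  · rw [smo_sub, (mem_FUN_iff hM hn).1 hz k k' ho, (mem_FUN_iff hM hn).1 hz' k k' ho, sub_zero]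
  · exact sub_eq_zero.2 (e q hq)

theorem vertexOK_of_mem_FUN (hM : M.IsSmoothMesh) (hn : 1 ≤ n) {z : M.CP n → ℝ}
    (hz : z ∈ M.FUN n) (v : V) : VertexOK z v := fun k k' _ ho => by
  rw [(mem_FUN_iff hM hn).1 hz k k' ho]; exact dvd_zero _

/-- Tangent plane interpolation at an inner vertex. -/
theorem dependsOnlyOn_tangent (hM : M.IsSmoothMesh) (hn : 1 ≤ n) {D P : Set (M.CP n)}
    {h : F × Fin 4} (hv : ¬ M.IsBdVertex (M.org h)) (hVE : M.TemplateVE n D (M.org h))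
    (hP : ∀ k, M.org k = M.org h → M.cp n k 0 0 ∈ P ∧ M.cp n k 1 0 ∈ P) :
    M.DependsOnlyOn n (M.cp n h 1 0) (D ∩ P) := by
  refine dependsOnlyOn_of_sub hM hn fun w hw h0 => ?_
  obtain ⟨hV, k₁, k₂, hk₁, hk₂, hk, hkD⟩ := hVE
  exact (vertexOK_of_mem_FUN hM hn hw _).eq_zero_of_tangent hM hn hv
    (fun x => h0 _ ⟨hV x.1 x.2, (hP x.1 x.2).1⟩) hk₁ hk₂ hk
    (h0 _ ⟨(hkD k₁ hk₁).2 (Or.inl rfl), (hP k₁ hk₁).2⟩)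
    (h0 _ ⟨(hkD k₂ hk₂).2 (Or.inr rfl), (hP k₂ hk₂).2⟩) ⟨h, rfl⟩

section

variable {h h' : F × Fin 4} {w : M.CP n → ℝ}

/-- The tangent at a boundary vertex. -/
theorem eq_zero_of_bd_last (hM : M.IsSmoothMesh) (hn : 1 ≤ n) (hb : M.EdgeToBd h h')
    (hw : w ∈ M.FUN n) (h0 : w (M.cp n h' 0 0) = 0) :
    w (M.cp n h (Fin.last n) 1) = 0 ↔ w (M.cp n h' 0 1) = 0 := by
  have ho := hb.1
  have hn0 : (n : ℝ) ≠ 0 := by positivity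
  have hS := (mem_FUN_iff hM hn).1 hw h h' ho
  rw [smo_eq_edgePol ho] at hS
  have h1 := congrArg (fun p => coeff (p.comp (1 - X)) 0) hS
  have e0 : M.cp n h (Fin.last n) 0 = M.cp n h' 0 0 := by rw [ho.cp_eq, Fin.rev_last]
  simp only [coeff_zero_edgePol_comp hn, coeff_zero_crossPol_comp hM hb, e0, h0, Fin.rev_last,
    zero_comp, coeff_zero, sub_zero, zero_mul, add_zero, mul_eq_zero, hn0, false_or] at h1
  have hl := coeff_zero_jac_pos hM ho.symm.isInnerEdge
  rw [← comp_one_sub_X_involutive (M.jac h')] at hl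
  have hr := coeff_zero_jac_comp_pos hM ho.isInnerEdge
  constructor <;> intro h2 <;> rw [h2] at h1
  · rwa [mul_zero, zero_add, mul_eq_zero, or_iff_right hr.ne'] at h1
  · rwa [mul_zero, add_zero, mul_eq_zero, or_iff_right hl.ne'] at h1

/-- The twist at a boundary vertex. -/
theorem eq_zero_of_bd_rev_one (hM : M.IsSmoothMesh) (hn : 1 ≤ n) (hb : M.EdgeToBd h h')
    (hw : w ∈ M.FUN n) (h0 : w (M.cp n h' 0 0) = 0) (h1 : w (M.cp n h' 1 0) = 0)
    (h2 : w (M.cp n h (Fin.last n) 1) = 0) (h3 : w (M.cp n h (Fin.rev 1) 1) = 0) :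
    w (M.cp n h' 1 1) = 0 := by
  have ho := hb.1
  have hn0 : (n : ℝ) ≠ 0 := by positivity
  have hS := (mem_FUN_iff hM hn).1 hw h h' ho
  rw [smo_eq_edgePol ho] at hS
  have h4 := congrArg (fun p => coeff (p.comp (1 - X)) 1) hS
  have e0 : M.cp n h (Fin.last n) 0 = M.cp n h' 0 0 := by rw [ho.cp_eq, Fin.rev_last]
  have e1 : M.cp n h (Fin.rev 1) 0 = M.cp n h' 1 0 := by rw [ho.cp_eq, Fin.rev_rev]
  rw [coeff_one_edgePol_comp hn (Or.inl (coeff_zero_crossPol_comp hM hb)) (by rw [e0, h0])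
    (by rw [e1, h1]) h2 (by rw [Fin.rev_last]; exact (eq_zero_of_bd_last hM hn hb hw h0).1 h2),
    h3, Fin.rev_rev, zero_comp, coeff_zero, mul_eq_zero, or_iff_right hn0, mul_eq_zero,
    or_iff_right hn0, mul_zero, zero_add, mul_eq_zero,
    or_iff_right (coeff_zero_jac_comp_pos hM ho.isInnerEdge).ne'] at h4
  exact h4

end

/-- For every constraint, the algorithm has an output that fits it. -/
theorem exists_isAlgorithmOutput_fits (hM : M.IsSmoothMesh) (hn : 5 ≤ n)
    (K : ConstraintType V F) :
    ∃ D : Set (M.CP n), M.IsAlgorithmOutput n D ∧ M.Fits n D (M.fixedPoints n K) := by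
  have e1 := val_one_of_le (n := n) (by omega)
  set P := M.fixedPoints n K with hPdef
  -- The left point of a pair at a boundary vertex is basic unless the right one is fixed and the
  -- left one is not. Thus a fixed left point is always basic, and a fixed right point that is
  -- dependent has a fixed basic partner.
  obtain ⟨D, hD, hdep, hbd⟩ := exists_isAlgorithmOutput hM hn
    (fun h => M.cp n (M.opp h) 0 1 ∈ P → M.cp n h (Fin.last n) 1 ∈ P)
    (fun h => M.cp n (M.opp h) 1 1 ∈ P → M.cp n h (Fin.rev 1) 1 ∈ P)
  refine ⟨D, hD, fun p hp => or_iff_not_imp_left.2 fun hpD => ?_⟩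
  have hV : ∀ {h}, M.org h ∈ K.tangentPlane → ∀ k, M.org k = M.org h →
      M.cp n k 0 0 ∈ P ∧ M.cp n k 1 0 ∈ P := fun hh k hk =>
    ⟨⟨k, Or.inr (Or.inl ⟨hk.symm ▸ hh, Or.inl rfl⟩)⟩,
      ⟨k, Or.inr (Or.inl ⟨hk.symm ▸ hh, Or.inr (Or.inl rfl)⟩)⟩⟩
  rcases hdep p hpD with ⟨h, i, hv, rfl⟩ | ⟨h, h', ⟨t, i⟩, ho, hv, hq, rfl⟩
  · fin_cases i
    · exact dependsOnlyOn_tangent hM (by omega) hv (hD.stage1_VE _ hv)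
        (hV (cp_one_mem_fixedPoints hM hn hv hp))
    · exact absurd hp (cp_two_notMem_fixedPoints hM hn (isInnerEdge_of_org hv))
    · exact absurd hp (cp_one_one_notMem_fixedPoints hn hv)
  have hi := ho.isInnerEdge
  have hi' := ho.symm.isInnerEdge
  rcases edgeBlock_cases hn hq with ⟨h1, h2⟩ | ⟨hw, ⟨h1, h2⟩ | ⟨h1, h2⟩⟩
  · simp only at h1 h2
    fin_cases i
    · exact absurd rfl h1
    · exact absurd hp (cp_sideRange_notMem_fixedPoints hn hi h2)
    · exact absurd hp (cp_sideRange_notMem_fixedPoints hn hi' (rev_mem_sideRange.2 h2))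
  · simp only at h1 h2
    subst h1 h2
    have : M.edgePt n h h' (Fin.rev 2, 0) = M.cp n h' 2 0 := by
      rw [show M.edgePt n h h' (Fin.rev 2, 0) = M.cp n h (Fin.rev 2) 0 from rfl, ho.cp_eq,
        Fin.rev_rev]
    rw [this] at hp
    exact absurd hp (cp_two_notMem_fixedPoints hM hn hi')
  have hb : M.EdgeToBd h h' := ⟨ho, hv, hw⟩
  obtain ⟨hb1, hb2⟩ := hbd h h' hb
  rw [hM.opp_eq ho] at hb1 hb2
  obtain ⟨hC0, hC1, hX0, hX1⟩ := hD.stage3_step1 h h' hb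
  have hprev := hM.edgeToBd_prev hb
  simp only at h1 h2
  fin_cases i
  · exact absurd rfl h1
  · rcases h2 with rfl | rfl
    · exact absurd (hb1.2 fun _ => hp) hpD
    · exact absurd (hb2.2 fun _ => hp) hpD
  rcases h2 with rfl | rfl
  · have e : M.edgePt n h h' (Fin.last n, 2) = M.cp n h' 0 1 := by
      rw [← Fin.rev_last]; rfl
    change M.edgePt n h h' (Fin.last n, 2) ∈ P at hp
    change M.edgePt n h h' (Fin.last n, 2) ∉ D at hpD
    change M.DependsOnlyOn n (M.edgePt n h h' (Fin.last n, 2)) (D ∩ P)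
    rw [e] at hp hpD ⊢
    have hLD : M.cp n h (Fin.last n) 1 ∈ D := by
      rcases hX0 with h3 | h3
      exacts [h3.1, absurd h3.1 hpD]
    exact dependsOnlyOn_of_sub hM (by omega) fun w hwF h0 =>
      (eq_zero_of_bd_last hM (by omega) hb hwF
        (h0 _ ⟨hC0, cp_corner_mem_fixedPoints hM hn hprev hp⟩)).1 (h0 _ ⟨hLD, hb1.1 hLD hp⟩)
  · have e : M.edgePt n h h' (Fin.rev 1, 2) = M.cp n h' 1 1 := by
      rw [show M.edgePt n h h' (Fin.rev 1, 2) = M.cp n h' (Fin.rev (Fin.rev 1)) 1 from rfl,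
        Fin.rev_rev]
    change M.edgePt n h h' (Fin.rev 1, 2) ∈ P at hp
    change M.edgePt n h h' (Fin.rev 1, 2) ∉ D at hpD
    change M.DependsOnlyOn n (M.edgePt n h h' (Fin.rev 1, 2)) (D ∩ P)
    rw [e] at hp hpD ⊢
    have hLD : M.cp n h (Fin.rev 1) 1 ∈ D := by
      rcases hX1 with h3 | h3
      exacts [h3.1, absurd h3.1 hpD]
    have hLP := hb2.1 hLD hp
    -- Twists at a boundary vertex are fixed only by clamped conditions. As both twists are fixed,
    -- the boundary edges on both sides are clamped, and all first-order data at the vertex are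
    -- fixed as well.
    obtain ⟨k, hk, hkP, ⟨-, h3⟩ | ⟨rfl, -⟩⟩ :=
      cp_side_mem_fixedPoints hn hi' (by omega) (by omega) hp
    · omega
    obtain ⟨k, hk', hkP', ⟨rfl, -⟩ | ⟨-, h3⟩⟩ :=
      cp_side_mem_fixedPoints hn hi (by rw [Fin.val_rev]; omega) (by rw [Fin.val_rev]; omega) hLP
    swap
    · rw [Fin.val_rev] at h3; omega
    have hP0 : M.cp n h' 0 0 ∈ P := by
      have := (hkP (Fin.last n)).1
      rwa [cp_prev, Fin.rev_last] at this
    have hP1 : M.cp n h' 1 0 ∈ P := by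
      have := (hkP (Fin.last n)).2
      rwa [cp_prev, Fin.rev_last] at this
    have hP2 : M.cp n h (Fin.last n) 1 ∈ P := by
      rw [cp_last_one_eq]; exact (hkP' 1).1
    have hP3 : M.cp n h' 0 1 ∈ P := by
      rw [cp_zero_one_eq]; exact (hkP _).1
    refine dependsOnlyOn_of_sub hM (by omega) fun w hwF h0 => ?_
    have hw0 := h0 _ ⟨hC0, hP0⟩
    refine eq_zero_of_bd_rev_one hM (by omega) hb hwF hw0 (h0 _ ⟨hC1, hP1⟩) ?_ (h0 _ ⟨hLD, hLP⟩)
    rcases hX0 with h3 | h3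
    · exact h0 _ ⟨h3.1, hP2⟩
    · exact (eq_zero_of_bd_last hM (by omega) hb hwF hw0).2 (h0 _ ⟨h3.1, hP3⟩)

end Mesh
end SmoothQuadMesh
end

theorem mainTheorem11 {V F : Type*} [Finite V] [Finite F] (M : SmoothQuadMesh.Mesh V F)
    (hM : M.IsSmoothMesh) (n : ℕ) (hn : 5 ≤ n) :
    (∀ K : SmoothQuadMesh.Mesh.ConstraintType V F, ∃ D : Set (M.CP n),
      M.IsAlgorithmOutput n D ∧ M.IsMDS n D ∧ M.Fits n D (M.fixedPoints n K)) ∧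
    (∀ D : Set (M.CP n), M.IsAlgorithmOutput n D → M.IsMDS n D) ∧
    (∀ P : Set (M.CP n), ∃ D : Set (M.CP n), M.IsMDS n D ∧ M.Fits n D P) := by
  refine ⟨fun K => ?_, fun D hD => hD.isMDS hM hn,
    fun P => SmoothQuadMesh.Mesh.exists_isMDS_fits hM (by omega) P⟩
  obtain ⟨D, hD, hK⟩ := SmoothQuadMesh.Mesh.exists_isAlgorithmOutput_fits hM hn K
  exact ⟨D, hD, hD.isMDS hM hn, hK⟩
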